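/- Let $\mathsf G\rightrightarrows M$ be a Lie groupoid over a compact oriented manifold $M$ of dimension $n$ (without boundary), with source $s$, target $t$, units $u$, and Lie algebroid $\mathfrak g=\ker(dt)|_M$ of rank $r$ (anchor $\rho=ds$, bracket given by left invariant vector fields on $\mathsf G$). Suppose that $\mathsf G$ is unimodular, and let $\Omega$ be a nowhere vanishing smooth section of $L_{\mathfrak g}=\bigwedge^{r}\mathfrak g\otimes\bigwedge^{n}T^*M$ that is invariant under the canonical action of $\mathsf G$ on $L_{\mathfrak g}$. Let the vector bundle $\pi:\mathfrak g^*\to M$ be oriented, orient its total space by "base first, then fibre", and let $Th(\mathfrak g^*)\in H^r_c(\mathfrak g^*)$ be its Thom class, i.e. the class of the closed compactly supported $r$-forms with integral $1$ over each fibre. Let $\pi^!\mathfrak g$ be the pull-back Lie algebroid over the manifold $\mathfrak g^*$, with fibres $(\pi^!\mathfrak g)_p=\{(X,\xi)\in\mathfrak g_{\pi(p)}\oplus T_p\mathfrak g^*:\rho(X)=d\pi(\xi)\}$ and anchor $\rho_{\pi^!\mathfrak g}(X,\xi)=\xi$, and put $Th^{\mathfrak g}(\mathfrak g^*)=\rho_{\pi^!\mathfrak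 g}^*Th(\mathfrak g^*)\in H^r_c(\pi^!\mathfrak g)$. Let $\Theta=d_{\pi^!\mathfrak g}\lambda$ be the canonical symplectic form on $\pi^!\mathfrak g$, where $\lambda_p(X,\xi)=\langle p,X\rangle$. The volume form $\Omega_{\pi^!\mathfrak g}=\Theta^r\otimes\pi^*\Omega$, a section of $\bigwedge^{2r}\pi^!\mathfrak g\otimes\bigwedge^{n+r}T^*\mathfrak g^*$, is normalized as follows. The factor $\pi^*\Omega$ is the $(n+r)$-form on $\mathfrak g^*$ obtained by regarding $\bigwedge^r\mathfrak g_x$ as the top degree forms on the fibre $\mathfrak g_x^*$: if locally $\Omega=e_1\wedge\dots\wedge e_r\otimes\mu$ and $\xi_1,\dots,\xi_r$ are the fibre coordinates defined by $e_1,\dots,e_r$, it is $\pi^*\mu\wedge d\xi_1\wedge\dots\wedge d\xi_r$. The factor $\Theta^r$ stands for the section of $\bigwedge^{2r}\pi^!\mathfrak g$ on which the Liouville volume $\frac{(-1)^{r(r+1)/2}}{r!}\,\Theta^{\wedge r}$ takes the value $1$. Then, for every $\alpha\in H^r(\mathfrak g)$ (Lie algebroid cohomology with values in the trivial representation on $M\times\mathbb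 C$), $$\int_M\langle\alpha,\Omega\rangle=\int_{\mathfrak g^*}\big\langle\pi^*\alpha\wedge Th^{\mathfrak g}(\mathfrak g^*),\,\Theta^r\otimes\pi^*\Omega\big\rangle .$$ That is, the equality holds for every representative of $\alpha$ on the left and every representative in $\Omega^{2r}_c(\pi^!\mathfrak g)$ of the class $\pi^*\alpha\wedge Th^{\mathfrak g}(\mathfrak g^*)\in H^{2r}_c(\pi^!\mathfrak g)$ on the right. -/

import Mathlib

open Bundle Manifold ContDiff Set Topology Module
noncomputable section

/-- The Euclidean space of dimension `k`. -/
abbrev EuSp (k : ℕ) : Type := EuclideanSpace ℝ (Fin k)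

/-- The model with corners of the total space of the dual of a vector bundle of rank `r` over an
`n`-manifold. -/
abbrev dualModel (n r : ℕ) := (𝓡 n).prod 𝓘(ℝ, EuSp r →L[ℝ] ℝ)

/-- A Lie groupoid `G ⇉ M` with `dim M = n` and `dim G = n + r`. The product `mul g h` is meaningful
for the composable pairs, those with `s g = t h`; then `s (gh) = s h` and `t (gh) = t g`. The manifold
`G` need not be Hausdorff. -/
structure LieGroupoid (n r : ℕ) (M G : Type*)
    [TopologicalSpace M] [ChartedSpace (EuSp n) M] [IsManifold (𝓡 n) ∞ M]
    [TopologicalSpace G] [ChartedSpace (EuSp (n + r)) G] [IsManifold (𝓡 (n + r)) ∞ G] where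
  s : G → M
  t : G → M
  u : M → G
  inv : G → G
  mul : G → G → G
  s_u : ∀ x, s (u x) = x
  t_u : ∀ x, t (u x) = x
  s_mul : ∀ g h, s g = t h → s (mul g h) = s h
  t_mul : ∀ g h, s g = t h → t (mul g h) = t g
  mul_assoc : ∀ g h k, s g = t h → s h = t k → mul (mul g h) k = mul g (mul h k)
  u_mul : ∀ g, mul (u (t g)) g = g
  mul_u : ∀ g, mul g (u (s g)) = g
  s_inv : ∀ g, s (inv g) = t g
  t_inv : ∀ g, t (inv g) = s g
  mul_inv : ∀ g, mul g (inv g) = u (t g)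
  inv_mul : ∀ g, mul (inv g) g = u (s g)
  contMDiff_s : ContMDiff (𝓡 (n + r)) (𝓡 n) ∞ s
  contMDiff_t : ContMDiff (𝓡 (n + r)) (𝓡 n) ∞ t
  contMDiff_u : ContMDiff (𝓡 n) (𝓡 (n + r)) ∞ u
  contMDiff_inv : ContMDiff (𝓡 (n + r)) (𝓡 (n + r)) ∞ inv
  submersion_s : ∀ g, Function.Surjective (mfderiv (𝓡 (n + r)) (𝓡 n) s g)
  submersion_t : ∀ g, Function.Surjective (mfderiv (𝓡 (n + r)) (𝓡 n) t g)
  contMDiffOn_mul : ContMDiffOn ((𝓡 (n + r)).prod (𝓡 (n + r))) (𝓡 (n + r)) ∞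
    (fun p : G × G => mul p.1 p.2) {p : G × G | s p.1 = t p.2}

namespace LieGroupoid

variable {n r : ℕ} {M G : Type*}
    [TopologicalSpace M] [ChartedSpace (EuSp n) M] [IsManifold (𝓡 n) ∞ M]
    [TopologicalSpace G] [ChartedSpace (EuSp (n + r)) G] [IsManifold (𝓡 (n + r)) ∞ G]
    (Γ : LieGroupoid n r M G)

/-- The fibre `𝔤_x = ker (dt)_{u(x)} ⊆ T_{u(x)} G` of the Lie algebroid. -/
def kerT (x : M) : Submodule ℝ (TangentSpace (𝓡 (n + r)) (Γ.u x)) :=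
  LinearMap.ker (mfderiv (𝓡 (n + r)) (𝓡 n) Γ.t (Γ.u x)).toLinearMap

/-- The fibre `𝔤_x`. The vector bundle `𝔤 = ker(dt)|_M` over `M` is constructed below. -/
def Alg (x : M) : Type := Γ.kerT x

instance (x : M) : FiniteDimensional ℝ (TangentSpace (𝓡 n) x) :=
  inferInstanceAs (FiniteDimensional ℝ (EuSp n))
instance (x : M) : T2Space (TangentSpace (𝓡 n) x) :=
  inferInstanceAs (T2Space (EuSp n))

instance (x : M) : AddCommGroup (Γ.Alg x) := inferInstanceAs (AddCommGroup (Γ.kerT x))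
instance (x : M) : Module ℝ (Γ.Alg x) := inferInstanceAs (Module ℝ (Γ.kerT x))
instance (x : M) : TopologicalSpace (Γ.Alg x) := inferInstanceAs (TopologicalSpace (Γ.kerT x))
instance (x : M) : IsTopologicalAddGroup (Γ.Alg x) :=
  inferInstanceAs (IsTopologicalAddGroup (Γ.kerT x))
instance (x : M) : ContinuousSMul ℝ (Γ.Alg x) := inferInstanceAs (ContinuousSMul ℝ (Γ.kerT x))
instance (x : M) : FiniteDimensional ℝ (Γ.Alg x) :=
  inferInstanceAs (FiniteDimensional ℝ (Γ.kerT x))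
instance (x : M) : T2Space (Γ.Alg x) := inferInstanceAs (T2Space (Γ.kerT x))

/-- The inclusion `𝔤_x ⊆ T_{u(x)} G`. -/
def incl (x : M) : Γ.Alg x →L[ℝ] TangentSpace (𝓡 (n + r)) (Γ.u x) := (Γ.kerT x).subtypeL

theorem incl_injective (x : M) : Function.Injective (Γ.incl x) := Subtype.val_injective

theorem mfderiv_t_incl (x : M) (v : Γ.Alg x) :
    mfderiv (𝓡 (n + r)) (𝓡 n) Γ.t (Γ.u x) (Γ.incl x v) = 0 := v.2

/-- A tangent vector at a unit which is tangent to the `t`-fibre, as an element of `𝔤`. -/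
def ofKer (x : M) (w : TangentSpace (𝓡 (n + r)) (Γ.u x))
    (hw : mfderiv (𝓡 (n + r)) (𝓡 n) Γ.t (Γ.u x) w = 0) : Γ.Alg x := (⟨w, hw⟩ : Γ.kerT x)

theorem incl_ofKer (x : M) (w : TangentSpace (𝓡 (n + r)) (Γ.u x))
    (hw : mfderiv (𝓡 (n + r)) (𝓡 n) Γ.t (Γ.u x) w = 0) : Γ.incl x (Γ.ofKer x w hw) = w := rfl

/-! ### Local trivialisations -/

/-- A local trivialisation of `TG` around the unit `u(x₀)`. -/
abbrev trG (x₀ : M) := trivializationAt (EuSp (n + r))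
  (TangentSpace (𝓡 (n + r)) : G → Type) (Γ.u x₀)
/-- A local trivialisation of `TM` around `x₀`. -/
abbrev trM (x₀ : M) := trivializationAt (EuSp n)
  (TangentSpace (𝓡 n) : M → Type) (Γ.t (Γ.u x₀))

/-- `dt` along the units, read in the local trivialisations around `x₀`. -/
def dtLoc (x₀ x : M) : EuSp (n + r) →L[ℝ] EuSp n :=
  ((Γ.trM x₀).continuousLinearMapAt ℝ (Γ.t (Γ.u x))).comp
    ((mfderiv (𝓡 (n + r)) (𝓡 n) Γ.t (Γ.u x)).comp ((Γ.trG x₀).symmL ℝ (Γ.u x)))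

/-- The points at which both trivialisations are defined. -/
def dom (x₀ : M) : Set M :=
  {x | Γ.u x ∈ (Γ.trG x₀).baseSet ∧ Γ.t (Γ.u x) ∈ (Γ.trM x₀).baseSet}

theorem isOpen_dom (x₀ : M) : IsOpen (Γ.dom x₀) :=
  ((Γ.trG x₀).open_baseSet.preimage Γ.contMDiff_u.continuous).inter
    ((Γ.trM x₀).open_baseSet.preimage (Γ.contMDiff_t.continuous.comp Γ.contMDiff_u.continuous))

theorem mem_dom (x₀ : M) : x₀ ∈ Γ.dom x₀ :=
  ⟨mem_baseSet_trivializationAt _ _ _, mem_baseSet_trivializationAt _ _ _⟩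

theorem contMDiffOn_dtLoc (x₀ : M) :
    ContMDiffOn (𝓡 n) 𝓘(ℝ, EuSp (n + r) →L[ℝ] EuSp n) ∞ (Γ.dtLoc x₀) (Γ.dom x₀) := by
  have key : ∀ v, ContMDiffOn (𝓡 n) 𝓘(ℝ, EuSp n) ∞ (fun x => Γ.dtLoc x₀ x v) (Γ.dom x₀) := by
    intro v
    have h0 : ContMDiffOn (𝓡 n) ((𝓡 (n + r)).prod 𝓘(ℝ, EuSp (n + r))) ∞
        (fun x => (Γ.u x, v)) (Γ.dom x₀) :=
      Γ.contMDiff_u.contMDiffOn.prodMk contMDiffOn_const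
    have h1 : ContMDiffOn (𝓡 n) (𝓡 (n + r)).tangent ∞
        (fun x => (⟨Γ.u x, (Γ.trG x₀).symmL ℝ (Γ.u x) v⟩ : TangentBundle (𝓡 (n + r)) G))
        (Γ.dom x₀) := by
      refine (((Γ.trG x₀).contMDiffOn_symm (IB := 𝓡 (n + r)) (n := ∞)).comp h0
        (fun x hx => ?_)).congr fun x hx => ?_
      · rw [mem_preimage, Trivialization.mem_target]
        exact hx.1
      · rw [Trivialization.symmL_apply _ hx.1, Trivialization.mk_symm _ hx.1]
        rfl
    have h2 := (Γ.contMDiff_t.contMDiff_tangentMap (m := ∞) (by simp)).comp_contMDiffOn h1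
    have h3 := (((Γ.trM x₀).contMDiffOn_iff (IB := 𝓡 n) (n := ∞) (fun x hx => ?_)).1 h2).2
    · refine h3.congr fun x hx => ?_
      simp only [dtLoc, ContinuousLinearMap.comp_apply]
      exact Trivialization.continuousLinearMapAt_apply_of_mem ℝ _ hx.2 _
    · rw [Trivialization.mem_source]
      exact hx.2
  let b := Module.finBasis ℝ (EuSp (n + r))
  have hsum : Γ.dtLoc x₀ = fun x => ∑ i, ContinuousLinearMap.smulRightL ℝ _ _
      (LinearMap.toContinuousLinearMap (b.coord i)) (Γ.dtLoc x₀ x (b i)) := by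
    funext x
    ext1 v
    conv_lhs => rw [← b.sum_repr v, map_sum]
    simp
  rw [hsum]
  refine contMDiffOn_finsetSum fun i _ => ?_
  exact (ContinuousLinearMap.contMDiff (ContinuousLinearMap.smulRightL ℝ _ _
      (LinearMap.toContinuousLinearMap (b.coord i)))).comp_contMDiffOn (key (b i))

theorem dtLoc_surjective (x₀ : M) : Function.Surjective (Γ.dtLoc x₀ x₀) := by
  intro w
  obtain ⟨v, hv⟩ := Γ.submersion_t (Γ.u x₀) ((Γ.trM x₀).symmL ℝ _ w)
  refine ⟨(Γ.trG x₀).continuousLinearMapAt ℝ _ v, ?_⟩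
  simp only [dtLoc, ContinuousLinearMap.comp_apply]
  rw [Trivialization.symmL_continuousLinearMapAt _ (Γ.mem_dom x₀).1, hv,
    Trivialization.continuousLinearMapAt_symmL _ (Γ.mem_dom x₀).2]

theorem exists_proj (x₀ : M) : ∃ P : EuSp (n + r) →L[ℝ] EuSp r,
    (P.prod (Γ.dtLoc x₀ x₀)).IsInvertible := by
  set D := (Γ.dtLoc x₀ x₀).toLinearMap with hD
  obtain ⟨Q, hQ⟩ := (LinearMap.ker D).subtype.exists_leftInverse_of_injective
    (Submodule.ker_subtype _)
  have hr : Module.finrank ℝ (LinearMap.ker D) = Module.finrank ℝ (EuSp r) := by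
    have h1 := LinearMap.finrank_range_add_finrank_ker D
    rw [LinearMap.range_eq_top.2 (Γ.dtLoc_surjective x₀), finrank_top] at h1
    simp only [finrank_euclideanSpace_fin] at h1 ⊢
    omega
  let e := LinearEquiv.ofFinrankEq _ _ hr
  let P : EuSp (n + r) →L[ℝ] EuSp r := LinearMap.toContinuousLinearMap (e.toLinearMap ∘ₗ Q)
  refine ⟨P, ?_⟩
  have hinj : Function.Injective (P.prod (Γ.dtLoc x₀ x₀)).toLinearMap := by
    rw [injective_iff_map_eq_zero]
    intro v hv
    have hv2 : D v = 0 := congrArg Prod.snd hv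
    have hv1 : e (Q v) = 0 := congrArg Prod.fst hv
    have : Q v = ⟨v, hv2⟩ := LinearMap.congr_fun hQ ⟨v, hv2⟩
    rw [this, LinearEquiv.map_eq_zero_iff] at hv1
    exact congrArg Subtype.val hv1
  have hdim : Module.finrank ℝ (EuSp (n + r)) = Module.finrank ℝ (EuSp r × EuSp n) := by
    simp only [Module.finrank_prod, finrank_euclideanSpace_fin]
    omega
  refine ⟨(LinearEquiv.ofInjectiveOfFinrankEq _ hinj hdim).toContinuousLinearEquiv, ?_⟩
  ext1 v
  rfl

/-- A projection onto `ℝ^r` which is an isomorphism on the kernel of `dt` at `x₀`. -/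
def locProj (x₀ : M) : EuSp (n + r) →L[ℝ] EuSp r := (Γ.exists_proj x₀).choose

/-- The map `(P, dt)`, an isomorphism for `x` close to `x₀`. -/
def locMap (x₀ x : M) : EuSp (n + r) →L[ℝ] EuSp r × EuSp n :=
  (Γ.locProj x₀).prod (Γ.dtLoc x₀ x)

/-- The neighbourhood of `x₀` over which `𝔤` is trivialised. -/
def base (x₀ : M) : Set M := Γ.dom x₀ ∩ {x | (Γ.locMap x₀ x).IsInvertible}

theorem mem_base (x₀ : M) : x₀ ∈ Γ.base x₀ := ⟨Γ.mem_dom x₀, (Γ.exists_proj x₀).choose_spec⟩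

theorem contMDiffOn_locMap (x₀ : M) :
    ContMDiffOn (𝓡 n) 𝓘(ℝ, EuSp (n + r) →L[ℝ] EuSp r × EuSp n) ∞ (Γ.locMap x₀) (Γ.dom x₀) := by
  have h : Γ.locMap x₀ = fun x => (ContinuousLinearMap.inl ℝ _ _).comp (Γ.locProj x₀) +
      ContinuousLinearMap.compL ℝ (EuSp (n + r)) (EuSp n) (EuSp r × EuSp n)
        (ContinuousLinearMap.inr ℝ _ _) (Γ.dtLoc x₀ x) := by
    funext x
    ext1 v
    simp [locMap]
  rw [h]
  exact contMDiffOn_const.add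
    ((ContinuousLinearMap.contMDiff _).comp_contMDiffOn (Γ.contMDiffOn_dtLoc x₀))

theorem isOpen_base (x₀ : M) : IsOpen (Γ.base x₀) :=
  (Γ.contMDiffOn_locMap x₀).continuousOn.isOpen_inter_preimage (Γ.isOpen_dom x₀)
    ContinuousLinearEquiv.isOpen


theorem mfderiv_symmL_inverse (x₀ x : M) (hx : x ∈ Γ.base x₀) (w : EuSp r) :
    mfderiv (𝓡 (n + r)) (𝓡 n) Γ.t (Γ.u x)
      ((Γ.trG x₀).symmL ℝ (Γ.u x) ((Γ.locMap x₀ x).inverse (w, 0))) = 0 := by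
  have h1 : Γ.dtLoc x₀ x ((Γ.locMap x₀ x).inverse (w, 0)) = 0 :=
    congrArg Prod.snd (hx.2.self_apply_inverse (w, (0 : EuSp n)))
  have h2 := congrArg ((Γ.trM x₀).symmL ℝ (Γ.t (Γ.u x))) h1
  simp only [dtLoc, ContinuousLinearMap.comp_apply] at h2
  rw [Trivialization.symmL_continuousLinearMapAt _ hx.1.2] at h2
  rw [h2, map_zero]

open scoped Classical in
/-- The inverse of the local trivialisation of `𝔤` around `x₀`. -/
def locInv (x₀ x : M) (w : EuSp r) : Γ.Alg x :=
  if hx : x ∈ Γ.base x₀ then Γ.ofKer x _ (Γ.mfderiv_symmL_inverse x₀ x hx w) else 0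

theorem incl_locInv (x₀ x : M) (hx : x ∈ Γ.base x₀) (w : EuSp r) :
    Γ.incl x (Γ.locInv x₀ x w) =
      (Γ.trG x₀).symmL ℝ (Γ.u x) ((Γ.locMap x₀ x).inverse (w, 0)) := by
  rw [locInv, dif_pos hx, incl_ofKer]

/-- The local trivialisation of `𝔤` around `x₀`, fibrewise. -/
def locTriv (x₀ x : M) : Γ.Alg x →L[ℝ] EuSp r :=
  (Γ.locProj x₀).comp (((Γ.trG x₀).continuousLinearMapAt ℝ (Γ.u x)).comp (Γ.incl x))

theorem locTriv_locInv (x₀ x : M) (hx : x ∈ Γ.base x₀) (w : EuSp r) :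
    Γ.locTriv x₀ x (Γ.locInv x₀ x w) = w := by
  simp only [locTriv, ContinuousLinearMap.comp_apply]
  rw [Γ.incl_locInv x₀ x hx, Trivialization.continuousLinearMapAt_symmL _ hx.1.1]
  exact congrArg Prod.fst (hx.2.self_apply_inverse (w, (0 : EuSp n)))

theorem locTriv_injective (x₀ x : M) (hx : x ∈ Γ.base x₀) :
    Function.Injective (Γ.locTriv x₀ x) := by
  rw [injective_iff_map_eq_zero]
  intro v hv
  have h : Γ.locMap x₀ x ((Γ.trG x₀).continuousLinearMapAt ℝ (Γ.u x) (Γ.incl x v)) = 0 := by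
    refine Prod.ext hv ?_
    change Γ.dtLoc x₀ x _ = 0
    simp only [dtLoc, ContinuousLinearMap.comp_apply]
    rw [Trivialization.symmL_continuousLinearMapAt _ hx.1.1, Γ.mfderiv_t_incl, map_zero]
  have h2 := congrArg (Γ.locMap x₀ x).inverse h
  rw [hx.2.inverse_apply_self, map_zero] at h2
  have h3 := congrArg ((Γ.trG x₀).symmL ℝ (Γ.u x)) h2
  rw [Trivialization.symmL_continuousLinearMapAt _ hx.1.1, map_zero] at h3
  exact Γ.incl_injective x (h3.trans (map_zero _).symm)

theorem locInv_locTriv (x₀ x : M) (hx : x ∈ Γ.base x₀) (v : Γ.Alg x) :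
    Γ.locInv x₀ x (Γ.locTriv x₀ x v) = v :=
  Γ.locTriv_injective x₀ x hx (Γ.locTriv_locInv x₀ x hx _)

/-- The local trivialisation of `𝔤` around `x₀`. -/
def pretriv (x₀ : M) : Pretrivialization (EuSp r) (π (EuSp r) Γ.Alg) where
  toFun p := (p.1, Γ.locTriv x₀ p.1 p.2)
  invFun q := ⟨q.1, Γ.locInv x₀ q.1 q.2⟩
  source := π (EuSp r) Γ.Alg ⁻¹' Γ.base x₀
  target := Γ.base x₀ ×ˢ univ
  map_source' p hp := ⟨hp, mem_univ _⟩
  map_target' q hq := hq.1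
  left_inv' p hp := by
    rw [Γ.locInv_locTriv x₀ p.1 hp]
  right_inv' q hq := by
    rw [Γ.locTriv_locInv x₀ q.1 hq.1]
  open_target := (Γ.isOpen_base x₀).prod isOpen_univ
  baseSet := Γ.base x₀
  open_baseSet := Γ.isOpen_base x₀
  source_eq := rfl
  target_eq := rfl
  proj_toFun _ _ := rfl

instance (x₀ : M) : (Γ.pretriv x₀).IsLinear ℝ where
  linear x _ := ⟨fun v w => map_add (Γ.locTriv x₀ x) v w, fun c v => map_smul (Γ.locTriv x₀ x) c v⟩

theorem pretriv_symm (x₀ x : M) (hx : x ∈ Γ.base x₀) (w : EuSp r) :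
    (Γ.pretriv x₀).symm x w = Γ.locInv x₀ x w := by
  have h : (⟨x, (Γ.pretriv x₀).symm x w⟩ : TotalSpace (EuSp r) Γ.Alg) = ⟨x, Γ.locInv x₀ x w⟩ :=
    (Γ.pretriv x₀).mk_symm hx w
  simpa using h

/-- The transition functions of `𝔤`. -/
def locChange (x₀ x₁ x : M) : EuSp r →L[ℝ] EuSp r :=
  (Γ.locProj x₁).comp ((((Γ.trG x₀).coordChangeL ℝ (Γ.trG x₁) (Γ.u x)) :
    EuSp (n + r) →L[ℝ] EuSp (n + r)).comp ((Γ.locMap x₀ x).inverse.comp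
      (ContinuousLinearMap.inl ℝ (EuSp r) (EuSp n))))

theorem locChange_apply (x₀ x₁ x : M) (hx : x ∈ Γ.base x₀ ∩ Γ.base x₁) (w : EuSp r) :
    Γ.locChange x₀ x₁ x w = (Γ.pretriv x₁ ⟨x, (Γ.pretriv x₀).symm x w⟩).2 := by
  rw [Γ.pretriv_symm x₀ x hx.1]
  change _ = Γ.locTriv x₁ x (Γ.locInv x₀ x w)
  simp only [locTriv, locChange, ContinuousLinearMap.comp_apply, ContinuousLinearMap.inl_apply]
  rw [Γ.incl_locInv x₀ x hx.1, ContinuousLinearEquiv.coe_coe,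
    Trivialization.coordChangeL_apply _ _ ⟨hx.1.1.1, hx.2.1.1⟩,
    Trivialization.symmL_apply _ hx.1.1.1,
    Trivialization.continuousLinearMapAt_apply_of_mem ℝ _ hx.2.1.1]

theorem contMDiffOn_locChange (x₀ x₁ : M) :
    ContMDiffOn (𝓡 n) 𝓘(ℝ, EuSp r →L[ℝ] EuSp r) ∞ (Γ.locChange x₀ x₁)
      (Γ.base x₀ ∩ Γ.base x₁) := by
  have h1 : ContMDiffOn (𝓡 n) 𝓘(ℝ, EuSp (n + r) →L[ℝ] EuSp (n + r)) ∞
      (fun x => (((Γ.trG x₀).coordChangeL ℝ (Γ.trG x₁) (Γ.u x)) :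
        EuSp (n + r) →L[ℝ] EuSp (n + r))) (Γ.base x₀ ∩ Γ.base x₁) :=
    (contMDiffOn_coordChangeL (IB := 𝓡 (n + r)) (n := ∞) (Γ.trG x₀) (Γ.trG x₁)).comp
      Γ.contMDiff_u.contMDiffOn (fun x hx => ⟨hx.1.1.1, hx.2.1.1⟩)
  have h2 : ContMDiffOn (𝓡 n) 𝓘(ℝ, EuSp r × EuSp n →L[ℝ] EuSp (n + r)) ∞
      (fun x => (Γ.locMap x₀ x).inverse) (Γ.base x₀ ∩ Γ.base x₁) := by
    intro x hx
    exact (hx.1.2.contDiffAt_map_inverse (n := ∞)).contMDiffAt.comp_contMDiffWithinAt x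
      ((Γ.contMDiffOn_locMap x₀).mono (fun y hy => hy.1.1) x hx)
  exact contMDiffOn_const.clm_comp (h1.clm_comp (h2.clm_comp contMDiffOn_const))

/-- The smooth vector bundle structure of `𝔤`, a subbundle of `u^*TG`. -/
def prebundle : VectorPrebundle ℝ (EuSp r) Γ.Alg where
  pretrivializationAtlas := range Γ.pretriv
  pretrivialization_linear' := by
    rintro _ ⟨x₀, rfl⟩
    infer_instance
  pretrivializationAt := Γ.pretriv
  mem_base_pretrivializationAt := Γ.mem_base
  pretrivialization_mem_atlas x := ⟨x, rfl⟩
  exists_coordChange := by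
    rintro _ ⟨x₀, rfl⟩ _ ⟨x₁, rfl⟩
    exact ⟨Γ.locChange x₀ x₁, (Γ.contMDiffOn_locChange x₀ x₁).continuousOn,
      fun x hx w => Γ.locChange_apply x₀ x₁ x hx w⟩
  totalSpaceMk_isInducing x := by
    have h1 : IsInducing (Γ.locTriv x x) :=
      (LinearMap.isClosedEmbedding_of_injective (f := (Γ.locTriv x x).toLinearMap)
        (LinearMap.ker_eq_bot.2 (Γ.locTriv_injective x x (Γ.mem_base x)))).isInducing
    exact (isInducing_const_prod (x := x)).2 h1

instance : Γ.prebundle.IsContMDiff (𝓡 n) ∞ where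
  exists_contMDiffCoordChange := by
    rintro _ ⟨x₀, rfl⟩ _ ⟨x₁, rfl⟩
    exact ⟨Γ.locChange x₀ x₁, Γ.contMDiffOn_locChange x₀ x₁,
      fun x hx w => Γ.locChange_apply x₀ x₁ x hx w⟩

instance : TopologicalSpace (TotalSpace (EuSp r) Γ.Alg) := Γ.prebundle.totalSpaceTopology
instance : FiberBundle (EuSp r) Γ.Alg := Γ.prebundle.toFiberBundle
instance : VectorBundle ℝ (EuSp r) Γ.Alg := Γ.prebundle.toVectorBundle
instance : ContMDiffVectorBundle ∞ (EuSp r) Γ.Alg (𝓡 n) := Γ.prebundle.contMDiffVectorBundle (𝓡 n)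

/-- The dual bundle `𝔤*`, as a smooth vector bundle over `M`. -/
abbrev Dual (x : M) : Type := Γ.Alg x →L[ℝ] Bundle.Trivial M ℝ x

/-- The total space of `𝔤*`, a smooth manifold of dimension `n + r`. -/
abbrev DualTotal : Type _ :=
  TotalSpace (EuSp r →L[ℝ] ℝ) (fun x : M => Γ.Alg x →L[ℝ] Bundle.Trivial M ℝ x)

end LieGroupoid

/-! ## Exterior algebra -/

section Exterior

variable {V W : Type*} [AddCommGroup V] [Module ℝ V] [AddCommGroup W] [Module ℝ W]
  {K : Type*} [NormedField K] [NormedAlgebra ℝ K]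

/-- The wedge product of alternating forms (sum over shuffles). -/
def wedge {a b : ℕ} (α : V [⋀^Fin a]→ₗ[ℝ] K) (β : V [⋀^Fin b]→ₗ[ℝ] K) :
    V [⋀^Fin (a + b)]→ₗ[ℝ] K :=
  ((LinearMap.mul' ℝ K).compAlternatingMap (α.domCoprod β)).domDomCongr finSumFinEquiv

/-- The `k`-fold wedge power of a 2-form. -/
def wedgePow (θ : V [⋀^Fin 2]→ₗ[ℝ] ℝ) : (k : ℕ) → V [⋀^Fin (2 * k)]→ₗ[ℝ] ℝ
  | 0 => (AlternatingMap.constOfIsEmpty ℝ V (Fin 0) 1 : V [⋀^Fin 0]→ₗ[ℝ] ℝ)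
  | k + 1 => wedge (wedgePow θ k) θ

/-- The pairing `⟨α, Ω⟩` of a `k`-form on `V` with an element `Ω` of `⋀^k V ⊗ ⋀^ι W*`, the latter
written as a form on `W` with values in `⋀^k V`. -/
def pairing {k : ℕ} {ι : Type*} (α : V [⋀^Fin k]→ₗ[ℝ] K) (Ω : W [⋀^ι]→ₗ[ℝ] ⋀[ℝ]^k V) :
    W [⋀^ι]→ₗ[ℝ] K :=
  (exteriorPower.alternatingMapLinearEquiv α).compAlternatingMap Ω

end Exterior

/-! ## Manifolds, and the cochain complex of a Lie algebroid -/

section Manifold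

variable {E : Type} [NormedAddCommGroup E] [NormedSpace ℝ E] {H : Type*} [TopologicalSpace H]
  (I : ModelWithCorners ℝ E H) (N : Type*) [TopologicalSpace N] [ChartedSpace H N]

variable {N} in
/-- The derivative `v·f` of a function along a tangent vector. -/
def dirDeriv {K : Type} [NormedAddCommGroup K] [NormedSpace ℝ K] (f : N → K) (p : N)
    (v : TangentSpace I p) : K := mfderiv I 𝓘(ℝ, K) f p v

variable {N} in
/-- The identification of the tangent spaces at two equal points. -/
def castTangent {p q : N} (h : p = q) : TangentSpace I p →ₗ[ℝ] TangentSpace I q :=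
  h ▸ LinearMap.id

/-- The ingredients of the cochain complex of a Lie algebroid over `N`: the fibres, the anchor,
the smooth sections, and the graph of the Lie bracket of smooth sections
(`IsBracket X Y Z` means `Z = [X, Y]`). -/
structure AlgebroidData where
  Fiber : N → Type
  [addCommGroup : ∀ p, AddCommGroup (Fiber p)]
  [module : ∀ p, Module ℝ (Fiber p)]
  anchor : ∀ p, Fiber p →ₗ[ℝ] TangentSpace I p
  IsSmooth : (∀ p, Fiber p) → Prop
  IsBracket : (∀ p, Fiber p) → (∀ p, Fiber p) → (∀ p, Fiber p) → Prop

attribute [instance] AlgebroidData.addCommGroup AlgebroidData.module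

namespace AlgebroidData

variable {I N} (A : AlgebroidData I N)

/-- Families of alternating `k`-forms on the fibres, with values in `K`. -/
abbrev Form (K : Type) [NormedField K] [NormedAlgebra ℝ K] (k : ℕ) : Type _ :=
  ∀ p, A.Fiber p [⋀^Fin k]→ₗ[ℝ] K

variable {A} {K : Type} [NormedField K] [NormedAlgebra ℝ K] {k : ℕ}

/-- `α` is a smooth `k`-form, that is, `α ∈ Ω^k_A`. -/
def IsSmoothForm (α : A.Form K k) : Prop :=
  ∀ X : Fin k → ∀ p, A.Fiber p, (∀ i, A.IsSmooth (X i)) →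
    ContMDiff I 𝓘(ℝ, K) ∞ (fun p => α p (fun i => X i p))

/-- `β = d_A α`, given by the Koszul formula
`β(X₀,…,X_k) = ∑ᵢ (-1)ⁱ ρ(Xᵢ)·α(…,X̂ᵢ,…) + ∑_{i<j} (-1)^{i+j} α([Xᵢ,Xⱼ],…,X̂ᵢ,…,X̂ⱼ,…)`.
In the second sum the bracket is moved to the `i`-th slot, which costs a sign `(-1)ⁱ`. -/
def IsDifferential (α : A.Form K k) (β : A.Form K (k + 1)) : Prop :=
  ∀ (X : Fin (k + 1) → ∀ p, A.Fiber p) (B : Fin (k + 1) → Fin (k + 1) → ∀ p, A.Fiber p),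
    (∀ i, A.IsSmooth (X i)) → (∀ i j, i < j → A.IsBracket (X i) (X j) (B i j)) →
    ∀ p, β p (fun i => X i p) =
      ∑ i : Fin (k + 1), (-1 : K) ^ (i : ℕ) *
          dirDeriv I (fun q => α q (fun l => X (i.succAbove l) q)) p (A.anchor p (X i p)) +
      ∑ j : Fin (k + 1), ∑ i ∈ Finset.Iio j, (-1 : K) ^ (j : ℕ) *
          α p (fun l => Function.update X i (B i j) (j.succAbove l) p)

/-- `α` is a smooth form with `d_A α = 0`. -/
def IsCocycle (α : A.Form K k) : Prop := IsSmoothForm α ∧ IsDifferential α 0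

/-- `α` has compact support. -/
def IsCompactlySupported (α : A.Form K k) : Prop := IsCompact (closure {p | α p ≠ 0})

/-- `α` is the differential of a smooth form. -/
def IsExact : {k : ℕ} → A.Form K k → Prop
  | 0, α => α = 0
  | _ + 1, α => ∃ β, IsSmoothForm β ∧ IsDifferential β α

/-- `α` is the differential of a compactly supported smooth form. -/
def IsExactCompact : {k : ℕ} → A.Form K k → Prop
  | 0, α => α = 0
  | _ + 1, α => ∃ β, IsSmoothForm β ∧ IsCompactlySupported β ∧ IsDifferential β α

end AlgebroidData

/-- The tangent Lie algebroid `TN`; its cochain complex is the de Rham complex. -/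
def tangentAlgebroid [IsManifold I ∞ N] : AlgebroidData I N where
  Fiber p := TangentSpace I p
  anchor _ := LinearMap.id
  IsSmooth X := ContMDiff I I.tangent ∞ (fun p => (⟨p, X p⟩ : TangentBundle I N))
  IsBracket X Y Z := ∀ p, Z p = VectorField.mlieBracket I X Y p

variable {N}

/-- The coordinate frame at the point with coordinates `y` of the chart around `c`. -/
def coordFrame {ι : Type*} (b : Basis ι ℝ E) (c : N) (y : E) (i : ι) :
    TangentSpace I ((extChartAt I c).symm y) :=
  mfderiv 𝓘(ℝ, E) I (extChartAt I c).symm y (b i)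

open scoped Classical in
/-- The integral `∫_N η` of a compactly supported top degree form over a manifold oriented by the
nowhere vanishing top degree form `vol`. The support is covered by finitely many charts
`c 0, …, c (m-1)`, and the integrals over the disjoint pieces
`source (c i) \ ⋃_{j<i} source (c j)`, computed in coordinates, are added up. The result depends
neither on the charts nor on the basis `b` of the model space, and only on the sign of `vol`. -/
def formIntegral [FiniteDimensional ℝ E] {ι : Type*} [Fintype ι] (b : Basis ι ℝ E)
    (vol : ∀ p : N, TangentSpace I p [⋀^ι]→ₗ[ℝ] ℝ)
    (η : ∀ p : N, TangentSpace I p [⋀^ι]→ₗ[ℝ] ℂ) : ℂ :=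
  letI : MeasurableSpace E := borel E
  haveI : BorelSpace E := ⟨rfl⟩
  if h : ∃ (m : ℕ) (c : Fin m → N),
      closure {p | η p ≠ 0} ⊆ ⋃ i, (extChartAt I (c i)).source then
    let c := h.choose_spec.choose
    ∑ i, ∫ y in {y ∈ (extChartAt I (c i)).target |
        ∀ j < i, (extChartAt I (c i)).symm y ∉ (extChartAt I (c j)).source},
      (Real.sign (vol _ (coordFrame I b (c i) y)) : ℂ) * η _ (coordFrame I b (c i) y) ∂b.addHaar
  else 0

end Manifold

namespace LieGroupoid

variable {n r : ℕ} {M G : Type*}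
    [TopologicalSpace M] [ChartedSpace (EuSp n) M] [IsManifold (𝓡 n) ∞ M]
    [TopologicalSpace G] [ChartedSpace (EuSp (n + r)) G] [IsManifold (𝓡 (n + r)) ∞ G]
    (Γ : LieGroupoid n r M G)

/-! ## The Lie algebroid of a Lie groupoid -/

/-- The anchor `ρ : 𝔤 → TM`, the restriction of `ds`. -/
def anchor (x : M) : Γ.Alg x →ₗ[ℝ] TangentSpace (𝓡 n) x :=
  castTangent (𝓡 n) (Γ.s_u x) ∘ₗ
    (mfderiv (𝓡 (n + r)) (𝓡 n) Γ.s (Γ.u x)).toLinearMap ∘ₗ (Γ.incl x).toLinearMap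

/-- The derivative of the multiplication at a composable pair `(g, h)`, applied to `(X, Y)`.
It is only used for `ds(X) = dt(Y)`, that is, for `(X, Y)` tangent to the submanifold of composable
pairs; for such vectors the derivative within this submanifold is unambiguous. -/
def tangentMul (g h : G) (X : TangentSpace (𝓡 (n + r)) g) (Y : TangentSpace (𝓡 (n + r)) h) :
    TangentSpace (𝓡 (n + r)) (Γ.mul g h) :=
  mfderivWithin ((𝓡 (n + r)).prod (𝓡 (n + r))) (𝓡 (n + r)) (fun p : G × G => Γ.mul p.1 p.2)
    {p : G × G | Γ.s p.1 = Γ.t p.2} (g, h) (X, Y)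

/-- Left translation `𝔤_{s(g)} → T_g G`, `X ↦ dL_g(X)`. -/
def leftTranslate (g : G) (X : Γ.Alg (Γ.s g)) : TangentSpace (𝓡 (n + r)) g :=
  castTangent (𝓡 (n + r)) (Γ.mul_u g) (Γ.tangentMul g (Γ.u (Γ.s g)) 0 (Γ.incl (Γ.s g) X))

/-- The Lie algebroid `𝔤` of `G`. The bracket of two sections is the restriction to the units of
the bracket of the corresponding left invariant vector fields on `G`. -/
def algebroid : AlgebroidData (𝓡 n) M where
  Fiber := Γ.Alg
  anchor := Γ.anchor
  IsSmooth X := ContMDiff (𝓡 n) ((𝓡 n).prod 𝓘(ℝ, EuSp r)) ∞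
    (fun x => (⟨x, X x⟩ : TotalSpace (EuSp r) Γ.Alg))
  IsBracket X Y Z := ∀ x, Γ.incl x (Z x) = VectorField.mlieBracket (𝓡 (n + r))
    (fun g => Γ.leftTranslate g (X (Γ.s g))) (fun g => Γ.leftTranslate g (Y (Γ.s g))) (Γ.u x)

section Pullback

variable {E : Type} [NormedAddCommGroup E] [NormedSpace ℝ E] {H : Type*} [TopologicalSpace H]
  (I : ModelWithCorners ℝ E H) {P : Type*} [TopologicalSpace P] [ChartedSpace H P]
  [IsManifold I ∞ P] (f : P → M)

/-- The fibre `{(X, ξ) ∈ 𝔤_{f(p)} ⊕ T_p P | ρ(X) = df(ξ)}` of the pull-back `f^!𝔤`. -/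
def pullbackFiber (p : P) : Submodule ℝ (Γ.Alg (f p) × TangentSpace I p) :=
  LinearMap.eqLocus (Γ.anchor (f p) ∘ₗ LinearMap.fst ℝ _ _)
    ((mfderiv I (𝓡 n) f p).toLinearMap ∘ₗ LinearMap.snd ℝ _ _)

/-- The pull-back Lie algebroid `f^!𝔤` over `P`. The bracket of `(∑ᵢ φᵢ Xᵢ, ξ)` and `(∑ⱼ ψⱼ Yⱼ, η)`
with `φᵢ, ψⱼ` functions on `P` and `Xᵢ, Yⱼ` sections of `𝔤` is
`(∑ᵢⱼ φᵢ ψⱼ [Xᵢ,Yⱼ] + ∑ⱼ ξ(ψⱼ) Yⱼ - ∑ᵢ η(φᵢ) Xᵢ, [ξ,η])`. -/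
def pullbackAlgebroid : AlgebroidData I P where
  Fiber p := Γ.pullbackFiber I f p
  anchor p := LinearMap.snd ℝ _ _ ∘ₗ (Γ.pullbackFiber I f p).subtype
  IsSmooth σ := ContMDiff I ((𝓡 n).prod 𝓘(ℝ, EuSp r)) ∞
      (fun p => (⟨f p, (σ p).1.1⟩ : TotalSpace (EuSp r) Γ.Alg)) ∧
    ContMDiff I I.tangent ∞ (fun p => (⟨p, (σ p).1.2⟩ : TangentBundle I P))
  IsBracket σ τ υ := ∃ (k l : ℕ) (φ : Fin k → P → ℝ) (ψ : Fin l → P → ℝ)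
    (X : Fin k → ∀ x, Γ.Alg x) (Y : Fin l → ∀ x, Γ.Alg x) (Z : Fin k → Fin l → ∀ x, Γ.Alg x),
    (∀ i, ContMDiff I 𝓘(ℝ, ℝ) ∞ (φ i)) ∧ (∀ j, ContMDiff I 𝓘(ℝ, ℝ) ∞ (ψ j)) ∧
    (∀ i, Γ.algebroid.IsSmooth (X i)) ∧ (∀ j, Γ.algebroid.IsSmooth (Y j)) ∧
    (∀ i j, Γ.algebroid.IsBracket (X i) (Y j) (Z i j)) ∧
    (∀ p, (σ p).1.1 = ∑ i, φ i p • X i (f p)) ∧ (∀ p, (τ p).1.1 = ∑ j, ψ j p • Y j (f p)) ∧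
    (∀ p, (υ p).1.1 = ∑ i, ∑ j, (φ i p * ψ j p) • Z i j (f p)
      + ∑ j, dirDeriv I (ψ j) p (σ p).1.2 • Y j (f p)
      - ∑ i, dirDeriv I (φ i) p (τ p).1.2 • X i (f p)) ∧
    (∀ p, (υ p).1.2 = VectorField.mlieBracket I (fun q => (σ q).1.2) (fun q => (τ q).1.2) p)

variable {K : Type} [NormedField K] [NormedAlgebra ℝ K] {k : ℕ}

/-- The pull-back `f^*α` of a form on `𝔤` to `f^!𝔤`. -/
def pullbackForm (α : Γ.algebroid.Form K k) : (Γ.pullbackAlgebroid I f).Form K k :=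
  fun p => (α (f p)).compLinearMap (LinearMap.fst ℝ _ _ ∘ₗ (Γ.pullbackFiber I f p).subtype)

/-- The pull-back `ρ^*τ` of a differential form on `P` to `f^!𝔤` along the anchor. -/
def anchorPullback (τ : (tangentAlgebroid I P).Form K k) : (Γ.pullbackAlgebroid I f).Form K k :=
  fun p => (τ p).compLinearMap ((Γ.pullbackAlgebroid I f).anchor p)

end Pullback

/-! ## Invariant transversal densities -/

/-- Sections of `L_𝔤 = ⋀^top 𝔤 ⊗ ⋀^top T*M`, written as `n`-forms on `M` with values
in `⋀^r 𝔤`. -/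
abbrev Density : Type _ := ∀ x : M, TangentSpace (𝓡 n) x [⋀^Fin n]→ₗ[ℝ] ⋀[ℝ]^r (Γ.Alg x)

/-- `S : T_{s(g)} M → T_g G` is the derivative of a local bisection `b` of `G` with `b(s(g)) = g`
(`s ∘ b = id`, and `t ∘ b` a local diffeomorphism), and `A : 𝔤_{s(g)} → 𝔤_{t(g)}` is the derivative
of the conjugation `h ↦ b(t(h)) h b(s(h))⁻¹`, that is, `A(X) · S(ρ(X)) = dL_g(X)`. -/
structure IsAdjointJet (g : G) (S : TangentSpace (𝓡 n) (Γ.s g) →ₗ[ℝ] TangentSpace (𝓡 (n + r)) g)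
    (A : Γ.Alg (Γ.s g) →ₗ[ℝ] Γ.Alg (Γ.t g)) : Prop where
  s_comp : ∀ m, mfderiv (𝓡 (n + r)) (𝓡 n) Γ.s g (S m) = m
  t_comp : Function.Bijective (fun m => mfderiv (𝓡 (n + r)) (𝓡 n) Γ.t g (S m))
  anchor_comp : ∀ X, Γ.anchor (Γ.t g) (A X) =
    mfderiv (𝓡 (n + r)) (𝓡 n) Γ.t g (S (Γ.anchor (Γ.s g) X))
  mul_comp : ∀ X, castTangent (𝓡 (n + r)) (Γ.u_mul g)
      (Γ.tangentMul (Γ.u (Γ.t g)) g (Γ.incl (Γ.t g) (A X)) (S (Γ.anchor (Γ.s g) X))) =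
    Γ.leftTranslate g X

/-- `Ω` is a nowhere vanishing `G`-invariant smooth section of `L_𝔤`. The canonical action of an
arrow `g` on `L_𝔤` is `⋀^top A ⊗ ⋀^top ((dt ∘ S)⁻¹)^*` for any adjoint jet `(S, A)` at `g`. -/
structure IsInvariantVolume (Ω : Γ.Density) : Prop where
  smooth : ∀ β : Γ.algebroid.Form ℝ r, AlgebroidData.IsSmoothForm β →
    AlgebroidData.IsSmoothForm (A := tangentAlgebroid (𝓡 n) M) (fun x => pairing (β x) (Ω x))
  ne_zero : ∀ x, Ω x ≠ 0
  invariant : ∀ g S A, Γ.IsAdjointJet g S A → ∀ m : Fin n → TangentSpace (𝓡 n) (Γ.s g),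
    Ω (Γ.t g) (fun i => mfderiv (𝓡 (n + r)) (𝓡 n) Γ.t g (S (m i))) =
      exteriorPower.map r A (Ω (Γ.s g) m)

/-! ## The manifold `𝔤*` -/

/-- The projection `π : 𝔤* → M`. -/
def proj (p : Γ.DualTotal) : M := p.1

/-- The vertical lift of `w ∈ 𝔤*_x` to a tangent vector of `𝔤*` at `p ∈ 𝔤*_x`. -/
def vertLift (p : Γ.DualTotal) (w : Γ.Dual p.1) : TangentSpace (dualModel n r) p :=
  castTangent (dualModel n r) (by simp)
    (mfderiv 𝓘(ℝ, ℝ) (dualModel n r) (fun s : ℝ => (⟨p.1, p.2 + s • w⟩ : Γ.DualTotal)) 0 (1 : ℝ))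

/-- The vertical component `T_p 𝔤* → 𝔤*_x` in the local trivialisation of `𝔤*` around `x = π(p)`;
it is a left inverse of the vertical lift. -/
def vertPart (p : Γ.DualTotal) : TangentSpace (dualModel n r) p →ₗ[ℝ] Γ.Dual p.1 :=
  let e := trivializationAt (EuSp r →L[ℝ] ℝ) (fun x : M => Γ.Alg x →L[ℝ] Bundle.Trivial M ℝ x) p.1
  (e.symmL ℝ p.1).toLinearMap ∘ₗ
    (mfderiv (dualModel n r) 𝓘(ℝ, EuSp r →L[ℝ] ℝ) (fun q => (e q).2) p).toLinearMap

/-- The differential `T_p 𝔤* → T_x M` of the projection. -/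
def dproj (p : Γ.DualTotal) : TangentSpace (dualModel n r) p →ₗ[ℝ] TangentSpace (𝓡 n) p.1 :=
  (mfderiv (dualModel n r) (𝓡 n) Γ.proj p).toLinearMap

/-- A nowhere vanishing smooth top degree form on `M`; it represents an orientation of `M`. -/
structure IsOrientationForm (vol : (tangentAlgebroid (𝓡 n) M).Form ℝ n) : Prop where
  smooth : AlgebroidData.IsSmoothForm vol
  ne_zero : ∀ x, vol x ≠ 0

/-- A nowhere vanishing smooth family of top degree forms on the fibres of the vector bundle `𝔤*`;
it represents an orientation of this vector bundle. -/
structure IsFiberOrientationForm (vol : ∀ x : M, Γ.Dual x [⋀^Fin r]→ₗ[ℝ] ℝ) : Prop where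
  smooth : ∀ w : Fin r → ∀ x, Γ.Dual x,
    (∀ i, ContMDiff (𝓡 n) (dualModel n r) ∞ (fun x => (⟨x, w i x⟩ : Γ.DualTotal))) →
    ContMDiff (𝓡 n) 𝓘(ℝ, ℝ) ∞ (fun x => vol x (fun i => w i x))
  ne_zero : ∀ x, vol x ≠ 0

/-- The orientation of the manifold `𝔤*` induced by orientations of `M` and of the vector bundle
`𝔤*`: base first, then fibre. -/
def totalOrientation (volM : (tangentAlgebroid (𝓡 n) M).Form ℝ n)
    (volE : ∀ x : M, Γ.Dual x [⋀^Fin r]→ₗ[ℝ] ℝ) (p : Γ.DualTotal) :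
    TangentSpace (dualModel n r) p [⋀^Fin n ⊕ Fin r]→ₗ[ℝ] ℝ :=
  (LinearMap.mul' ℝ ℝ).compAlternatingMap
    (((volM p.1).compLinearMap (Γ.dproj p)).domCoprod ((volE p.1).compLinearMap (Γ.vertPart p)))

/-- `τ` represents the Thom class of the oriented vector bundle `𝔤*`: it is a closed, compactly
supported `r`-form on `𝔤*` whose integral over each (oriented) fibre `𝔤*_x` is `1`. The integral is
computed in the linear coordinates of an arbitrary basis of `𝔤*_x`. -/
structure IsThomForm (volE : ∀ x : M, Γ.Dual x [⋀^Fin r]→ₗ[ℝ] ℝ)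
    (τ : (tangentAlgebroid (dualModel n r) Γ.DualTotal).Form ℂ r) : Prop where
  cocycle : AlgebroidData.IsCocycle τ
  compact : AlgebroidData.IsCompactlySupported τ
  integral_eq_one : ∀ (x : M) (b : Basis (Fin r) ℝ (Γ.Dual x)),
    (Real.sign (volE x b) : ℂ) * ∫ c : Fin r → ℝ,
      τ ⟨x, ∑ i, c i • b i⟩ (fun i => Γ.vertLift ⟨x, ∑ i, c i • b i⟩ (b i)) = 1

/-! ## The pull-back `π^!𝔤` of `𝔤` along `π : 𝔤* → M` -/

/-- The Lie algebroid `π^!𝔤` over `𝔤*`. -/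
abbrev piAlgebroid : AlgebroidData (dualModel n r) Γ.DualTotal :=
  Γ.pullbackAlgebroid (dualModel n r) Γ.proj

/-- The tautological 1-form `λ_p(X, ξ) = ⟨p, X⟩` on `π^!𝔤`. -/
def tautological : Γ.piAlgebroid.Form ℝ 1 := fun p =>
  AlternatingMap.ofSubsingleton ℝ (Γ.piAlgebroid.Fiber p) ℝ (0 : Fin 1)
    ((p.2 : Γ.Alg p.1 →L[ℝ] ℝ).toLinearMap ∘ₗ
      (LinearMap.fst ℝ _ _ ∘ₗ (Γ.pullbackFiber (dualModel n r) Γ.proj p).subtype))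

/-- The form `π^*Ω ∈ ⋀^{n+r} T_p^* 𝔤*`: the factor `⋀^r 𝔤` of `Ω` consists of the top degree forms
on the fibre `𝔤*_x`. With `Ω = (e₁ ∧ … ∧ e_r) ⊗ μ` and the linear coordinates `ξ₁, …, ξ_r` on the
fibres of `𝔤*` given by `e₁, …, e_r`, it is `π^*μ ∧ dξ₁ ∧ … ∧ dξ_r`. -/
def densityForm (Ω : Γ.Density) (p : Γ.DualTotal) :
    TangentSpace (dualModel n r) p [⋀^Fin n ⊕ Fin r]→ₗ[ℝ] ℝ :=
  (contractRight ℝ (⋀[ℝ]^r (Γ.Alg p.1))).compAlternatingMap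
    (((Ω p.1).compLinearMap (Γ.dproj p)).domCoprod
      ((exteriorPower.alternatingMapToDual ℝ (Γ.Alg p.1) r).compLinearMap
        (ContinuousLinearMap.coeLM ℝ ∘ₗ Γ.vertPart p)))

/-- The element of `⋀^{2r} (π^!𝔤)_p` dual to the Liouville volume `(-1)^{r(r+1)/2} Θ^r / r!`. -/
def liouvilleDual (Θ : Γ.piAlgebroid.Form ℝ 2) (p : Γ.DualTotal) :
    ⋀[ℝ]^(2 * r) (Γ.piAlgebroid.Fiber p) :=
  Classical.epsilon fun ν => exteriorPower.alternatingMapLinearEquiv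
    (((-1 : ℝ) ^ (r * (r + 1) / 2) / (r.factorial : ℝ)) • wedgePow (Θ p) r) ν = 1

/-- The volume form `Ω_{π^!𝔤} = Θ^r ⊗ π^*Ω`, a section of `⋀^{2r} π^!𝔤 ⊗ ⋀^{n+r} T^*𝔤*`. -/
def symplecticVolume (Θ : Γ.piAlgebroid.Form ℝ 2) (Ω : Γ.Density) (p : Γ.DualTotal) :
    TangentSpace (dualModel n r) p [⋀^Fin n ⊕ Fin r]→ₗ[ℝ] ⋀[ℝ]^(2 * r) (Γ.piAlgebroid.Fiber p) :=
  (LinearMap.toSpanSingleton ℝ _ (Γ.liouvilleDual Θ p)).compAlternatingMap (Γ.densityForm Ω p)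

/-- The form `π^*α ∧ ρ^*τ` on `π^!𝔤`. -/
def thomProduct (α : Γ.algebroid.Form ℂ r)
    (τ : (tangentAlgebroid (dualModel n r) Γ.DualTotal).Form ℂ r) :
    Γ.piAlgebroid.Form ℂ (2 * r) := fun p =>
  (wedge (Γ.pullbackForm (dualModel n r) Γ.proj α p)
    (Γ.anchorPullback (dualModel n r) Γ.proj τ p)).domDomCongr (finCongr (two_mul r).symm)

/-- The integral `∫_M ⟨α, Ω⟩`. -/
def baseIntegral (volM : (tangentAlgebroid (𝓡 n) M).Form ℝ n) (α : Γ.algebroid.Form ℂ r)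
    (Ω : Γ.Density) : ℂ :=
  formIntegral (𝓡 n) (EuclideanSpace.basisFun (Fin n) ℝ).toBasis volM
    (fun x => pairing (α x) (Ω x))

/-- The integral `∫_{𝔤*} ⟨c, W⟩` of a form `c` of top degree on `π^!𝔤` against a section `W` of
`⋀^{2r} π^!𝔤 ⊗ ⋀^{n+r} T^*𝔤*`. -/
def totalIntegral (vol : ∀ p : Γ.DualTotal,
      TangentSpace (dualModel n r) p [⋀^Fin n ⊕ Fin r]→ₗ[ℝ] ℝ)
    (c : Γ.piAlgebroid.Form ℂ (2 * r))
    (W : ∀ p : Γ.DualTotal, TangentSpace (dualModel n r) p [⋀^Fin n ⊕ Fin r]→ₗ[ℝ]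
      ⋀[ℝ]^(2 * r) (Γ.piAlgebroid.Fiber p)) : ℂ :=
  formIntegral (dualModel n r)
    ((EuclideanSpace.basisFun (Fin n) ℝ).toBasis.prod
      ((EuclideanSpace.basisFun (Fin r) ℝ).toBasis.dualBasis.map
        LinearMap.toContinuousLinearMap))
    vol (fun p => pairing (c p) (W p))

end LieGroupoid

end

set_option linter.unusedSectionVars false

/-! Both integrals depend only on the cohomology classes, and for the representative `π^*α ∧ ρ^*τ`
the integral over `𝔤*` is computed by integrating along the fibres.

Invariance under exact forms is a Stokes theorem, `formIntegral_pairing_differential_eq_zero`. In a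
chart let `h` be the coefficient of the density, `e_j` a local frame of the algebroid with `[e_i,
e_j] = ∑_m C_ij^m e_m`, `v_j` the anchors of the frame in coordinates, and `β_j` the value of `β` on
the frame with `e_j` omitted. By the Koszul formula the pairing with `dβ` is `∑_j (-1)^j h (v_j·β_j
+ (∑_i C_ij^i) β_j)`. If `div (h v_j) = h ∑_i C_ij^i`, this is the divergence of `∑_j (-1)^j β_j h
v_j`, and its integral vanishes when the support is compact. The structure
`AlgebroidData.UnimodularFrame` records exactly this infinitesimal invariance.

For `𝔤` it is obtained from the invariance under the groupoid. Near a unit of `G` there are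
coordinates `(y, w)` with `y` those of the target and `w` along the `t`-fibre; multiplication and
source become maps `mult` and `src` of Euclidean spaces. The bisections with constant `w` provide
adjoint jets, so invariance of `Ω` says that `h` at the target times `det multLeft` equals `h` at
the source times `det srcBase` times `det multRight` (`eventually_coeff`). All these operators are
the identity at the unit, so differentiation there in a fibre direction gives an identity between
traces (`divergence_anchorVec`). The structure functions are the antisymmetrised second derivative
of `mult` (`locTriv_bracket`), and symmetry of second derivatives makes the two computations match.

On `π^!𝔤` one uses the frame made of the `e_i`, lifted without vertical component in the chart, and
of the vertical coordinate fields `f_j`. Brackets involving an `f_j` vanish and the others have the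
structure functions of `𝔤`, while all coefficients depend on the base point only; hence
infinitesimal invariance passes from `Ω` to the symplectic volume (`exists_extension_piFrame`). The
canonical form satisfies `Θ(e_i, f_j) = -δ_ij` and `Θ(f_i, f_j) = 0`. Its top power on this frame is
therefore `(-1)^(r(r+1)/2) r!`, whatever the values `Θ(e_i, e_j)` are (`wedgePow_append`), and the
normalised multivector is `e_1 ∧ … ∧ e_r ∧ f_1 ∧ … ∧ f_r`.

Finally `π^*α` kills the `f_j`, so `π^*α ∧ ρ^*τ` takes the value `α(e_1, …, e_r) τ(f_1, …, f_r)` on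
this frame. The integrand over `𝔤*` is the one over `M` times the vertical part of `τ`; Fubini's
theorem and the normalisation of the Thom form finish the computation (`totalIntegral_thomProduct`).

The definition of `formIntegral` hides a choice of charts. That it may be computed from any
decomposition into pieces supported in charts is `formIntegral_eq_sum_chartIntegral`. Cutoff
functions and partitions of unity on `𝔤*` are pulled back from the compact Hausdorff manifold `M`.
-/

noncomputable section

/-! ### Alternating maps: shuffles, Koszul sums, triangular substitutions -/

section ExteriorAlgebra

open scoped TensorProduct

variable {V : Type*} [AddCommGroup V] [Module ℝ V]

/-- Only the identity shuffle contributes if the first factor is killed by the second block. -/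
theorem AlternatingMap.domCoprod_sumElim {ι κ N₁ N₂ : Type*} [Fintype ι] [Fintype κ]
    [DecidableEq ι] [DecidableEq κ] [AddCommGroup N₁] [Module ℝ N₁] [AddCommGroup N₂] [Module ℝ N₂]
    (a : V [⋀^ι]→ₗ[ℝ] N₁) (b : V [⋀^κ]→ₗ[ℝ] N₂) (v : ι → V) (w : κ → V)
    (h : ∀ (x : ι → V) i j, x i = w j → a x = 0) :
    a.domCoprod b (Sum.elim v w) = a v ⊗ₜ b w := by
  classical
  rw [AlternatingMap.domCoprod_apply, sum_apply]
  refine (Finset.sum_eq_single (Quotient.mk'' (1 : Equiv.Perm (ι ⊕ κ))) ?_ ?_).trans ?_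
  · intro σ _ hσ
    induction σ using Quotient.inductionOn' with | _ σ
    rw [AlternatingMap.domCoprod.summand_mk'']
    -- A permutation preserving the first block lies in the subgroup by which permutations are
    -- divided, so its class is trivial. Any other one feeds a vector of the second block to `a`.
    by_cases hm : Set.MapsTo σ (Set.range Sum.inl) (Set.range Sum.inl)
    · refine absurd ?_ hσ
      refine Quotient.sound' ?_
      rw [QuotientGroup.leftRel_apply]
      exact (Subgroup.mul_mem_cancel_right _ (Subgroup.one_mem _)).2
        (inv_mem (Equiv.Perm.mem_sumCongrHom_range_of_perm_mapsTo_inl hm))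
    · simp only [Set.MapsTo, not_forall] at hm
      obtain ⟨_, ⟨i, rfl⟩, hi⟩ := hm
      have : ∃ j, σ (Sum.inl i) = Sum.inr j := by
        rcases hh : σ (Sum.inl i) with l | l
        · exact absurd ⟨l, hh.symm⟩ hi
        · exact ⟨l, rfl⟩
      obtain ⟨j, hj⟩ := this
      simp only [_root_.smul_apply, MultilinearMap.domDomCongr_apply,
        MultilinearMap.domCoprod_apply, AlternatingMap.coe_multilinearMap]
      rw [h (fun i₁ => Sum.elim v w (σ (Sum.inl i₁))) i j (by simp [hj])]
      simp
  · simp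
  · rw [AlternatingMap.domCoprod.summand_mk'']
    simp [MultilinearMap.domCoprod_apply]

/-- The Koszul sum of the bracket terms of a form of degree one less than the rank. -/
theorem AlternatingMap.sum_update_bracket {K : Type*} [NormedField K] [NormedAlgebra ℝ K] {k : ℕ}
    (b : V [⋀^Fin k]→ₗ[ℝ] K) (E : Fin (k + 1) → V) (C : Fin (k + 1) → Fin (k + 1) → Fin (k + 1) → ℝ)
    (hC : ∀ i j m, C i j m = - C j i m) :
    ∑ j : Fin (k + 1), ∑ i ∈ Finset.Iio j, (-1 : K) ^ (j : ℕ) *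
        b (fun l => Function.update E i (∑ m, C i j m • E m) (j.succAbove l)) =
      ∑ j : Fin (k + 1), (-1 : K) ^ (j : ℕ) * ((∑ i, C i j i) • b (j.removeNth E)) := by
  -- In the expansion of the bracket only the components along `E i` and `E j` survive, because
  -- every other frame vector already occurs among the arguments. The first is the trace
  -- contribution of `(i, j)`; the second, after moving `E j` into place and using antisymmetry of
  -- `C`, is that of `(j, i)`.
  have key : ∀ i j : Fin (k + 1), i < j → (-1 : K) ^ (j : ℕ) *
        b (fun l => Function.update E i (∑ m, C i j m • E m) (j.succAbove l)) =
      (-1 : K) ^ (j : ℕ) * (C i j i • b (j.removeNth E)) +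
      (-1 : K) ^ (i : ℕ) * (C j i j • b (i.removeNth E)) := by
    intro i j hij
    obtain ⟨i', hi'⟩ := Fin.exists_succAbove_eq hij.ne
    have hup : ∀ x, (fun l => Function.update E i x (j.succAbove l)) =
        Function.update (j.removeNth E) i' x := by
      intro x
      funext l
      by_cases hl : l = i'
      · subst hl; simp [hi']
      · rw [Function.update_of_ne hl, Function.update_of_ne]
        · rfl
        · rw [← hi']
          exact fun h => hl (Fin.succAbove_right_injective h)
    rw [hup, AlternatingMap.map_update_sum]
    have hterm : ∀ m, m ≠ i → m ≠ j → b (Function.update (j.removeNth E) i' (C i j m • E m)) = 0 := by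
      intro m hmi hmj
      obtain ⟨m', hm'⟩ := Fin.exists_succAbove_eq hmj
      have hne : i' ≠ m' := by
        rintro rfl
        exact hmi (hm'.symm.trans hi')
      rw [AlternatingMap.map_update_smul, AlternatingMap.map_eq_zero_of_eq b _ (i := i') (j := m'),
        smul_zero]
      · rw [Function.update_self, Function.update_of_ne hne.symm, ← hm']
        rfl
      · exact hne
    rw [Finset.sum_eq_add i j hij.ne (fun m _ hm => hterm m hm.1 hm.2) (by simp) (by simp), mul_add]
    congr 1
    · rw [AlternatingMap.map_update_smul]
      have : Function.update (j.removeNth E) i' (E i) = j.removeNth E := by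
        rw [Function.update_eq_self_iff]
        rw [← hi']
        rfl
      rw [this]
    · rw [AlternatingMap.map_update_smul]
      -- Putting `E j` in the place of `E i` gives a family with a repeated vector, and the two ways
      -- of deleting one copy are related by a sign.
      have h0 := b.neg_one_pow_smul_map_removeNth_add_eq_zero_of_eq
        (v := Function.update E i (E j)) (i := i) (j := j)
        (by rw [Function.update_self, Function.update_of_ne hij.ne']) hij.ne
      have h1 : j.removeNth (Function.update E i (E j)) = Function.update (j.removeNth E) i' (E j) :=
        hup (E j)
      have h2 : i.removeNth (Function.update E i (E j)) = i.removeNth E := by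
        funext l
        simp [Fin.removeNth]
      rw [h1, h2] at h0
      have h3 : (-1 : K) ^ (j : ℕ) * b (Function.update (j.removeNth E) i' (E j)) =
          -((-1 : K) ^ (i : ℕ) * b (i.removeNth E)) := by
        have h4 : ∀ (p : ℕ) (x : K), ((-1 : ℤ) ^ p) • x = (-1 : K) ^ p * x := by
          intro p x
          simp [zsmul_eq_mul]
        rw [← h4, ← h4]
        exact eq_neg_of_add_eq_zero_right h0
      rw [mul_smul_comm, h3, hC i j j, neg_smul, smul_neg, neg_neg, mul_smul_comm]
  -- The full trace contains diagonal terms, which the sum over `i < j` does not produce;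
  -- antisymmetry makes them vanish.
  have hdiag : ∀ j m, C j j m = 0 := fun j m => by linarith [hC j j m]
  set T : Fin (k + 1) → Fin (k + 1) → K := fun i j =>
    (-1 : K) ^ (j : ℕ) * (C i j i • b (j.removeNth E)) with hT
  calc _ = ∑ j, ∑ i ∈ Finset.Iio j, (T i j + T j i) :=
        Finset.sum_congr rfl fun j _ => Finset.sum_congr rfl fun i hi =>
          key i j (Finset.mem_Iio.1 hi)
    _ = ∑ j, ∑ i ∈ Finset.Iio j, T i j + ∑ j, ∑ i ∈ Finset.Ioi j, T i j := by
        simp only [Finset.sum_add_distrib]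
        congr 1
        refine Finset.sum_comm' fun x y => ?_
        simp
    _ = ∑ j, ∑ i, T i j := by
        rw [← Finset.sum_add_distrib]
        refine Finset.sum_congr rfl fun j _ => ?_
        rw [← Finset.sum_union, ← Finset.sum_subset (Finset.subset_univ _)]
        · intro i _ hi
          have : i = j := by
            simp only [Finset.mem_union, Finset.mem_Iio, Finset.mem_Ioi, not_or, not_lt] at hi
            exact le_antisymm hi.2 hi.1
          subst this
          simp [hT, hdiag]
        · rw [Finset.disjoint_left]
          intro i h1 h2
          exact lt_asymm (Finset.mem_Iio.1 h1) (Finset.mem_Ioi.1 h2)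
    _ = _ := by
        refine Finset.sum_congr rfl fun j _ => ?_
        rw [Finset.sum_smul, Finset.mul_sum]

/-- Changing some of the arguments of an alternating map by combinations of the others. -/
theorem AlternatingMap.map_sumElim_add_sum {N ι κ : Type*} [AddCommGroup N] [Module ℝ N]
    [Fintype ι] [Fintype κ] (f : V [⋀^ι ⊕ κ]→ₗ[ℝ] N) (v : ι → V) (w : κ → V) (a : ι → κ → ℝ) :
    f (Sum.elim (fun i => v i + ∑ j, a i j • w j) w) = f (Sum.elim v w) := by
  classical
  have h : Sum.elim (fun i => v i + ∑ j, a i j • w j) w =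
      Sum.elim v w + Sum.elim (fun i => ∑ j, a i j • w j) 0 := by
    funext x
    rcases x with i | j <;> simp
  rw [h]
  -- Multilinear expansion over the set of slots that keep the original vector. A proper subset
  -- either leaves a zero in a slot of the second block, or keeps all `w j` and puts a combination
  -- of them in a slot of the first block; both give zero.
  have h2 := f.toMultilinearMap.map_add_univ (Sum.elim v w)
    (Sum.elim (fun i => ∑ j, a i j • w j) 0)
  refine h2.trans ((Finset.sum_eq_single Finset.univ ?_ ?_).trans ?_)
  · intro s _ hs
    obtain ⟨x, hx⟩ : ∃ x, x ∉ s := by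
      by_contra! h3
      exact hs (Finset.eq_univ_iff_forall.2 h3)
    by_cases hk : ∃ j : κ, Sum.inr j ∉ s
    · obtain ⟨j, hj⟩ := hk
      exact f.toMultilinearMap.map_coord_zero (Sum.inr j) (by simp [hj])
    · push Not at hk
      rcases x with i | j
      · set y := s.piecewise (Sum.elim v w) (Sum.elim (fun i => ∑ j, a i j • w j) 0) with hy
        have h4 : y = Function.update y (Sum.inl i) (∑ j, a i j • w j) := by
          rw [eq_comm, Function.update_eq_self_iff, hy]
          simp [hx]
        change f y = 0
        rw [h4, AlternatingMap.map_update_sum]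
        refine Finset.sum_eq_zero fun j _ => ?_
        rw [AlternatingMap.map_update_smul, f.map_eq_zero_of_eq _ (i := Sum.inl i) (j := Sum.inr j),
          smul_zero]
        · simp [hy, hk j]
        · simp
      · exact absurd (hk j) hx
  · simp
  · simp

end ExteriorAlgebra

/-! ### The top power of a 2-form on a symplectic frame -/

section Darboux

open scoped Nat

variable {V : Type*} [AddCommGroup V] [Module ℝ V]

/-- The enumeration `(0,0), (0,1), (1,0), (1,1), …` of `Fin k × Fin 2`. -/
def pairEquiv (k : ℕ) : Fin (2 * k) ≃ Fin k × Fin 2 :=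
  (finCongr (mul_comm 2 k)).trans finProdFinEquiv.symm

theorem pairEquiv_fst_val (k : ℕ) (x : Fin (2 * k)) : ((pairEquiv k x).1 : ℕ) = x / 2 := rfl

theorem pairEquiv_snd_val (k : ℕ) (x : Fin (2 * k)) : ((pairEquiv k x).2 : ℕ) = x % 2 := rfl

/-- The enumeration of pairs, with the last pair split off. -/
def pairEquivSum (k : ℕ) : Fin (2 * k) ⊕ Fin 2 ≃ Fin (k + 1) × Fin 2 :=
  finSumFinEquiv.trans (pairEquiv (k + 1))

theorem pairEquivSum_inl (k : ℕ) (i : Fin (2 * k)) :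
    pairEquivSum k (Sum.inl i) = ((pairEquiv k i).1.castSucc, (pairEquiv k i).2) := by
  refine Prod.ext (Fin.ext ?_) (Fin.ext ?_) <;>
    simp [pairEquivSum, pairEquiv, Fin.divNat, Fin.modNat]

theorem pairEquivSum_inr (k : ℕ) (b : Fin 2) :
    pairEquivSum k (Sum.inr b) = (Fin.last k, b) := by
  refine Prod.ext (Fin.ext ?_) (Fin.ext ?_) <;>
    simp [pairEquivSum, pairEquiv, Fin.divNat, Fin.modNat] <;> omega

/-- Exchange of the `i`-th pair with the last one. -/
def pairSwap (k : ℕ) (i : Fin (k + 1)) : Equiv.Perm (Fin (2 * k) ⊕ Fin 2) :=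
  (pairEquivSum k).symm.permCongr (Equiv.prodCongrLeft fun _ => Equiv.swap i (Fin.last k))

theorem pairEquivSum_pairSwap (k : ℕ) (i : Fin (k + 1)) (x : Fin (2 * k) ⊕ Fin 2) :
    pairEquivSum k (pairSwap k i x) =
      (Equiv.swap i (Fin.last k) (pairEquivSum k x).1, (pairEquivSum k x).2) := by
  simp [pairSwap, Equiv.permCongr_apply, Equiv.prodCongrLeft]

/-- The permutation performs the same exchange on the first and on the second members of the pairs,
so its sign is a square. -/
theorem sign_pairSwap (k : ℕ) (i : Fin (k + 1)) : Equiv.Perm.sign (pairSwap k i) = 1 := by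
  rw [pairSwap, Equiv.Perm.sign_permCongr, Equiv.Perm.sign_prodCongrLeft]
  simp

/-- Induction on the number of factors. Since `θ` vanishes on vectors from different pairs, a
shuffle contributes to `θ^k ∧ θ` only if it hands a complete pair to the last factor. The shuffle
for the `i`-th pair is represented by `pairSwap k i`; it is even, so the `k + 1` contributions agree
and the factorial appears. -/
theorem wedgePow_pairs (θ : V [⋀^Fin 2]→ₗ[ℝ] ℝ) (k : ℕ) (u : Fin k → Fin 2 → V)
    (h0 : ∀ i j, i ≠ j → ∀ a b, θ ![u i a, u j b] = 0) (h1 : ∀ i, θ ![u i 0, u i 1] = -1) :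
    wedgePow θ k (fun x => u (pairEquiv k x).1 (pairEquiv k x).2) = (-1) ^ k * k ! := by
  induction k with
  | zero => simp [wedgePow]
  | succ k ih =>
    set y : Fin (2 * k) ⊕ Fin 2 → V :=
      fun x => u (pairEquivSum k x).1 (pairEquivSum k x).2 with hy
    have hval : ∀ σ : Equiv.Perm (Fin (2 * k) ⊕ Fin 2),
        LinearMap.mul' ℝ ℝ (AlternatingMap.domCoprod.summand (wedgePow θ k) θ
          (Quotient.mk'' σ) y) = Equiv.Perm.sign σ • (wedgePow θ k (fun i => y (σ (Sum.inl i))) *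
            θ (fun b => y (σ (Sum.inr b)))) := by
      intro σ
      rw [AlternatingMap.domCoprod.summand_mk'']
      simp only [smul_apply, MultilinearMap.domDomCongr_apply,
        MultilinearMap.domCoprod_apply, AlternatingMap.coe_multilinearMap]
      rw [map_zsmul_unit, LinearMap.mul'_apply]
    have hθ : ∀ f : Fin 2 → V, θ f = θ ![f 0, f 1] := fun f => by
      congr 1
      funext b
      fin_cases b <;> rfl
    have hswap : ∀ i x, y (pairSwap k i x) =
        u (Equiv.swap i (Fin.last k) (pairEquivSum k x).1) (pairEquivSum k x).2 := by
      intro i x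
      rw [hy]
      simp only [pairEquivSum_pairSwap]
    change LinearMap.mul' ℝ ℝ ((wedgePow θ k).domCoprod θ y) = _
    rw [AlternatingMap.domCoprod_apply, sum_apply, map_sum]
    have hmain : ∑ i : Fin (k + 1), (-1 : ℝ) ^ k * k ! * (-1) =
        ∑ σ, LinearMap.mul' ℝ ℝ (AlternatingMap.domCoprod.summand (wedgePow θ k) θ σ y) := by
      refine Finset.sum_of_injOn (fun i => Quotient.mk'' (pairSwap k i)) ?_
        (fun _ _ => Finset.mem_coe.2 (Finset.mem_univ _)) ?_ ?_
      · intro i _ j _ hij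
        have h := Quotient.exact' hij
        rw [QuotientGroup.leftRel_apply] at h
        obtain ⟨⟨sl, sr⟩, hs⟩ := h
        have h2 : pairSwap k i (Sum.inr (sr 0)) = pairSwap k j (Sum.inr 0) := by
          have := Equiv.congr_fun hs (Sum.inr 0)
          simp only [Equiv.Perm.sumCongrHom_apply, Equiv.Perm.sumCongr_apply, Sum.map_inr,
            Equiv.Perm.coe_mul, Function.comp_apply] at this
          rw [this]
          simp
        have h3 := congrArg (fun x => (pairEquivSum k x).1) h2
        simpa [pairEquivSum_pairSwap, pairEquivSum_inr] using h3
      · intro q _ hq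
        induction q using Quotient.inductionOn' with | _ σ
        rw [hval, hθ]
        -- If the last two slots receive members of one pair `i`, they receive all of it, and the
        -- class of `σ` is that of `pairSwap k i`, which was excluded. Otherwise the factor `θ`
        -- vanishes.
        by_cases hp : (pairEquivSum k (σ (Sum.inr 0))).1 = (pairEquivSum k (σ (Sum.inr 1))).1
        · refine absurd ?_ hq
          set i := (pairEquivSum k (σ (Sum.inr 0))).1 with hi
          refine ⟨i, by simp, ?_⟩
          refine Quotient.sound' ?_
          rw [QuotientGroup.leftRel_apply]
          refine Equiv.Perm.mem_sumCongrHom_range_of_perm_mapsTo_inl ?_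
          rintro _ ⟨l, rfl⟩
          rcases hx : ((pairSwap k i)⁻¹ * σ) (Sum.inl l) with z | b
          · exact ⟨z, rfl⟩
          · exfalso
            rw [Equiv.Perm.mul_apply, Equiv.Perm.inv_eq_iff_eq] at hx
            have hx2 : pairEquivSum k (σ (Sum.inl l)) = (i, b) := by
              rw [hx, pairEquivSum_pairSwap, pairEquivSum_inr]
              simp
            have hne : (pairEquivSum k (σ (Sum.inr 0))).2 ≠ (pairEquivSum k (σ (Sum.inr 1))).2 := by
              intro h
              have := σ.injective ((pairEquivSum k).injective (Prod.ext hp h))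
              simp at this
            have : ∃ b', (pairEquivSum k (σ (Sum.inr b'))).2 = b := by
              rcases eq_or_ne (pairEquivSum k (σ (Sum.inr 0))).2 b with h | h
              · exact ⟨0, h⟩
              · exact ⟨1, by omega⟩
            obtain ⟨b', hb'⟩ := this
            have hb1 : (pairEquivSum k (σ (Sum.inr b'))).1 = i := by
              fin_cases b'
              · rfl
              · exact hp.symm
            have := σ.injective ((pairEquivSum k).injective
              (hx2.trans (Prod.ext (y := (i, b)) hb1 hb').symm))
            simp at this
        · rw [h0 _ _ hp, mul_zero, smul_zero]
      · intro i _
        rw [hval, sign_pairSwap, one_smul, hθ]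
        have e1 : (fun l => y (pairSwap k i (Sum.inl l))) = fun x =>
            (fun j => u (Equiv.swap i (Fin.last k) j.castSucc)) (pairEquiv k x).1
              (pairEquiv k x).2 := by
          funext l
          rw [hswap, pairEquivSum_inl]
        rw [e1, ih (fun j => u (Equiv.swap i (Fin.last k) j.castSucc))]
        · rw [hswap, hswap, pairEquivSum_inr, pairEquivSum_inr, h1]
        · intro j l hjl a b
          exact h0 _ _ (fun h => hjl (Fin.castSucc_injective _ ((Equiv.injective _) h))) a b
        · intro j
          exact h1 _
    rw [← hmain]
    simp [Nat.factorial_succ, pow_succ]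
    ring

/-- Passing from the order `v₀, w₀, v₁, w₁, …` to the order `v₀, …, v_{k-1}, w₀, …, w_{k-1}`. -/
theorem AlternatingMap.map_append_eq_pairs {N : Type*} [AddCommGroup N] [Module ℝ N] (k : ℕ)
    (f : V [⋀^Fin (2 * k)]→ₗ[ℝ] N) (u : Fin k → Fin 2 → V) :
    f (Fin.append (fun i => u i 0) (fun i => u i 1) ∘ Fin.cast (two_mul k)) =
      (-1 : ℝ) ^ (k * (k - 1) / 2) • f (fun x => u (pairEquiv k x).1 (pairEquiv k x).2) := by
  induction k with
  | zero =>
    simp only [zero_mul, Nat.zero_div, pow_zero, one_smul]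
    congr 1
    funext x
    exact x.elim0
  | succ k ih =>
    -- With the first pair frozen in the two leading arguments, the induction hypothesis applies to
    -- the remaining `2 * k` ones.
    set g : V [⋀^Fin (2 * k)]→ₗ[ℝ] N := (f.curryLeft (u 0 0)).curryLeft (u 0 1) with hg
    have happ : ∀ (m : ℕ) (a b : Fin m → V) (x : Fin (2 * m)),
        (Fin.append a b ∘ Fin.cast (two_mul m)) x =
          if h : x.1 < m then a ⟨x, h⟩ else b ⟨x - m, by omega⟩ := by
      intro m a b x
      rw [Function.comp_apply]
      split_ifs with h
      · exact (congrArg _ (Fin.ext rfl)).trans (Fin.append_left a b ⟨x, h⟩)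
      · refine (congrArg _ (Fin.ext ?_)).trans (Fin.append_right a b ⟨x - m, by omega⟩)
        simp only [Fin.val_cast, Fin.val_natAdd]
        omega
    have e1 : Fin.append (fun i => u i 0) (fun i => u i 1) ∘ Fin.cast (two_mul (k + 1)) =
        Matrix.vecCons (u 0 0) (Fin.insertNth ⟨k, by omega⟩ (u 0 1)
          (Fin.append (fun i : Fin k => u i.succ 0) (fun i => u i.succ 1) ∘
            Fin.cast (two_mul k)) : Fin (2 * k + 1) → V) := by
      funext x
      rw [happ]
      refine Fin.cases ?_ (fun z => ?_) (x : Fin (2 * k + 1 + 1))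
      · simp
      · rw [Matrix.cons_val_succ]
        rcases Fin.eq_self_or_eq_succAbove (⟨k, by omega⟩ : Fin (2 * k + 1)) z with rfl | ⟨l, rfl⟩
        · rw [Fin.insertNth_apply_same]
          simp
        · rw [Fin.insertNth_apply_succAbove, happ]
          by_cases hl : l.1 < k
          · have : (Fin.succAbove (⟨k, by omega⟩ : Fin (2 * k + 1)) l : ℕ) = l + 0 := by
              rw [Fin.succAbove_of_castSucc_lt _ _ (by simpa [Fin.lt_def] using hl)]
              simp
            rw [dif_pos (by rw [Fin.val_succ]; omega), dif_pos hl]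
            congr 1
            exact Fin.ext (by rw [Fin.val_succ, Fin.val_succ, this])
          · have : (Fin.succAbove (⟨k, by omega⟩ : Fin (2 * k + 1)) l : ℕ) = l + 1 := by
              rw [Fin.succAbove_of_le_castSucc _ _ (by simpa [Fin.le_def] using hl)]
              simp
            rw [dif_neg (by rw [Fin.val_succ]; omega), dif_neg hl]
            congr 1
            refine Fin.ext ?_
            simp only [Fin.val_succ, this]
            omega
    have e2 : (fun x => u (pairEquiv (k + 1) x).1 (pairEquiv (k + 1) x).2) =
        Matrix.vecCons (u 0 0) (Matrix.vecCons (u 0 1)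
          (fun x => u (pairEquiv k x).1.succ (pairEquiv k x).2)) := by
      funext x
      refine Fin.cases ?_ (fun z => Fin.cases ?_ (fun l => ?_) z) (x : Fin (2 * k + 1 + 1))
      · rw [Matrix.cons_val_zero]
        have h1 : (pairEquiv (k + 1) (0 : Fin (2 * k + 1 + 1))).1 = 0 :=
          Fin.ext ((pairEquiv_fst_val _ _).trans (Nat.zero_div 2))
        have h2 : (pairEquiv (k + 1) (0 : Fin (2 * k + 1 + 1))).2 = 0 :=
          Fin.ext ((pairEquiv_snd_val _ _).trans (Nat.zero_mod 2))
        rw [h1, h2]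
      · rw [Matrix.cons_val_succ, Matrix.cons_val_zero]
        have h1 : (pairEquiv (k + 1) (Fin.succ 0 : Fin (2 * k + 1 + 1))).1 = 0 :=
          Fin.ext ((pairEquiv_fst_val _ _).trans (by
            simp only [Fin.val_succ, Fin.val_zero, zero_add, Nat.reduceDiv]))
        have h2 : (pairEquiv (k + 1) (Fin.succ 0 : Fin (2 * k + 1 + 1))).2 = 1 :=
          Fin.ext ((pairEquiv_snd_val _ _).trans (by rw [Fin.val_succ]; rfl))
        rw [h1, h2]
      · rw [Matrix.cons_val_succ, Matrix.cons_val_succ]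
        congr 1
        · refine Fin.ext ?_
          simp [pairEquiv, Fin.divNat]
          omega
        · refine Fin.ext ?_
          simp [pairEquiv, Fin.modNat]
          omega
    rw [e1, e2]
    change (f.curryLeft (u 0 0)) _ = _ • g _
    -- Moving `w₀` to the second place passes the `k` remaining vectors `v_i`. The sign `(-1)^k`
    -- adds up with the inductive one because the triangular numbers satisfy `k(k-1)/2 + k =
    -- (k+1)k/2`.
    rw [AlternatingMap.map_insertNth]
    change _ • g _ = _
    rw [ih g (fun i => u i.succ)]
    have h3 : ∀ (p : ℕ) (x : N), ((-1 : ℤ) ^ p) • x = ((-1 : ℝ) ^ p) • x := by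
      intro p x
      rw [← Int.cast_smul_eq_zsmul ℝ]
      simp
    rw [h3, smul_smul, ← pow_add]
    congr 2
    rw [Nat.triangle_succ, add_comm]

/-- The Liouville volume of a symplectic basis up to isotropic corrections. -/
theorem wedgePow_append (θ : V [⋀^Fin 2]→ₗ[ℝ] ℝ) (k : ℕ) (v w : Fin k → V)
    (hvw : ∀ i j, θ ![v i, w j] = if i = j then -1 else 0) (hw : ∀ i j, θ ![w i, w j] = 0) :
    wedgePow θ k (Fin.append v w ∘ Fin.cast (two_mul k)) = (-1) ^ (k * (k + 1) / 2) * k ! := by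
  let B : V →ₗ[ℝ] V →ₗ[ℝ] ℝ := LinearMap.mk₂ ℝ (fun x y => θ ![x, y])
    (fun x y z => θ.map_vecCons_add ![z] x y) (fun c x y => θ.map_vecCons_smul ![y] c x)
    (fun x y z => (θ.curryLeft x).map_vecCons_add ![] y z)
    (fun c x y => (θ.curryLeft x).map_vecCons_smul ![] c y)
  have hB : ∀ x y, θ ![x, y] = B x y := fun x y => rfl
  have hanti : ∀ x y, B x y = - B y x := by
    intro x y
    rw [← hB, ← hB, ← θ.map_swap ![y, x] (i := 0) (j := 1) (by simp)]
    congr 1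
    funext b
    fin_cases b <;> simp
  have hself : ∀ x, B x x = 0 := fun x => by linarith [hanti x x]
  -- Half of the pairing of `v i` with `v j` is removed by subtracting multiples of the `w j`. This
  -- makes the first half isotropic without changing the value of the top power, so nothing has to
  -- be assumed about `θ` on the `v i`.
  set v' : Fin k → V := fun i => v i + ∑ j, (-(θ ![v i, v j]) / 2) • w j with hv'
  have hvw' : ∀ i j, B (v' i) (w j) = if i = j then -1 else 0 := by
    intro i j
    simp only [hv', map_add, map_sum, map_smul, LinearMap.add_apply, LinearMap.sum_apply,
      LinearMap.smul_apply, ← hB, hvw, hw]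
    simp
  have hvv' : ∀ i j, B (v' i) (v' j) = 0 := by
    intro i j
    have hwv : ∀ l j, B (w l) (v j) = if j = l then 1 else 0 := by
      intro l j
      rw [hanti, ← hB, hvw]
      split_ifs <;> simp
    have e1 : B (v' i) (v j) = B (v i) (v j) - θ ![v i, v j] / 2 := by
      simp only [hv', map_add, map_sum, map_smul, LinearMap.add_apply, LinearMap.sum_apply,
        LinearMap.smul_apply, hwv]
      simp
      ring
    have e2 : B (v' i) (v' j) = B (v' i) (v j) + θ ![v j, v i] / 2 := by
      conv_lhs => rw [show v' j = v j + ∑ l, (-(θ ![v j, v l]) / 2) • w l from rfl]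
      simp only [map_add, map_sum, map_smul, hvw']
      simp
      ring
    rw [e2, e1, hB, hB, hanti (v j) (v i)]
    ring
  have hsum : ∀ x : Fin k → V, Fin.append x w ∘ Fin.cast (two_mul k) =
      Sum.elim x w ∘ ((finCongr (two_mul k)).trans finSumFinEquiv.symm) := by
    intro x
    funext i
    simp only [Function.comp_apply, Equiv.trans_apply, finCongr_apply]
    generalize Fin.cast (two_mul k) i = z
    refine Fin.addCases (fun l => ?_) (fun l => ?_) z
    · rw [finSumFinEquiv_symm_apply_castAdd, Fin.append_left, Sum.elim_inl]
    · rw [finSumFinEquiv_symm_apply_natAdd, Fin.append_right, Sum.elim_inr]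
  have h1 := AlternatingMap.map_sumElim_add_sum ((wedgePow θ k).domDomCongr
    ((finCongr (two_mul k)).trans finSumFinEquiv.symm)) v w (fun i j => -(θ ![v i, v j]) / 2)
  have h2 : wedgePow θ k (Fin.append v w ∘ Fin.cast (two_mul k)) =
      wedgePow θ k (Fin.append v' w ∘ Fin.cast (two_mul k)) := by
    rw [hsum, hsum]
    exact h1.symm
  rw [h2]
  have h3 := AlternatingMap.map_append_eq_pairs k (wedgePow θ k) (fun i => ![v' i, w i])
  have h4 := wedgePow_pairs θ k (fun i => ![v' i, w i]) (fun i j hij a b => by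
      fin_cases a <;> fin_cases b
      · exact hvv' i j
      · exact (hvw' i j).trans (if_neg hij)
      · exact (hanti (w i) (v' j)).trans (by rw [hvw', if_neg (Ne.symm hij), neg_zero])
      · exact hw i j) (fun i => (hvw' i i).trans (if_pos rfl))
  refine h3.trans ?_
  -- The reordering contributes `k(k-1)/2` and the `k` values `-1` contribute `k` to the exponent of
  -- `-1`; the total is `k(k+1)/2`.
  rw [h4, smul_eq_mul, ← mul_assoc, ← pow_add]
  congr 2
  have := Nat.triangle_succ k
  rw [Nat.add_sub_cancel, mul_comm] at this
  exact this.symm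

end Darboux

/-! ### Independence of `formIntegral` of the charts -/

section ChartIntegral

open MeasureTheory

theorem real_sign_mul (x y : ℝ) : Real.sign (x * y) = Real.sign x * Real.sign y := by
  rcases lt_trichotomy x 0 with hx | rfl | hx <;> rcases lt_trichotomy y 0 with hy | rfl | hy <;>
    simp [Real.sign_of_neg, Real.sign_of_pos, mul_pos_of_neg_of_neg, mul_neg_of_neg_of_pos,
      mul_neg_of_pos_of_neg, *]

theorem AlternatingMap.finset_sum_apply {V W κ ι : Type*} [AddCommGroup V] [Module ℝ V]
    [AddCommGroup W] [Module ℝ W] (s : Finset κ) (f : κ → V [⋀^ι]→ₗ[ℝ] W) (v : ι → V) :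
    (∑ k ∈ s, f k) v = ∑ k ∈ s, f k v :=
  map_sum (⟨⟨fun g => g v, rfl⟩, fun _ _ => rfl⟩ : V [⋀^ι]→ₗ[ℝ] W →+ W) f s

/-- An alternating form of top degree is determined by its value on a basis. -/
theorem AlternatingMap.eq_det_smul_basis {V N ι : Type*} [AddCommGroup V] [Module ℝ V]
    [AddCommGroup N] [Module ℝ N] [Fintype ι] [DecidableEq ι] (b : Basis ι ℝ V)
    (f : V [⋀^ι]→ₗ[ℝ] N) (v : ι → V) : f v = b.det v • f b := by
  have h : f = (LinearMap.toSpanSingleton ℝ N (f b)).compAlternatingMap b.det := by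
    refine Basis.ext_alternating b fun σ hσ => ?_
    let τ : Equiv.Perm ι := Equiv.ofBijective σ (Finite.injective_iff_bijective.1 hσ)
    have h1 := f.map_perm b τ
    have h2 := b.det.map_perm b τ
    refine h1.trans ?_
    change _ = b.det (b ∘ τ) • f b
    rw [h2, b.det_self]
    rcases Int.units_eq_one_or (Equiv.Perm.sign τ) with h | h <;> simp [h]
  rw [h]
  simp [b.det_self]

/-- Pulled back along `L`, the form has top degree on `V`, so `D` acts through its determinant.
Neither `L` nor `D` need be invertible. -/
theorem AlternatingMap.map_comp_basis {V W N ι : Type*} [AddCommGroup V] [Module ℝ V]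
    [AddCommGroup W] [Module ℝ W]
    [AddCommGroup N] [Module ℝ N] [Fintype ι] (b : Basis ι ℝ V)
    (f : W [⋀^ι]→ₗ[ℝ] N) (L : V →ₗ[ℝ] W) (D : V →ₗ[ℝ] V) :
    f (fun i => L (D (b i))) = LinearMap.det D • f (fun i => L (b i)) := by
  classical
  have := (f.compLinearMap L).eq_det_smul_basis b (D ∘ b)
  rw [b.det_comp, b.det_self, mul_one] at this
  exact this

variable {E : Type} [NormedAddCommGroup E] [NormedSpace ℝ E] {H : Type*} [TopologicalSpace H]
  (I : ModelWithCorners ℝ E H) [I.Boundaryless] {N : Type*} [TopologicalSpace N] [ChartedSpace H N]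
  [IsManifold I ∞ N] {ι : Type*} (b : Basis ι ℝ E)
  (vol : ∀ p : N, TangentSpace I p [⋀^ι]→ₗ[ℝ] ℝ) (η : ∀ p : N, TangentSpace I p [⋀^ι]→ₗ[ℝ] ℂ)

/-- The integrand of `formIntegral` in the chart around `c`. -/
def chartDensity (c : N) (y : E) : ℂ :=
  (Real.sign (vol _ (coordFrame I b c y)) : ℂ) * η _ (coordFrame I b c y)

/-- The part of the target of the `i`-th chart which is not covered by the preceding ones. -/
def chartPiece {m : ℕ} (c : Fin m → N) (i : Fin m) : Set E :=
  {y ∈ (extChartAt I (c i)).target |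
    ∀ j < i, (extChartAt I (c i)).symm y ∉ (extChartAt I (c j)).source}

/-- The change of coordinates between two charts. -/
def chartChange (c c' : N) (y : E) : E := extChartAt I c' ((extChartAt I c).symm y)

variable {I}

theorem mdifferentiableAt_extChartAt_symm {c : N} {y : E} (hy : y ∈ (extChartAt I c).target) :
    MDifferentiableAt 𝓘(ℝ, E) I (extChartAt I c).symm y :=
  ((contMDiffOn_extChartAt_symm (n := ∞) c).contMDiffAt
    ((isOpen_extChartAt_target c).mem_nhds hy)).mdifferentiableAt (by simp)

theorem contMDiffAt_extChartAt_of_mem_source {c p : N} (hp : p ∈ (extChartAt I c).source) :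
    ContMDiffAt I 𝓘(ℝ, E) ∞ (extChartAt I c) p :=
  contMDiffAt_extChartAt' (by rwa [← extChartAt_source I])

theorem contMDiffAt_extChartAt_symm_of_mem_target {c : N} {y : E}
    (hy : y ∈ (extChartAt I c).target) :
    ContMDiffAt 𝓘(ℝ, E) I ∞ (extChartAt I c).symm y :=
  (contMDiffOn_extChartAt_symm (n := ∞) c).contMDiffAt ((isOpen_extChartAt_target c).mem_nhds hy)

theorem contDiffAt_chartChange {c c' : N} {y : E} (hy : y ∈ (extChartAt I c).target)
    (hy' : (extChartAt I c).symm y ∈ (extChartAt I c').source) :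
    ContDiffAt ℝ ∞ (chartChange I c c') y :=
  ((contMDiffAt_extChartAt_of_mem_source hy').comp y
    (contMDiffAt_extChartAt_symm_of_mem_target hy)).contDiffAt

theorem isOpen_target_inter_source (c c' : N) :
    IsOpen {y | y ∈ (extChartAt I c).target ∧ (extChartAt I c).symm y ∈ (extChartAt I c').source} :=
  (continuousOn_extChartAt_symm c).isOpen_inter_preimage (isOpen_extChartAt_target c)
    (isOpen_extChartAt_source c')

/-- The chain rule for the inverse of one chart written as the inverse of the other after the change
of coordinates. Both sides are read in the model space, since the base points agree only by a proved
equation. -/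
theorem coordFrame_chartChange {c c' : N} {y : E} (hy : y ∈ (extChartAt I c).target)
    (hy' : (extChartAt I c).symm y ∈ (extChartAt I c').source) (i : ι) :
    (coordFrame I b c y i : E) =
      (mfderiv 𝓘(ℝ, E) I (extChartAt I c').symm (chartChange I c c' y) : E →L[ℝ] E)
        (fderiv ℝ (chartChange I c c') y (b i)) := by
  have h1 : (extChartAt I c).symm =ᶠ[𝓝 y] (extChartAt I c').symm ∘ chartChange I c c' := by
    filter_upwards [(isOpen_target_inter_source c c').mem_nhds ⟨hy, hy'⟩] with z hz
    exact ((extChartAt I c').left_inv hz.2).symm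
  have ht : chartChange I c c' y ∈ (extChartAt I c').target := (extChartAt I c').map_source hy'
  have h2 := mfderiv_comp (I := 𝓘(ℝ, E)) (I' := 𝓘(ℝ, E)) (I'' := I) y
    (mdifferentiableAt_extChartAt_symm ht)
    ((contDiffAt_chartChange hy hy').differentiableAt (by simp)).mdifferentiableAt
  have h3 : (coordFrame I b c y i : E) =
      (mfderiv 𝓘(ℝ, E) I ((extChartAt I c').symm ∘ chartChange I c c') y : E →L[ℝ] E) (b i) := by
    rw [← h1.mfderiv_eq]
    rfl
  rw [h3, h2, mfderiv_eq_fderiv]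
  rfl

theorem map_coordFrame_chartChange [Fintype ι] {K : Type*} [AddCommGroup K] [Module ℝ K]
    (κ : ∀ p : N, TangentSpace I p [⋀^ι]→ₗ[ℝ] K) {c c' : N} {y : E}
    (hy : y ∈ (extChartAt I c).target)
    (hy' : (extChartAt I c).symm y ∈ (extChartAt I c').source) :
    κ _ (coordFrame I b c y) = (fderiv ℝ (chartChange I c c') y).det •
      κ _ (coordFrame I b c' (chartChange I c c' y)) := by
  -- Regarding all tangent spaces as the model space removes the base point from the type, so that
  -- it can be rewritten.
  let κ' : N → E [⋀^ι]→ₗ[ℝ] K := κ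
  have h0 : (extChartAt I c').symm (chartChange I c c' y) = (extChartAt I c).symm y :=
    (extChartAt I c').left_inv hy'
  change κ' _ _ = _ • κ' _ _
  rw [h0]
  have h1 : (coordFrame I b c y : ι → E) = fun i => _ :=
    funext fun i => coordFrame_chartChange b hy hy' i
  rw [h1]
  exact (κ' ((extChartAt I c).symm y)).map_comp_basis b
    (mfderiv 𝓘(ℝ, E) I (extChartAt I c').symm (chartChange I c c' y) : E →L[ℝ] E).toLinearMap
    (fderiv ℝ (chartChange I c c') y).toLinearMap

/-- The form changes by the Jacobian and the sign of the orientation by the sign of the Jacobian;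
the product changes by its absolute value, as in the change of variables formula. -/
theorem chartDensity_chartChange [Fintype ι] {c c' : N} {y : E}
    (hy : y ∈ (extChartAt I c).target)
    (hy' : (extChartAt I c).symm y ∈ (extChartAt I c').source) :
    chartDensity I b vol η c y = |(fderiv ℝ (chartChange I c c') y).det| •
      chartDensity I b vol η c' (chartChange I c c' y) := by
  rw [chartDensity, map_coordFrame_chartChange b vol hy hy', map_coordFrame_chartChange b η hy hy',
    chartDensity, smul_eq_mul, real_sign_mul]
  set d := (fderiv ℝ (chartChange I c c') y).det
  have hd : Real.sign d * d = |d| := by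
    rcases lt_trichotomy d 0 with h | h | h
    · rw [Real.sign_of_neg h, abs_of_neg h]; ring
    · simp [h]
    · rw [Real.sign_of_pos h, abs_of_pos h]; ring
  rw [← hd, Complex.real_smul, Complex.real_smul]
  push_cast
  ring

theorem chartDensity_eq_zero {c : N} {y : E} (h : η ((extChartAt I c).symm y) = 0) :
    chartDensity I b vol η c y = 0 := by
  rw [chartDensity, h, AlternatingMap.zero_apply, mul_zero]

variable [MeasurableSpace E] [BorelSpace E]

theorem measurableSet_piece {m : ℕ} (c : Fin m → N) (c0 : N) (i : Fin m) :
    MeasurableSet {y ∈ (extChartAt I c0).target |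
      ∀ j < i, (extChartAt I c0).symm y ∉ (extChartAt I (c j)).source} := by
  have : {y ∈ (extChartAt I c0).target |
      ∀ j < i, (extChartAt I c0).symm y ∉ (extChartAt I (c j)).source} =
      (extChartAt I c0).target \ ⋃ j, ⋃ (_ : j < i), {y ∈ (extChartAt I c0).target |
        (extChartAt I c0).symm y ∈ (extChartAt I (c j)).source} := by
    ext y
    simp only [Set.mem_ofPred_eq, mem_sdiff, mem_iUnion, not_exists, not_and]
    exact ⟨fun h => ⟨h.1, fun j hj _ => h.2 j hj⟩, fun h => ⟨h.1, fun j hj => h.2 j hj h.1⟩⟩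
  rw [this]
  exact (isOpen_extChartAt_target c0).measurableSet.diff (MeasurableSet.iUnion fun j =>
    MeasurableSet.iUnion fun _ => (isOpen_target_inter_source c0 (c j)).measurableSet)

theorem measurableSet_chartPiece {m : ℕ} (c : Fin m → N) (i : Fin m) :
    MeasurableSet (chartPiece I c i) :=
  measurableSet_piece c (c i) i

theorem exists_first {m : ℕ} {P : Fin m → Prop} (h : ∃ i, P i) : ∃ i, P i ∧ ∀ j < i, ¬ P j := by
  classical
  obtain ⟨i, hi, hmin⟩ := WellFounded.has_min (wellFounded_lt (α := Fin m)) {i | P i} h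
  exact ⟨i, hi, fun j hj hP => hmin j hP hj⟩

variable [Fintype ι] [FiniteDimensional ℝ E]

/-- The integral of a form supported in one chart can be computed piecewise in other charts. -/
theorem sum_setIntegral_chartPiece {m : ℕ} (c : Fin m → N) (c0 : N)
    (hc : ∀ p, η p ≠ 0 → ∃ i, p ∈ (extChartAt I (c i)).source)
    (hc0 : ∀ p, η p ≠ 0 → p ∈ (extChartAt I c0).source)
    (hint : IntegrableOn (chartDensity I b vol η c0) (extChartAt I c0).target b.addHaar) :
    (∀ i, IntegrableOn (chartDensity I b vol η (c i)) (chartPiece I c i) b.addHaar) ∧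
      ∑ i, ∫ y in chartPiece I c i, chartDensity I b vol η (c i) y ∂b.addHaar =
        ∫ y in (extChartAt I c0).target, chartDensity I b vol η c0 y ∂b.addHaar := by
  -- `S i` is the part of the `i`-th piece visible in the chart around `c0`, and `R i` is its image
  -- there. The sets `R i` are disjoint and contain every point of that chart at which the form is
  -- nonzero, while the density vanishes on the rest of each piece.
  let S : Fin m → Set E := fun i => chartPiece I c i ∩
    {y | y ∈ (extChartAt I (c i)).target ∧ (extChartAt I (c i)).symm y ∈ (extChartAt I c0).source}
  let R : Fin m → Set E := fun i => {z | z ∈ (extChartAt I c0).target ∧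
      (extChartAt I c0).symm z ∈ (extChartAt I (c i)).source} ∩
    {z ∈ (extChartAt I c0).target |
      ∀ j < i, (extChartAt I c0).symm z ∉ (extChartAt I (c j)).source}
  have hS : ∀ i, MeasurableSet (S i) := fun i => (measurableSet_chartPiece c i).inter
    (isOpen_target_inter_source (c i) c0).measurableSet
  have hR : ∀ i, MeasurableSet (R i) := fun i =>
    (isOpen_target_inter_source c0 (c i)).measurableSet.inter (measurableSet_piece c c0 i)
  have himg : ∀ i, chartChange I (c i) c0 '' S i = R i := by
    intro i
    ext z
    constructor
    · rintro ⟨y, ⟨⟨hy1, hy2⟩, -, hy3⟩, rfl⟩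
      have h0 : (extChartAt I c0).symm (chartChange I (c i) c0 y) = (extChartAt I (c i)).symm y :=
        (extChartAt I c0).left_inv hy3
      have h1 : chartChange I (c i) c0 y ∈ (extChartAt I c0).target :=
        (extChartAt I c0).map_source hy3
      refine ⟨⟨h1, ?_⟩, h1, ?_⟩
      · rw [h0]
        exact (extChartAt I (c i)).map_target hy1
      · rw [h0]
        exact hy2
    · rintro ⟨⟨hz1, hz2⟩, -, hz3⟩
      have h0 : (extChartAt I (c i)).symm (extChartAt I (c i) ((extChartAt I c0).symm z)) =
        (extChartAt I c0).symm z := (extChartAt I (c i)).left_inv hz2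
      refine ⟨extChartAt I (c i) ((extChartAt I c0).symm z),
        ⟨⟨(extChartAt I (c i)).map_source hz2, ?_⟩, (extChartAt I (c i)).map_source hz2, ?_⟩, ?_⟩
      · rw [h0]
        exact hz3
      · rw [h0]
        exact (extChartAt I c0).map_target hz1
      · rw [chartChange, h0]
        exact (extChartAt I c0).right_inv hz1
  have hder : ∀ i, ∀ y ∈ S i, HasFDerivWithinAt (chartChange I (c i) c0)
      (fderiv ℝ (chartChange I (c i) c0) y) (S i) y := fun i y hy =>
    ((contDiffAt_chartChange hy.2.1 hy.2.2).differentiableAt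
      (by simp)).hasFDerivAt.hasFDerivWithinAt
  have hinj : ∀ i, InjOn (chartChange I (c i) c0) (S i) := by
    intro i y hy y' hy' h
    have h1 := (extChartAt I c0).injOn hy.2.2 hy'.2.2 h
    rw [← (extChartAt I (c i)).right_inv hy.2.1, h1, (extChartAt I (c i)).right_inv hy'.2.1]
  have hJ : ∀ i, ∀ y ∈ S i, chartDensity I b vol η (c i) y =
      |(fderiv ℝ (chartChange I (c i) c0) y).det| •
        chartDensity I b vol η c0 (chartChange I (c i) c0 y) :=
    fun i y hy => chartDensity_chartChange b vol η hy.2.1 hy.2.2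
  have hzero : ∀ i, ∀ y ∈ chartPiece I c i \ S i, chartDensity I b vol η (c i) y = 0 := by
    intro i y hy
    refine chartDensity_eq_zero b vol η ?_
    by_contra h
    exact hy.2 ⟨hy.1, hy.1.1, hc0 _ h⟩
  have hRint : ∀ i, IntegrableOn (chartDensity I b vol η c0) (R i) b.addHaar := fun i =>
    hint.mono_set fun z hz => hz.1.1
  have hSint : ∀ i, IntegrableOn (chartDensity I b vol η (c i)) (S i) b.addHaar := by
    intro i
    have h1 := (integrableOn_image_iff_integrableOn_abs_det_fderiv_smul b.addHaar (hS i) (hder i)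
      (hinj i) (chartDensity I b vol η c0)).1 (by rw [himg]; exact hRint i)
    exact h1.congr_fun (fun y hy => (hJ i y hy).symm) (hS i)
  refine ⟨fun i => (hSint i).of_forall_sdiff_eq_zero (measurableSet_chartPiece c i) (hzero i), ?_⟩
  have h1 : ∀ i, ∫ y in chartPiece I c i, chartDensity I b vol η (c i) y ∂b.addHaar =
      ∫ y in R i, chartDensity I b vol η c0 y ∂b.addHaar := by
    intro i
    rw [setIntegral_eq_of_subset_of_forall_sdiff_eq_zero (measurableSet_chartPiece c i)
      inter_subset_left (hzero i), ← himg, integral_image_eq_integral_abs_det_fderiv_smul b.addHaar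
      (hS i) (hder i) (hinj i)]
    exact setIntegral_congr_fun (hS i) (hJ i)
  rw [Finset.sum_congr rfl fun i _ => h1 i, ← integral_iUnion_fintype hR _ hRint]
  · rw [setIntegral_eq_of_subset_of_forall_sdiff_eq_zero
      (isOpen_extChartAt_target c0).measurableSet]
    · exact iUnion_subset fun i z hz => hz.1.1
    · intro z hz
      refine chartDensity_eq_zero b vol η ?_
      by_contra h
      obtain ⟨i, hi, hmin⟩ := exists_first (hc _ h)
      exact hz.2 (mem_iUnion.2 ⟨i, ⟨hz.1, hi⟩, hz.1, hmin⟩)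
  · intro i j hij
    rw [Function.onFun, Set.disjoint_left]
    intro z hz hz'
    rcases lt_or_gt_of_ne hij with h | h
    · exact hz'.2.2 i h hz.1.2
    · exact hz.2.2 j h hz'.1.2

/-- Exposes the charts chosen inside the definition. Only the fact that they cover the support is
available afterwards. -/
theorem exists_formIntegral_eq (h : ∃ (m : ℕ) (c : Fin m → N),
      closure {p | η p ≠ 0} ⊆ ⋃ i, (extChartAt I (c i)).source) :
    ∃ (m : ℕ) (c : Fin m → N), closure {p | η p ≠ 0} ⊆ ⋃ i, (extChartAt I (c i)).source ∧
      formIntegral I b vol η =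
        ∑ i, ∫ y in chartPiece I c i, chartDensity I b vol η (c i) y ∂b.addHaar := by
  obtain rfl : ‹MeasurableSpace E› = borel E := BorelSpace.measurable_eq
  refine ⟨h.choose, h.choose_spec.choose, h.choose_spec.choose_spec, ?_⟩
  rw [formIntegral, dif_pos h]
  rfl

variable {b vol η}

/-- `formIntegral` is the sum of the chart integrals of a decomposition into forms supported in
charts. -/
theorem formIntegral_eq_sum_chartIntegral {m : ℕ} (c : Fin m → N)
    (hc : ∀ p, ∃ i, p ∈ (extChartAt I (c i)).source) {l : ℕ}
    (θ : Fin l → ∀ p : N, TangentSpace I p [⋀^ι]→ₗ[ℝ] ℂ) (d : Fin l → N)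
    (hθ : ∀ k p, θ k p ≠ 0 → p ∈ (extChartAt I (d k)).source)
    (hint : ∀ k, IntegrableOn (chartDensity I b vol (θ k) (d k)) (extChartAt I (d k)).target
      b.addHaar)
    (hη : ∀ p, η p = ∑ k, θ k p) :
    formIntegral I b vol η =
      ∑ k, ∫ y in (extChartAt I (d k)).target, chartDensity I b vol (θ k) (d k) y ∂b.addHaar := by
  classical
  have hJη : ∀ (c0 : N) y, chartDensity I b vol η c0 y =
      ∑ k, chartDensity I b vol (θ k) c0 y := by
    intro c0 y
    simp only [chartDensity, hη, AlternatingMap.finset_sum_apply, Finset.mul_sum]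
  have hA := fun k => sum_setIntegral_chartPiece b vol (θ k) c (d k) (fun p _ => hc p) (hθ k)
    (hint k)
  have hpint : ∀ i, IntegrableOn (chartDensity I b vol η (c i)) (chartPiece I c i) b.addHaar := by
    intro i
    have : chartDensity I b vol η (c i) = ∑ k, chartDensity I b vol (θ k) (c i) := by
      funext y
      rw [hJη, Finset.sum_apply]
    rw [this]
    exact integrable_finsetSum' _ fun k _ => (hA k).1 i
  -- The given decomposition is first compared with the pieces of the cover `c`, which also yields
  -- integrability of the density of `η` on these pieces.
  have hB : ∑ k, ∫ y in (extChartAt I (d k)).target,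
      chartDensity I b vol (θ k) (d k) y ∂b.addHaar =
      ∑ i, ∫ y in chartPiece I c i, chartDensity I b vol η (c i) y ∂b.addHaar := by
    rw [← Finset.sum_congr rfl fun k _ => (hA k).2, Finset.sum_comm]
    refine Finset.sum_congr rfl fun i _ => ?_
    rw [← integral_finsetSum _ fun k _ => (hA k).1 i]
    exact integral_congr_ae (Filter.Eventually.of_forall fun y => (hJη (c i) y).symm)
  -- The charts chosen by `formIntegral` are unrelated to the `d k`. Cutting `η` along the pieces of
  -- `c` gives forms `ζ i`, each supported in one known chart and integrable there, which can be
  -- compared with the chosen charts one at a time.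
  let P : Fin m → N → Prop := fun i p => p ∈ (extChartAt I (c i)).source ∧
    ∀ j < i, p ∉ (extChartAt I (c j)).source
  let ζ : Fin m → ∀ p : N, TangentSpace I p [⋀^ι]→ₗ[ℝ] ℂ := fun i p => if P i p then η p else 0
  have hζJ : ∀ i, ∀ y ∈ chartPiece I c i,
      chartDensity I b vol (ζ i) (c i) y = chartDensity I b vol η (c i) y := by
    intro i y hy
    have : ζ i ((extChartAt I (c i)).symm y) = η ((extChartAt I (c i)).symm y) :=
      if_pos ⟨(extChartAt I (c i)).map_target hy.1, hy.2⟩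
    simp only [chartDensity, this]
  have hζ0 : ∀ i, ∀ y ∈ (extChartAt I (c i)).target \ chartPiece I c i,
      chartDensity I b vol (ζ i) (c i) y = 0 := by
    intro i y hy
    refine chartDensity_eq_zero b vol _ (if_neg fun h => hy.2 ⟨hy.1, h.2⟩)
  have hsub : ∀ i, chartPiece I c i ⊆ (extChartAt I (c i)).target := fun i y hy => hy.1
  have hζint : ∀ i, IntegrableOn (chartDensity I b vol (ζ i) (c i)) (extChartAt I (c i)).target
      b.addHaar := fun i =>
    ((hpint i).congr_fun (fun y hy => (hζJ i y hy).symm)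
      (measurableSet_chartPiece c i)).of_forall_sdiff_eq_zero
        (isOpen_extChartAt_target (c i)).measurableSet (hζ0 i)
  have hsumζ : ∀ p, ∑ i, ζ i p = η p := by
    intro p
    obtain ⟨i, hi, hmin⟩ := exists_first (hc p)
    refine (Finset.sum_eq_single i (fun j _ hj => if_neg fun h => ?_) (by simp)).trans
      (if_pos ⟨hi, hmin⟩)
    rcases lt_or_gt_of_ne hj with h1 | h1
    · exact hmin j h1 h.1
    · exact h.2 i h1 hi
  have hex : ∃ (m : ℕ) (c : Fin m → N),
      closure {p | η p ≠ 0} ⊆ ⋃ i, (extChartAt I (c i)).source :=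
    ⟨m, c, fun p _ => mem_iUnion.2 (hc p)⟩
  obtain ⟨m', c', hcov, hform⟩ := exists_formIntegral_eq b vol η hex
  rw [hB, hform]
  have hC := fun i => sum_setIntegral_chartPiece b vol (ζ i) c' (c i)
    (fun p hp => mem_iUnion.1 (hcov (subset_closure (by
      intro h
      apply hp
      change (if P i p then η p else 0) = 0
      rw [h, ite_self]))))
    (fun p hp => by
      by_contra h
      exact hp (if_neg fun h1 => h h1.1)) (hζint i)
  have hD : ∀ i, ∫ y in chartPiece I c i, chartDensity I b vol η (c i) y ∂b.addHaar =
      ∫ y in (extChartAt I (c i)).target, chartDensity I b vol (ζ i) (c i) y ∂b.addHaar := by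
    intro i
    rw [setIntegral_eq_of_subset_of_forall_sdiff_eq_zero
      (isOpen_extChartAt_target (c i)).measurableSet (hsub i) (hζ0 i)]
    exact setIntegral_congr_fun (measurableSet_chartPiece c i) fun y hy => (hζJ i y hy).symm
  rw [Finset.sum_congr rfl fun i _ => hD i, ← Finset.sum_congr rfl fun i _ => (hC i).2,
    Finset.sum_comm]
  refine Finset.sum_congr rfl fun k _ => ?_
  rw [← integral_finsetSum _ fun i _ => (hC i).1 k]
  refine integral_congr_ae (Filter.Eventually.of_forall fun y => ?_)
  simp only [chartDensity, ← hsumζ, AlternatingMap.finset_sum_apply, Finset.mul_sum]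

end ChartIntegral

/-! ### Integrals of derivatives in Euclidean space -/

section Divergence

open MeasureTheory

variable {E : Type} [NormedAddCommGroup E] [NormedSpace ℝ E] [FiniteDimensional ℝ E]
  [MeasurableSpace E] [BorelSpace E]

/-- The integral of a derivative of a compactly supported function vanishes. -/
theorem integral_fderiv_apply_eq_zero (μ : Measure E) [μ.IsAddHaarMeasure] {g : E → ℂ}
    (hg : ContDiff ℝ 1 g) (hc : HasCompactSupport g) (v : E) :
    ∫ y, fderiv ℝ g y v ∂μ = 0 := by
  have hcont : Continuous fun y => fderiv ℝ g y v :=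
    (hg.continuous_fderiv (by simp)).clm_apply continuous_const
  have hsupp : HasCompactSupport fun y => fderiv ℝ g y v :=
    hc.fderiv_apply (𝕜 := ℝ) v
  have h := integral_smul_fderiv_eq_neg_fderiv_smul_of_integrable (𝕜 := ℝ) (μ := μ)
    (f := fun _ : E => (1 : ℝ)) (g := g) (v := v) (by simp)
    (by simpa using hcont.integrable_of_hasCompactSupport hsupp)
    (by simpa using hg.continuous.integrable_of_hasCompactSupport hc)
    (by fun_prop) (fun x _ => (hg.differentiable (by simp)) x)
  simpa using h

/-- The factor `s` serves as the sign of an orientation form, which is only locally constant because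
a chart domain need not be connected. As `g` vanishes on `U` outside the compact set `K`, the
product extended by zero is of class `C^1` on the whole space, and the global statement applies. -/
theorem setIntegral_locallyConst_mul_fderiv_eq_zero (μ : Measure E) [μ.IsAddHaarMeasure]
    {U K : Set E} (hU : IsOpen U) (hK : IsCompact K) (hKU : K ⊆ U) {g : E → ℂ}
    (hg : ContDiffOn ℝ 1 g U) (hg0 : ∀ y ∈ U, y ∉ K → g y = 0) {s : E → ℝ}
    (hs : ∀ y ∈ U, ∀ᶠ z in 𝓝 y, s z = s y) (v : E) :
    ∫ y in U, (s y : ℂ) * fderiv ℝ g y v ∂μ = 0 := by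
  classical
  let G : E → ℂ := U.indicator fun y => (s y : ℂ) * g y
  have hloc : ∀ y ∈ U, G =ᶠ[𝓝 y] fun z => (s y : ℂ) * g z := by
    intro y hy
    filter_upwards [hs y hy, hU.mem_nhds hy] with z hz hzU
    simp only [G, indicator_of_mem hzU, hz]
  have hout : ∀ y ∉ K, G =ᶠ[𝓝 y] fun _ => 0 := by
    intro y hy
    filter_upwards [hK.isClosed.isOpen_compl.mem_nhds hy] with z hz
    by_cases hzU : z ∈ U
    · simp only [G, indicator_of_mem hzU, hg0 z hzU hz, mul_zero]
    · exact indicator_of_notMem hzU _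
  have hG : ContDiff ℝ 1 G := by
    rw [contDiff_iff_contDiffAt]
    intro y
    by_cases hy : y ∈ U
    · exact (contDiffAt_const.mul (hg.contDiffAt (hU.mem_nhds hy))).congr_of_eventuallyEq
        (hloc y hy)
    · exact contDiffAt_const.congr_of_eventuallyEq (hout y fun h => hy (hKU h))
  have hGc : HasCompactSupport G :=
    HasCompactSupport.intro hK fun y hy => (hout y hy).eq_of_nhds
  rw [← integral_fderiv_apply_eq_zero μ hG hGc v]
  rw [← setIntegral_eq_integral_of_forall_compl_eq_zero (s := U)
    (f := fun y => fderiv ℝ G y v)]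
  · refine setIntegral_congr_fun hU.measurableSet fun y hy => ?_
    have h1 : fderiv ℝ G y = fderiv ℝ (fun z => (s y : ℂ) * g z) y := (hloc y hy).fderiv_eq
    have h2 : DifferentiableAt ℝ g y :=
      (hg.contDiffAt (hU.mem_nhds hy)).differentiableAt (by simp)
    simp only [h1]
    rw [fderiv_const_mul h2]
    rfl
  · intro y hy
    rw [(hout y fun h => hy (hKU h)).fderiv_eq]
    simp

end Divergence

/-! ### Integration with partitions of unity -/

section Partition

open MeasureTheory

variable {E : Type} [NormedAddCommGroup E] [NormedSpace ℝ E] {H : Type*} [TopologicalSpace H]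
  (I : ModelWithCorners ℝ E H) (N : Type*) [TopologicalSpace N] [ChartedSpace H N]

/-- A finite smooth partition of unity subordinate to open subsets of coordinate charts. -/
structure ChartPartition where
  size : ℕ
  center : Fin size → N
  weight : Fin size → N → ℝ
  contMDiff_weight : ∀ l, ContMDiff I 𝓘(ℝ, ℝ) ∞ (weight l)
  sum_weight : ∀ p, ∑ l, weight l p = 1
  dom : Fin size → Set N
  isOpen_dom : ∀ l, IsOpen (dom l)
  dom_subset : ∀ l, dom l ⊆ (extChartAt I (center l)).source
  tsupport_weight : ∀ l, tsupport (weight l) ⊆ dom l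

variable {I N}

theorem ChartPartition.exists_mem_source (P : ChartPartition I N) (p : N) :
    ∃ l, p ∈ (extChartAt I (P.center l)).source := by
  by_contra! h
  have h0 : ∑ l, P.weight l p = 0 := Finset.sum_eq_zero fun l _ => by
    by_contra hne
    exact h l (P.dom_subset l (P.tsupport_weight l (subset_tsupport _ hne)))
  rw [P.sum_weight] at h0
  exact one_ne_zero h0

/-- The image in the chart of the part of a compact set which meets the support of a weight. -/
def ChartPartition.chartCompact (P : ChartPartition I N) (Z : Set N) (l : Fin P.size) : Set E :=
  extChartAt I (P.center l) '' (tsupport (P.weight l) ∩ Z)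

/-- The part of the target of a chart which corresponds to the domain. -/
def ChartPartition.region (P : ChartPartition I N) (l : Fin P.size) : Set E :=
  (extChartAt I (P.center l)).target ∩ (extChartAt I (P.center l)).symm ⁻¹' P.dom l

variable [I.Boundaryless] [IsManifold I ∞ N] (P : ChartPartition I N) {Z : Set N}

theorem ChartPartition.isOpen_region (l : Fin P.size) : IsOpen (P.region l) :=
  (continuousOn_extChartAt_symm (P.center l)).isOpen_inter_preimage
    (isOpen_extChartAt_target (P.center l)) (P.isOpen_dom l)

theorem ChartPartition.isCompact_chartCompact (hZ : IsCompact Z) (l : Fin P.size) :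
    IsCompact (P.chartCompact Z l) :=
  (hZ.inter_left (isClosed_tsupport _)).image_of_continuousOn
    ((continuousOn_extChartAt (P.center l)).mono fun _ hp =>
      P.dom_subset l (P.tsupport_weight l hp.1))

theorem ChartPartition.chartCompact_subset (l : Fin P.size) :
    P.chartCompact Z l ⊆ P.region l := by
  rintro _ ⟨p, hp, rfl⟩
  have h := P.tsupport_weight l hp.1
  refine ⟨(extChartAt I (P.center l)).map_source (P.dom_subset l h), ?_⟩
  rwa [mem_preimage, (extChartAt I (P.center l)).left_inv (P.dom_subset l h)]

theorem ChartPartition.notMem_of_notMem_chartCompact {l : Fin P.size} {y : E}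
    (hy : y ∈ P.region l) (hK : y ∉ P.chartCompact Z l) :
    (extChartAt I (P.center l)).symm y ∉ tsupport (P.weight l) ∨
      (extChartAt I (P.center l)).symm y ∉ Z := by
  by_contra! h
  exact hK ⟨_, ⟨h.1, h.2⟩, (extChartAt I (P.center l)).right_inv hy.1⟩

theorem ChartPartition.contDiffOn_weight (l : Fin P.size) :
    ContDiffOn ℝ ∞ (fun y => P.weight l ((extChartAt I (P.center l)).symm y))
      (extChartAt I (P.center l)).target :=
  ((P.contMDiff_weight l).comp_contMDiffOn
    (contMDiffOn_extChartAt_symm (P.center l))).contDiffOn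

variable [MeasurableSpace E] [BorelSpace E] [FiniteDimensional ℝ E]
  {ι : Type*} [Fintype ι] {b : Basis ι ℝ E}
  {vol : ∀ p : N, TangentSpace I p [⋀^ι]→ₗ[ℝ] ℝ} {η : ∀ p : N, TangentSpace I p [⋀^ι]→ₗ[ℝ] ℂ}

theorem integrableOn_of_eq_zero_off_compact {μ : Measure E} [IsFiniteMeasureOnCompacts μ]
    {U K : Set E} (hU : IsOpen U) (hK : IsCompact K) (hKU : K ⊆ U) {f : E → ℂ}
    (hf : ContinuousOn f U) (h0 : ∀ y ∈ U, y ∉ K → f y = 0) : IntegrableOn f U μ :=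
  ((hf.mono hKU).integrableOn_compact hK).of_forall_sdiff_eq_zero hU.measurableSet
    fun y hy => h0 y hy.1 hy.2

/-- The integral of a sum of forms with supports in the charts of a partition. -/
theorem ChartPartition.formIntegral_eq_sum
    (θ : Fin P.size → ∀ p : N, TangentSpace I p [⋀^ι]→ₗ[ℝ] ℂ)
    (hθ : ∀ l p, p ∉ tsupport (P.weight l) → θ l p = 0)
    (hint : ∀ l, IntegrableOn (chartDensity I b vol (θ l) (P.center l)) (P.region l) b.addHaar)
    (hη : ∀ p, η p = ∑ l, θ l p) :
    formIntegral I b vol η =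
      ∑ l, ∫ y in P.region l, chartDensity I b vol (θ l) (P.center l) y ∂b.addHaar := by
  have h0 : ∀ l, ∀ y ∈ (extChartAt I (P.center l)).target \ P.region l,
      chartDensity I b vol (θ l) (P.center l) y = 0 := fun l y hy =>
    chartDensity_eq_zero _ _ _ (hθ l _ fun h => hy.2 ⟨hy.1, P.tsupport_weight l h⟩)
  rw [formIntegral_eq_sum_chartIntegral P.center P.exists_mem_source θ P.center
    (fun l p hp => P.dom_subset l (P.tsupport_weight l (by
      by_contra h
      exact hp (hθ l p h)))) (fun l => (hint l).of_forall_sdiff_eq_zero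
      (isOpen_extChartAt_target _).measurableSet (h0 l)) hη]
  exact Finset.sum_congr rfl fun l _ => setIntegral_eq_of_subset_of_forall_sdiff_eq_zero
    (isOpen_extChartAt_target _).measurableSet inter_subset_left (h0 l)

/-- The integral of a form computed with a partition of unity. -/
theorem ChartPartition.formIntegral_eq (hZ : IsCompact Z)
    (hη : ∀ l, ContinuousOn (chartDensity I b vol η (P.center l)) (P.region l))
    (h0 : ∀ l, ∀ y ∈ P.region l, (extChartAt I (P.center l)).symm y ∉ Z →
      chartDensity I b vol η (P.center l) y = 0) :
    (∀ l, IntegrableOn (fun y => (P.weight l ((extChartAt I (P.center l)).symm y) : ℂ) *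
      chartDensity I b vol η (P.center l) y) (P.region l) b.addHaar) ∧
    formIntegral I b vol η = ∑ l, ∫ y in P.region l,
      (P.weight l ((extChartAt I (P.center l)).symm y) : ℂ) *
        chartDensity I b vol η (P.center l) y ∂b.addHaar := by
  have hJ : ∀ l y, chartDensity I b vol (fun p => P.weight l p • η p) (P.center l) y =
      (P.weight l ((extChartAt I (P.center l)).symm y) : ℂ) *
        chartDensity I b vol η (P.center l) y := by
    intro l y
    simp only [chartDensity, AlternatingMap.smul_apply, Complex.real_smul]
    ring
  have hint : ∀ l, IntegrableOn (fun y =>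
      (P.weight l ((extChartAt I (P.center l)).symm y) : ℂ) *
      chartDensity I b vol η (P.center l) y) (P.region l) b.addHaar := by
    intro l
    refine integrableOn_of_eq_zero_off_compact (P.isOpen_region l)
      (P.isCompact_chartCompact hZ l) (P.chartCompact_subset l)
      ((Complex.continuous_ofReal.comp_continuousOn
        ((P.contDiffOn_weight l).continuousOn.mono inter_subset_left)).mul (hη _)) fun y hy hK => ?_
    rcases P.notMem_of_notMem_chartCompact hy hK with h | h
    · rw [image_eq_zero_of_notMem_tsupport h]
      simp
    · rw [h0 _ y hy h, mul_zero]
  refine ⟨hint, ?_⟩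
  rw [P.formIntegral_eq_sum (fun l p => P.weight l p • η p)]
  · simp only [hJ]
  · intro l p hp
    rw [image_eq_zero_of_notMem_tsupport hp, zero_smul]
  · intro l
    exact (hint l).congr_fun (fun y _ => (hJ l y).symm) (P.isOpen_region l).measurableSet
  · intro p
    rw [← Finset.sum_smul, P.sum_weight, one_smul]

end Partition

/-! ### Stokes' theorem for Lie algebroids with an invariant density -/

section Stokes

open MeasureTheory

variable {E : Type} [NormedAddCommGroup E] [NormedSpace ℝ E] {H : Type*} [TopologicalSpace H]
  {I : ModelWithCorners ℝ E H} {N : Type*} [TopologicalSpace N] [ChartedSpace H N]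
  {ι : Type*}

/-- The divergence of a vector field on a vector space with basis `b`. -/
def divergence [Fintype ι] (b : Basis ι ℝ E) (V : E → E) (y : E) : ℝ :=
  ∑ a, b.repr (fderiv ℝ V y (b a)) a

/-- Sections of `⋀^{k+1} A ⊗ ⋀^top T*N` with a local frame of `A` over the part `U` of the chart around `c` for which
the section is infinitesimally invariant: with `h` the coefficient of `W` and `ρ j` the anchors of
the frame, the divergence of `h ρ_j` is the trace of the adjoint action. -/
structure AlgebroidData.UnimodularFrame (A : AlgebroidData I N) {k : ℕ} [Fintype ι]
    (b : Basis ι ℝ E)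
    (W : ∀ p : N, TangentSpace I p [⋀^ι]→ₗ[ℝ] ⋀[ℝ]^(k + 1) (A.Fiber p)) (c : N)
    (U : Set E) where
  frame : Fin (k + 1) → ∀ p, A.Fiber p
  coeff : E → ℝ
  vec : Fin (k + 1) → E → E
  contDiffOn_coeff : ContDiffOn ℝ ∞ coeff U
  contDiffOn_vec : ∀ j, ContDiffOn ℝ ∞ (vec j) U
  apply_coordFrame : ∀ y ∈ U, W _ (coordFrame I b c y) =
    coeff y • exteriorPower.ιMulti ℝ (k + 1) (fun j => frame j ((extChartAt I c).symm y))
  anchor_frame : ∀ y ∈ U, ∀ j,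
    A.anchor _ (frame j ((extChartAt I c).symm y)) =
      mfderiv 𝓘(ℝ, E) I (extChartAt I c).symm y (vec j y)
  exists_extension : ∀ y ∈ U,
    ∃ (X : Fin (k + 1) → ∀ p, A.Fiber p) (B : Fin (k + 1) → Fin (k + 1) → ∀ p, A.Fiber p)
      (C : Fin (k + 1) → Fin (k + 1) → Fin (k + 1) → ℝ),
      (∀ j, A.IsSmooth (X j)) ∧ (∀ i j, i < j → A.IsBracket (X i) (X j) (B i j)) ∧
      (∀ᶠ q in 𝓝 ((extChartAt I c).symm y), ∀ j, X j q = frame j q) ∧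
      (∀ i j m, C i j m = - C j i m) ∧
      (∀ i j, i < j → B i j ((extChartAt I c).symm y) =
        ∑ m, C i j m • frame m ((extChartAt I c).symm y)) ∧
      (∀ j, divergence b (fun z => coeff z • vec j z) y = coeff y * ∑ i, C i j i)

namespace AlgebroidData.UnimodularFrame

variable {A : AlgebroidData I N} {k : ℕ} [Fintype ι] {b : Basis ι ℝ E}
  {W : ∀ p : N, TangentSpace I p [⋀^ι]→ₗ[ℝ] ⋀[ℝ]^(k + 1) (A.Fiber p)} {c : N} {U : Set E}
  (F : A.UnimodularFrame b W c U) (β : A.Form ℂ k)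

/-- The coefficients of a form of degree one less than the rank. -/
def cofactor (j : Fin (k + 1)) (y : E) : ℂ :=
  β ((extChartAt I c).symm y) (j.removeNth fun m => F.frame m ((extChartAt I c).symm y))

theorem pairing_apply {K : Type*} [NormedField K] [NormedAlgebra ℝ K] (γ : A.Form ℂ (k + 1))
    {y : E} (hy : y ∈ U) :
    pairing (γ ((extChartAt I c).symm y)) (W _) (coordFrame I b c y) =
      F.coeff y • γ ((extChartAt I c).symm y) (fun j => F.frame j ((extChartAt I c).symm y)) := by
  simp only [pairing, LinearMap.compAlternatingMap_apply]
  rw [F.apply_coordFrame y hy, map_smul, exteriorPower.alternatingMapLinearEquiv_apply_ιMulti]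

variable [I.Boundaryless] [IsManifold I ∞ N]

/-- Smoothness of forms is tested on global sections only, so near each point the local frame is
replaced by a global extension which agrees with it there. -/
theorem contDiffOn_cofactor (hU : U ⊆ (extChartAt I c).target) (hβ : IsSmoothForm β) (j : Fin (k + 1)) :
    ContDiffOn ℝ ∞ (F.cofactor β j) U := by
  intro y hy
  obtain ⟨X, B, C, hX, -, hXE, -⟩ := F.exists_extension y hy
  have h1 : ContMDiff I 𝓘(ℝ, ℂ) ∞ (fun p => β p (fun l => X (j.succAbove l) p)) :=
    hβ _ fun l => hX _
  have hsymm := contMDiffAt_extChartAt_symm_of_mem_target (I := I) (hU hy)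
  have h2 : ContDiffAt ℝ ∞ (fun y => β ((extChartAt I c).symm y)
      (fun l => X (j.succAbove l) ((extChartAt I c).symm y))) y :=
    ((h1 _).comp y hsymm).contDiffAt
  refine (h2.congr_of_eventuallyEq ?_).contDiffWithinAt
  filter_upwards [hsymm.continuousAt.eventually hXE] with z hz
  simp only [cofactor, hz]
  rfl

/-- The Koszul formula in a unimodular frame: the differential is a divergence. -/
theorem coeff_smul_differential (hU : U ⊆ (extChartAt I c).target) {γ : A.Form ℂ (k + 1)} (hβ : IsSmoothForm β)
    (hγ : IsDifferential β γ) {y : E} (hy : y ∈ U) :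
    F.coeff y • γ ((extChartAt I c).symm y) (fun j => F.frame j ((extChartAt I c).symm y)) =
      ∑ j : Fin (k + 1), (-1 : ℂ) ^ (j : ℕ) *
        (fderiv ℝ (F.cofactor β j) y (F.coeff y • F.vec j y) +
          (divergence b (fun z => F.coeff z • F.vec j z) y : ℂ) * F.cofactor β j y) := by
  obtain ⟨X, B, C, hX, hB, hXE, hC, hBC, hdiv⟩ := F.exists_extension y hy
  set p := (extChartAt I c).symm y with hp
  have hsymm := contMDiffAt_extChartAt_symm_of_mem_target (I := I) (hU hy)
  have hXp := hXE.self_of_nhds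
  have h1 := hγ X B hX hB p
  have hXp' : (fun i => X i p) = fun j => F.frame j p := funext hXp
  rw [hXp'] at h1
  -- The first Koszul sum becomes Euclidean: the chart carries the anchor of the frame vector to
  -- `F.vec j`, and the chain rule identifies the derivatives.
  have hfst : ∀ j : Fin (k + 1),
      dirDeriv I (fun q => β q (fun l => X (j.succAbove l) q)) p (A.anchor p (X j p)) =
        fderiv ℝ (F.cofactor β j) y (F.vec j y) := by
    intro j
    have hs : ContMDiff I 𝓘(ℝ, ℂ) ∞ (fun p => β p (fun l => X (j.succAbove l) p)) :=
      hβ _ fun l => hX _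
    rw [hXp, F.anchor_frame y hy]
    have h2 := mfderiv_comp (I := 𝓘(ℝ, E)) (I' := I) (I'' := 𝓘(ℝ, ℂ)) y
      ((hs p).mdifferentiableAt (by simp)) (mdifferentiableAt_extChartAt_symm (hU hy))
    have h3 : (fun p => β p (fun l => X (j.succAbove l) p)) ∘ (extChartAt I c).symm =ᶠ[𝓝 y]
        F.cofactor β j := by
      filter_upwards [hsymm.continuousAt.eventually hXE] with z hz
      simp only [cofactor, hz, Function.comp_apply]
      rfl
    rw [h3.mfderiv_eq, mfderiv_eq_fderiv] at h2
    rw [h2]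
    rfl
  have hsnd : ∑ j : Fin (k + 1), ∑ i ∈ Finset.Iio j, (-1 : ℂ) ^ (j : ℕ) *
          β p (fun l => Function.update X i (B i j) (j.succAbove l) p) =
      ∑ j : Fin (k + 1), (-1 : ℂ) ^ (j : ℕ) * ((∑ i, C i j i) • F.cofactor β j y) := by
    have h2 := (β p).sum_update_bracket (fun j => F.frame j p) C hC
    refine Eq.trans ?_ h2
    refine Finset.sum_congr rfl fun j _ => Finset.sum_congr rfl fun i hi => ?_
    congr 2
    funext l
    have hij := Finset.mem_Iio.1 hi
    rw [← hBC i j hij]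
    by_cases hl : j.succAbove l = i
    · rw [hl, Function.update_self, Function.update_self]
    · rw [Function.update_of_ne hl, Function.update_of_ne hl, hXp]
  rw [hsnd, ← Finset.sum_add_distrib] at h1
  rw [h1, Finset.smul_sum]
  refine Finset.sum_congr rfl fun j _ => ?_
  -- Infinitesimal invariance enters here: the coefficient times the trace of the structure
  -- functions is the divergence.
  rw [hfst, hdiv, map_smul]
  simp only [Complex.real_smul]
  push_cast
  ring

end AlgebroidData.UnimodularFrame

/-- The form `dχ ∧ β` on a Lie algebroid. -/
def wedgeDeriv {A : AlgebroidData I N} {k : ℕ} (χ : N → ℝ) (β : A.Form ℂ k) :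
    A.Form ℂ (k + 1) := fun p =>
  AlternatingMap.alternatizeUncurryFin
    (((show TangentSpace I p →ₗ[ℝ] ℝ from (mfderiv I 𝓘(ℝ, ℝ) χ p).toLinearMap) ∘ₗ
      A.anchor p).smulRight (β p))

theorem wedgeDeriv_apply {A : AlgebroidData I N} {k : ℕ} (χ : N → ℝ) (β : A.Form ℂ k) (p : N)
    (v : Fin (k + 1) → A.Fiber p) :
    wedgeDeriv χ β p v = ∑ j : Fin (k + 1), (-1 : ℂ) ^ (j : ℕ) *
      ((dirDeriv I χ p (A.anchor p (v j)) : ℝ) * β p (j.removeNth v)) := by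
  rw [wedgeDeriv, AlternatingMap.alternatizeUncurryFin_apply]
  refine Finset.sum_congr rfl fun j _ => ?_
  rw [LinearMap.smulRight_apply, AlternatingMap.smul_apply, Complex.real_smul, zsmul_eq_mul]
  push_cast
  rfl

variable [I.Boundaryless] [IsManifold I ∞ N] [FiniteDimensional ℝ E]
  {A : AlgebroidData I N} {k : ℕ} [Fintype ι] {b : Basis ι ℝ E}
  {W : ∀ p : N, TangentSpace I p [⋀^ι]→ₗ[ℝ] ⋀[ℝ]^(k + 1) (A.Fiber p)}

/-- The Leibniz rule for the divergence of `χ G V`. It is written in components with respect to `b`,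
so that each summand is a directional derivative of a scalar function. -/
theorem fderiv_real_mul_smul {χ : E → ℝ} {G : E → ℂ} {V : E → E} {y : E}
    (hχ : DifferentiableAt ℝ χ y) (hG : DifferentiableAt ℝ G y) (hV : DifferentiableAt ℝ V y) :
    ∑ a, fderiv ℝ (fun z => ((χ z : ℂ) * G z) * (b.repr (V z) a : ℝ)) y (b a) =
      (χ y : ℂ) * (fderiv ℝ G y (V y) + (divergence b V y : ℂ) * G y) +
        (fderiv ℝ χ y (V y) : ℂ) * G y := by
  have hχ' : HasFDerivAt (fun z => (χ z : ℂ)) (Complex.ofRealCLM.comp (fderiv ℝ χ y)) y :=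
    Complex.ofRealCLM.hasFDerivAt.comp y hχ.hasFDerivAt
  have hVa : ∀ a, HasFDerivAt (fun z => ((b.repr (V z) a : ℝ) : ℂ))
      (Complex.ofRealCLM.comp ((b.coord a).toContinuousLinearMap.comp (fderiv ℝ V y))) y := fun a =>
    Complex.ofRealCLM.hasFDerivAt.comp y
      (((b.coord a).toContinuousLinearMap.hasFDerivAt).comp y hV.hasFDerivAt)
  have h1 : ∀ a, fderiv ℝ (fun z => ((χ z : ℂ) * G z) * (b.repr (V z) a : ℝ)) y (b a) =
      (χ y : ℂ) * G y * (b.repr (fderiv ℝ V y (b a)) a : ℝ) +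
      (b.repr (V y) a : ℝ) * ((χ y : ℂ) * fderiv ℝ G y (b a) + G y * (fderiv ℝ χ y (b a) : ℝ)) := by
    intro a
    have h : HasFDerivAt (fun z => ((χ z : ℂ) * G z) * (b.repr (V z) a : ℝ)) _ y :=
      (hχ'.mul hG.hasFDerivAt).mul (hVa a)
    rw [h.fderiv]
    simp [mul_add]
  rw [Finset.sum_congr rfl fun a _ => h1 a, Finset.sum_add_distrib, ← Finset.mul_sum,
    divergence]
  have h2 : ∀ (L : E →L[ℝ] ℂ), ∑ a, (b.repr (V y) a : ℂ) * L (b a) = L (V y) := by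
    intro L
    conv_rhs => rw [← b.sum_repr (V y), map_sum]
    simp
  have h3 : ∑ a, (b.repr (V y) a : ℂ) * (fderiv ℝ χ y (b a) : ℝ) = (fderiv ℝ χ y (V y) : ℂ) :=
    h2 (Complex.ofRealCLM.comp (fderiv ℝ χ y))
  rw [← h2 (fderiv ℝ G y), ← h3, Complex.ofReal_sum, Finset.mul_sum, Finset.sum_mul,
    Finset.sum_mul, mul_add, Finset.mul_sum, Finset.mul_sum, ← Finset.sum_add_distrib,
    ← Finset.sum_add_distrib, ← Finset.sum_add_distrib]
  exact Finset.sum_congr rfl fun a _ => by ring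

/-- Integrals of exact compactly supported forms against invariant sections vanish. -/
theorem formIntegral_pairing_differential_eq_zero [MeasurableSpace E] [BorelSpace E]
    (P : ChartPartition I N)
    {vol : ∀ p : N, TangentSpace I p [⋀^ι]→ₗ[ℝ] ℝ}
    (hvol : ∀ l, ContinuousOn (fun y => vol _ (coordFrame I b (P.center l) y)) (P.region l))
    (hvol0 : ∀ l, ∀ y ∈ P.region l, vol _ (coordFrame I b (P.center l) y) ≠ 0)
    (F : ∀ l, A.UnimodularFrame b W (P.center l) (P.region l)) {β : A.Form ℂ k} {γ : A.Form ℂ (k + 1)}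
    (hβ : AlgebroidData.IsSmoothForm β) (hβc : AlgebroidData.IsCompactlySupported β)
    (hγ : AlgebroidData.IsDifferential β γ) :
    formIntegral I b vol (fun p => pairing (γ p) (W p)) = 0 := by
  set Z := closure {p | β p ≠ 0} with hZ
  have hβ0 : ∀ p ∉ Z, β p = 0 := fun p hp => by
    by_contra h
    exact hp (subset_closure h)
  have hsub : ∀ l, P.region l ⊆ (extChartAt I (P.center l)).target := fun l => inter_subset_left
  let s : Fin P.size → E → ℝ := fun l y => Real.sign (vol _ (coordFrame I b (P.center l) y))
  -- A continuous function without zeros has locally constant sign, so the orientation sign does not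
  -- interfere with differentiation.
  have hs : ∀ l, ∀ y ∈ P.region l, ∀ᶠ z in 𝓝 y, s l z = s l y := by
    intro l y hy
    have hcont := (hvol l).continuousAt ((P.isOpen_region l).mem_nhds hy)
    rcases lt_or_gt_of_ne (hvol0 l y hy) with h | h
    · filter_upwards [hcont.eventually (gt_mem_nhds h)] with z hz
      simp only [s]
      rw [Real.sign_of_neg hz, Real.sign_of_neg h]
    · filter_upwards [hcont.eventually (lt_mem_nhds h)] with z hz
      simp only [s]
      rw [Real.sign_of_pos hz, Real.sign_of_pos h]
  have hscont : ∀ l, ContinuousOn (fun y => (s l y : ℂ)) (P.region l) := by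
    intro l y hy
    refine ContinuousAt.continuousWithinAt ?_
    refine Complex.continuous_ofReal.continuousAt.comp ?_
    exact continuousAt_const.congr (Filter.EventuallyEq.symm (hs l y hy))
  have hdens : ∀ l, ∀ y ∈ P.region l,
      chartDensity I b vol (fun p => pairing (γ p) (W p)) (P.center l) y = (s l y : ℂ) *
        ∑ j : Fin (k + 1), (-1 : ℂ) ^ (j : ℕ) *
        (fderiv ℝ ((F l).cofactor β j) y ((F l).coeff y • (F l).vec j y) +
          (divergence b (fun z => (F l).coeff z • (F l).vec j z) y : ℂ) *
            (F l).cofactor β j y) := by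
    intro l y hy
    rw [← (F l).coeff_smul_differential β (hsub l) hβ hγ hy, ← (F l).pairing_apply (K := ℂ) γ hy]
    rfl
  have hV : ∀ l j, ContDiffOn ℝ ∞ (fun z => (F l).coeff z • (F l).vec j z)
      (P.region l) :=
    fun l j => (F l).contDiffOn_coeff.smul ((F l).contDiffOn_vec j)
  have hG : ∀ l j, ContDiffOn ℝ ∞ ((F l).cofactor β j) (P.region l) :=
    fun l j => (F l).contDiffOn_cofactor β (hsub l) hβ j
  have hdiv : ∀ l j, ContinuousOn
      (fun y => (divergence b (fun z => (F l).coeff z • (F l).vec j z) y : ℂ))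
      (P.region l) := by
    intro l j
    refine Complex.continuous_ofReal.comp_continuousOn (continuousOn_finsetSum _ fun a _ => ?_)
    exact (LinearMap.continuous_of_finiteDimensional (b.coord a)).comp_continuousOn
      (((hV l j).continuousOn_fderiv_of_isOpen (P.isOpen_region l) (by simp)).clm_apply
        continuousOn_const)
  have hcontD : ∀ l, ContinuousOn (chartDensity I b vol (fun p => pairing (γ p) (W p)) (P.center l))
      (P.region l) := by
    intro l
    refine ContinuousOn.congr ?_ (hdens l)
    refine (hscont l).mul (continuousOn_finsetSum _ fun j _ => continuousOn_const.mul ?_)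
    exact (((hG l j).continuousOn_fderiv_of_isOpen (P.isOpen_region l)
      (by simp)).clm_apply (hV l j).continuousOn).add ((hdiv l j).mul (hG l j).continuousOn)
  have hcof0 : ∀ l j, ∀ y ∈ P.region l, (extChartAt I (P.center l)).symm y ∉ Z →
      (F l).cofactor β j =ᶠ[𝓝 y] 0 := by
    intro l j y hy hZy
    have h1 : ∀ᶠ p in 𝓝 ((extChartAt I (P.center l)).symm y), p ∉ Z :=
      isClosed_closure.isOpen_compl.mem_nhds hZy
    filter_upwards [(contMDiffAt_extChartAt_symm_of_mem_target (I := I)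
      (hsub l hy)).continuousAt.eventually h1] with z hz
    rw [AlgebroidData.UnimodularFrame.cofactor, hβ0 _ hz]
    rfl
  have hzero : ∀ l, ∀ y ∈ P.region l, (extChartAt I (P.center l)).symm y ∉ Z →
      chartDensity I b vol (fun p => pairing (γ p) (W p)) (P.center l) y = 0 := by
    intro l y hy hZy
    rw [hdens l y hy]
    refine mul_eq_zero_of_right _ (Finset.sum_eq_zero fun j _ => ?_)
    have h1 := hcof0 l j y hy hZy
    rw [h1.fderiv_eq, h1.eq_of_nhds]
    simp
  rw [(P.formIntegral_eq hβc hcontD hzero).2]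
  have hdensχ : ∀ l, ∀ y ∈ P.region l,
      chartDensity I b vol (fun p => pairing (wedgeDeriv (P.weight l) β p) (W p)) (P.center l) y =
      (s l y : ℂ) * ∑ j : Fin (k + 1), (-1 : ℂ) ^ (j : ℕ) *
        ((fderiv ℝ (fun y => P.weight l ((extChartAt I (P.center l)).symm y)) y
          ((F l).coeff y • (F l).vec j y) : ℂ) *
            (F l).cofactor β j y) := by
    intro l y hy
    have h1 := (F l).pairing_apply (K := ℂ) (wedgeDeriv (P.weight l) β) hy
    refine (congrArg (fun x => (s l y : ℂ) * x) h1).trans ?_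
    congr 1
    rw [wedgeDeriv_apply, Finset.smul_sum]
    refine Finset.sum_congr rfl fun j _ => ?_
    have h2 : dirDeriv I (P.weight l) ((extChartAt I (P.center l)).symm y)
        (A.anchor _ ((F l).frame j ((extChartAt I (P.center l)).symm y))) =
        fderiv ℝ (fun y => P.weight l ((extChartAt I (P.center l)).symm y)) y
          ((F l).vec j y) := by
      rw [(F l).anchor_frame y hy]
      have h3 := mfderiv_comp (I := 𝓘(ℝ, E)) (I' := I) (I'' := 𝓘(ℝ, ℝ)) y
        ((P.contMDiff_weight l _).mdifferentiableAt (by simp))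
        (mdifferentiableAt_extChartAt_symm (hsub l hy))
      rw [mfderiv_eq_fderiv] at h3
      exact (congrArg (fun L : E →L[ℝ] ℝ => L ((F l).vec j y)) h3).symm
    rw [h2, map_smul, Complex.real_smul]
    simp only [smul_eq_mul]
    push_cast
    simp only [AlgebroidData.UnimodularFrame.cofactor]
    ring
  have hχ : ∀ l, ContDiffOn ℝ ∞ (fun y => P.weight l ((extChartAt I (P.center l)).symm y))
      (P.region l) := fun l => (P.contDiffOn_weight l).mono (hsub l)
  have hKint : ∀ l, IntegrableOn (chartDensity I b vol
      (fun p => pairing (wedgeDeriv (P.weight l) β p) (W p)) (P.center l))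
      (P.region l) b.addHaar := by
    intro l
    refine integrableOn_of_eq_zero_off_compact (P.isOpen_region l)
      (P.isCompact_chartCompact hβc l) (P.chartCompact_subset l) ?_ ?_
    · refine ContinuousOn.congr ?_ (hdensχ l)
      refine (hscont _).mul (continuousOn_finsetSum _ fun j _ => continuousOn_const.mul ?_)
      exact (Complex.continuous_ofReal.comp_continuousOn
        (((hχ l).continuousOn_fderiv_of_isOpen (P.isOpen_region l)
          (by simp)).clm_apply (hV _ j).continuousOn)).mul (hG _ j).continuousOn
    · intro y hy hK
      rw [hdensχ l y hy]
      refine mul_eq_zero_of_right _ (Finset.sum_eq_zero fun j _ => mul_eq_zero_of_right _ ?_)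
      rcases P.notMem_of_notMem_chartCompact hy hK with h | h
      · have h1 : (fun y => P.weight l ((extChartAt I (P.center l)).symm y)) =ᶠ[𝓝 y] 0 := by
          have h2 : ∀ᶠ p in 𝓝 ((extChartAt I (P.center l)).symm y), p ∉ tsupport (P.weight l) :=
            (isClosed_tsupport _).isOpen_compl.mem_nhds h
          filter_upwards [(contMDiffAt_extChartAt_symm_of_mem_target (I := I)
            (hsub l hy)).continuousAt.eventually h2] with z hz
          exact image_eq_zero_of_notMem_tsupport hz
        rw [h1.fderiv_eq]
        simp
      · rw [(hcof0 _ j y hy h).eq_of_nhds]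
        simp
  -- The forms `dχ_l ∧ β` are supported in the charts and add up to zero, because the weights add up
  -- to the constant one. Their integrals therefore add up to the integral of the zero form.
  have hKsum : ∑ l, ∫ y in P.region l, chartDensity I b vol
      (fun p => pairing (wedgeDeriv (P.weight l) β p) (W p)) (P.center l) y ∂b.addHaar = 0 := by
    rw [← P.formIntegral_eq_sum (η := fun _ => 0)
      (fun l p => pairing (wedgeDeriv (P.weight l) β p) (W p))]
    · have h := P.formIntegral_eq_sum (b := b) (vol := vol) (η := fun _ => 0) (fun _ _ => 0)
        (fun _ _ _ => rfl) (fun l => by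
          refine integrableOn_zero.congr_fun (fun y _ => ?_) (P.isOpen_region l).measurableSet
          exact (mul_zero _).symm) (fun p => by simp)
      rw [h]
      exact Finset.sum_eq_zero fun l _ =>
        setIntegral_eq_zero_of_forall_eq_zero fun y _ => mul_zero _
    · intro l p hp
      have h1 : P.weight l =ᶠ[𝓝 p] fun _ => 0 := notMem_tsupport_iff_eventuallyEq.1 hp
      have h3 : wedgeDeriv (P.weight l) β p = 0 := by
        ext v
        rw [wedgeDeriv_apply]
        refine Finset.sum_eq_zero fun j _ => ?_
        have h4 : mfderiv I 𝓘(ℝ, ℝ) (P.weight l) p = mfderiv I 𝓘(ℝ, ℝ) (fun _ => (0 : ℝ)) p :=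
          h1.mfderiv_eq
        rw [dirDeriv, h4, mfderiv_const]
        change (-1 : ℂ) ^ (j : ℕ) * (((0 : ℝ) : ℂ) * _) = 0
        simp
      rw [h3]
      ext v
      simp [pairing]
    · exact hKint
    · intro p
      have h3 : ∑ l, wedgeDeriv (P.weight l) β p = 0 := by
        ext v
        rw [AlternatingMap.finset_sum_apply]
        simp only [wedgeDeriv_apply]
        rw [Finset.sum_comm]
        refine Finset.sum_eq_zero fun j _ => ?_
        rw [← Finset.mul_sum, ← Finset.sum_mul, ← Complex.ofReal_sum]
        have h4 : ∑ l, dirDeriv I (P.weight l) p (A.anchor p (v j)) = 0 := by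
          have h5 : HasMFDerivAt I 𝓘(ℝ, ℝ) (∑ l, P.weight l) p
              (∑ l, mfderiv I 𝓘(ℝ, ℝ) (P.weight l) p : TangentSpace I p →L[ℝ] ℝ) :=
            HasMFDerivAt.sum fun l _ => (((P.contMDiff_weight l) p).mdifferentiableAt
              (by simp)).hasMFDerivAt
          have h6 : (∑ l, P.weight l) = fun _ => (1 : ℝ) := by
            funext q
            rw [Finset.sum_apply, P.sum_weight]
          rw [h6] at h5
          have h7 := hasMFDerivAt_unique h5 (hasMFDerivAt_const (1 : ℝ) p)
          have h8 := congrArg (fun L : TangentSpace I p →L[ℝ] ℝ => L (A.anchor p (v j))) h7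
          refine Eq.trans ?_ h8
          exact (map_sum (ContinuousLinearMap.apply ℝ ℝ (show E from A.anchor p (v j)))
            (fun l => (show E →L[ℝ] ℝ from mfderiv I 𝓘(ℝ, ℝ) (P.weight l) p)) Finset.univ).symm
        rw [h4]
        simp
      ext v
      rw [AlternatingMap.finset_sum_apply]
      simp only [pairing, LinearMap.compAlternatingMap_apply]
      rw [← LinearMap.sum_apply, ← map_sum, h3]
      simp
  -- Integration by parts in one chart: `χ_l` times the density of `dβ`, plus the density of `dχ_l ∧
  -- β`, is up to the orientation sign the divergence of the compactly supported field `∑_j (-1)^j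
  -- χ_l β_j h v_j`. In this form the differential of `χ_l β` is never needed.
  have hmain : ∀ l, ∫ y in P.region l,
      (P.weight l ((extChartAt I (P.center l)).symm y) : ℂ) *
        chartDensity I b vol (fun p => pairing (γ p) (W p)) (P.center l) y ∂b.addHaar =
      - ∫ y in P.region l, chartDensity I b vol
      (fun p => pairing (wedgeDeriv (P.weight l) β p) (W p)) (P.center l) y ∂b.addHaar := by
    intro l
    set χ : E → ℝ := fun y => P.weight l ((extChartAt I (P.center l)).symm y) with hχdef
    let g : Fin (k + 1) → ι → E → ℂ := fun j a z =>
      ((χ z : ℂ) * (F l).cofactor β j z) * (b.repr ((F l).coeff z • (F l).vec j z) a : ℝ)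
    have hg : ∀ j a, ContDiffOn ℝ ∞ (g j a) (P.region l) := by
      intro j a
      refine ((Complex.ofRealCLM.contDiff.comp_contDiffOn (hχ l)).mul (hG l j)).mul
        (Complex.ofRealCLM.contDiff.comp_contDiffOn ?_)
      exact (b.coord a).toContinuousLinearMap.contDiff.comp_contDiffOn (hV l j)
    have hg0 : ∀ j a, ∀ y ∈ P.region l, y ∉ P.chartCompact Z l → g j a y = 0 := by
      intro j a y hy hK
      rcases P.notMem_of_notMem_chartCompact hy hK with h | h
      · simp only [g, hχdef]
        rw [image_eq_zero_of_notMem_tsupport h]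
        simp
      · simp only [g]
        rw [(hcof0 _ j y hy h).eq_of_nhds]
        simp
    have hzero' := fun j a => setIntegral_locallyConst_mul_fderiv_eq_zero b.addHaar
      (P.isOpen_region l) (P.isCompact_chartCompact hβc l) (P.chartCompact_subset l)
      ((hg j a).of_le (by simp)) (hg0 j a) (hs l) (b a)
    have hgint : ∀ j a, IntegrableOn (fun y => (s l y : ℂ) * fderiv ℝ (g j a) y (b a))
        (P.region l) b.addHaar := by
      intro j a
      refine integrableOn_of_eq_zero_off_compact (P.isOpen_region l)
        (P.isCompact_chartCompact hβc l) (P.chartCompact_subset l)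
        ((hscont l).mul (((hg j a).continuousOn_fderiv_of_isOpen (P.isOpen_region l)
          (by simp)).clm_apply continuousOn_const)) ?_
      intro y hy hK
      have h1 : g j a =ᶠ[𝓝 y] 0 := by
        filter_upwards [(P.isOpen_region l).mem_nhds hy,
          (P.isCompact_chartCompact hβc l).isClosed.isOpen_compl.mem_nhds hK] with z hz hzK
        exact hg0 j a z hz hzK
      rw [h1.fderiv_eq]
      simp
    rw [← sub_eq_zero, sub_neg_eq_add, ← integral_add
      (P.formIntegral_eq hβc hcontD hzero |>.1 l) (hKint l)]
    have hpt : ∀ y ∈ P.region l, (χ y : ℂ) *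
        chartDensity I b vol (fun p => pairing (γ p) (W p)) (P.center l) y +
        chartDensity I b vol (fun p => pairing (wedgeDeriv (P.weight l) β p) (W p)) (P.center l) y =
        ∑ j : Fin (k + 1), (-1 : ℂ) ^ (j : ℕ) *
          ∑ a, (s l y : ℂ) * fderiv ℝ (g j a) y (b a) := by
      intro y hy
      rw [hdens l y hy, hdensχ l y hy]
      have hU := (P.isOpen_region l).mem_nhds hy
      have h1 : ∀ j, ∑ a, fderiv ℝ (g j a) y (b a) = _ := fun j => fderiv_real_mul_smul (b := b)
        (χ := χ)
        (((hχ l).contDiffAt hU).differentiableAt (by simp))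
        (((hG l j).contDiffAt hU).differentiableAt (by simp))
        (((hV l j).contDiffAt hU).differentiableAt (by simp))
      simp only [← Finset.mul_sum]
      simp only [h1]
      rw [Finset.mul_sum, Finset.mul_sum, Finset.mul_sum, ← Finset.sum_add_distrib]
      refine Finset.sum_congr rfl fun j _ => ?_
      ring
    rw [setIntegral_congr_fun (P.isOpen_region l).measurableSet hpt,
      integral_finsetSum]
    · refine Finset.sum_eq_zero fun j _ => ?_
      rw [integral_const_mul, integral_finsetSum _ fun a _ => hgint j a]
      simp only [hzero', Finset.sum_const_zero, mul_zero]
    · intro j _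
      exact (integrable_finsetSum _ fun a _ => hgint j a).const_mul _
  rw [Finset.sum_congr rfl fun l _ => hmain l, Finset.sum_neg_distrib, hKsum, neg_zero]

end Stokes

/-! ### Lie brackets of related vector fields -/

section Related

open VectorField

variable {E F : Type*} [NormedAddCommGroup E] [NormedSpace ℝ E] [NormedAddCommGroup F]
  [NormedSpace ℝ F]

/-- Differentiating the relations produces second derivatives of `f`; they are symmetric and cancel
in the bracket. -/
theorem fderiv_lieBracket_of_related {f : E → F} {x : E} (hf : ContDiffAt ℝ 2 f x)
    {V W : E → E} {V' W' : F → F} (hV : DifferentiableAt ℝ V x) (hW : DifferentiableAt ℝ W x)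
    (hV' : DifferentiableAt ℝ V' (f x)) (hW' : DifferentiableAt ℝ W' (f x))
    (hVV : ∀ᶠ z in 𝓝 x, fderiv ℝ f z (V z) = V' (f z))
    (hWW : ∀ᶠ z in 𝓝 x, fderiv ℝ f z (W z) = W' (f z)) :
    fderiv ℝ f x (lieBracket ℝ V W x) = lieBracket ℝ V' W' (f x) := by
  have hfd := hf.differentiableAt (by simp)
  rw [fderiv_apply_lieBracket_of_isSymmSndFDerivAt hf
    (hf.isSymmSndFDerivAt (by simp)) hW hV, Filter.EventuallyEq.fderiv_eq hWW,
    Filter.EventuallyEq.fderiv_eq hVV]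
  have h1 : fderiv ℝ (fun z => W' (f z)) x = (fderiv ℝ W' (f x)).comp (fderiv ℝ f x) :=
    fderiv_comp x hW' hfd
  have h2 : fderiv ℝ (fun z => V' (f z)) x = (fderiv ℝ V' (f x)).comp (fderiv ℝ f x) :=
    fderiv_comp x hV' hfd
  rw [h1, h2, ContinuousLinearMap.comp_apply, ContinuousLinearMap.comp_apply,
    hVV.self_of_nhds, hWW.self_of_nhds]
  rfl

end Related

section RelatedManifold

open VectorField

variable {E : Type} [NormedAddCommGroup E] [NormedSpace ℝ E] {H : Type*} [TopologicalSpace H]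
  {I : ModelWithCorners ℝ E H} {N : Type*} [TopologicalSpace N] [ChartedSpace H N]
  [I.Boundaryless] [IsManifold I ∞ N]
  {E' : Type} [NormedAddCommGroup E'] [NormedSpace ℝ E'] {H' : Type*} [TopologicalSpace H']
  {I' : ModelWithCorners ℝ E' H'} {N' : Type*} [TopologicalSpace N'] [ChartedSpace H' N']
  [I'.Boundaryless] [IsManifold I' ∞ N']

variable (I) in
/-- A vector field read in the chart around `c`. -/
def chartField (c : N) (V : ∀ p : N, TangentSpace I p) (y : E) : E :=
  mfderiv I 𝓘(ℝ, E) (extChartAt I c) ((extChartAt I c).symm y) (V ((extChartAt I c).symm y))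

theorem chartField_eq_snd {c : N} (V : ∀ p : N, TangentSpace I p) {y : E}
    (hy : y ∈ (extChartAt I c).target) :
    chartField I c V y = (trivializationAt E (TangentSpace I) c
      (⟨(extChartAt I c).symm y, V ((extChartAt I c).symm y)⟩ : TangentBundle I N)).2 := by
  have h : (extChartAt I c).symm y ∈ (chartAt H c).source := by
    rw [← extChartAt_source I]
    exact (extChartAt I c).map_target hy
  rw [chartField, ← TangentBundle.continuousLinearMapAt_trivializationAt h]
  exact Trivialization.continuousLinearMapAt_apply_of_mem ℝ _
    (by rwa [TangentBundle.trivializationAt_baseSet]) _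

theorem contDiffAt_chartField {c : N} {V : ∀ p : N, TangentSpace I p} {y : E} {m : ℕ∞}
    (hy : y ∈ (extChartAt I c).target)
    (hV : ContMDiffAt I I.tangent m (fun p => (⟨p, V p⟩ : TangentBundle I N))
      ((extChartAt I c).symm y)) :
    ContDiffAt ℝ m (chartField I c V) y := by
  have h : (extChartAt I c).symm y ∈ (chartAt H c).source := by
    rw [← extChartAt_source I]
    exact (extChartAt I c).map_target hy
  have h1 := (Trivialization.contMDiffAt_section_iff (IB := I) (n := m)
    (trivializationAt E (TangentSpace I) c) (s := V)
    (by rwa [TangentBundle.trivializationAt_baseSet])).1 hV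
  have h2 := (h1.comp y ((contMDiffAt_extChartAt_symm_of_mem_target hy).of_le
    (show (m : WithTop ℕ∞) ≤ ∞ by exact_mod_cast le_top))).contDiffAt
  refine h2.congr_of_eventuallyEq ?_
  filter_upwards [(isOpen_extChartAt_target c).mem_nhds hy] with z hz
  exact chartField_eq_snd V hz

/-- The bracket on a manifold is the Euclidean bracket of the fields pulled back by the inverse
chart, and near the point these pull-backs are the fields `chartField`. -/
theorem mfderiv_extChartAt_mlieBracket (V W : ∀ p : N, TangentSpace I p) (p : N) :
    (mfderiv I 𝓘(ℝ, E) (extChartAt I p) p (mlieBracket I V W p) : E) =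
      lieBracket ℝ (chartField I p V) (chartField I p W) (extChartAt I p p) := by
  have hcf : ∀ V : ∀ p : N, TangentSpace I p,
      mpullbackWithin 𝓘(ℝ, E) I (extChartAt I p).symm V (range I) =ᶠ[𝓝 (extChartAt I p p)]
        chartField I p V := by
    intro V
    filter_upwards [extChartAt_target_mem_nhds p] with y hy
    rw [mpullbackWithin_apply, chartField]
    have h1 := mfderiv_extChartAt_comp_mfderivWithin_extChartAt_symm (I := I) hy
    have h2 := mfderivWithin_extChartAt_symm_comp_mfderiv_extChartAt (I := I) hy
    rw [ContinuousLinearMap.inverse_eq h2 h1]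
    rfl
  rw [← mlieBracketWithin_univ, mlieBracketWithin_apply]
  have h3 := isInvertible_mfderiv_extChartAt (I := I) (mem_extChartAt_source (I := I) p)
  refine (h3.self_apply_inverse _).trans ?_
  simp only [I.range_eq_univ, preimage_univ, inter_univ]
  refine Eq.trans (congrFun (lieBracketWithin_univ (𝕜 := ℝ) (E := E)) _) ?_
  have hV := hcf V
  have hW := hcf W
  rw [I.range_eq_univ] at hV hW
  exact Filter.EventuallyEq.lieBracket_vectorField_eq (𝕜 := ℝ) (E := E) hV hW

/-- Brackets of related vector fields are related. -/
theorem mfderiv_mlieBracket_of_related {f : N → N'} {p : N} (hf : ContMDiffAt I I' ∞ f p)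
    {V W : ∀ q : N, TangentSpace I q} {V' W' : ∀ q : N', TangentSpace I' q}
    (hV : ContMDiffAt I I.tangent 1 (fun q => (⟨q, V q⟩ : TangentBundle I N)) p)
    (hW : ContMDiffAt I I.tangent 1 (fun q => (⟨q, W q⟩ : TangentBundle I N)) p)
    (hV' : ContMDiffAt I' I'.tangent 1 (fun q => (⟨q, V' q⟩ : TangentBundle I' N')) (f p))
    (hW' : ContMDiffAt I' I'.tangent 1 (fun q => (⟨q, W' q⟩ : TangentBundle I' N')) (f p))
    (hVV : ∀ᶠ q in 𝓝 p, mfderiv I I' f q (V q) = V' (f q))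
    (hWW : ∀ᶠ q in 𝓝 p, mfderiv I I' f q (W q) = W' (f q)) :
    mfderiv I I' f p (mlieBracket I V W p) = mlieBracket I' V' W' (f p) := by
  have hinj := (isInvertible_mfderiv_extChartAt (I := I')
    (mem_extChartAt_source (I := I') (f p))).injective
  refine hinj ?_
  refine Eq.trans ?_ (mfderiv_extChartAt_mlieBracket V' W' (f p)).symm
  let φ := extChartAt I p
  let ψ := extChartAt I' (f p)
  have hφp : φ.symm (φ p) = p := extChartAt_to_inv p
  have hy : φ p ∈ φ.target := mem_extChartAt_target p
  let g : E → E' := ψ ∘ f ∘ φ.symm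
  have hg : ContDiffAt ℝ ∞ g (φ p) := by
    refine ContMDiffAt.contDiffAt ?_
    refine ContMDiffAt.comp (φ p) (I' := I') ?_ (ContMDiffAt.comp (φ p) (I' := I) ?_
      (contMDiffAt_extChartAt_symm_of_mem_target hy))
    · simp only [Function.comp_apply, hφp]
      exact contMDiffAt_extChartAt
    · rwa [hφp]
  have hgp : g (φ p) = ψ (f p) := by simp only [g, Function.comp_apply, hφp]
  have hev : ∀ᶠ z in 𝓝 (φ p), z ∈ φ.target ∧ MDifferentiableAt I I' f (φ.symm z) ∧
      f (φ.symm z) ∈ ψ.source := by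
    have h1 : ∀ᶠ q in 𝓝 p, MDifferentiableAt I I' f q ∧ f q ∈ ψ.source := by
      have h2 : ∀ᶠ q in 𝓝 p, ContMDiffAt I I' 1 f q :=
        (contMDiffAt_iff_contMDiffAt_nhds (n := 1) (by simp)).1 (hf.of_le (by simp))
      filter_upwards [h2, hf.continuousAt.eventually (extChartAt_source_mem_nhds (I := I') (f p))]
        with q hq hq'
      exact ⟨hq.mdifferentiableAt (by simp), hq'⟩
    have h3 : Filter.Tendsto φ.symm (𝓝 (φ p)) (𝓝 p) := by
      have := (contMDiffAt_extChartAt_symm_of_mem_target (I := I) hy).continuousAt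
      rw [ContinuousAt] at this
      rwa [hφp] at this
    filter_upwards [extChartAt_target_mem_nhds (I := I) p, h3.eventually h1] with z hz hz'
    exact ⟨hz, hz'⟩
  -- The expression `g` of `f` in charts intertwines the chart differentials; this transfers
  -- relatedness to the Euclidean fields.
  have hfd : ∀ᶠ z in 𝓝 (φ p), ∀ v : TangentSpace I (φ.symm z),
      fderiv ℝ g z (mfderiv I 𝓘(ℝ, E) φ (φ.symm z) v) =
        mfderiv I' 𝓘(ℝ, E') ψ (f (φ.symm z)) (mfderiv I I' f (φ.symm z) v) := by
    filter_upwards [hev] with z ⟨hz, hz1, hz2⟩ v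
    have h1 : MDifferentiableAt I' 𝓘(ℝ, E') ψ (f (φ.symm z)) :=
      (contMDiffAt_extChartAt_of_mem_source hz2).mdifferentiableAt (by simp)
    have h2 := mdifferentiableAt_extChartAt_symm (I := I) hz
    have h3 : mfderiv 𝓘(ℝ, E) 𝓘(ℝ, E') g z = (mfderiv I' 𝓘(ℝ, E') ψ (f (φ.symm z))).comp
        ((mfderiv I I' f (φ.symm z)).comp (mfderiv 𝓘(ℝ, E) I φ.symm z)) := by
      rw [← mfderiv_comp z hz1 h2]
      exact mfderiv_comp z (g := ψ) (f := f ∘ φ.symm) h1 (hz1.comp z h2)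
    rw [mfderiv_eq_fderiv] at h3
    rw [h3]
    have h4 := mfderivWithin_extChartAt_symm_comp_mfderiv_extChartAt (I := I) hz
    rw [I.range_eq_univ, mfderivWithin_univ] at h4
    change mfderiv I' 𝓘(ℝ, E') ψ (f (φ.symm z)) (mfderiv I I' f (φ.symm z)
      (((mfderiv 𝓘(ℝ, E) I φ.symm z).comp (mfderiv I 𝓘(ℝ, E) φ (φ.symm z))) v)) = _
    rw [h4]
    rfl
  have hrel : ∀ {V : ∀ q : N, TangentSpace I q} {V' : ∀ q : N', TangentSpace I' q},
      (∀ᶠ q in 𝓝 p, mfderiv I I' f q (V q) = V' (f q)) →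
      ∀ᶠ z in 𝓝 (φ p), fderiv ℝ g z (chartField I p V z) = chartField I' (f p) V' (g z) := by
    intro V V' h
    have h3 : Filter.Tendsto φ.symm (𝓝 (φ p)) (𝓝 p) := by
      have := (contMDiffAt_extChartAt_symm_of_mem_target (I := I) hy).continuousAt
      rw [ContinuousAt] at this
      rwa [hφp] at this
    filter_upwards [hfd, hev, h3.eventually h] with z hz hz' hz''
    rw [chartField, hz, hz'', chartField]
    -- The variable `q` absorbs the equation between `f (φ.symm z)` and the point recovered from its
    -- coordinates, which occurs in the types.
    have h4 : ∀ q, q = f (φ.symm z) → (mfderiv I' 𝓘(ℝ, E') ψ (f (φ.symm z)) (V' (f (φ.symm z))) : E')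
        = mfderiv I' 𝓘(ℝ, E') ψ q (V' q) := by
      rintro _ rfl
      rfl
    exact h4 _ (ψ.left_inv hz'.2.2)
  have hbr := fderiv_lieBracket_of_related (hg.of_le (WithTop.coe_le_coe.2 (le_top (a := (2 : ℕ∞)))))
    ((contDiffAt_chartField (m := 1) hy (by rw [hφp]; exact hV)).differentiableAt (by simp))
    ((contDiffAt_chartField (m := 1) hy (by rw [hφp]; exact hW)).differentiableAt (by simp))
    (V' := chartField I' (f p) V') (W' := chartField I' (f p) W')
    (by
      rw [hgp]
      exact (contDiffAt_chartField (m := 1) (mem_extChartAt_target (f p))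
        (by rw [extChartAt_to_inv]; exact hV')).differentiableAt (by simp))
    (by
      rw [hgp]
      exact (contDiffAt_chartField (m := 1) (mem_extChartAt_target (f p))
        (by rw [extChartAt_to_inv]; exact hW')).differentiableAt (by simp))
    (hrel hVV) (hrel hWW)
  rw [hgp] at hbr
  refine Eq.trans ?_ hbr
  have h5 : ∀ v : E, fderiv ℝ g (φ p) ((mfderiv I 𝓘(ℝ, E) φ (φ.symm (φ p)) : E →L[ℝ] E) v) =
      (mfderiv I' 𝓘(ℝ, E') ψ (f (φ.symm (φ p))) : E' →L[ℝ] E')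
        ((mfderiv I I' f (φ.symm (φ p)) : E →L[ℝ] E') v) := hfd.self_of_nhds
  rw [hφp] at h5
  rw [← mfderiv_extChartAt_mlieBracket]
  exact (h5 _).symm

end RelatedManifold

/-- Each tangent space is definitionally the model space, and there the transport is the identity.
Vectors at points which are equal only by a groupoid axiom are compared in this way. -/
theorem castTangent_coe {E : Type} [NormedAddCommGroup E] [NormedSpace ℝ E] {H : Type*}
    [TopologicalSpace H] (I : ModelWithCorners ℝ E H) {N : Type*} [TopologicalSpace N]
    [ChartedSpace H N] {p q : N} (h : p = q) (v : TangentSpace I p) :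
    (castTangent I h v : E) = v := by
  subst h
  rfl

theorem HasMFDerivAt.prodMk_space {E F F' : Type*} [NormedAddCommGroup E] [NormedSpace ℝ E]
    [NormedAddCommGroup F] [NormedSpace ℝ F] [NormedAddCommGroup F'] [NormedSpace ℝ F']
    {H : Type*} [TopologicalSpace H] {I : ModelWithCorners ℝ E H} {N : Type*} [TopologicalSpace N]
    [ChartedSpace H N] {f : N → F} {g : N → F'} {p : N} {f' : E →L[ℝ] F} {g' : E →L[ℝ] F'}
    (hf : HasMFDerivAt I 𝓘(ℝ, F) f p f') (hg : HasMFDerivAt I 𝓘(ℝ, F') g p g') :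
    HasMFDerivAt I 𝓘(ℝ, F × F') (fun q => (f q, g q)) p (f'.prod g') :=
  ⟨hf.1.prodMk hg.1, hf.2.prodMk hg.2⟩

/-! ### Coordinates of the groupoid near a unit -/

namespace LieGroupoid

variable {n r : ℕ} {M G : Type*}
    [TopologicalSpace M] [ChartedSpace (EuSp n) M] [IsManifold (𝓡 n) ∞ M]
    [TopologicalSpace G] [ChartedSpace (EuSp (n + r)) G] [IsManifold (𝓡 (n + r)) ∞ G]
    (Γ : LieGroupoid n r M G)

theorem anchor_coe (x : M) (X : Γ.Alg x) : (Γ.anchor x X : EuSp n) =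
    mfderiv (𝓡 (n + r)) (𝓡 n) Γ.s (Γ.u x) (Γ.incl x X) :=
  castTangent_coe (𝓡 n) (Γ.s_u x) _

theorem leftTranslate_coe (g : G) (X : Γ.Alg (Γ.s g)) :
    (Γ.leftTranslate g X : EuSp (n + r)) =
      Γ.tangentMul g (Γ.u (Γ.s g)) 0 (Γ.incl (Γ.s g) X) :=
  castTangent_coe (𝓡 (n + r)) (Γ.mul_u g) _

section Curves

variable {E : Type} [NormedAddCommGroup E] [NormedSpace ℝ E] {H : Type*} [TopologicalSpace H]
  {I : ModelWithCorners ℝ E H} {N : Type*} [TopologicalSpace N] [ChartedSpace H N]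

/-- Multiplication is smooth within the composable pairs only. A family that remains composable near
`q` turns this into ordinary smoothness. -/
theorem contMDiffAt_mul {k : ℕ∞} {γ δ : N → G} {q : N} (hγ : ContMDiffAt I (𝓡 (n + r)) k γ q)
    (hδ : ContMDiffAt I (𝓡 (n + r)) k δ q) (h : ∀ᶠ p in 𝓝 q, Γ.s (γ p) = Γ.t (δ p)) :
    ContMDiffAt I (𝓡 (n + r)) k (fun p => Γ.mul (γ p) (δ p)) q := by
  have h1 := (Γ.contMDiffOn_mul (γ q, δ q) h.self_of_nhds).of_le
    (show (k : WithTop ℕ∞) ≤ ∞ by exact_mod_cast le_top)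
  have h2 := h1.comp' q (hγ.prodMk hδ).contMDiffWithinAt (s := univ)
  refine h2.contMDiffAt ?_
  filter_upwards [h] with p hp
  exact ⟨mem_univ _, hp⟩

/-- The derivative of the multiplication along composable families. -/
theorem mfderiv_mul {γ δ : N → G} {q : N} (hγ : MDifferentiableAt I (𝓡 (n + r)) γ q)
    (hδ : MDifferentiableAt I (𝓡 (n + r)) δ q) (h : ∀ᶠ p in 𝓝 q, Γ.s (γ p) = Γ.t (δ p))
    (v : TangentSpace I q) :
    mfderiv I (𝓡 (n + r)) (fun p => Γ.mul (γ p) (δ p)) q v =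
      Γ.tangentMul (γ q) (δ q) (mfderiv I (𝓡 (n + r)) γ q v) (mfderiv I (𝓡 (n + r)) δ q v) := by
  have h1 := ((Γ.contMDiffOn_mul (γ q, δ q) h.self_of_nhds).mdifferentiableWithinAt
    (by simp)).hasMFDerivWithinAt
  have h2 : HasMFDerivWithinAt I ((𝓡 (n + r)).prod (𝓡 (n + r))) (fun p => (γ p, δ p))
      ((fun p => (γ p, δ p)) ⁻¹' {p : G × G | Γ.s p.1 = Γ.t p.2}) q _ :=
    (hγ.hasMFDerivAt.prodMk hδ.hasMFDerivAt).hasMFDerivWithinAt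
  have h3 := h1.comp q h2 (fun _ hp => hp)
  have h4 := h3.hasMFDerivAt h
  have h5 := h4.mfderiv
  exact congrArg (fun L : E →L[ℝ] EuSp (n + r) => L v) h5

end Curves

/-- Coordinates of `G` near the units: those of the target, and the fibre coordinates. -/
def coord (c : M) (g : G) : EuSp n × EuSp r :=
  (extChartAt (𝓡 n) c (Γ.t g), Γ.locProj c (extChartAt (𝓡 (n + r)) (Γ.u c) g -
    extChartAt (𝓡 (n + r)) (Γ.u c) (Γ.u (Γ.t g))))

theorem u_mem_source {c x : M} (hx : x ∈ Γ.base c) :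
    Γ.u x ∈ (extChartAt (𝓡 (n + r)) (Γ.u c)).source := by
  have h := hx.1.1
  rwa [TangentBundle.trivializationAt_baseSet, ← extChartAt_source (𝓡 (n + r))] at h

theorem contMDiffAt_coord {c : M} {g : G} (ht : Γ.t g ∈ (extChartAt (𝓡 n) c).source)
    (hg : g ∈ (extChartAt (𝓡 (n + r)) (Γ.u c)).source)
    (hu : Γ.u (Γ.t g) ∈ (extChartAt (𝓡 (n + r)) (Γ.u c)).source) :
    ContMDiffAt (𝓡 (n + r)) 𝓘(ℝ, EuSp n × EuSp r) ∞ (Γ.coord c) g := by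
  refine ContMDiffAt.prodMk_space
    ((contMDiffAt_extChartAt_of_mem_source ht).comp g (Γ.contMDiff_t g)) ?_
  refine (ContinuousLinearMap.contMDiff (Γ.locProj c)).contMDiffAt.comp g ?_
  exact (contMDiffAt_extChartAt_of_mem_source hg).sub
    ((contMDiffAt_extChartAt_of_mem_source hu).comp g
      ((Γ.contMDiff_u _).comp g (Γ.contMDiff_t g)))

theorem mfderiv_coord {c : M} {g : G} (ht : Γ.t g ∈ (extChartAt (𝓡 n) c).source)
    (hg : g ∈ (extChartAt (𝓡 (n + r)) (Γ.u c)).source)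
    (hu : Γ.u (Γ.t g) ∈ (extChartAt (𝓡 (n + r)) (Γ.u c)).source)
    (X : TangentSpace (𝓡 (n + r)) g) :
    (mfderiv (𝓡 (n + r)) 𝓘(ℝ, EuSp n × EuSp r) (Γ.coord c) g X : EuSp n × EuSp r) =
      ((mfderiv (𝓡 n) 𝓘(ℝ, EuSp n) (extChartAt (𝓡 n) c) (Γ.t g)
        (mfderiv (𝓡 (n + r)) (𝓡 n) Γ.t g X) : EuSp n),
      Γ.locProj c ((show EuSp (n + r) from mfderiv (𝓡 (n + r)) 𝓘(ℝ, EuSp (n + r))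
          (extChartAt (𝓡 (n + r)) (Γ.u c)) g X) -
        (show EuSp (n + r) from mfderiv (𝓡 n) 𝓘(ℝ, EuSp (n + r))
          (extChartAt (𝓡 (n + r)) (Γ.u c) ∘ Γ.u) (Γ.t g)
            (mfderiv (𝓡 (n + r)) (𝓡 n) Γ.t g X)))) := by
  have h1 := ((contMDiffAt_extChartAt_of_mem_source ht).mdifferentiableAt (by simp)).hasMFDerivAt
  have h2 := ((contMDiffAt_extChartAt_of_mem_source hg).mdifferentiableAt (by simp)).hasMFDerivAt
  have h3 := (((contMDiffAt_extChartAt_of_mem_source hu).comp (Γ.t g)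
    (Γ.contMDiff_u _)).mdifferentiableAt (by simp)).hasMFDerivAt
  have ht' := ((Γ.contMDiff_t g).mdifferentiableAt (by simp)).hasMFDerivAt
  have h4 : HasMFDerivAt (𝓡 (n + r)) 𝓘(ℝ, EuSp n × EuSp r) (Γ.coord c) g _ :=
    HasMFDerivAt.prodMk_space (HasMFDerivAt.comp g h1 ht')
      (HasMFDerivAt.comp g (Γ.locProj c).hasMFDerivAt
        (HasMFDerivAt.sub h2 (HasMFDerivAt.comp (f := Γ.t) g h3 ht')))
  have h5 := h4.mfderiv
  exact congrArg (fun L : EuSp (n + r) →L[ℝ] EuSp n × EuSp r => L X) h5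

/-- Vectors tangent to the `t`-fibre have no base component, and the correction by the unit over the
target does not move along them. -/
theorem mfderiv_coord_incl {c x : M} (hx : x ∈ Γ.base c) (hc : x ∈ (extChartAt (𝓡 n) c).source)
    (X : Γ.Alg x) : (mfderiv (𝓡 (n + r)) 𝓘(ℝ, EuSp n × EuSp r) (Γ.coord c) (Γ.u x) (Γ.incl x X) :
      EuSp n × EuSp r) = (0, Γ.locTriv c x X) := by
  have h1 := Γ.u_mem_source hx
  rw [Γ.mfderiv_coord (by rwa [Γ.t_u]) h1 (by rwa [Γ.t_u]), Γ.mfderiv_t_incl, map_zero, map_zero]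
  refine Prod.ext rfl ?_
  refine Eq.trans (congrArg (Γ.locProj c) (sub_zero _)) ?_
  rw [extChartAt_source] at h1
  simp only [locTriv, ContinuousLinearMap.comp_apply]
  rw [TangentBundle.continuousLinearMapAt_trivializationAt h1]
  rfl

/-- The base component forces a vector in the kernel to be tangent to the `t`-fibre. It then belongs
to `𝔤`, where the fibre component is the injective map `locTriv`. -/
theorem mfderiv_coord_injective {c x : M} (hx : x ∈ Γ.base c)
    (hc : x ∈ (extChartAt (𝓡 n) c).source) (X : TangentSpace (𝓡 (n + r)) (Γ.u x))
    (h0 : (mfderiv (𝓡 (n + r)) 𝓘(ℝ, EuSp n × EuSp r) (Γ.coord c) (Γ.u x) X :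
      EuSp n × EuSp r) = 0) : X = 0 := by
  have h1 := Γ.u_mem_source hx
  have h2 := h0
  have htu : Γ.t (Γ.u x) ∈ (extChartAt (𝓡 n) c).source := by rwa [Γ.t_u]
  rw [Γ.mfderiv_coord htu h1 (by rwa [Γ.t_u])] at h2
  have h3 : mfderiv (𝓡 (n + r)) (𝓡 n) Γ.t (Γ.u x) X = 0 := by
    have h4 := (isInvertible_mfderiv_extChartAt (I := 𝓡 n) htu).injective
    exact h4 ((congrArg Prod.fst h2).trans (map_zero _).symm)
  have h5 := Γ.mfderiv_coord_incl hx hc (Γ.ofKer x X h3)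
  rw [Γ.incl_ofKer, h0] at h5
  have h6 : Γ.ofKer x X h3 = 0 :=
    Γ.locTriv_injective c x hx ((congrArg Prod.snd h5).symm.trans (map_zero _).symm)
  rw [← Γ.incl_ofKer x X h3, h6, map_zero]

/-- A parametrisation of a neighbourhood of a unit of `G`, inverse to the coordinates. -/
structure UnitChart (c x : M) where
  mem_base : x ∈ Γ.base c
  mem_source : x ∈ (extChartAt (𝓡 n) c).source
  param : EuSp n × EuSp r → G
  contMDiffAt_param : ContMDiffAt 𝓘(ℝ, EuSp n × EuSp r) (𝓡 (n + r)) 3 param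
    (extChartAt (𝓡 n) c x, 0)
  param_base : param (extChartAt (𝓡 n) c x, 0) = Γ.u x
  coord_param : ∀ᶠ z in 𝓝 (extChartAt (𝓡 n) c x, 0), Γ.coord c (param z) = z
  param_coord : ∀ᶠ g in 𝓝 (Γ.u x), param (Γ.coord c g) = g

theorem coord_u {c x : M} (_ : x ∈ (extChartAt (𝓡 n) c).source) :
    Γ.coord c (Γ.u x) = (extChartAt (𝓡 n) c x, 0) := by
  rw [coord, Γ.t_u, sub_self, map_zero]

/-- The inverse function theorem: the coordinates, read in a chart of `G`, have injective
differential between spaces of equal dimension. Three derivatives suffice, since the later arguments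
use the second derivative of the multiplication and its symmetry. -/
theorem exists_unitChart {c x : M} (hx : x ∈ Γ.base c) (hc : x ∈ (extChartAt (𝓡 n) c).source) :
    Nonempty (Γ.UnitChart c x) := by
  have h1 := Γ.u_mem_source hx
  let κ := extChartAt (𝓡 (n + r)) (Γ.u c)
  let e0 := κ (Γ.u x)
  have he0 : e0 ∈ κ.target := κ.map_source h1
  have hinv : κ.symm e0 = Γ.u x := κ.left_inv h1
  let K : EuSp (n + r) → EuSp n × EuSp r := Γ.coord c ∘ κ.symm
  have hcoord : ContMDiffAt (𝓡 (n + r)) 𝓘(ℝ, EuSp n × EuSp r) ∞ (Γ.coord c) (Γ.u x) :=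
    Γ.contMDiffAt_coord (by rwa [Γ.t_u]) h1 (by rwa [Γ.t_u])
  have hcoord' : ContMDiffAt (𝓡 (n + r)) 𝓘(ℝ, EuSp n × EuSp r) ∞ (Γ.coord c) (κ.symm e0) := by
    rwa [hinv]
  have hsymm := contMDiffAt_extChartAt_symm_of_mem_target (I := 𝓡 (n + r)) he0
  have hK : ContDiffAt ℝ 3 K e0 := ((hcoord'.comp e0 hsymm).contDiffAt).of_le
    (WithTop.coe_le_coe.2 (le_top (a := (3 : ℕ∞))))
  have hK0 : K e0 = (extChartAt (𝓡 n) c x, 0) := by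
    simp only [K, Function.comp_apply, hinv]
    exact Γ.coord_u hc
  have hinj : ∀ v, fderiv ℝ K e0 v = 0 → v = 0 := by
    intro v hv
    have h2 : mfderiv 𝓘(ℝ, EuSp (n + r)) 𝓘(ℝ, EuSp n × EuSp r) K e0 =
        (mfderiv (𝓡 (n + r)) 𝓘(ℝ, EuSp n × EuSp r) (Γ.coord c) (κ.symm e0)).comp
          (mfderiv 𝓘(ℝ, EuSp (n + r)) (𝓡 (n + r)) κ.symm e0) :=
      mfderiv_comp e0 (hcoord'.mdifferentiableAt (by simp)) (hsymm.mdifferentiableAt (by simp))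
    rw [mfderiv_eq_fderiv] at h2
    rw [h2] at hv
    have h3 : ∀ g, g = Γ.u x → ∀ w : EuSp (n + r),
        (mfderiv (𝓡 (n + r)) 𝓘(ℝ, EuSp n × EuSp r) (Γ.coord c) g : EuSp (n + r) →L[ℝ] _) w =
          (0 : EuSp n × EuSp r) → w = 0 := by
      rintro _ rfl w hw
      exact Γ.mfderiv_coord_injective hx hc w hw
    have h4 := h3 _ hinv _ hv
    have h5 := mfderiv_extChartAt_comp_mfderivWithin_extChartAt_symm (I := 𝓡 (n + r)) he0
    rw [ModelWithCorners.Boundaryless.range_eq_univ, mfderivWithin_univ] at h5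
    have h6 := congrArg (fun L : EuSp (n + r) →L[ℝ] EuSp (n + r) => L v) h5
    refine Eq.trans h6.symm ?_
    exact Eq.trans (congrArg (mfderiv (𝓡 (n + r)) 𝓘(ℝ, EuSp (n + r)) κ (κ.symm e0)) h4) (map_zero _)
  have hdim : Module.finrank ℝ (EuSp (n + r)) = Module.finrank ℝ (EuSp n × EuSp r) := by
    simp only [Module.finrank_prod, finrank_euclideanSpace_fin]
  let D : EuSp (n + r) ≃L[ℝ] EuSp n × EuSp r :=
    (LinearEquiv.ofInjectiveOfFinrankEq (fderiv ℝ K e0).toLinearMap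
      ((injective_iff_map_eq_zero _).2 hinj) hdim).toContinuousLinearEquiv
  have hD : HasFDerivAt K (D : EuSp (n + r) →L[ℝ] EuSp n × EuSp r) e0 := by
    have : (D : EuSp (n + r) →L[ℝ] EuSp n × EuSp r) = fderiv ℝ K e0 := by
      ext1 v
      rfl
    rw [this]
    exact (hK.differentiableAt (by simp)).hasFDerivAt
  let e := hK.toOpenPartialHomeomorph K hD (by simp)
  have hes : e0 ∈ e.source := hK.mem_toOpenPartialHomeomorph_source hD (by simp)
  have het : K e0 ∈ e.target := hK.image_mem_toOpenPartialHomeomorph_target hD (by simp)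
  have hsm : ContDiffAt ℝ 3 e.symm (K e0) := hK.to_localInverse hD (by simp)
  have hl0 : e.symm (K e0) = e0 := e.left_inv hes
  have hchart : (extChartAt (𝓡 n) c x, (0 : EuSp r)) = K e0 := hK0.symm
  have hnear : ∀ᶠ z in 𝓝 (K e0), z ∈ e.target := e.open_target.mem_nhds het
  refine ⟨⟨hx, hc, fun z => κ.symm (e.symm z), ?_, ?_, ?_, ?_⟩⟩
  · rw [hchart]
    refine ContMDiffAt.comp (I' := 𝓘(ℝ, EuSp (n + r))) (K e0) ?_ hsm.contMDiffAt
    rw [hl0]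
    exact hsymm.of_le (WithTop.coe_le_coe.2 (le_top (a := (3 : ℕ∞))))
  · simp only [hchart, hl0, hinv]
  · rw [hchart]
    filter_upwards [hnear] with z hz
    exact e.right_inv hz
  · have h2 : ∀ᶠ g in 𝓝 (Γ.u x), g ∈ κ.source ∧ κ g ∈ e.source := by
      have h3 : κ.source ∈ 𝓝 (Γ.u x) := (isOpen_extChartAt_source _).mem_nhds h1
      have h4 : ContinuousAt κ (Γ.u x) :=
        (contMDiffAt_extChartAt_of_mem_source (I := 𝓡 (n + r)) h1).continuousAt
      filter_upwards [h3, h4.eventually (e.open_source.mem_nhds hes)] with g hg hg'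
      exact ⟨hg, hg'⟩
    filter_upwards [h2] with g ⟨hg, hg'⟩
    have h3 : e.symm (Γ.coord c g) = κ g := by
      have h4 := e.left_inv hg'
      have h5 : e (κ g) = Γ.coord c g := congrArg (Γ.coord c) (κ.left_inv hg)
      rwa [h5] at h4
    rw [h3, κ.left_inv hg]

end LieGroupoid

/-! ### The groupoid operations in coordinates -/

namespace LieGroupoid

variable {n r : ℕ} {M G : Type*}
    [TopologicalSpace M] [ChartedSpace (EuSp n) M] [IsManifold (𝓡 n) ∞ M]
    [TopologicalSpace G] [ChartedSpace (EuSp (n + r)) G] [IsManifold (𝓡 (n + r)) ∞ G]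
    {Γ : LieGroupoid n r M G}

namespace UnitChart

variable {c x : M} (U : Γ.UnitChart c x)

/-- The coordinates of the base point of a unit chart. -/
def base (_ : Γ.UnitChart c x) : EuSp n := extChartAt (𝓡 n) c x

theorem base_mem_target : U.base ∈ (extChartAt (𝓡 n) c).target :=
  (extChartAt (𝓡 n) c).map_source U.mem_source

theorem symm_base : (extChartAt (𝓡 n) c).symm U.base = x :=
  (extChartAt (𝓡 n) c).left_inv U.mem_source

/-- The source map in coordinates. -/
def src (z : EuSp n × EuSp r) : EuSp n := extChartAt (𝓡 n) c (Γ.s (U.param z))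

/-- The fibre coordinates of the multiplication. -/
def mult (q : (EuSp n × EuSp r) × EuSp r) : EuSp r :=
  (Γ.coord c (Γ.mul (U.param q.1) (U.param (U.src q.1, q.2)))).2

theorem param_zero_base : U.param (U.base, 0) = Γ.u x := U.param_base

theorem continuousAt_param : ContinuousAt U.param (U.base, 0) := U.contMDiffAt_param.continuousAt

theorem tendsto_param : Filter.Tendsto U.param (𝓝 (U.base, 0)) (𝓝 (Γ.u x)) := by
  have h := U.continuousAt_param
  rwa [ContinuousAt, U.param_zero_base] at h

theorem contDiffAt_src : ContDiffAt ℝ 3 U.src (U.base, 0) := by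
  have h1 : Γ.s (U.param (U.base, 0)) = x := by rw [U.param_zero_base, Γ.s_u]
  refine ContMDiffAt.contDiffAt ?_
  refine ContMDiffAt.comp (I' := 𝓡 n) (g := extChartAt (𝓡 n) c)
    (f := fun z => Γ.s (U.param z)) (U.base, 0) ?_
    (((Γ.contMDiff_s.of_le (WithTop.coe_le_coe.2 (le_top (a := (3 : ℕ∞))))) _).comp (U.base, 0)
      U.contMDiffAt_param)
  rw [h1]
  exact (contMDiffAt_extChartAt_of_mem_source U.mem_source).of_le
    (WithTop.coe_le_coe.2 (le_top (a := (3 : ℕ∞))))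

theorem src_base : U.src (U.base, 0) = U.base := by
  rw [src, U.param_zero_base, Γ.s_u]
  rfl

theorem tendsto_src : Filter.Tendsto U.src (𝓝 (U.base, 0)) (𝓝 U.base) := by
  have h := U.contDiffAt_src.continuousAt
  rwa [ContinuousAt, U.src_base] at h

theorem eventually_t : ∀ᶠ z in 𝓝 (U.base, 0),
    Γ.t (U.param z) = (extChartAt (𝓡 n) c).symm z.1 := by
  have h1 : Filter.Tendsto (fun z => Γ.t (U.param z)) (𝓝 (U.base, 0)) (𝓝 x) := by
    have h := (Γ.contMDiff_t.continuous.tendsto (Γ.u x)).comp U.tendsto_param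
    rwa [Γ.t_u] at h
  filter_upwards [U.coord_param,
    h1.eventually ((isOpen_extChartAt_source c).mem_nhds U.mem_source)] with z hz hz'
  have h2 : extChartAt (𝓡 n) c (Γ.t (U.param z)) = z.1 := congrArg Prod.fst hz
  rw [← h2, (extChartAt (𝓡 n) c).left_inv hz']

theorem eventually_s : ∀ᶠ z in 𝓝 (U.base, 0),
    (extChartAt (𝓡 n) c).symm (U.src z) = Γ.s (U.param z) := by
  have h1 : Filter.Tendsto (fun z => Γ.s (U.param z)) (𝓝 (U.base, 0)) (𝓝 x) := by
    have h := (Γ.contMDiff_s.continuous.tendsto (Γ.u x)).comp U.tendsto_param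
    rwa [Γ.s_u] at h
  filter_upwards [h1.eventually ((isOpen_extChartAt_source c).mem_nhds U.mem_source)] with z hz
  exact (extChartAt (𝓡 n) c).left_inv hz

theorem tendsto_src_prod : Filter.Tendsto (fun q : (EuSp n × EuSp r) × EuSp r => (U.src q.1, q.2))
    (𝓝 ((U.base, 0), 0)) (𝓝 (U.base, 0)) := by
  rw [nhds_prod_eq (x := U.base)]
  refine Filter.Tendsto.prodMk (U.tendsto_src.comp ?_) ?_
  · exact (continuous_fst.tendsto ((U.base, (0 : EuSp r)), (0 : EuSp r)))
  · exact (continuous_snd.tendsto ((U.base, (0 : EuSp r)), (0 : EuSp r)))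

theorem tendsto_fst : Filter.Tendsto (fun q : (EuSp n × EuSp r) × EuSp r => q.1)
    (𝓝 ((U.base, 0), 0)) (𝓝 (U.base, 0)) :=
  continuous_fst.tendsto ((U.base, (0 : EuSp r)), (0 : EuSp r))

theorem eventually_composable : ∀ᶠ q in 𝓝 ((U.base, (0 : EuSp r)), (0 : EuSp r)),
    Γ.s (U.param q.1) = Γ.t (U.param (U.src q.1, q.2)) := by
  filter_upwards [U.tendsto_fst.eventually U.eventually_s,
    U.tendsto_src_prod.eventually U.eventually_t] with q h1 h2
  rw [h2, h1]

theorem contMDiffAt_mul_param : ContMDiffAt 𝓘(ℝ, (EuSp n × EuSp r) × EuSp r) (𝓡 (n + r)) 3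
    (fun q : (EuSp n × EuSp r) × EuSp r => Γ.mul (U.param q.1) (U.param (U.src q.1, q.2)))
    ((U.base, 0), 0) := by
  refine Γ.contMDiffAt_mul (k := 3) ?_ ?_ U.eventually_composable
  · exact ContMDiffAt.comp (I' := 𝓘(ℝ, EuSp n × EuSp r)) ((U.base, 0), 0) (g := U.param)
      (f := fun q : (EuSp n × EuSp r) × EuSp r => q.1) U.contMDiffAt_param
      contDiffAt_fst.contMDiffAt
  · refine ContMDiffAt.comp (I' := 𝓘(ℝ, EuSp n × EuSp r)) ((U.base, 0), 0) (g := U.param)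
      (f := fun q : (EuSp n × EuSp r) × EuSp r => (U.src q.1, q.2)) ?_ ?_
    · simp only [U.src_base]
      exact U.contMDiffAt_param
    · exact ((ContDiffAt.comp ((U.base, 0), 0) (g := U.src)
        (f := fun q : (EuSp n × EuSp r) × EuSp r => q.1) U.contDiffAt_src contDiffAt_fst).prodMk
        contDiffAt_snd).contMDiffAt

theorem mul_param_base : Γ.mul (U.param (U.base, 0)) (U.param (U.src (U.base, 0), 0)) = Γ.u x := by
  have h := Γ.u_mul (Γ.u x)
  rw [Γ.t_u] at h
  rw [U.src_base, U.param_zero_base, h]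

theorem contMDiffAt_coord_u (U : Γ.UnitChart c x) : ContMDiffAt (𝓡 (n + r)) 𝓘(ℝ, EuSp n × EuSp r) ∞ (Γ.coord c)
    (Γ.u x) :=
  have h1 := Γ.u_mem_source U.mem_base
  Γ.contMDiffAt_coord (by rw [Γ.t_u]; exact U.mem_source) h1 (by rwa [Γ.t_u])

theorem contDiffAt_mult : ContDiffAt ℝ 3 U.mult ((U.base, 0), 0) := by
  have h1 : ContMDiffAt 𝓘(ℝ, (EuSp n × EuSp r) × EuSp r) 𝓘(ℝ, EuSp n × EuSp r) 3
      (fun q : (EuSp n × EuSp r) × EuSp r =>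
        Γ.coord c (Γ.mul (U.param q.1) (U.param (U.src q.1, q.2)))) ((U.base, 0), 0) := by
    refine ContMDiffAt.comp (I' := 𝓡 (n + r)) ((U.base, 0), 0) (g := Γ.coord c) ?_
      U.contMDiffAt_mul_param
    rw [U.mul_param_base]
    exact U.contMDiffAt_coord_u.of_le (WithTop.coe_le_coe.2 (le_top (a := (3 : ℕ∞))))
  exact contDiffAt_snd.comp _ h1.contDiffAt

/-- A product has the target of its first factor, hence the same base coordinate; its fibre
coordinate is `mult`. Applying the parametrisation recovers the product near the unit. -/
theorem eventually_mul : ∀ᶠ q in 𝓝 ((U.base, (0 : EuSp r)), (0 : EuSp r)),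
    U.param (q.1.1, U.mult q) = Γ.mul (U.param q.1) (U.param (U.src q.1, q.2)) := by
  have h1 := U.contMDiffAt_mul_param.continuousAt
  rw [ContinuousAt, U.mul_param_base] at h1
  filter_upwards [U.eventually_composable, h1.eventually U.param_coord,
    U.tendsto_fst.eventually U.coord_param] with q h2 h3 h4
  have h5 : Γ.coord c (Γ.mul (U.param q.1) (U.param (U.src q.1, q.2))) = (q.1.1, U.mult q) := by
    refine Prod.ext ?_ rfl
    simp only [coord]
    rw [Γ.t_mul _ _ h2]
    exact congrArg Prod.fst h4
  rw [h5] at h3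
  exact h3

theorem eventually_param_zero : ∀ᶠ y in 𝓝 U.base,
    U.param (y, 0) = Γ.u ((extChartAt (𝓡 n) c).symm y) := by
  have h1 : Filter.Tendsto (fun y => Γ.u ((extChartAt (𝓡 n) c).symm y)) (𝓝 U.base)
      (𝓝 (Γ.u x)) := by
    have h2 := (contMDiffAt_extChartAt_symm_of_mem_target (I := 𝓡 n) U.base_mem_target).continuousAt
    rw [ContinuousAt, U.symm_base] at h2
    exact (Γ.contMDiff_u.continuous.tendsto x).comp h2
  filter_upwards [h1.eventually U.param_coord,
    (isOpen_extChartAt_target c).mem_nhds U.base_mem_target] with y hy hy'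
  rw [Γ.coord_u ((extChartAt (𝓡 n) c).map_target hy'), (extChartAt (𝓡 n) c).right_inv hy'] at hy
  exact hy

theorem eventually_src_zero : ∀ᶠ y in 𝓝 U.base, U.src (y, 0) = y := by
  filter_upwards [U.eventually_param_zero,
    (isOpen_extChartAt_target c).mem_nhds U.base_mem_target] with y hy hy'
  rw [src, hy, Γ.s_u, (extChartAt (𝓡 n) c).right_inv hy']

/-- Points with zero fibre coordinate are units, so this is the right unit law; the next unit law
comes from the left one in the same way. -/
theorem eventually_mult_right_zero : ∀ᶠ z in 𝓝 (U.base, (0 : EuSp r)), U.mult (z, 0) = z.2 := by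
  filter_upwards [U.tendsto_src.eventually U.eventually_param_zero, U.eventually_s,
    U.coord_param] with z h1 h2 h3
  rw [mult]
  simp only
  rw [h1, h2, Γ.mul_u, h3]

theorem tendsto_fst' : Filter.Tendsto (fun z : EuSp n × EuSp r => z.1) (𝓝 (U.base, 0))
    (𝓝 U.base) := continuous_fst.tendsto (U.base, (0 : EuSp r))

theorem eventually_mult_left_zero : ∀ᶠ z in 𝓝 (U.base, (0 : EuSp r)),
    U.mult ((z.1, 0), z.2) = z.2 := by
  filter_upwards [U.tendsto_fst'.eventually U.eventually_param_zero,
    U.tendsto_fst'.eventually U.eventually_src_zero, U.eventually_t, U.coord_param] with z h1 h2 h3 h4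
  rw [mult]
  simp only
  rw [h1, h2, ← h3, Γ.u_mul, h4]

/-- This is `s (gh) = s h`. Its derivatives in the two factors give the identities that relate
anchors to adjoint jets. -/
theorem eventually_src_mult : ∀ᶠ q in 𝓝 ((U.base, (0 : EuSp r)), (0 : EuSp r)),
    U.src (q.1.1, U.mult q) = U.src (U.src q.1, q.2) := by
  filter_upwards [U.eventually_mul, U.eventually_composable] with q h1 h2
  rw [src, h1, Γ.s_mul _ _ h2]
  rfl

end UnitChart

end LieGroupoid

/-! ### First derivatives of the operations -/

namespace LieGroupoid

variable {n r : ℕ} {M G : Type*}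
    [TopologicalSpace M] [ChartedSpace (EuSp n) M] [IsManifold (𝓡 n) ∞ M]
    [TopologicalSpace G] [ChartedSpace (EuSp (n + r)) G] [IsManifold (𝓡 (n + r)) ∞ G]
    {Γ : LieGroupoid n r M G}

namespace UnitChart

variable {c x : M} (U : Γ.UnitChart c x)

/-- The derivative of the parametrisation. -/
def dparam (z : EuSp n × EuSp r) : EuSp n × EuSp r →L[ℝ] EuSp (n + r) :=
  mfderiv 𝓘(ℝ, EuSp n × EuSp r) (𝓡 (n + r)) U.param z

theorem eventually_mdifferentiableAt : ∀ᶠ z in 𝓝 (U.base, (0 : EuSp r)),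
    MDifferentiableAt 𝓘(ℝ, EuSp n × EuSp r) (𝓡 (n + r)) U.param z := by
  filter_upwards [(contMDiffAt_iff_contMDiffAt_nhds (n := 3) (by simp)).1
    U.contMDiffAt_param] with z hz
  exact hz.mdifferentiableAt (by simp)

theorem mfderiv_param_comp {V : Type} [NormedAddCommGroup V] [NormedSpace ℝ V]
    {h : V → EuSp n × EuSp r} {q : V} {z : EuSp n × EuSp r} (hz : h q = z)
    (hp : MDifferentiableAt 𝓘(ℝ, EuSp n × EuSp r) (𝓡 (n + r)) U.param z)
    (hh : DifferentiableAt ℝ h q) :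
    MDifferentiableAt 𝓘(ℝ, V) (𝓡 (n + r)) (fun q => U.param (h q)) q ∧
    ∀ v : V, (mfderiv 𝓘(ℝ, V) (𝓡 (n + r)) (fun q => U.param (h q)) q v : EuSp (n + r)) =
      U.dparam z (fderiv ℝ h q v) := by
  subst hz
  refine ⟨hp.comp q hh.mdifferentiableAt, fun v => ?_⟩
  have h1 := mfderiv_comp q hp hh.mdifferentiableAt
  rw [mfderiv_eq_fderiv] at h1
  exact congrArg (fun L : V →L[ℝ] EuSp (n + r) => L v) h1

theorem eventually_fderiv_src : ∀ᶠ z in 𝓝 (U.base, (0 : EuSp r)), ∀ v,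
    fderiv ℝ U.src z v = (mfderiv (𝓡 n) 𝓘(ℝ, EuSp n) (extChartAt (𝓡 n) c) (Γ.s (U.param z))
      (mfderiv (𝓡 (n + r)) (𝓡 n) Γ.s (U.param z) (U.dparam z v)) : EuSp n) := by
  have h1 : Filter.Tendsto (fun z => Γ.s (U.param z)) (𝓝 (U.base, 0)) (𝓝 x) := by
    have h := (Γ.contMDiff_s.continuous.tendsto (Γ.u x)).comp U.tendsto_param
    rwa [Γ.s_u] at h
  filter_upwards [U.eventually_mdifferentiableAt,
    h1.eventually ((isOpen_extChartAt_source c).mem_nhds U.mem_source)] with z hz hz' v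
  have h2 := ((contMDiffAt_extChartAt_of_mem_source hz').mdifferentiableAt (by simp)).hasMFDerivAt
  have h3 := ((Γ.contMDiff_s (U.param z)).mdifferentiableAt (by simp)).hasMFDerivAt
  have h4 : HasMFDerivAt 𝓘(ℝ, EuSp n × EuSp r) 𝓘(ℝ, EuSp n) U.src z _ :=
    HasMFDerivAt.comp (f := fun z => Γ.s (U.param z)) z h2
      (HasMFDerivAt.comp (f := U.param) z h3 hz.hasMFDerivAt)
  have h5 := h4.mfderiv
  rw [mfderiv_eq_fderiv] at h5
  exact congrArg (fun L : EuSp n × EuSp r →L[ℝ] EuSp n => L v) h5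

theorem eventually_mfderiv_t : ∀ᶠ z in 𝓝 (U.base, (0 : EuSp r)), ∀ v,
    (mfderiv (𝓡 n) 𝓘(ℝ, EuSp n) (extChartAt (𝓡 n) c) (Γ.t (U.param z))
      (mfderiv (𝓡 (n + r)) (𝓡 n) Γ.t (U.param z) (U.dparam z v)) : EuSp n) = v.1 := by
  have h1 : Filter.Tendsto (fun z => Γ.t (U.param z)) (𝓝 (U.base, 0)) (𝓝 x) := by
    have h := (Γ.contMDiff_t.continuous.tendsto (Γ.u x)).comp U.tendsto_param
    rwa [Γ.t_u] at h
  filter_upwards [U.eventually_mdifferentiableAt, U.coord_param.eventually_nhds,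
    h1.eventually ((isOpen_extChartAt_source c).mem_nhds U.mem_source)] with z hz hc hz' v
  have h2 := ((contMDiffAt_extChartAt_of_mem_source hz').mdifferentiableAt (by simp)).hasMFDerivAt
  have h3 := ((Γ.contMDiff_t (U.param z)).mdifferentiableAt (by simp)).hasMFDerivAt
  have h4 : HasMFDerivAt 𝓘(ℝ, EuSp n × EuSp r) 𝓘(ℝ, EuSp n)
      (fun z => extChartAt (𝓡 n) c (Γ.t (U.param z))) z _ :=
    HasMFDerivAt.comp (f := fun z => Γ.t (U.param z)) z h2
      (HasMFDerivAt.comp (f := U.param) z h3 hz.hasMFDerivAt)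
  have h5 := h4.mfderiv
  have h6 : (fun z => extChartAt (𝓡 n) c (Γ.t (U.param z))) =ᶠ[𝓝 z] Prod.fst := by
    filter_upwards [hc] with z' hz'
    exact congrArg Prod.fst hz'
  rw [h6.mfderiv_eq, mfderiv_eq_fderiv, fderiv_fst] at h5
  exact congrArg (fun L : EuSp n × EuSp r →L[ℝ] EuSp n => L v) h5.symm

theorem eventually_mfderiv_coord : ∀ᶠ z in 𝓝 (U.base, (0 : EuSp r)), ∀ v,
    (mfderiv (𝓡 (n + r)) 𝓘(ℝ, EuSp n × EuSp r) (Γ.coord c) (U.param z) (U.dparam z v) :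
      EuSp n × EuSp r) = v := by
  have h1 : ∀ᶠ g in 𝓝 (Γ.u x),
      ContMDiffAt (𝓡 (n + r)) 𝓘(ℝ, EuSp n × EuSp r) 1 (Γ.coord c) g :=
    (contMDiffAt_iff_contMDiffAt_nhds (n := 1) (by simp)).1 (U.contMDiffAt_coord_u.of_le (by simp))
  filter_upwards [U.eventually_mdifferentiableAt, U.coord_param.eventually_nhds,
    U.tendsto_param.eventually h1] with z hz hc hz' v
  have h4 : HasMFDerivAt 𝓘(ℝ, EuSp n × EuSp r) 𝓘(ℝ, EuSp n × EuSp r)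
      (fun z => Γ.coord c (U.param z)) z _ :=
    HasMFDerivAt.comp (f := U.param) z (hz'.mdifferentiableAt (by simp)).hasMFDerivAt
      hz.hasMFDerivAt
  have h5 := h4.mfderiv
  have h6 : (fun z => Γ.coord c (U.param z)) =ᶠ[𝓝 z] id := hc
  rw [h6.mfderiv_eq, mfderiv_eq_fderiv, fderiv_id] at h5
  exact congrArg (fun L : EuSp n × EuSp r →L[ℝ] EuSp n × EuSp r => L v) h5.symm

/-- A member of the local frame of the Lie algebroid, as a tangent vector of `G`. -/
def frameVec (_ : Γ.UnitChart c x) (p : M) (w : EuSp r) : EuSp (n + r) :=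
  Γ.incl p (Γ.locInv c p w)

theorem eventually_symm : ∀ᶠ y in 𝓝 U.base, y ∈ (extChartAt (𝓡 n) c).target ∧
    (extChartAt (𝓡 n) c).symm y ∈ Γ.base c := by
  have h2 := (contMDiffAt_extChartAt_symm_of_mem_target (I := 𝓡 n) U.base_mem_target).continuousAt
  rw [ContinuousAt, U.symm_base] at h2
  filter_upwards [(isOpen_extChartAt_target c).mem_nhds U.base_mem_target,
    h2.eventually ((Γ.isOpen_base c).mem_nhds U.mem_base)] with y h3 h4
  exact ⟨h3, h4⟩

theorem tendsto_zero : Filter.Tendsto (fun y : EuSp n => (y, (0 : EuSp r))) (𝓝 U.base)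
    (𝓝 (U.base, 0)) :=
  (continuous_id.prodMk continuous_const).tendsto U.base

/-- Both sides have the same image under the differential of the coordinates, which is injective at
units. -/
theorem eventually_dparam_zero : ∀ᶠ y in 𝓝 U.base, ∀ w,
    U.dparam (y, 0) (0, w) = U.frameVec ((extChartAt (𝓡 n) c).symm y) w := by
  filter_upwards [U.eventually_symm, U.eventually_param_zero,
    U.tendsto_zero.eventually U.eventually_mfderiv_coord] with y ⟨h1, h2⟩ h3 h4 w
  have h5 := h4 (0, w)
  have h6 := Γ.mfderiv_coord_incl h2 ((extChartAt (𝓡 n) c).map_target h1)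
    (Γ.locInv c _ w)
  rw [Γ.locTriv_locInv c _ h2] at h6
  have h7 : ∀ g, g = Γ.u ((extChartAt (𝓡 n) c).symm y) → ∀ X : EuSp (n + r),
      (mfderiv (𝓡 (n + r)) 𝓘(ℝ, EuSp n × EuSp r) (Γ.coord c) g X : EuSp n × EuSp r) = (0, w) →
      X = Γ.incl _ (Γ.locInv c ((extChartAt (𝓡 n) c).symm y) w) := by
    rintro _ rfl X hX
    refine (sub_eq_zero (a := (X : EuSp (n + r)))).1 ?_
    refine Γ.mfderiv_coord_injective h2 ((extChartAt (𝓡 n) c).map_target h1) _ ?_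
    refine (map_sub (mfderiv (𝓡 (n + r)) 𝓘(ℝ, EuSp n × EuSp r) (Γ.coord c)
      (Γ.u ((extChartAt (𝓡 n) c).symm y))) X _).trans ?_
    exact sub_eq_zero.2 (hX.trans h6.symm)
  exact h7 _ h3 _ h5

theorem differentiableAt_pair {V W : Type*} [NormedAddCommGroup V] [NormedSpace ℝ V]
    [NormedAddCommGroup W] [NormedSpace ℝ W] (a : V) (b : W) :
    HasFDerivAt (fun w : W => (a, w)) (ContinuousLinearMap.inr ℝ V W) b :=
  (hasFDerivAt_const a b).prodMk (hasFDerivAt_id b)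

theorem tendsto_pair_zero : Filter.Tendsto (fun z : EuSp n × EuSp r => (z, (0 : EuSp r)))
    (𝓝 (U.base, 0)) (𝓝 ((U.base, 0), 0)) :=
  (continuous_id.prodMk continuous_const).tendsto (U.base, (0 : EuSp r))

theorem tendsto_zero_pair : Filter.Tendsto
    (fun z : EuSp n × EuSp r => ((z.1, (0 : EuSp r)), z.2)) (𝓝 (U.base, 0))
    (𝓝 ((U.base, 0), 0)) :=
  ((continuous_fst.prodMk continuous_const).prodMk continuous_snd).tendsto (U.base, (0 : EuSp r))

theorem tendsto_src_zero : Filter.Tendsto (fun z : EuSp n × EuSp r => (U.src z, (0 : EuSp r)))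
    (𝓝 (U.base, 0)) (𝓝 (U.base, 0)) :=
  U.tendsto_zero.comp U.tendsto_src

theorem tendsto_fst_zero : Filter.Tendsto (fun z : EuSp n × EuSp r => (z.1, (0 : EuSp r)))
    (𝓝 (U.base, 0)) (𝓝 (U.base, 0)) :=
  U.tendsto_zero.comp U.tendsto_fst'

theorem eventually_differentiableAt_mult : ∀ᶠ q in 𝓝 ((U.base, (0 : EuSp r)), (0 : EuSp r)),
    DifferentiableAt ℝ U.mult q := by
  filter_upwards [U.contDiffAt_mult.eventually (by simp)] with q hq
  exact hq.differentiableAt (by simp)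

theorem eventually_differentiableAt_src : ∀ᶠ q in 𝓝 (U.base, (0 : EuSp r)),
    DifferentiableAt ℝ U.src q := by
  filter_upwards [U.contDiffAt_src.eventually (by simp)] with q hq
  exact hq.differentiableAt (by simp)

/-- Left invariant vector fields in coordinates. -/
theorem eventually_leftTranslate : ∀ᶠ z in 𝓝 (U.base, (0 : EuSp r)), ∀ w,
    (Γ.leftTranslate (U.param z) (Γ.locInv c (Γ.s (U.param z)) w) : EuSp (n + r)) =
      U.dparam z (0, fderiv ℝ U.mult (z, 0) (0, w)) := by
  filter_upwards [U.eventually_mdifferentiableAt, U.eventually_s,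
    U.tendsto_src.eventually U.eventually_param_zero,
    U.tendsto_src.eventually U.eventually_dparam_zero,
    U.tendsto_src_zero.eventually U.eventually_mdifferentiableAt,
    U.tendsto_pair_zero.eventually U.eventually_composable.eventually_nhds,
    U.tendsto_pair_zero.eventually U.eventually_mul.eventually_nhds,
    U.tendsto_pair_zero.eventually U.eventually_differentiableAt_mult,
    U.eventually_mult_right_zero] with z h1 h2 h3 h4 h5 h6 h7 h8 h9 w
  have hcont : Filter.Tendsto (fun w : EuSp r => (z, w)) (𝓝 0) (𝓝 (z, 0)) :=
    (continuous_const.prodMk continuous_id).tendsto 0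
  have hδ := U.mfderiv_param_comp (h := fun w : EuSp r => (U.src z, w)) (q := 0) rfl h5
    (differentiableAt_pair _ _).differentiableAt
  -- The family `w ↦ param z · param (src z, w)` is differentiated at zero twice: by the derivative
  -- of the multiplication, and through its coordinate expression `mult`.
  have hm := Γ.mfderiv_mul (I := 𝓘(ℝ, EuSp r)) (γ := fun _ : EuSp r => U.param z)
    (δ := fun w => U.param (U.src z, w)) (q := 0) mdifferentiableAt_const hδ.1
    (hcont.eventually h6) w
  have hp : HasFDerivAt (fun w : EuSp r => (z.1, U.mult (z, w))) _ 0 :=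
    (hasFDerivAt_const z.1 (0 : EuSp r)).prodMk
      (h8.hasFDerivAt.comp (0 : EuSp r) (differentiableAt_pair z 0))
  have hμ := U.mfderiv_param_comp (h := fun w : EuSp r => (z.1, U.mult (z, w))) (q := 0)
    (z := z) (Prod.ext rfl h9) h1 hp.differentiableAt
  have heq : (fun w : EuSp r => Γ.mul (U.param z) (U.param (U.src z, w))) =ᶠ[𝓝 0]
      fun w => U.param (z.1, U.mult (z, w)) := by
    filter_upwards [hcont.eventually h7] with w hw
    exact hw.symm
  rw [heq.mfderiv_eq] at hm
  have hm2 := (hμ.2 w).symm.trans hm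
  rw [hp.fderiv] at hm2
  refine Eq.trans ?_ hm2.symm
  rw [leftTranslate_coe]
  have hfin : ∀ h, h = Γ.u (Γ.s (U.param z)) → ∀ X : EuSp (n + r), X = 0 → ∀ Y : EuSp (n + r),
      Y = U.frameVec (Γ.s (U.param z)) w →
      (Γ.tangentMul (U.param z) (Γ.u (Γ.s (U.param z))) 0 (Γ.incl _
        (Γ.locInv c (Γ.s (U.param z)) w)) : EuSp (n + r)) =
      Γ.tangentMul (U.param z) h X Y := by
    rintro _ rfl _ rfl _ rfl
    rfl
  refine hfin _ (by rw [h3, h2]) _ ?_ _ ?_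
  · rw [mfderiv_const]
    rfl
  · rw [hδ.2, (differentiableAt_pair _ _).fderiv, ← h2]
    exact h4 w

/-- Multiplication from the left by the derivative of a bisection, in coordinates. -/
theorem eventually_tangentMul : ∀ᶠ z in 𝓝 (U.base, (0 : EuSp r)), ∀ a,
    (Γ.tangentMul (Γ.u (Γ.t (U.param z))) (U.param z) (U.frameVec (Γ.t (U.param z)) a)
      (U.dparam z (fderiv ℝ U.src (z.1, 0) (0, a), 0)) : EuSp (n + r)) =
      U.dparam z (0, fderiv ℝ U.mult ((z.1, 0), z.2) ((0, a), 0)) := by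
  filter_upwards [U.eventually_mdifferentiableAt, U.eventually_t,
    U.tendsto_fst'.eventually U.eventually_param_zero,
    U.tendsto_fst'.eventually U.eventually_dparam_zero,
    U.tendsto_fst_zero.eventually U.eventually_mdifferentiableAt,
    U.tendsto_zero_pair.eventually U.eventually_composable.eventually_nhds,
    U.tendsto_zero_pair.eventually U.eventually_mul.eventually_nhds,
    U.tendsto_zero_pair.eventually U.eventually_differentiableAt_mult,
    U.eventually_mult_left_zero, U.tendsto_fst'.eventually U.eventually_src_zero,
    U.tendsto_fst_zero.eventually U.eventually_differentiableAt_src]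
    with z h1 h2 h3 h4 h5 h6 h7 h8 h9 h10 h11 a
  have hcont : Filter.Tendsto (fun v : EuSp r => ((z.1, v), z.2)) (𝓝 0) (𝓝 ((z.1, 0), z.2)) :=
    ((continuous_const.prodMk continuous_id).prodMk continuous_const).tendsto 0
  have hγ := U.mfderiv_param_comp (h := fun v : EuSp r => (z.1, v)) (q := 0) rfl h5
    (differentiableAt_pair _ _).differentiableAt
  -- When the first factor leaves the unit, the base coordinate of the second has to follow its
  -- source to keep the pair composable; the fibre coordinate stays fixed. This is the motion along
  -- the bisection parallel to the base.
  have hd : HasFDerivAt (fun v : EuSp r => (U.src (z.1, v), z.2)) _ 0 :=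
    (h11.hasFDerivAt.comp (0 : EuSp r) (differentiableAt_pair z.1 0)).prodMk
      (hasFDerivAt_const z.2 (0 : EuSp r))
  have hδ := U.mfderiv_param_comp (h := fun v : EuSp r => (U.src (z.1, v), z.2)) (q := 0) (z := z)
    (Prod.ext h10 rfl) h1 hd.differentiableAt
  have hm := Γ.mfderiv_mul (I := 𝓘(ℝ, EuSp r)) (γ := fun v : EuSp r => U.param (z.1, v))
    (δ := fun v => U.param (U.src (z.1, v), z.2)) (q := 0) hγ.1 hδ.1 (hcont.eventually h6) a
  have hp : HasFDerivAt (fun v : EuSp r => (z.1, U.mult ((z.1, v), z.2))) _ 0 :=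
    (hasFDerivAt_const z.1 (0 : EuSp r)).prodMk
      (HasFDerivAt.comp (g := U.mult) (f := fun v : EuSp r => ((z.1, v), z.2)) (0 : EuSp r)
        h8.hasFDerivAt ((differentiableAt_pair z.1 (0 : EuSp r)).prodMk
        (hasFDerivAt_const z.2 (0 : EuSp r))))
  have hμ := U.mfderiv_param_comp (h := fun v : EuSp r => (z.1, U.mult ((z.1, v), z.2))) (q := 0)
    (z := z) (Prod.ext rfl h9) h1 hp.differentiableAt
  have heq : (fun v : EuSp r => Γ.mul (U.param (z.1, v)) (U.param (U.src (z.1, v), z.2))) =ᶠ[𝓝 0]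
      fun v => U.param (z.1, U.mult ((z.1, v), z.2)) := by
    filter_upwards [hcont.eventually h7] with w hw
    exact hw.symm
  rw [heq.mfderiv_eq] at hm
  have hm2 := (hμ.2 a).symm.trans hm
  rw [hp.fderiv] at hm2
  refine Eq.trans ?_ hm2.symm
  have hfin : ∀ g, g = Γ.u (Γ.t (U.param z)) → ∀ h, h = U.param z → ∀ X Y X' Y' : EuSp (n + r),
      X = X' → Y = Y' → (Γ.tangentMul (Γ.u (Γ.t (U.param z))) (U.param z) X' Y' : EuSp (n + r)) =
      Γ.tangentMul g h X Y := by
    rintro _ rfl _ rfl _ _ _ _ rfl rfl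
    rfl
  refine hfin _ (by rw [h3, h2]) _ (by rw [h10]) _ _ _ _ ?_ ?_
  · rw [hγ.2, (differentiableAt_pair _ _).fderiv, h2]
    exact h4 a
  · rw [hδ.2, hd.fderiv]
    rfl

end UnitChart

end LieGroupoid

/-! ### Derivatives of determinants, and adjoint jets in coordinates -/

/-- The derivative of the determinant at the identity is the trace. -/
theorem hasFDerivAt_linearMap_det {V E ι : Type*} [NormedAddCommGroup V] [NormedSpace ℝ V]
    [NormedAddCommGroup E] [NormedSpace ℝ E] [FiniteDimensional ℝ E] [Fintype ι] (b : Basis ι ℝ E)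
    {L : V → E →L[ℝ] E} {L' : V →L[ℝ] E →L[ℝ] E} {q : V} (hL : HasFDerivAt L L' q)
    (h1 : L q = ContinuousLinearMap.id ℝ E) :
    ∃ T : V →L[ℝ] ℝ, HasFDerivAt (fun z => LinearMap.det (L z).toLinearMap) T q ∧
      ∀ v, T v = ∑ i, b.repr (L' v (b i)) i := by
  classical
  have hcont : Continuous fun v : ι → E => b.det v := by
    simp only [Basis.det_apply]
    refine Continuous.matrix_det (continuous_matrix fun i j => ?_)
    exact (LinearMap.continuous_of_finiteDimensional (b.coord i)).comp (continuous_apply j)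
  let f : ContinuousMultilinearMap ℝ (fun _ : ι => E) ℝ := ⟨b.det.toMultilinearMap, hcont⟩
  have hg : ∀ i, HasFDerivAt (fun z => L z (b i))
      ((ContinuousLinearMap.apply ℝ E (b i)).comp L') q := fun i =>
    (ContinuousLinearMap.apply ℝ E (b i)).hasFDerivAt.comp q hL
  have h2 := HasFDerivAt.multilinear_comp f hg
  have h3 : (fun z => LinearMap.det (L z).toLinearMap) = fun z => f fun i => L z (b i) := by
    funext z
    have := b.det_comp (L z).toLinearMap b
    rw [b.det_self, mul_one] at this
    exact this.symm
  refine ⟨_, h3 ▸ h2, fun v => ?_⟩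
  rw [sum_apply]
  refine Finset.sum_congr rfl fun i _ => ?_
  -- At `q` the operator is the identity, so one column of the identity matrix is replaced by a
  -- vector. By Cramer's rule the determinant is the corresponding coordinate, and these coordinates
  -- add up to the trace.
  change b.det (Function.update (fun j => L q (b j)) i (L' v (b i))) = _
  rw [h1]
  change b.det (Function.update b i (L' v (b i))) = _
  rw [Basis.det_apply, Basis.toMatrix_update, ← Matrix.cramer_apply, b.toMatrix_self,
    Matrix.cramer_one]
  rfl

namespace LieGroupoid

variable {n r : ℕ} {M G : Type*}
    [TopologicalSpace M] [ChartedSpace (EuSp n) M] [IsManifold (𝓡 n) ∞ M]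
    [TopologicalSpace G] [ChartedSpace (EuSp (n + r)) G] [IsManifold (𝓡 (n + r)) ∞ G]
    {Γ : LieGroupoid n r M G}

variable (Γ) in
/-- The local trivialisation of the Lie algebroid at a point, as a linear equivalence. -/
def frameEquiv {c p : M} (hp : p ∈ Γ.base c) : Γ.Alg p ≃ₗ[ℝ] EuSp r :=
  { (Γ.locTriv c p).toLinearMap with
    invFun := Γ.locInv c p
    left_inv := fun v => Γ.locInv_locTriv c p hp v
    right_inv := fun w => Γ.locTriv_locInv c p hp w }

namespace UnitChart

variable {c x : M} (U : Γ.UnitChart c x)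

/-- The derivative of `src ∘ mult = src ∘ src` in the second factor: a left invariant field has the
same image under `ds` as its value at the source unit. -/
theorem eventually_src_right : ∀ᶠ z in 𝓝 (U.base, (0 : EuSp r)), ∀ w,
    fderiv ℝ U.src z (0, fderiv ℝ U.mult (z, 0) (0, w)) = fderiv ℝ U.src (U.src z, 0) (0, w) := by
  filter_upwards [U.tendsto_pair_zero.eventually U.eventually_src_mult.eventually_nhds,
    U.tendsto_pair_zero.eventually U.eventually_differentiableAt_mult,
    U.eventually_differentiableAt_src,
    U.tendsto_src_zero.eventually U.eventually_differentiableAt_src,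
    U.eventually_mult_right_zero] with z h1 h2 h3 h4 h5 w
  have hcont : Filter.Tendsto (fun w : EuSp r => (z, w)) (𝓝 0) (𝓝 (z, 0)) :=
    (continuous_const.prodMk continuous_id).tendsto 0
  have hz : (z.1, U.mult (z, 0)) = z := Prod.ext rfl h5
  have ha : HasFDerivAt (fun w : EuSp r => U.src (z.1, U.mult (z, w))) _ 0 :=
    HasFDerivAt.comp (g := U.src) (f := fun w : EuSp r => (z.1, U.mult (z, w))) (0 : EuSp r)
      (by rw [hz]; exact h3.hasFDerivAt) ((hasFDerivAt_const z.1 (0 : EuSp r)).prodMk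
        (HasFDerivAt.comp (g := U.mult) (0 : EuSp r) h2.hasFDerivAt (differentiableAt_pair z 0)))
  have hb : HasFDerivAt (fun w : EuSp r => U.src (U.src z, w)) _ 0 :=
    HasFDerivAt.comp (g := U.src) (0 : EuSp r) h4.hasFDerivAt (differentiableAt_pair (U.src z) 0)
  have heq : (fun w : EuSp r => U.src (z.1, U.mult (z, w))) =ᶠ[𝓝 0]
      fun w => U.src (U.src z, w) := hcont.eventually h1
  exact congrArg (fun L : EuSp r →L[ℝ] EuSp n => L w)
    (ha.unique (hb.congr_of_eventuallyEq heq))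

theorem eventually_src_left : ∀ᶠ z in 𝓝 (U.base, (0 : EuSp r)), ∀ a,
    fderiv ℝ U.src z (0, fderiv ℝ U.mult ((z.1, 0), z.2) ((0, a), 0)) =
      fderiv ℝ U.src z (fderiv ℝ U.src (z.1, 0) (0, a), 0) := by
  filter_upwards [U.tendsto_zero_pair.eventually U.eventually_src_mult.eventually_nhds,
    U.tendsto_zero_pair.eventually U.eventually_differentiableAt_mult,
    U.eventually_differentiableAt_src,
    U.tendsto_fst_zero.eventually U.eventually_differentiableAt_src,
    U.eventually_mult_left_zero, U.tendsto_fst'.eventually U.eventually_src_zero]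
    with z h1 h2 h3 h4 h5 h6 a
  have hcont : Filter.Tendsto (fun v : EuSp r => ((z.1, v), z.2)) (𝓝 0) (𝓝 ((z.1, 0), z.2)) :=
    ((continuous_const.prodMk continuous_id).prodMk continuous_const).tendsto 0
  have hz : (z.1, U.mult ((z.1, 0), z.2)) = z := Prod.ext rfl h5
  have hz' : (U.src (z.1, 0), z.2) = z := Prod.ext h6 rfl
  have ha : HasFDerivAt (fun v : EuSp r => U.src (z.1, U.mult ((z.1, v), z.2))) _ 0 :=
    HasFDerivAt.comp (g := U.src) (f := fun v : EuSp r => (z.1, U.mult ((z.1, v), z.2)))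
      (0 : EuSp r) (by rw [hz]; exact h3.hasFDerivAt)
      ((hasFDerivAt_const z.1 (0 : EuSp r)).prodMk
        (HasFDerivAt.comp (g := U.mult) (f := fun v : EuSp r => ((z.1, v), z.2)) (0 : EuSp r)
          h2.hasFDerivAt ((differentiableAt_pair z.1 (0 : EuSp r)).prodMk
            (hasFDerivAt_const z.2 (0 : EuSp r)))))
  have hb : HasFDerivAt (fun v : EuSp r => U.src (U.src (z.1, v), z.2)) _ 0 :=
    HasFDerivAt.comp (g := U.src) (f := fun v : EuSp r => (U.src (z.1, v), z.2)) (0 : EuSp r)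
      (by rw [hz']; exact h3.hasFDerivAt)
      ((HasFDerivAt.comp (g := U.src) (0 : EuSp r) h4.hasFDerivAt
        (differentiableAt_pair z.1 0)).prodMk (hasFDerivAt_const z.2 (0 : EuSp r)))
  have heq : (fun v : EuSp r => U.src (z.1, U.mult ((z.1, v), z.2))) =ᶠ[𝓝 0]
      fun v => U.src (U.src (z.1, v), z.2) := hcont.eventually h1
  exact congrArg (fun L : EuSp r →L[ℝ] EuSp n => L a)
    (ha.unique (hb.congr_of_eventuallyEq heq))

/-- The anchor of the frame, in coordinates. -/
def anchorVec (y : EuSp n) (w : EuSp r) : EuSp n := fderiv ℝ U.src (y, 0) (0, w)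

/-- At the units the vectors `(0, w)` represent the frame of `𝔤`, and the anchor is the restriction
of `ds`. -/
theorem eventually_anchor : ∀ᶠ y in 𝓝 U.base, ∀ w,
    (mfderiv (𝓡 n) 𝓘(ℝ, EuSp n) (extChartAt (𝓡 n) c) ((extChartAt (𝓡 n) c).symm y)
      (Γ.anchor _ (Γ.locInv c ((extChartAt (𝓡 n) c).symm y) w)) : EuSp n) =
      fderiv ℝ U.src (y, 0) (0, w) := by
  filter_upwards [U.tendsto_zero.eventually U.eventually_fderiv_src, U.eventually_dparam_zero,
    U.eventually_param_zero] with y h1 h2 h3 w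
  rw [h1, h2]
  have h4 : ∀ g p, g = Γ.u p → ∀ X : Γ.Alg p,
      (mfderiv (𝓡 n) 𝓘(ℝ, EuSp n) (extChartAt (𝓡 n) c) p (Γ.anchor p X) : EuSp n) =
      (mfderiv (𝓡 n) 𝓘(ℝ, EuSp n) (extChartAt (𝓡 n) c) (Γ.s g) : EuSp n →L[ℝ] EuSp n)
        ((mfderiv (𝓡 (n + r)) (𝓡 n) Γ.s g : EuSp (n + r) →L[ℝ] EuSp n) (Γ.incl p X)) := by
    rintro _ p rfl X
    have h5 : ∀ q, q = p → ∀ Y : EuSp n, Y = Γ.anchor p X →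
        (mfderiv (𝓡 n) 𝓘(ℝ, EuSp n) (extChartAt (𝓡 n) c) p (Γ.anchor p X) : EuSp n) =
        (mfderiv (𝓡 n) 𝓘(ℝ, EuSp n) (extChartAt (𝓡 n) c) q : EuSp n →L[ℝ] EuSp n) Y := by
      rintro _ rfl _ rfl
      rfl
    exact h5 _ (Γ.s_u p) _ (Γ.anchor_coe p X).symm
  exact h4 _ _ h3 _

/-- The derivative of the source map along the base. -/
def srcBase (z : EuSp n × EuSp r) : EuSp n →L[ℝ] EuSp n :=
  (fderiv ℝ U.src z).comp (ContinuousLinearMap.inl ℝ _ _)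

/-- The derivative of the multiplication in the first factor, at a unit. -/
def multLeft (z : EuSp n × EuSp r) : EuSp r →L[ℝ] EuSp r :=
  (fderiv ℝ U.mult ((z.1, 0), z.2)).comp
    ((ContinuousLinearMap.inl ℝ _ _).comp (ContinuousLinearMap.inr ℝ _ _))

/-- The derivative of the multiplication in the second factor, at a unit. -/
def multRight (z : EuSp n × EuSp r) : EuSp r →L[ℝ] EuSp r :=
  (fderiv ℝ U.mult (z, 0)).comp (ContinuousLinearMap.inr ℝ _ _)

theorem contDiffAt_fderiv_src : ContDiffAt ℝ 2 (fderiv ℝ U.src) (U.base, 0) :=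
  U.contDiffAt_src.fderiv_right (by norm_num)

theorem contDiffAt_fderiv_mult : ContDiffAt ℝ 2 (fderiv ℝ U.mult) ((U.base, 0), 0) :=
  U.contDiffAt_mult.fderiv_right (by norm_num)

theorem contDiffAt_srcBase : ContDiffAt ℝ 2 U.srcBase (U.base, 0) :=
  U.contDiffAt_fderiv_src.clm_comp contDiffAt_const

theorem contDiffAt_multLeft : ContDiffAt ℝ 2 U.multLeft (U.base, 0) := by
  refine ContDiffAt.clm_comp ?_ contDiffAt_const
  exact ContDiffAt.comp (g := fderiv ℝ U.mult)
    (f := fun z : EuSp n × EuSp r => ((z.1, (0 : EuSp r)), z.2)) (U.base, 0)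
    U.contDiffAt_fderiv_mult ((contDiffAt_fst.prodMk contDiffAt_const).prodMk contDiffAt_snd)

theorem contDiffAt_multRight : ContDiffAt ℝ 2 U.multRight (U.base, 0) := by
  refine ContDiffAt.clm_comp ?_ contDiffAt_const
  exact ContDiffAt.comp (g := fderiv ℝ U.mult)
    (f := fun z : EuSp n × EuSp r => (z, (0 : EuSp r))) (U.base, 0)
    U.contDiffAt_fderiv_mult (contDiffAt_id.prodMk contDiffAt_const)

/-- The source is the identity on units. Together with the unit laws of `mult` this makes `srcBase`,
`multLeft` and `multRight` the identity at the base unit, hence invertible nearby, and their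
determinants have traces as derivatives. -/
theorem srcBase_base : U.srcBase (U.base, 0) = ContinuousLinearMap.id ℝ _ := by
  have h1 : HasFDerivAt (fun y => U.src (y, 0)) (U.srcBase (U.base, 0)) U.base :=
    HasFDerivAt.comp (g := U.src) (f := fun y : EuSp n => (y, (0 : EuSp r))) U.base
      (U.contDiffAt_src.differentiableAt (by simp)).hasFDerivAt
      ((hasFDerivAt_id U.base).prodMk (hasFDerivAt_const (0 : EuSp r) U.base))
  exact h1.unique ((hasFDerivAt_id U.base).congr_of_eventuallyEq U.eventually_src_zero)

theorem multLeft_base : U.multLeft (U.base, 0) = ContinuousLinearMap.id ℝ _ := by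
  have h1 : HasFDerivAt (fun v => U.mult ((U.base, v), 0)) (U.multLeft (U.base, 0)) 0 :=
    HasFDerivAt.comp (g := U.mult) (f := fun v : EuSp r => ((U.base, v), (0 : EuSp r))) (0 : EuSp r)
      (U.contDiffAt_mult.differentiableAt (by simp)).hasFDerivAt
      ((differentiableAt_pair U.base (0 : EuSp r)).prodMk (hasFDerivAt_const (0 : EuSp r) _))
  refine h1.unique ((hasFDerivAt_id _).congr_of_eventuallyEq ?_)
  have hcont : Filter.Tendsto (fun v : EuSp r => (U.base, v)) (𝓝 0) (𝓝 (U.base, 0)) :=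
    (continuous_const.prodMk continuous_id).tendsto 0
  exact hcont.eventually U.eventually_mult_right_zero

theorem multRight_base : U.multRight (U.base, 0) = ContinuousLinearMap.id ℝ _ := by
  have h1 : HasFDerivAt (fun w => U.mult ((U.base, 0), w)) (U.multRight (U.base, 0)) 0 :=
    HasFDerivAt.comp (g := U.mult) (f := fun v : EuSp r => ((U.base, (0 : EuSp r)), v))
      (0 : EuSp r) (U.contDiffAt_mult.differentiableAt (by simp)).hasFDerivAt
      (differentiableAt_pair (U.base, (0 : EuSp r)) (0 : EuSp r))
  refine h1.unique ((hasFDerivAt_id _).congr_of_eventuallyEq ?_)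
  have hcont : Filter.Tendsto (fun v : EuSp r => (U.base, v)) (𝓝 0) (𝓝 (U.base, 0)) :=
    (continuous_const.prodMk continuous_id).tendsto 0
  exact hcont.eventually U.eventually_mult_left_zero

theorem eventually_isInvertible {V : Type*} [NormedAddCommGroup V] [NormedSpace ℝ V] {E : Type*}
    [NormedAddCommGroup E] [NormedSpace ℝ E] [CompleteSpace E] {L : V → E →L[ℝ] E} {q : V}
    (hL : ContinuousAt L q) (h1 : L q = ContinuousLinearMap.id ℝ E) :
    ∀ᶠ z in 𝓝 q, (L z).IsInvertible := by
  refine hL.eventually (p := fun A : E →L[ℝ] E => A.IsInvertible) ?_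
  rw [h1]
  exact ContinuousLinearEquiv.isOpen.mem_nhds ⟨ContinuousLinearEquiv.refl ℝ E, rfl⟩

/-- The derivative of a local bisection at `param z` which is parallel to the base. -/
def jet (z : EuSp n × EuSp r) :
    TangentSpace (𝓡 n) (Γ.s (U.param z)) →ₗ[ℝ] TangentSpace (𝓡 (n + r)) (U.param z) :=
  (show EuSp n →L[ℝ] EuSp (n + r) from
    (U.dparam z).comp ((ContinuousLinearMap.inl ℝ (EuSp n) (EuSp r)).comp
      ((U.srcBase z).inverse.comp (show EuSp n →L[ℝ] EuSp n from
        mfderiv (𝓡 n) 𝓘(ℝ, EuSp n) (extChartAt (𝓡 n) c) (Γ.s (U.param z)))))).toLinearMap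

/-- The conjugation with the bisection of `jet`, on the Lie algebroid. -/
def conj (z : EuSp n × EuSp r) (hs : Γ.s (U.param z) ∈ Γ.base c) (ht : Γ.t (U.param z) ∈ Γ.base c) :
    Γ.Alg (Γ.s (U.param z)) →ₗ[ℝ] Γ.Alg (Γ.t (U.param z)) :=
  (Γ.frameEquiv ht).symm.toLinearMap ∘ₗ
    ((U.multLeft z).inverse.comp (U.multRight z)).toLinearMap ∘ₗ (Γ.frameEquiv hs).toLinearMap

/-- The points with the fibre coordinate of `z` form a bisection; `jet` is its tangent,
reparametrised by the source through the inverse of `srcBase`. The equation `A(X) · S(ρ(X)) =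
dL_g(X)` becomes `multLeft (A X) = multRight X`, and this is how `conj` is defined. -/
theorem eventually_isAdjointJet : ∀ᶠ z in 𝓝 (U.base, (0 : EuSp r)),
    ∃ (hs : Γ.s (U.param z) ∈ Γ.base c) (ht : Γ.t (U.param z) ∈ Γ.base c),
      Γ.IsAdjointJet (U.param z) (U.jet z) (U.conj z hs ht) := by
  have hs : Filter.Tendsto (fun z => Γ.s (U.param z)) (𝓝 (U.base, 0)) (𝓝 x) := by
    have h := (Γ.contMDiff_s.continuous.tendsto (Γ.u x)).comp U.tendsto_param
    rwa [Γ.s_u] at h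
  have ht : Filter.Tendsto (fun z => Γ.t (U.param z)) (𝓝 (U.base, 0)) (𝓝 x) := by
    have h := (Γ.contMDiff_t.continuous.tendsto (Γ.u x)).comp U.tendsto_param
    rwa [Γ.t_u] at h
  have hbase := (Γ.isOpen_base c).mem_nhds U.mem_base
  have hsource := (isOpen_extChartAt_source (I := 𝓡 n) c).mem_nhds U.mem_source
  filter_upwards [hs.eventually hbase, ht.eventually hbase, hs.eventually hsource,
    ht.eventually hsource,
    eventually_isInvertible U.contDiffAt_srcBase.continuousAt U.srcBase_base,
    eventually_isInvertible U.contDiffAt_multLeft.continuousAt U.multLeft_base,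
    U.eventually_fderiv_src, U.eventually_mfderiv_t, U.tendsto_fst'.eventually U.eventually_anchor,
    U.tendsto_src.eventually U.eventually_anchor, U.eventually_s, U.eventually_t,
    U.eventually_src_left, U.eventually_src_right, U.eventually_tangentMul,
    U.eventually_leftTranslate] with z
    hs ht hs' ht' hJ hB h1 h2 h3 h4 h5 h6 h7 h8 h9 h10
  -- The horizontal displacement of the bisection along `ρ(X)` is the anchor of the conjugated
  -- element. This combines the derivatives of `src ∘ mult` in its two factors and gives both
  -- compatibility with anchors and the second argument of the product.
  have hanch : ∀ X : Γ.Alg (Γ.s (U.param z)), (U.srcBase z).inverse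
      (mfderiv (𝓡 n) 𝓘(ℝ, EuSp n) (extChartAt (𝓡 n) c) (Γ.s (U.param z)) (Γ.anchor _ X)) =
      fderiv ℝ U.src (z.1, 0) (0, (U.multLeft z).inverse (U.multRight z (Γ.frameEquiv hs X))) := by
    intro X
    have h11 := h4 (Γ.frameEquiv hs X)
    rw [h5] at h11
    have h12 : Γ.locInv c (Γ.s (U.param z)) (Γ.frameEquiv hs X) = X :=
      Γ.locInv_locTriv c _ hs X
    rw [h12] at h11
    rw [h11, hJ.inverse_apply_eq, ← h8]
    have h13 := h7 ((U.multLeft z).inverse (U.multRight z (Γ.frameEquiv hs X)))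
    have h14 := hB.self_apply_inverse (U.multRight z (Γ.frameEquiv hs X))
    exact (congrArg (fun v => fderiv ℝ U.src z (0, v)) h14).symm.trans h13
  have hconj : ∀ X : Γ.Alg (Γ.s (U.param z)), U.conj z hs ht X =
      Γ.locInv c (Γ.t (U.param z))
        ((U.multLeft z).inverse (U.multRight z (Γ.frameEquiv hs X))) := fun _ => rfl
  have hjet : ∀ m, (U.jet z m : EuSp (n + r)) = U.dparam z ((U.srcBase z).inverse
      (mfderiv (𝓡 n) 𝓘(ℝ, EuSp n) (extChartAt (𝓡 n) c) (Γ.s (U.param z)) m), 0) := fun _ => rfl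
  have hφs := isInvertible_mfderiv_extChartAt (I := 𝓡 n) hs'
  have hφt := isInvertible_mfderiv_extChartAt (I := 𝓡 n) ht'
  refine ⟨hs, ht, ⟨?_, ?_, ?_, ?_⟩⟩
  · intro m
    refine hφs.injective ?_
    have h11 := h1 ((U.srcBase z).inverse
      (mfderiv (𝓡 n) 𝓘(ℝ, EuSp n) (extChartAt (𝓡 n) c) (Γ.s (U.param z)) m), 0)
    refine Eq.trans h11.symm ?_
    exact hJ.self_apply_inverse _
  · rw [← Function.Bijective.of_comp_iff' (f := fun v => (mfderiv (𝓡 n) 𝓘(ℝ, EuSp n)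
      (extChartAt (𝓡 n) c) (Γ.t (U.param z)) v)) hφt.bijective]
    have h11 : (fun v => (mfderiv (𝓡 n) 𝓘(ℝ, EuSp n) (extChartAt (𝓡 n) c) (Γ.t (U.param z)) v :
        EuSp n)) ∘ (fun m => (mfderiv (𝓡 (n + r)) (𝓡 n) Γ.t (U.param z) (U.jet z m) : EuSp n)) =
        (U.srcBase z).inverse ∘ (fun m => (mfderiv (𝓡 n) 𝓘(ℝ, EuSp n) (extChartAt (𝓡 n) c)
          (Γ.s (U.param z)) m : EuSp n)) := by
      funext m
      exact h2 _
    refine Eq.mpr (congrArg Function.Bijective h11) ?_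
    exact Function.Bijective.comp hJ.inverse.bijective hφs.bijective
  · intro X
    refine hφt.injective ?_
    have h11 := h3 ((U.multLeft z).inverse (U.multRight z (Γ.frameEquiv hs X)))
    rw [← h6] at h11
    refine Eq.trans h11 ?_
    rw [← hanch X]
    exact (h2 ((U.srcBase z).inverse (mfderiv (𝓡 n) 𝓘(ℝ, EuSp n) (extChartAt (𝓡 n) c)
      (Γ.s (U.param z)) (Γ.anchor _ X)), 0)).symm
  · intro X
    refine Eq.trans (castTangent_coe _ _ _) ?_
    have h11 := h9 ((U.multLeft z).inverse (U.multRight z (Γ.frameEquiv hs X)))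
    have h12 := h10 (Γ.frameEquiv hs X)
    have h13 : Γ.locInv c (Γ.s (U.param z)) (Γ.frameEquiv hs X) = X :=
      Γ.locInv_locTriv c _ hs X
    rw [h13] at h12
    refine Eq.trans ?_ h12.symm
    have h14 := hB.self_apply_inverse (U.multRight z (Γ.frameEquiv hs X))
    refine Eq.trans ?_ (h11.trans (congrArg (fun v => U.dparam z (0, v)) h14))
    rw [← hanch X]
    rfl

end UnitChart

end LieGroupoid

/-! ### Infinitesimal invariance of the density -/

namespace LieGroupoid

variable {n r : ℕ} {M G : Type*}
    [TopologicalSpace M] [ChartedSpace (EuSp n) M] [IsManifold (𝓡 n) ∞ M]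
    [TopologicalSpace G] [ChartedSpace (EuSp (n + r)) G] [IsManifold (𝓡 (n + r)) ∞ G]
    {Γ : LieGroupoid n r M G}

theorem ιMulti_locInv_ne_zero {c p : M} (hp : p ∈ Γ.base c) (b : Basis (Fin r) ℝ (EuSp r)) :
    exteriorPower.ιMulti ℝ r (fun i => Γ.locInv c p (b i)) ≠ 0 := by
  intro h
  have h1 := congrArg (exteriorPower.alternatingMapLinearEquiv
    (b.det.compLinearMap (Γ.locTriv c p).toLinearMap)) h
  rw [exteriorPower.alternatingMapLinearEquiv_apply_ιMulti, map_zero] at h1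
  have h2 : (fun i => Γ.locTriv c p (Γ.locInv c p (b i))) = b :=
    funext fun i => Γ.locTriv_locInv c p hp (b i)
  have h3 : b.det (fun i => Γ.locTriv c p (Γ.locInv c p (b i))) = 0 := h1
  rw [h2, b.det_self] at h3
  exact one_ne_zero h3

namespace UnitChart

variable {c x : M} (U : Γ.UnitChart c x)

theorem det_inverse_comp {E : Type*} [NormedAddCommGroup E] [NormedSpace ℝ E] {A B : E →L[ℝ] E}
    (hA : A.IsInvertible) : LinearMap.det A.toLinearMap *
      LinearMap.det (A.inverse.comp B).toLinearMap = LinearMap.det B.toLinearMap := by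
  rw [← LinearMap.det_comp]
  congr 1
  ext v
  exact hA.self_apply_inverse (B v)

/-- Invariance of a transversal density, in coordinates. -/
theorem eventually_coeff {Ω : Γ.Density} (hΩ : Γ.IsInvariantVolume Ω)
    (b₁ : Basis (Fin n) ℝ (EuSp n)) (b : Basis (Fin r) ℝ (EuSp r)) {f : EuSp n → ℝ}
    (hf : ∀ᶠ y in 𝓝 U.base, Ω _ (coordFrame (𝓡 n) b₁ c y) =
      f y • exteriorPower.ιMulti ℝ r (fun i => Γ.locInv c ((extChartAt (𝓡 n) c).symm y) (b i))) :
    ∀ᶠ z in 𝓝 (U.base, (0 : EuSp r)),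
      f z.1 * LinearMap.det (U.multLeft z).toLinearMap =
        f (U.src z) * LinearMap.det (U.srcBase z).toLinearMap *
          LinearMap.det (U.multRight z).toLinearMap := by
  have ht : Filter.Tendsto (fun z => Γ.t (U.param z)) (𝓝 (U.base, 0)) (𝓝 x) := by
    have h := (Γ.contMDiff_t.continuous.tendsto (Γ.u x)).comp U.tendsto_param
    rwa [Γ.t_u] at h
  have hsource := (isOpen_extChartAt_source (I := 𝓡 n) c).mem_nhds U.mem_source
  -- The point `p` is kept as a variable because the statement is used at the source and at the
  -- target of `param z`, whose coordinates are known only through equations.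
  have hfD : ∀ᶠ y in 𝓝 U.base, ∀ p, p = (extChartAt (𝓡 n) c).symm y →
      ∀ (D : EuSp n →ₗ[ℝ] EuSp n) (m : Fin n → EuSp n),
      (∀ i, m i = (mfderiv 𝓘(ℝ, EuSp n) (𝓡 n) (extChartAt (𝓡 n) c).symm y : EuSp n →L[ℝ] EuSp n)
        (D (b₁ i))) →
      (show EuSp n [⋀^Fin n]→ₗ[ℝ] ⋀[ℝ]^r (Γ.Alg p) from Ω p) m =
        (LinearMap.det D * f y) • exteriorPower.ιMulti ℝ r (fun i => Γ.locInv c p (b i)) := by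
    filter_upwards [hf] with y hy
    rintro _ rfl D m hm
    rw [funext hm]
    have h1 := AlternatingMap.map_comp_basis b₁ (show EuSp n [⋀^Fin n]→ₗ[ℝ] ⋀[ℝ]^r
      (Γ.Alg ((extChartAt (𝓡 n) c).symm y)) from Ω _)
      (show EuSp n →L[ℝ] EuSp n from
        mfderiv 𝓘(ℝ, EuSp n) (𝓡 n) (extChartAt (𝓡 n) c).symm y).toLinearMap D
    refine h1.trans ?_
    rw [mul_smul]
    exact congrArg (LinearMap.det D • ·) hy
  filter_upwards [U.eventually_isAdjointJet, U.tendsto_fst'.eventually hfD,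
    U.tendsto_src.eventually hfD, U.eventually_s, U.eventually_t,
    eventually_isInvertible U.contDiffAt_srcBase.continuousAt U.srcBase_base,
    eventually_isInvertible U.contDiffAt_multLeft.continuousAt U.multLeft_base,
    U.eventually_mfderiv_t, ht.eventually hsource, U.tendsto_fst'.eventually U.eventually_symm,
    U.tendsto_src.eventually U.eventually_symm]
    with z ⟨hs, ht, hA⟩ h1 h2 h3 h4 hJ hB h5 ht' h6 h7
  -- the frame at the source
  let m : Fin n → EuSp n := fun i =>
    (mfderiv 𝓘(ℝ, EuSp n) (𝓡 n) (extChartAt (𝓡 n) c).symm (U.src z) : EuSp n →L[ℝ] EuSp n)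
      (U.srcBase z (b₁ i))
  have hinv := hΩ.invariant (U.param z) _ _ hA m
  have hright := h2 _ h3.symm (U.srcBase z).toLinearMap m fun _ => rfl
  have hcancel : ∀ y ∈ (extChartAt (𝓡 n) c).target, ∀ p, p = (extChartAt (𝓡 n) c).symm y →
      ∀ v : EuSp n, (mfderiv (𝓡 n) 𝓘(ℝ, EuSp n) (extChartAt (𝓡 n) c) p : EuSp n →L[ℝ] EuSp n)
        ((mfderiv 𝓘(ℝ, EuSp n) (𝓡 n) (extChartAt (𝓡 n) c).symm y : EuSp n →L[ℝ] EuSp n) v) = v := by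
    rintro y hy _ rfl v
    have h8 := mfderiv_extChartAt_comp_mfderivWithin_extChartAt_symm (I := 𝓡 n) hy
    rw [ModelWithCorners.Boundaryless.range_eq_univ, mfderivWithin_univ] at h8
    exact congrArg (fun L : EuSp n →L[ℝ] EuSp n => L v) h8
  -- The vectors `m` were defined with `srcBase`, the inverse of which occurs in `jet`; their images
  -- under `dt ∘ S` are thus the coordinate frame at the target and no determinant appears on this
  -- side.
  have hleft := h1 _ h4 LinearMap.id
    (fun i => mfderiv (𝓡 (n + r)) (𝓡 n) Γ.t (U.param z) (U.jet z (m i))) fun i => by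
      refine (isInvertible_mfderiv_extChartAt (I := 𝓡 n) ht').injective ?_
      refine (h5 _).trans ?_
      refine Eq.trans ?_ (hcancel _ h6.1 _ h4 _).symm
      change (U.srcBase z).inverse (mfderiv (𝓡 n) 𝓘(ℝ, EuSp n) (extChartAt (𝓡 n) c)
        (Γ.s (U.param z)) (m i)) = _
      refine (congrArg (U.srcBase z).inverse (hcancel _ h7.1 _ h3.symm _)).trans ?_
      exact hJ.inverse_apply_self _
  have hR : exteriorPower.map r (U.conj z hs ht) (exteriorPower.ιMulti ℝ r
      (fun i => Γ.locInv c (Γ.s (U.param z)) (b i))) =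
      LinearMap.det ((U.multLeft z).inverse.comp (U.multRight z)).toLinearMap •
        exteriorPower.ιMulti ℝ r (fun i => Γ.locInv c (Γ.t (U.param z)) (b i)) := by
    rw [exteriorPower.map_apply_ιMulti]
    have h8 := AlternatingMap.map_comp_basis b
      (exteriorPower.ιMulti ℝ r (M := Γ.Alg (Γ.t (U.param z))))
      (Γ.frameEquiv ht).symm.toLinearMap
      ((U.multLeft z).inverse.comp (U.multRight z)).toLinearMap
    refine Eq.trans ?_ h8
    congr 1
    funext i
    change Γ.locInv c _ ((U.multLeft z).inverse (U.multRight z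
      (Γ.locTriv c _ (Γ.locInv c _ (b i))))) = _
    rw [Γ.locTriv_locInv c _ hs]
    rfl
  have hfin := hleft.symm.trans (hinv.trans ((congrArg (exteriorPower.map r (U.conj z hs ht))
    hright).trans (map_smul _ _ _)))
  rw [hR, smul_smul, LinearMap.det_id, one_mul] at hfin
  -- Both sides are multiples of the same nonzero element of the top exterior power, so the
  -- coefficients can be compared.
  have h9 := smul_left_injective ℝ (ιMulti_locInv_ne_zero ht b) hfin
  rw [h9, ← det_inverse_comp hB (B := U.multRight z)]
  ring

/-- The second derivative of the multiplication at a unit. -/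
def multSnd : (EuSp n × EuSp r) × EuSp r →L[ℝ] (EuSp n × EuSp r) × EuSp r →L[ℝ] EuSp r :=
  fderiv ℝ (fderiv ℝ U.mult) ((U.base, 0), 0)

theorem multSnd_symm (v w) : U.multSnd v w = U.multSnd w v :=
  (U.contDiffAt_mult.isSymmSndFDerivAt (by
    rw [minSmoothness_of_isRCLikeNormedField]
    exact WithTop.coe_le_coe.2 (by norm_num : (2 : ℕ∞) ≤ 3))) v w

theorem srcSnd_symm (v w) : fderiv ℝ (fderiv ℝ U.src) (U.base, 0) v w =
    fderiv ℝ (fderiv ℝ U.src) (U.base, 0) w v :=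
  (U.contDiffAt_src.isSymmSndFDerivAt (by
    rw [minSmoothness_of_isRCLikeNormedField]
    exact WithTop.coe_le_coe.2 (by norm_num : (2 : ℕ∞) ≤ 3))) v w

theorem fderiv_clm_comp_const {V E F E' : Type*} [NormedAddCommGroup V] [NormedSpace ℝ V]
    [NormedAddCommGroup E] [NormedSpace ℝ E] [NormedAddCommGroup F] [NormedSpace ℝ F]
    [NormedAddCommGroup E'] [NormedSpace ℝ E'] {L : V → E →L[ℝ] F} {q : V}
    (hL : DifferentiableAt ℝ L q) (ℓ : E' →L[ℝ] E) (v : V) (a : E') :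
    fderiv ℝ (fun z => (L z).comp ℓ) q v a = fderiv ℝ L q v (ℓ a) := by
  rw [fderiv_clm_comp hL (differentiableAt_const _)]
  simp

/-- In `multLeft` the variable enters through the base slot and the second factor, while the
derivative is taken in the first factor. In a fibre direction the result is the mixed second
derivative of `mult`. -/
theorem fderiv_multLeft (v : EuSp n × EuSp r) (a : EuSp r) :
    fderiv ℝ U.multLeft (U.base, 0) v a = U.multSnd ((v.1, 0), v.2) ((0, a), 0) := by
  have h1 : DifferentiableAt ℝ (fderiv ℝ U.mult) ((U.base, (0 : EuSp r)), (0 : EuSp r)) :=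
    U.contDiffAt_fderiv_mult.differentiableAt (by simp)
  have h2 : HasFDerivAt (fun z : EuSp n × EuSp r => ((z.1, (0 : EuSp r)), z.2))
      (((ContinuousLinearMap.fst ℝ (EuSp n) (EuSp r)).prod 0).prod
        (ContinuousLinearMap.snd ℝ (EuSp n) (EuSp r))) (U.base, (0 : EuSp r)) :=
    (hasFDerivAt_fst.prodMk (hasFDerivAt_const (0 : EuSp r) _)).prodMk hasFDerivAt_snd
  have h3 : HasFDerivAt (fun z : EuSp n × EuSp r => fderiv ℝ U.mult ((z.1, 0), z.2)) _ (U.base, 0) :=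
    HasFDerivAt.comp (g := fderiv ℝ U.mult) (f := fun z : EuSp n × EuSp r =>
      ((z.1, (0 : EuSp r)), z.2)) (U.base, (0 : EuSp r)) h1.hasFDerivAt h2
  refine (fderiv_clm_comp_const h3.differentiableAt _ v a).trans ?_
  rw [h3.fderiv]
  rfl

theorem fderiv_multRight (v : EuSp n × EuSp r) (a : EuSp r) :
    fderiv ℝ U.multRight (U.base, 0) v a = U.multSnd (v, 0) (0, a) := by
  have h1 : DifferentiableAt ℝ (fderiv ℝ U.mult) ((U.base, (0 : EuSp r)), (0 : EuSp r)) :=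
    U.contDiffAt_fderiv_mult.differentiableAt (by simp)
  have h2 : HasFDerivAt (fun z : EuSp n × EuSp r => (z, (0 : EuSp r)))
      ((ContinuousLinearMap.id ℝ (EuSp n × EuSp r)).prod 0) (U.base, (0 : EuSp r)) :=
    (hasFDerivAt_id _).prodMk (hasFDerivAt_const (0 : EuSp r) _)
  have h3 : HasFDerivAt (fun z : EuSp n × EuSp r => fderiv ℝ U.mult (z, 0)) _ (U.base, 0) :=
    HasFDerivAt.comp (g := fderiv ℝ U.mult) (f := fun z : EuSp n × EuSp r =>
      (z, (0 : EuSp r))) (U.base, (0 : EuSp r)) h1.hasFDerivAt h2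
  refine (fderiv_clm_comp_const h3.differentiableAt _ v a).trans ?_
  rw [h3.fderiv]
  rfl

theorem fderiv_srcBase (v : EuSp n × EuSp r) (a : EuSp n) :
    fderiv ℝ U.srcBase (U.base, 0) v a = fderiv ℝ (fderiv ℝ U.src) (U.base, 0) v (a, 0) :=
  fderiv_clm_comp_const (U.contDiffAt_fderiv_src.differentiableAt (by simp)) _ v a

theorem hasFDerivAt_anchorVec (w : EuSp r) : HasFDerivAt (fun y => U.anchorVec y w)
    ((ContinuousLinearMap.apply ℝ (EuSp n) ((0 : EuSp n), w)).comp
      ((fderiv ℝ (fderiv ℝ U.src) (U.base, 0)).comp (ContinuousLinearMap.inl ℝ _ _))) U.base := by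
  have h1 := (U.contDiffAt_fderiv_src.differentiableAt (by simp)).hasFDerivAt
  exact (ContinuousLinearMap.apply ℝ (EuSp n) ((0 : EuSp n), w)).hasFDerivAt.comp U.base
    (HasFDerivAt.comp (g := fderiv ℝ U.src) (f := fun y : EuSp n => (y, (0 : EuSp r))) U.base h1
      ((hasFDerivAt_id U.base).prodMk (hasFDerivAt_const (0 : EuSp r) U.base)))

/-- Infinitesimal invariance of a transversal density. -/
theorem divergence_anchorVec {Ω : Γ.Density} (hΩ : Γ.IsInvariantVolume Ω)
    (b₁ : Basis (Fin n) ℝ (EuSp n)) (b : Basis (Fin r) ℝ (EuSp r)) {f : EuSp n → ℝ}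
    (hf : ∀ᶠ y in 𝓝 U.base, Ω _ (coordFrame (𝓡 n) b₁ c y) =
      f y • exteriorPower.ιMulti ℝ r (fun i => Γ.locInv c ((extChartAt (𝓡 n) c).symm y) (b i)))
    (hfd : DifferentiableAt ℝ f U.base) (w : EuSp r) :
    divergence b₁ (fun y => f y • U.anchorVec y w) U.base =
      f U.base * ∑ i, b.repr (U.multSnd ((0, b i), 0) (0, w) - U.multSnd ((0, w), 0) (0, b i)) i := by
  have h0 := U.eventually_coeff hΩ b₁ b hf
  obtain ⟨T₁, hT₁, hT₁'⟩ := hasFDerivAt_linearMap_det b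
    (U.contDiffAt_multLeft.differentiableAt (by simp)).hasFDerivAt U.multLeft_base
  obtain ⟨T₂, hT₂, hT₂'⟩ := hasFDerivAt_linearMap_det b₁
    (U.contDiffAt_srcBase.differentiableAt (by simp)).hasFDerivAt U.srcBase_base
  obtain ⟨T₃, hT₃, hT₃'⟩ := hasFDerivAt_linearMap_det b
    (U.contDiffAt_multRight.differentiableAt (by simp)).hasFDerivAt U.multRight_base
  have hf1 : HasFDerivAt (fun z : EuSp n × EuSp r => f z.1) _ (U.base, 0) :=
    HasFDerivAt.comp (g := f) (f := Prod.fst) (U.base, (0 : EuSp r)) hfd.hasFDerivAt hasFDerivAt_fst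
  have hf2 : HasFDerivAt (fun z : EuSp n × EuSp r => f (U.src z)) _ (U.base, 0) :=
    HasFDerivAt.comp (g := f) (f := U.src) (U.base, (0 : EuSp r))
      (by rw [U.src_base]; exact hfd.hasFDerivAt)
      (U.contDiffAt_src.differentiableAt (by simp)).hasFDerivAt
  -- The relation of `eventually_coeff` is differentiated at the unit. The three determinants equal
  -- one there and the source fixes the base point, so in the direction `(0, w)` only traces and one
  -- derivative of `f` remain.
  have hl := hf1.mul hT₁
  have hr := (hf2.mul hT₂).mul hT₃
  have hder := congrArg (fun L : EuSp n × EuSp r →L[ℝ] ℝ => L (0, w))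
    (hl.unique (hr.congr_of_eventuallyEq h0))
  simp only [Pi.mul_apply, U.multLeft_base, U.srcBase_base, U.multRight_base, U.src_base, add_apply, smul_apply,
    ContinuousLinearMap.comp_apply, ContinuousLinearMap.coe_fst', map_zero, smul_eq_mul, mul_zero,
    add_zero, ContinuousLinearMap.coe_id, LinearMap.det_id, mul_one, one_mul, hT₁', hT₂', hT₃',
    fderiv_multLeft, fderiv_multRight, fderiv_srcBase] at hder
  have hdiv : divergence b₁ (fun y => f y • U.anchorVec y w) U.base =
      fderiv ℝ f U.base (U.anchorVec U.base w) + f U.base * ∑ a, b₁.repr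
        (fderiv ℝ (fderiv ℝ U.src) (U.base, 0) (0, w) (b₁ a, 0)) a := by
    have h1 : HasFDerivAt (fun y => f y • U.anchorVec y w) _ U.base :=
      hfd.hasFDerivAt.smul (U.hasFDerivAt_anchorVec w)
    rw [divergence, h1.fderiv]
    have h2 : fderiv ℝ f U.base (U.anchorVec U.base w) =
        ∑ a, b₁.repr (U.anchorVec U.base w) a * fderiv ℝ f U.base (b₁ a) := by
      conv_lhs => rw [← b₁.sum_repr (U.anchorVec U.base w), map_sum]
      simp
    rw [h2, Finset.mul_sum, ← Finset.sum_add_distrib]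
    refine Finset.sum_congr rfl fun a _ => ?_
    -- The divergence differentiates the anchor along the base, the trace of `srcBase`
    -- differentiates in the fibre direction. Symmetry of the second derivative of `src` identifies
    -- them.
    rw [U.srcSnd_symm]
    simp [mul_comm, add_comm]
  rw [hdiv]
  -- Symmetry of the second derivative of `mult` turns the trace coming from `multLeft` into the
  -- first term of the bracket.
  have hsub : ∑ i, b.repr (U.multSnd ((0, b i), 0) (0, w) - U.multSnd ((0, w), 0) (0, b i)) i =
      ∑ i, b.repr (U.multSnd ((0, 0), w) ((0, b i), 0)) i -
        ∑ i, b.repr (U.multSnd ((0, w), 0) (0, b i)) i := by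
    rw [← Finset.sum_sub_distrib]
    refine Finset.sum_congr rfl fun i _ => ?_
    rw [U.multSnd_symm ((0, 0), w), map_sub]
    rfl
  rw [hsub, mul_sub, ← sub_eq_zero]
  have hanch : U.anchorVec U.base w = fderiv ℝ U.src (U.base, 0) (0, w) := rfl
  rw [hanch]
  linarith

end UnitChart

end LieGroupoid

/-! ### Smoothness of sections, left invariant fields and their brackets -/

section TangentSection

variable {E : Type} [NormedAddCommGroup E] [NormedSpace ℝ E] {H : Type*} [TopologicalSpace H]
  {I : ModelWithCorners ℝ E H} {N : Type*} [TopologicalSpace N] [ChartedSpace H N]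
  [I.Boundaryless] [IsManifold I ∞ N]

/-- Smoothness of a vector field in a chart. -/
theorem contMDiffAt_tangentSection_iff {c p : N} (hp : p ∈ (extChartAt I c).source) {m : ℕ∞}
    {V : ∀ q : N, TangentSpace I q} :
    ContMDiffAt I I.tangent m (fun q => (⟨q, V q⟩ : TangentBundle I N)) p ↔
      ContMDiffAt I 𝓘(ℝ, E) m
        (fun q => (mfderiv I 𝓘(ℝ, E) (extChartAt I c) q (V q) : E)) p := by
  have : ContMDiffVectorBundle m E (TangentSpace I : N → Type _) I :=
    ContMDiffVectorBundle.of_le (n := ∞) (by exact_mod_cast le_top)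
  have hp' : p ∈ (trivializationAt E (TangentSpace I : N → Type _) c).baseSet := by
    rwa [TangentBundle.trivializationAt_baseSet, ← extChartAt_source I]
  refine (Trivialization.contMDiffAt_section_iff (n := m) (IB := I) (s := V)
    (trivializationAt E (TangentSpace I : N → Type _) c) hp').trans ?_
  refine Filter.EventuallyEq.contMDiffAt_iff ?_
  filter_upwards [(isOpen_extChartAt_source (I := I) c).mem_nhds hp] with q hq
  rw [extChartAt_source] at hq
  rw [← TangentBundle.continuousLinearMapAt_trivializationAt hq]
  exact (Trivialization.continuousLinearMapAt_apply_of_mem ℝ _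
    (by rwa [TangentBundle.trivializationAt_baseSet]) _).symm

theorem mlieBracket_vectorSpace (V W : ∀ x : E, TangentSpace 𝓘(ℝ, E) x) (x : E) :
    VectorField.mlieBracket 𝓘(ℝ, E) V W x = VectorField.lieBracket ℝ (E := E) V W x := by
  rw [← VectorField.mlieBracketWithin_univ, VectorField.mlieBracketWithin_eq_lieBracketWithin]
  exact congrFun VectorField.lieBracketWithin_univ x

end TangentSection

namespace LieGroupoid

variable {n r : ℕ} {M G : Type*}
    [TopologicalSpace M] [ChartedSpace (EuSp n) M] [IsManifold (𝓡 n) ∞ M]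
    [TopologicalSpace G] [ChartedSpace (EuSp (n + r)) G] [IsManifold (𝓡 (n + r)) ∞ G]
    (Γ : LieGroupoid n r M G)

/-- Smoothness of a section of `𝔤` in a local trivialisation. -/
theorem contMDiffAt_algSection_iff {c p : M} (hp : p ∈ Γ.base c) {X : ∀ x, Γ.Alg x} :
    ContMDiffAt (𝓡 n) ((𝓡 n).prod 𝓘(ℝ, EuSp r)) ∞
      (fun x => (⟨x, X x⟩ : TotalSpace (EuSp r) Γ.Alg)) p ↔
      ContMDiffAt (𝓡 n) 𝓘(ℝ, EuSp r) ∞ (fun x => Γ.locTriv c x (X x)) p :=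
  Trivialization.contMDiffAt_section_iff (n := ∞) (IB := 𝓡 n) (s := X) (trivializationAt (EuSp r) Γ.Alg c) hp

/-- The left invariant vector field of a section of `𝔤`. -/
def leftField (X : ∀ x, Γ.Alg x) (g : G) : TangentSpace (𝓡 (n + r)) g :=
  Γ.leftTranslate g (X (Γ.s g))

variable {Γ}

/-- In trivialisations the inclusion is `w ↦ (P, dt)⁻¹ (w, 0)`, and inversion of continuous linear
maps is smooth at invertible ones. -/
theorem contMDiff_incl {X : ∀ x, Γ.Alg x} (hX : Γ.algebroid.IsSmooth X) :
    ContMDiff (𝓡 n) (𝓡 (n + r)).tangent ∞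
      (fun x => (⟨Γ.u x, Γ.incl x (X x)⟩ : TangentBundle (𝓡 (n + r)) G)) := by
  intro x
  have h0 := (Γ.contMDiffAt_algSection_iff (Γ.mem_base x)).1 (hX x)
  have hb := (Γ.isOpen_base x).mem_nhds (Γ.mem_base x)
  have h1 : ContMDiffAt (𝓡 n) 𝓘(ℝ, EuSp r × EuSp n →L[ℝ] EuSp (n + r)) ∞
      (fun p => (Γ.locMap x p).inverse) x :=
    (((Γ.mem_base x).2.contDiffAt_map_inverse (n := ∞)).contMDiffAt.comp_contMDiffWithinAt x
      (Γ.contMDiffOn_locMap x x (Γ.mem_dom x))).contMDiffAt ((Γ.isOpen_dom x).mem_nhds (Γ.mem_dom x))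
  have h2 : ContMDiffAt (𝓡 n) 𝓘(ℝ, EuSp (n + r)) ∞
      (fun p => (Γ.locMap x p).inverse (Γ.locTriv x p (X p), 0)) x :=
    h1.clm_apply (h0.prodMk_space contMDiffAt_const)
  have h3 : ContMDiffAt (𝓡 n) ((𝓡 (n + r)).prod 𝓘(ℝ, EuSp (n + r))) ∞
      (fun p => (Γ.u p, (Γ.locMap x p).inverse (Γ.locTriv x p (X p), 0))) x :=
    (Γ.contMDiff_u x).prodMk h2
  have h4 := ((Γ.trG x).contMDiffOn_symm (IB := 𝓡 (n + r)) (n := ∞)).contMDiffAt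
    ((Γ.trG x).open_target.mem_nhds (x := (Γ.u x, (Γ.locMap x x).inverse (Γ.locTriv x x (X x), 0)))
      (by rw [Trivialization.mem_target]; exact (Γ.mem_dom x).1))
  refine (ContMDiffAt.comp x h4 h3).congr_of_eventuallyEq ?_
  filter_upwards [hb] with p hp
  have h5 := Γ.incl_locInv x p hp (Γ.locTriv x p (X p))
  rw [Γ.locInv_locTriv x p hp] at h5
  rw [h5, Trivialization.symmL_apply _ hp.1.1, Trivialization.mk_symm _ hp.1.1]
  rfl

theorem contMDiff_anchor {X : ∀ x, Γ.Alg x} (hX : Γ.algebroid.IsSmooth X) :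
    ContMDiff (𝓡 n) (𝓡 n).tangent ∞
      (fun x => (⟨x, Γ.anchor x (X x)⟩ : TangentBundle (𝓡 n) M)) := by
  have h1 := (Γ.contMDiff_s.contMDiff_tangentMap (m := ∞) (by simp)).comp (contMDiff_incl hX)
  refine h1.congr fun x => ?_
  have h2 : ∀ y (h : x = y) (v : TangentSpace (𝓡 n) x), (⟨x, v⟩ : TangentBundle (𝓡 n) M) =
      ⟨y, castTangent (𝓡 n) h v⟩ := by
    rintro _ rfl v
    rfl
  refine (h2 _ (Γ.s_u x).symm _).trans ?_
  have h3 : castTangent (𝓡 n) (Γ.s_u x).symm (Γ.anchor x (X x)) =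
      mfderiv (𝓡 (n + r)) (𝓡 n) Γ.s (Γ.u x) (Γ.incl x (X x)) :=
    (castTangent_coe (𝓡 n) (Γ.s_u x).symm (Γ.anchor x (X x))).trans (Γ.anchor_coe x (X x))
  rw [h3]
  rfl

namespace UnitChart

variable {c x : M} (U : Γ.UnitChart c x)

/-- A section of `𝔤` in coordinates. -/
def localSection (_ : Γ.UnitChart c x) (X : ∀ x, Γ.Alg x) (y : EuSp n) : EuSp r :=
  Γ.locTriv c ((extChartAt (𝓡 n) c).symm y) (X ((extChartAt (𝓡 n) c).symm y))

theorem contDiffAt_localSection {X : ∀ x, Γ.Alg x} (hX : Γ.algebroid.IsSmooth X) :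
    ContDiffAt ℝ ∞ (U.localSection X) U.base := by
  have h0 := (Γ.contMDiffAt_algSection_iff U.mem_base).1 (hX x)
  have h1 := contMDiffAt_extChartAt_symm_of_mem_target (I := 𝓡 n) U.base_mem_target
  rw [← U.symm_base] at h0
  exact (h0.comp U.base h1).contDiffAt

/-- A left invariant vector field in coordinates. -/
def leftVec (X : ∀ x, Γ.Alg x) (z : EuSp n × EuSp r) : EuSp n × EuSp r :=
  (0, fderiv ℝ U.mult (z, 0) (0, U.localSection X (U.src z)))

theorem contDiffAt_leftVec {X : ∀ x, Γ.Alg x} (hX : Γ.algebroid.IsSmooth X) :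
    ContDiffAt ℝ 1 (U.leftVec X) (U.base, 0) := by
  have h1 : ContDiffAt ℝ 1 (fun z : EuSp n × EuSp r => fderiv ℝ U.mult (z, 0)) (U.base, 0) :=
    ContDiffAt.comp (g := fderiv ℝ U.mult) (f := fun z : EuSp n × EuSp r => (z, (0 : EuSp r)))
      (U.base, (0 : EuSp r)) (U.contDiffAt_fderiv_mult.of_le (by norm_num))
      (contDiffAt_id.prodMk contDiffAt_const)
  have h2 : ContDiffAt ℝ 1 (fun z => U.localSection X (U.src z)) (U.base, 0) := by
    refine ContDiffAt.comp (g := U.localSection X) (f := U.src) (U.base, (0 : EuSp r)) ?_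
      (U.contDiffAt_src.of_le (by norm_num))
    rw [U.src_base]
    exact (U.contDiffAt_localSection hX).of_le (by simp)
  exact contDiffAt_const.prodMk (h1.clm_apply (contDiffAt_const.prodMk h2))

theorem eventually_leftField (X : ∀ x, Γ.Alg x) : ∀ᶠ z in 𝓝 (U.base, (0 : EuSp r)),
    (Γ.leftField X (U.param z) : EuSp (n + r)) = U.dparam z (U.leftVec X z) := by
  filter_upwards [U.eventually_leftTranslate, U.eventually_s,
    U.tendsto_src.eventually U.eventually_symm] with z h1 h2 h3
  have h4 := h1 (Γ.locTriv c _ (X (Γ.s (U.param z))))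
  rw [h2] at h3
  rw [Γ.locInv_locTriv c _ h3.2] at h4
  rw [leftField, h4, leftVec, localSection, h2]

theorem tendsto_coord : Filter.Tendsto (Γ.coord c) (𝓝 (Γ.u x)) (𝓝 (U.base, 0)) := by
  have h := U.contMDiffAt_coord_u.continuousAt.tendsto
  rwa [Γ.coord_u U.mem_source] at h

/-- What holds in coordinates holds near the unit. -/
theorem eventually_of_coord {P : G → EuSp n × EuSp r → Prop}
    (h : ∀ᶠ z in 𝓝 (U.base, (0 : EuSp r)), P (U.param z) z) :
    ∀ᶠ g in 𝓝 (Γ.u x), P g (Γ.coord c g) := by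
  filter_upwards [U.tendsto_coord.eventually h, U.param_coord] with g h1 h2
  rwa [h2] at h1

theorem eventually_mfderiv_coord_leftField (X : ∀ x, Γ.Alg x) : ∀ᶠ g in 𝓝 (Γ.u x),
    (mfderiv (𝓡 (n + r)) 𝓘(ℝ, EuSp n × EuSp r) (Γ.coord c) g (Γ.leftField X g) :
      EuSp n × EuSp r) = U.leftVec X (Γ.coord c g) := by
  refine U.eventually_of_coord (P := fun g z => (mfderiv (𝓡 (n + r)) 𝓘(ℝ, EuSp n × EuSp r)
    (Γ.coord c) g (Γ.leftField X g) : EuSp n × EuSp r) = U.leftVec X z) ?_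
  filter_upwards [U.eventually_leftField X, U.eventually_mfderiv_coord] with z h1 h2
  exact (congrArg (mfderiv (𝓡 (n + r)) 𝓘(ℝ, EuSp n × EuSp r) (Γ.coord c) (U.param z)) h1).trans
    (h2 _)

/-- Order one is all that the lemma on related brackets asks for, and the unit chart has only finite
order of smoothness. -/
theorem contMDiffAt_leftField (U : Γ.UnitChart c x) {X : ∀ x, Γ.Alg x}
    (hX : Γ.algebroid.IsSmooth X) :
    ContMDiffAt (𝓡 (n + r)) (𝓡 (n + r)).tangent 1
      (fun g => (⟨g, Γ.leftField X g⟩ : TangentBundle (𝓡 (n + r)) G)) (Γ.u x) := by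
  have hu : Γ.u x ∈ (extChartAt (𝓡 (n + r)) (Γ.u x)).source := mem_extChartAt_source _
  refine (contMDiffAt_tangentSection_iff (m := 1) hu).2 ?_
  have hκ := contMDiffAt_extChartAt_of_mem_source (I := 𝓡 (n + r)) hu
  let K : EuSp n × EuSp r → EuSp (n + r) := fun z => extChartAt (𝓡 (n + r)) (Γ.u x) (U.param z)
  have hK : ContDiffAt ℝ 2 K (U.base, 0) := by
    refine ContMDiffAt.contDiffAt (ContMDiffAt.comp (g := extChartAt (𝓡 (n + r)) (Γ.u x))
      (f := U.param) (I' := 𝓡 (n + r)) (U.base, (0 : EuSp r)) ?_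
      (U.contMDiffAt_param.of_le (by norm_num)))
    rw [U.param_zero_base]
    exact hκ.of_le (WithTop.coe_le_coe.2 (le_top (a := (2 : ℕ∞))))
  have hK' : ContDiffAt ℝ 1 (fun z => fderiv ℝ K z (U.leftVec X z)) (U.base, 0) :=
    (hK.fderiv_right (m := 1) (by norm_num)).clm_apply (U.contDiffAt_leftVec hX)
  have h1 : ContMDiffAt (𝓡 (n + r)) 𝓘(ℝ, EuSp (n + r)) 1
      (fun g => fderiv ℝ K (Γ.coord c g) (U.leftVec X (Γ.coord c g))) (Γ.u x) := by
    refine ContMDiffAt.comp (g := fun z => fderiv ℝ K z (U.leftVec X z)) (f := Γ.coord c)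
      (I' := 𝓘(ℝ, EuSp n × EuSp r)) (Γ.u x) ?_ (U.contMDiffAt_coord_u.of_le (by simp))
    rw [Γ.coord_u U.mem_source]
    exact hK'.contMDiffAt
  refine h1.congr_of_eventuallyEq ?_
  refine U.eventually_of_coord (P := fun g z => (mfderiv (𝓡 (n + r)) 𝓘(ℝ, EuSp (n + r))
    (extChartAt (𝓡 (n + r)) (Γ.u x)) g (Γ.leftField X g) : EuSp (n + r)) =
      fderiv ℝ K z (U.leftVec X z)) ?_
  filter_upwards [U.eventually_leftField X, U.eventually_mdifferentiableAt,
    U.tendsto_param.eventually ((isOpen_extChartAt_source (I := 𝓡 (n + r)) _).mem_nhds hu)]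
    with z h2 h3 h4
  have h5 : HasMFDerivAt 𝓘(ℝ, EuSp n × EuSp r) 𝓘(ℝ, EuSp (n + r)) K z _ :=
    HasMFDerivAt.comp (f := U.param) z
      ((contMDiffAt_extChartAt_of_mem_source (I := 𝓡 (n + r)) h4).mdifferentiableAt
        (by simp)).hasMFDerivAt h3.hasMFDerivAt
  have h6 := h5.mfderiv
  rw [mfderiv_eq_fderiv] at h6
  rw [h6]
  exact congrArg (mfderiv (𝓡 (n + r)) 𝓘(ℝ, EuSp (n + r)) (extChartAt (𝓡 (n + r)) (Γ.u x))
    (U.param z)) h2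

theorem eventually_mfderiv_t_leftField (U : Γ.UnitChart c x) (X : ∀ x, Γ.Alg x) :
    ∀ᶠ g in 𝓝 (Γ.u x), mfderiv (𝓡 (n + r)) (𝓡 n) Γ.t g (Γ.leftField X g) = 0 := by
  refine U.eventually_of_coord (P := fun g z => mfderiv (𝓡 (n + r)) (𝓡 n) Γ.t g
    (Γ.leftField X g) = 0) ?_
  filter_upwards [U.eventually_leftField X, U.eventually_mfderiv_t, U.eventually_t,
    U.tendsto_fst'.eventually U.eventually_symm] with z h1 h2 h3 h4
  have ht : Γ.t (U.param z) ∈ (extChartAt (𝓡 n) c).source := by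
    rw [h3]
    exact (extChartAt (𝓡 n) c).map_target h4.1
  refine (isInvertible_mfderiv_extChartAt (I := 𝓡 n) ht).injective ?_
  rw [h1, map_zero]
  exact h2 _

theorem eventually_mfderiv_s_leftField (U : Γ.UnitChart c x) (X : ∀ x, Γ.Alg x) :
    ∀ᶠ g in 𝓝 (Γ.u x), mfderiv (𝓡 (n + r)) (𝓡 n) Γ.s g (Γ.leftField X g) =
      Γ.anchor (Γ.s g) (X (Γ.s g)) := by
  refine U.eventually_of_coord (P := fun g z => mfderiv (𝓡 (n + r)) (𝓡 n) Γ.s g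
    (Γ.leftField X g) = Γ.anchor (Γ.s g) (X (Γ.s g))) ?_
  filter_upwards [U.eventually_leftField X, U.eventually_fderiv_src, U.eventually_s,
    U.tendsto_src.eventually U.eventually_symm, U.eventually_src_right,
    U.tendsto_src.eventually U.eventually_anchor] with z h1 h2 h3 h4 h5 h6
  have hs : Γ.s (U.param z) ∈ (extChartAt (𝓡 n) c).source := by
    rw [← h3]
    exact (extChartAt (𝓡 n) c).map_target h4.1
  refine (isInvertible_mfderiv_extChartAt (I := 𝓡 n) hs).injective ?_
  rw [h1]
  refine (h2 _).symm.trans ((h5 _).trans ?_)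
  refine (h6 _).symm.trans ?_
  have h7 : ∀ p, p = (extChartAt (𝓡 n) c).symm (U.src z) → (mfderiv (𝓡 n) 𝓘(ℝ, EuSp n)
      (extChartAt (𝓡 n) c) ((extChartAt (𝓡 n) c).symm (U.src z)) (Γ.anchor _ (Γ.locInv c _
        (U.localSection X (U.src z)))) : EuSp n) = mfderiv (𝓡 n) 𝓘(ℝ, EuSp n)
      (extChartAt (𝓡 n) c) p (Γ.anchor p (X p)) := by
    rintro _ rfl
    rw [localSection, Γ.locInv_locTriv c _ h4.2]
  exact h7 _ h3.symm

end UnitChart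

theorem nonempty_unitChart (x : M) : Nonempty (Γ.UnitChart x x) :=
  Γ.exists_unitChart (Γ.mem_base x) (mem_extChartAt_source x)

open VectorField

/-- Left invariant fields are `t`-related to zero near the units, hence so is their bracket. This
makes its restriction to the units a section of `𝔤`. -/
theorem mfderiv_t_mlieBracket {X Y : ∀ x, Γ.Alg x} (hX : Γ.algebroid.IsSmooth X)
    (hY : Γ.algebroid.IsSmooth Y) (x : M) :
    mfderiv (𝓡 (n + r)) (𝓡 n) Γ.t (Γ.u x)
      (mlieBracket (𝓡 (n + r)) (Γ.leftField X) (Γ.leftField Y) (Γ.u x)) = 0 := by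
  obtain ⟨U⟩ := Γ.nonempty_unitChart x
  have h0 : ContMDiffAt (𝓡 n) (𝓡 n).tangent 1
      (fun p => (⟨p, (0 : ∀ q, TangentSpace (𝓡 n) q) p⟩ : TangentBundle (𝓡 n) M)) (Γ.t (Γ.u x)) :=
    contMDiffAt_zeroSection ..
  rw [mfderiv_mlieBracket_of_related (Γ.contMDiff_t _) (U.contMDiffAt_leftField hX)
    (U.contMDiffAt_leftField hY) h0 h0 (U.eventually_mfderiv_t_leftField X)
    (U.eventually_mfderiv_t_leftField Y)]
  rw [mlieBracket_zero_left]
  rfl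

theorem exists_isBracket {X Y : ∀ x, Γ.Alg x} (hX : Γ.algebroid.IsSmooth X)
    (hY : Γ.algebroid.IsSmooth Y) : ∃ Z, Γ.algebroid.IsBracket X Y Z :=
  ⟨fun x => Γ.ofKer x _ (mfderiv_t_mlieBracket hX hY x), fun x => Γ.incl_ofKer x _ _⟩

/-- A left invariant field is `s`-related to the anchor of its section, and brackets of related
fields are related. -/
theorem anchor_bracket {X Y Z : ∀ x, Γ.Alg x} (hX : Γ.algebroid.IsSmooth X)
    (hY : Γ.algebroid.IsSmooth Y) (hZ : Γ.algebroid.IsBracket X Y Z) (x : M) :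
    Γ.anchor x (Z x) = mlieBracket (𝓡 n) (fun p => Γ.anchor p (X p))
      (fun p => Γ.anchor p (Y p)) x := by
  obtain ⟨U⟩ := Γ.nonempty_unitChart x
  have h1 := mfderiv_mlieBracket_of_related (I := 𝓡 (n + r)) (I' := 𝓡 n) (Γ.contMDiff_s (Γ.u x))
    (U.contMDiffAt_leftField hX) (U.contMDiffAt_leftField hY)
    (((contMDiff_anchor hX) _).of_le (by simp)) (((contMDiff_anchor hY) _).of_le (by simp))
    (U.eventually_mfderiv_s_leftField X) (U.eventually_mfderiv_s_leftField Y)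
  refine (Γ.anchor_coe x (Z x)).trans ?_
  refine (congrArg (mfderiv (𝓡 (n + r)) (𝓡 n) Γ.s (Γ.u x)) (hZ x)).trans ?_
  refine h1.trans ?_
  rw [Γ.s_u]

/-- The structure functions of `𝔤` with respect to a local frame. -/
theorem UnitChart.locTriv_bracket {c x : M} (U : Γ.UnitChart c x) {X Y Z : ∀ x, Γ.Alg x}
    {v w : EuSp r} (hX : Γ.algebroid.IsSmooth X) (hY : Γ.algebroid.IsSmooth Y)
    (hZ : Γ.algebroid.IsBracket X Y Z) (hXv : ∀ᶠ p in 𝓝 x, X p = Γ.locInv c p v)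
    (hYw : ∀ᶠ p in 𝓝 x, Y p = Γ.locInv c p w) :
    Γ.locTriv c x (Z x) = U.multSnd ((0, v), 0) (0, w) - U.multSnd ((0, w), 0) (0, v) := by
  -- A section with constant components `v` gives the left invariant field `(0, multRight z v)`. The
  -- bracket of two such fields involves the derivative of `multRight`, which is the second
  -- derivative of `mult`.
  have hvec : ∀ {X : ∀ x, Γ.Alg x} {v : EuSp r}, (∀ᶠ p in 𝓝 x, X p = Γ.locInv c p v) →
      ∀ᶠ z in 𝓝 (U.base, (0 : EuSp r)), U.leftVec X z = (0, U.multRight z v) := by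
    intro X v h
    have h1 : Filter.Tendsto (extChartAt (𝓡 n) c).symm (𝓝 U.base) (𝓝 x) := by
      have h2 := (contMDiffAt_extChartAt_symm_of_mem_target (I := 𝓡 n)
        U.base_mem_target).continuousAt.tendsto
      rwa [U.symm_base] at h2
    filter_upwards [U.tendsto_src.eventually (h1.eventually h),
      U.tendsto_src.eventually U.eventually_symm] with z hz hz'
    rw [UnitChart.leftVec, UnitChart.localSection, hz, Γ.locTriv_locInv c _ hz'.2]
    rfl
  have hsec : ∀ v, ContDiffAt ℝ 1 (fun z => ((0 : EuSp n), U.multRight z v)) (U.base, 0) :=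
    fun v => contDiffAt_const.prodMk ((U.contDiffAt_multRight.of_le (by norm_num)).clm_apply
      contDiffAt_const)
  have hsec' : ∀ v, ContMDiffAt 𝓘(ℝ, EuSp n × EuSp r) 𝓘(ℝ, EuSp n × EuSp r).tangent 1
      (fun z => (⟨z, ((0 : EuSp n), U.multRight z v)⟩ :
        TangentBundle 𝓘(ℝ, EuSp n × EuSp r) (EuSp n × EuSp r))) (Γ.coord c (Γ.u x)) := by
    intro v
    rw [Γ.coord_u U.mem_source]
    exact contMDiffAt_vectorSpace_iff_contDiffAt.2 (hsec v)
  have hrel : ∀ {X : ∀ x, Γ.Alg x} {v : EuSp r}, (∀ᶠ p in 𝓝 x, X p = Γ.locInv c p v) →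
      ∀ᶠ g in 𝓝 (Γ.u x), mfderiv (𝓡 (n + r)) 𝓘(ℝ, EuSp n × EuSp r) (Γ.coord c) g
        (Γ.leftField X g) = (0, U.multRight (Γ.coord c g) v) := by
    intro X v h
    filter_upwards [U.eventually_mfderiv_coord_leftField X,
      U.tendsto_coord.eventually (hvec h)] with g h1 h2
    exact h1.trans h2
  have h1 := mfderiv_mlieBracket_of_related (I := 𝓡 (n + r)) (I' := 𝓘(ℝ, EuSp n × EuSp r))
    U.contMDiffAt_coord_u (U.contMDiffAt_leftField hX) (U.contMDiffAt_leftField hY)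
    (hsec' v) (hsec' w) (hrel hXv) (hrel hYw)
  have h2 := Γ.mfderiv_coord_incl U.mem_base U.mem_source (Z x)
  have h3 := h2.symm.trans
    ((congrArg (mfderiv (𝓡 (n + r)) 𝓘(ℝ, EuSp n × EuSp r) (Γ.coord c) (Γ.u x)) (hZ x)).trans h1)
  replace h3 := h3.trans (mlieBracket_vectorSpace _ _ _)
  rw [Γ.coord_u U.mem_source] at h3
  have h4 : ∀ v a, fderiv ℝ (fun z => ((0 : EuSp n), U.multRight z v)) (U.base, 0) (0, a) =
      (0, U.multSnd ((0, a), 0) (0, v)) := by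
    intro v a
    have h5 := (U.contDiffAt_multRight.differentiableAt (by simp)).hasFDerivAt
    have h6 : HasFDerivAt (fun z => ((0 : EuSp n), U.multRight z v)) _ (U.base, (0 : EuSp r)) :=
      (hasFDerivAt_const (0 : EuSp n) _).prodMk (h5.clm_apply (hasFDerivAt_const v _))
    rw [h6.fderiv]
    simp [U.fderiv_multRight]
  refine (congrArg Prod.snd h3).trans ?_
  have h7 : ∀ v, U.multRight (extChartAt (𝓡 n) c x, 0) v = v := fun v =>
    congrArg (fun L : EuSp r →L[ℝ] EuSp r => L v) U.multRight_base
  rw [lieBracket, h7, h7]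
  refine (congrArg Prod.snd (congrArg₂ (· - ·) (h4 w v) (h4 v w))).trans ?_
  rfl

end LieGroupoid

/-! ### Local frames of the algebroid and the coefficient of the density -/

/-- The standard basis of the Euclidean space. -/
abbrev euBasis (k : ℕ) : Basis (Fin k) ℝ (EuSp k) := (EuclideanSpace.basisFun (Fin k) ℝ).toBasis

/-- The top exterior power is spanned by the volume element of a basis. -/
theorem exteriorPower.eq_smul_ιMulti_basis {V : Type*} [AddCommGroup V] [Module ℝ V] {k : ℕ}
    (e : Basis (Fin k) ℝ V) (w : ⋀[ℝ]^k V) :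
    w = exteriorPower.alternatingMapLinearEquiv e.det w • exteriorPower.ιMulti ℝ k e := by
  have h : LinearMap.id = (LinearMap.toSpanSingleton ℝ _ (exteriorPower.ιMulti ℝ k e)) ∘ₗ
      exteriorPower.alternatingMapLinearEquiv e.det := by
    refine exteriorPower.linearMap_ext ?_
    ext v : 1
    simp only [LinearMap.compAlternatingMap_apply, LinearMap.id_apply, LinearMap.comp_apply,
      exteriorPower.alternatingMapLinearEquiv_apply_ιMulti, LinearMap.toSpanSingleton_apply]
    exact AlternatingMap.eq_det_smul_basis e _ v
  exact LinearMap.congr_fun h w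

section CoordField

variable {E : Type} [NormedAddCommGroup E] [NormedSpace ℝ E] {H : Type*} [TopologicalSpace H]
  {I : ModelWithCorners ℝ E H} {N : Type*} [TopologicalSpace N] [ChartedSpace H N]
  [I.Boundaryless] [IsManifold I ∞ N]

theorem exists_contMDiff_tsupport_subset [FiniteDimensional ℝ E] [T2Space N] {x : N} {s : Set N}
    (hs : s ∈ 𝓝 x) : ∃ χ : N → ℝ, ContMDiff I 𝓘(ℝ, ℝ) ∞ χ ∧ tsupport χ ⊆ s ∧
      ∀ᶠ p in 𝓝 x, χ p = 1 := by
  obtain ⟨f, -, hf⟩ := (SmoothBumpFunction.nhds_basis_tsupport (I := I) x).mem_iff.1 hs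
  exact ⟨f, f.contMDiff, hf, f.eventuallyEq_one⟩

variable (I) in
/-- The vector field with components `v` in the chart around `c`. -/
def coordField (c : N) (v : N → E) (p : N) : TangentSpace I p :=
  (mfderiv I 𝓘(ℝ, E) (extChartAt I c) p).inverse (v p)

theorem mfderiv_extChartAt_coordField {c p : N} (hp : p ∈ (extChartAt I c).source) (v : N → E) :
    (mfderiv I 𝓘(ℝ, E) (extChartAt I c) p (coordField I c v p) : E) = v p :=
  (isInvertible_mfderiv_extChartAt (I := I) hp).self_apply_inverse _

theorem mfderiv_extChartAt_mfderiv_symm {c : N} {y : E} (hy : y ∈ (extChartAt I c).target)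
    (v : E) : (mfderiv I 𝓘(ℝ, E) (extChartAt I c) ((extChartAt I c).symm y)
      (mfderiv 𝓘(ℝ, E) I (extChartAt I c).symm y v) : E) = v := by
  have h8 := mfderiv_extChartAt_comp_mfderivWithin_extChartAt_symm (I := I) hy
  rw [ModelWithCorners.Boundaryless.range_eq_univ, mfderivWithin_univ] at h8
  exact congrArg (fun L : E →L[ℝ] E => L v) h8

theorem coordField_symm {c : N} {y : E} (hy : y ∈ (extChartAt I c).target) (v : N → E) :
    coordField I c v ((extChartAt I c).symm y) =
      mfderiv 𝓘(ℝ, E) I (extChartAt I c).symm y (v ((extChartAt I c).symm y)) := by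
  have hp := (extChartAt I c).map_target hy
  refine (isInvertible_mfderiv_extChartAt (I := I) hp).injective ?_
  exact (mfderiv_extChartAt_coordField hp v).trans (mfderiv_extChartAt_mfderiv_symm hy _).symm

theorem contMDiffAt_coordField {c p : N} (hp : p ∈ (extChartAt I c).source) {v : N → E} {m : ℕ∞}
    (hv : ContMDiffAt I 𝓘(ℝ, E) m v p) :
    ContMDiffAt I I.tangent m (fun q => (⟨q, coordField I c v q⟩ : TangentBundle I N)) p := by
  refine (contMDiffAt_tangentSection_iff hp).2 (hv.congr_of_eventuallyEq ?_)
  filter_upwards [(isOpen_extChartAt_source (I := I) c).mem_nhds hp] with q hq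
  exact mfderiv_extChartAt_coordField hq v

/-- Local fields become global after multiplication by a cutoff function, as the definitions of
smooth form and differential involve global sections only. -/
theorem contMDiff_smul_coordField {c : N} {χ : N → ℝ} (hχ : ContMDiff I 𝓘(ℝ, ℝ) ∞ χ)
    {s : Set N} (hs : IsOpen s) (hsupp : tsupport χ ⊆ s) (hsub : s ⊆ (extChartAt I c).source)
    {v : N → E} (hv : ContMDiffOn I 𝓘(ℝ, E) ∞ v s) :
    ContMDiff I I.tangent ∞
      (fun p => (⟨p, χ p • coordField I c v p⟩ : TangentBundle I N)) := by
  have h := ContMDiffOn.smul_section_of_tsupport (V := (TangentSpace I : N → Type _))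
    (s := coordField I c v) hχ.contMDiffOn hs hsupp (n := ∞) (fun p hp =>
      (contMDiffAt_coordField (hsub hp)
        (hv.contMDiffAt (hs.mem_nhds hp))).contMDiffWithinAt)
  exact h

/-- Smooth forms are smooth in coordinates. -/
theorem contDiffAt_form_apply {K : Type} [NormedField K] [NormedAlgebra ℝ K] {k : ℕ}
    {A : AlgebroidData I N} {η : A.Form K k} (hη : AlgebroidData.IsSmoothForm η) {c : N} {y : E}
    (hy : y ∈ (extChartAt I c).target) {v : Fin k → ∀ p, A.Fiber p}
    (hv : ∃ X : Fin k → ∀ p, A.Fiber p, (∀ i, A.IsSmooth (X i)) ∧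
      ∀ᶠ p in 𝓝 ((extChartAt I c).symm y), ∀ i, X i p = v i p) :
    ContDiffAt ℝ ∞ (fun y => η ((extChartAt I c).symm y)
      (fun i => v i ((extChartAt I c).symm y))) y := by
  obtain ⟨X, hX, hXv⟩ := hv
  have h2 := ((hη X hX _).comp y (contMDiffAt_extChartAt_symm_of_mem_target (I := I) hy)).contDiffAt
  refine h2.congr_of_eventuallyEq ?_
  have h3 := (contMDiffAt_extChartAt_symm_of_mem_target (I := I) hy).continuousAt
  filter_upwards [h3.eventually hXv] with z hz
  simp only [Function.comp_apply, hz]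

theorem contDiffAt_form_coordFrame {K : Type} [NormedField K] [NormedAlgebra ℝ K] {k : ℕ}
    {η : (tangentAlgebroid I N).Form K k} (hη : AlgebroidData.IsSmoothForm η) {c : N} {y : E}
    (hy : y ∈ (extChartAt I c).target) (hχ : ∃ χ : N → ℝ, ContMDiff I 𝓘(ℝ, ℝ) ∞ χ ∧
      tsupport χ ⊆ (extChartAt I c).source ∧ ∀ᶠ p in 𝓝 ((extChartAt I c).symm y), χ p = 1)
    (v : Fin k → E) :
    ContDiffAt ℝ ∞ (fun y => η ((extChartAt I c).symm y)
      (fun i => mfderiv 𝓘(ℝ, E) I (extChartAt I c).symm y (v i))) y := by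
  obtain ⟨χ, hχ, hs, h1⟩ := hχ
  have h := contDiffAt_form_apply hη hy (v := fun i => coordField I c fun _ => v i)
    ⟨fun i p => χ p • coordField I c (fun _ => v i) p, fun i => contMDiff_smul_coordField hχ
      (isOpen_extChartAt_source c) hs subset_rfl contMDiffOn_const, by
        filter_upwards [h1] with p hp i
        rw [hp, one_smul]⟩
  refine h.congr_of_eventuallyEq ?_
  filter_upwards [(isOpen_extChartAt_target (I := I) c).mem_nhds hy] with z hz
  congr 1
  funext i
  exact (coordField_symm hz fun _ => v i).symm

end CoordField

namespace LieGroupoid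

variable {n r : ℕ} {M G : Type*}
    [TopologicalSpace M] [ChartedSpace (EuSp n) M] [IsManifold (𝓡 n) ∞ M]
    [TopologicalSpace G] [ChartedSpace (EuSp (n + r)) G] [IsManifold (𝓡 (n + r)) ∞ G]
    {Γ : LieGroupoid n r M G}

theorem contMDiffAt_locInv {c p : M} (hp : p ∈ Γ.base c) (w : EuSp r) :
    ContMDiffAt (𝓡 n) ((𝓡 n).prod 𝓘(ℝ, EuSp r)) ∞
      (fun x => (⟨x, Γ.locInv c x w⟩ : TotalSpace (EuSp r) Γ.Alg)) p := by
  refine (Γ.contMDiffAt_algSection_iff hp).2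
    ((contMDiffAt_const (c := w)).congr_of_eventuallyEq ?_)
  filter_upwards [(Γ.isOpen_base c).mem_nhds hp] with q hq
  exact Γ.locTriv_locInv c q hq w

theorem isSmooth_smul_locInv {c : M} {χ : M → ℝ} (hχ : ContMDiff (𝓡 n) 𝓘(ℝ, ℝ) ∞ χ)
    (hsupp : tsupport χ ⊆ Γ.base c) (w : EuSp r) :
    Γ.algebroid.IsSmooth (fun p => χ p • Γ.locInv c p w) := by
  have h := ContMDiffOn.smul_section_of_tsupport (V := Γ.Alg) (F := EuSp r)
    (s := fun p => Γ.locInv c p w) hχ.contMDiffOn (Γ.isOpen_base c) hsupp (n := ∞) (fun p hp =>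
      (contMDiffAt_locInv hp w).contMDiffWithinAt)
  exact h

theorem locInv_repr {c p : M} (hp : p ∈ Γ.base c) (X : Γ.Alg p) :
    X = ∑ m, (euBasis r).repr (Γ.locTriv c p X) m • Γ.locInv c p (euBasis r m) := by
  have h := congrArg (Γ.frameEquiv hp).symm ((euBasis r).sum_repr (Γ.locTriv c p X))
  rw [map_sum] at h
  refine ((Γ.locInv_locTriv c p hp X).symm.trans h.symm).trans ?_
  exact Finset.sum_congr rfl fun m _ => map_smul (Γ.frameEquiv hp).symm _ _

/-- The local frame of `𝔤` around `c`, as a basis. -/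
def frameBasis {c p : M} (hp : p ∈ Γ.base c) : Basis (Fin r) ℝ (Γ.Alg p) :=
  (euBasis r).map (Γ.frameEquiv hp).symm

/-- The determinant form of the local frame around `c`. -/
def detForm (Γ : LieGroupoid n r M G) (c : M) : Γ.algebroid.Form ℝ r := fun p =>
  (euBasis r).det.compLinearMap (Γ.locTriv c p).toLinearMap

theorem detForm_eq {c p : M} (hp : p ∈ Γ.base c) : Γ.detForm c p = (Γ.frameBasis hp).det := by
  refine AlternatingMap.ext fun v => ?_
  exact (Basis.det_map (euBasis r) (Γ.frameEquiv hp).symm v).symm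

/-- These are the test forms which extract the coefficient of the density. In the trivialisation the
determinant is a polynomial in the components. -/
theorem isSmoothForm_smul_detForm {c : M} {χ : M → ℝ} (hχ : ContMDiff (𝓡 n) 𝓘(ℝ, ℝ) ∞ χ)
    (hsupp : tsupport χ ⊆ Γ.base c) :
    AlgebroidData.IsSmoothForm (A := Γ.algebroid) (fun p => χ p • Γ.detForm c p) := by
  intro X hX
  refine contMDiff_of_tsupport fun p hp => ?_
  have hp' : p ∈ Γ.base c := hsupp (by
    refine closure_mono ?_ hp
    intro q hq h0
    refine hq ?_
    change χ q • Γ.detForm c q _ = 0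
    rw [h0, zero_smul])
  refine (hχ p).smul ?_
  have h : ∀ i j, ContMDiffAt (𝓡 n) 𝓘(ℝ, ℝ) ∞
      (fun q => (euBasis r).repr (Γ.locTriv c q (X j q)) i) p := by
    intro i j
    have h1 := (Γ.contMDiffAt_algSection_iff hp').1 (hX j p)
    exact (((euBasis r).coord i).toContinuousLinearMap.contMDiff.contMDiffAt).comp p h1
  have h2 : ∀ q, Γ.detForm c q (fun i => X i q) = ∑ σ : Equiv.Perm (Fin r),
      (Equiv.Perm.sign σ : ℤ) • ∏ i, (euBasis r).repr (Γ.locTriv c q (X i q)) (σ i) := by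
    intro q
    change (euBasis r).det (fun i => Γ.locTriv c q (X i q)) = _
    rw [Basis.det_apply, Matrix.det_apply]
    rfl
  have h3 : ContMDiffAt (𝓡 n) 𝓘(ℝ, ℝ) ∞ (fun q => ∑ σ : Equiv.Perm (Fin r),
      (Equiv.Perm.sign σ : ℤ) • ∏ i, (euBasis r).repr (Γ.locTriv c q (X i q)) (σ i)) p := by
    refine contMDiffAt_finsetSum fun σ _ => ?_
    simp only [zsmul_eq_mul]
    exact contMDiffAt_const.mul (contMDiffAt_finsetProd fun i _ => h _ _)
  exact h3.congr_of_eventuallyEq (Filter.Eventually.of_forall h2)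

/-- The coefficient of a transversal density in the coordinates around `c`. -/
def baseCoeff (Ω : Γ.Density) (c : M) (y : EuSp n) : ℝ :=
  pairing (Γ.detForm c ((extChartAt (𝓡 n) c).symm y)) (Ω ((extChartAt (𝓡 n) c).symm y))
    (coordFrame (𝓡 n) (euBasis n) c y)

theorem apply_coordFrame_eq_baseCoeff (Ω : Γ.Density) {c : M} {y : EuSp n}
    (hy : (extChartAt (𝓡 n) c).symm y ∈ Γ.base c) :
    Ω _ (coordFrame (𝓡 n) (euBasis n) c y) = baseCoeff Ω c y •
      exteriorPower.ιMulti ℝ r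
        (fun i => Γ.locInv c ((extChartAt (𝓡 n) c).symm y) (euBasis r i)) := by
  have h := exteriorPower.eq_smul_ιMulti_basis (Γ.frameBasis hy)
    (Ω _ (coordFrame (𝓡 n) (euBasis n) c y))
  rw [← detForm_eq hy] at h
  exact h

/-- The points of the chart around `c` over which `𝔤` is trivialised. -/
def baseRegion (Γ : LieGroupoid n r M G) (c : M) : Set (EuSp n) :=
  (extChartAt (𝓡 n) c).target ∩ (extChartAt (𝓡 n) c).symm ⁻¹'
    ((extChartAt (𝓡 n) c).source ∩ Γ.base c)

theorem isOpen_baseRegion (c : M) : IsOpen (Γ.baseRegion c) :=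
  (continuousOn_extChartAt_symm c).isOpen_inter_preimage (isOpen_extChartAt_target c)
    ((isOpen_extChartAt_source c).inter (Γ.isOpen_base c))

variable [T2Space M]

/-- Smoothness of `Ω` is formulated through pairings with smooth forms on `𝔤`; pairing with the
cut-off determinant form yields the coefficient near each point. -/
theorem contDiffOn_baseCoeff {Ω : Γ.Density} (hΩ : Γ.IsInvariantVolume Ω) (c : M) :
    ContDiffOn ℝ ∞ (baseCoeff Ω c) (Γ.baseRegion c) := by
  intro y hy
  refine ContDiffAt.contDiffWithinAt ?_
  obtain ⟨χ, hχ, hs, h1⟩ := exists_contMDiff_tsupport_subset (I := 𝓡 n)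
    ((Γ.isOpen_base c).mem_nhds hy.2.2)
  have h2 := contDiffAt_form_coordFrame (hΩ.smooth _ (isSmoothForm_smul_detForm hχ hs)) hy.1
    (exists_contMDiff_tsupport_subset (I := 𝓡 n)
      ((isOpen_extChartAt_source c).mem_nhds hy.2.1)) (euBasis n)
  refine h2.congr_of_eventuallyEq ?_
  have h3 := (contMDiffAt_extChartAt_symm_of_mem_target (I := 𝓡 n) hy.1).continuousAt
  filter_upwards [h3.eventually h1] with z hz
  rw [hz, one_smul]
  rfl

/-- The anchors of the local frame in coordinates. -/
def baseVec (Γ : LieGroupoid n r M G) (c : M) (j : Fin r) : EuSp n → EuSp n :=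
  chartField (𝓡 n) c (fun p => Γ.anchor p (Γ.locInv c p (euBasis r j)))

theorem exists_extension_locInv {c x : M} (hx : x ∈ Γ.base c) :
    ∃ X : EuSp r → ∀ p, Γ.Alg p, (∀ w, Γ.algebroid.IsSmooth (X w)) ∧
      ∀ᶠ p in 𝓝 x, ∀ w, X w p = Γ.locInv c p w := by
  obtain ⟨χ, hχ, hs, h1⟩ := exists_contMDiff_tsupport_subset (I := 𝓡 n)
    ((Γ.isOpen_base c).mem_nhds hx)
  refine ⟨fun w p => χ p • Γ.locInv c p w, isSmooth_smul_locInv hχ hs, ?_⟩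
  filter_upwards [h1] with p hp w
  rw [hp, one_smul]

theorem contMDiffAt_anchor_locInv {c x : M} (hx : x ∈ Γ.base c) (w : EuSp r) :
    ContMDiffAt (𝓡 n) (𝓡 n).tangent ∞
      (fun p => (⟨p, Γ.anchor p (Γ.locInv c p w)⟩ : TangentBundle (𝓡 n) M)) x := by
  obtain ⟨X, hX, hXe⟩ := exists_extension_locInv hx
  refine (contMDiff_anchor (hX w) x).congr_of_eventuallyEq ?_
  filter_upwards [hXe] with p hp
  rw [hp]

theorem contDiffOn_baseVec (c : M) (j : Fin r) :
    ContDiffOn ℝ ∞ (Γ.baseVec c j) (Γ.baseRegion c) := fun _ hy =>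
  (contDiffAt_chartField (m := ⊤) hy.1
    (contMDiffAt_anchor_locInv hy.2.2 _)).contDiffWithinAt

theorem mfderiv_baseVec {c : M} {y : EuSp n} (hy : y ∈ (extChartAt (𝓡 n) c).target) (j : Fin r) :
    Γ.anchor _ (Γ.locInv c ((extChartAt (𝓡 n) c).symm y) (euBasis r j)) =
      mfderiv 𝓘(ℝ, EuSp n) (𝓡 n) (extChartAt (𝓡 n) c).symm y (Γ.baseVec c j y) :=
  (isInvertible_mfderiv_extChartAt (I := 𝓡 n) ((extChartAt (𝓡 n) c).map_target hy)).injective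
    (mfderiv_extChartAt_mfderiv_symm hy _).symm

/-- Extensions of the local frame with their structure functions. -/
theorem exists_extension_bracket {Ω : Γ.Density} (hΩ : Γ.IsInvariantVolume Ω) {c : M} {y : EuSp n}
    (hy : y ∈ Γ.baseRegion c) :
    ∃ C : Fin r → Fin r → Fin r → ℝ, (∀ i j m, C i j m = - C j i m) ∧
      (∀ i j, ∀ X Y Z : ∀ p, Γ.Alg p, Γ.algebroid.IsSmooth X → Γ.algebroid.IsSmooth Y →
        Γ.algebroid.IsBracket X Y Z →
        (∀ᶠ p in 𝓝 ((extChartAt (𝓡 n) c).symm y), X p = Γ.locInv c p (euBasis r i)) →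
        (∀ᶠ p in 𝓝 ((extChartAt (𝓡 n) c).symm y), Y p = Γ.locInv c p (euBasis r j)) →
        Z ((extChartAt (𝓡 n) c).symm y) =
          ∑ m, C i j m • Γ.locInv c ((extChartAt (𝓡 n) c).symm y) (euBasis r m)) ∧
      (∀ j, divergence (euBasis n) (fun z => baseCoeff Ω c z • Γ.baseVec c j z) y =
        baseCoeff Ω c y * ∑ i, C i j i) := by
  -- A unit chart at the point itself is used, so the structure functions at that point are the
  -- antisymmetrised second derivative of its multiplication. Only their values at the single point
  -- are needed.
  obtain ⟨U⟩ := Γ.exists_unitChart hy.2.2 hy.2.1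
  have hbase : U.base = y := (extChartAt (𝓡 n) c).right_inv hy.1
  refine ⟨fun i j m => (euBasis r).repr (U.multSnd ((0, euBasis r i), 0) (0, euBasis r j) -
    U.multSnd ((0, euBasis r j), 0) (0, euBasis r i)) m, fun i j m => ?_, ?_, fun j => ?_⟩
  · beta_reduce
    rw [← neg_sub, map_neg]
    rfl
  · intro i j X Y Z hX hY hZ hXi hYj
    beta_reduce
    rw [← U.locTriv_bracket hX hY hZ hXi hYj]
    exact locInv_repr hy.2.2 _
  · have hnear := (Γ.isOpen_baseRegion c).mem_nhds hy
    have h1 := U.divergence_anchorVec hΩ (euBasis n) (euBasis r) (f := baseCoeff Ω c) (by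
      rw [hbase]
      filter_upwards [hnear] with z hz
      exact apply_coordFrame_eq_baseCoeff Ω hz.2.2) (by
      rw [hbase]
      exact (((contDiffOn_baseCoeff hΩ c).contDiffAt hnear).differentiableAt (by simp)))
      (euBasis r j)
    rw [hbase] at h1
    rw [← h1]
    have h2 : (fun z => baseCoeff Ω c z • Γ.baseVec c j z) =ᶠ[𝓝 y]
        fun z => baseCoeff Ω c z • U.anchorVec z (euBasis r j) := by
      have h3 := U.eventually_anchor
      rw [hbase] at h3
      filter_upwards [h3] with z hz
      exact congrArg (baseCoeff Ω c z • ·) (hz _)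
    rw [divergence, divergence, h2.fderiv_eq]

end LieGroupoid

/-! ### Continuity and additivity of densities -/

section Density

variable {E : Type} [NormedAddCommGroup E] [NormedSpace ℝ E] [FiniteDimensional ℝ E]
  {H : Type*} [TopologicalSpace H]
  {I : ModelWithCorners ℝ E H} {N : Type*} [TopologicalSpace N] [ChartedSpace H N]
  {ι : Type*} [Fintype ι] {b : Basis ι ℝ E} {vol : ∀ p : N, TangentSpace I p [⋀^ι]→ₗ[ℝ] ℝ}
  {η η' : ∀ p : N, TangentSpace I p [⋀^ι]→ₗ[ℝ] ℂ}

theorem Real.continuousAt_sign {x : ℝ} (hx : x ≠ 0) : ContinuousAt Real.sign x := by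
  rcases lt_or_gt_of_ne hx with h | h
  · refine continuousAt_const.congr (f := fun _ => (-1 : ℝ)) ?_
    filter_upwards [gt_mem_nhds h] with z hz
    exact (Real.sign_of_neg hz).symm
  · refine continuousAt_const.congr (f := fun _ => (1 : ℝ)) ?_
    filter_upwards [lt_mem_nhds h] with z hz
    exact (Real.sign_of_pos hz).symm

theorem continuousOn_chartDensity {c : N} {U : Set E}
    (hvol : ContinuousOn (fun y => vol _ (coordFrame I b c y)) U)
    (hvol0 : ∀ y ∈ U, vol _ (coordFrame I b c y) ≠ 0)
    (hη : ContinuousOn (fun y => η _ (coordFrame I b c y)) U) :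
    ContinuousOn (chartDensity I b vol η c) U := by
  refine ContinuousOn.mul (fun y hy => ?_) hη
  exact Complex.continuous_ofReal.continuousAt.comp_continuousWithinAt
    (ContinuousAt.comp_continuousWithinAt (f := fun y => vol _ (coordFrame I b c y))
      (Real.continuousAt_sign (hvol0 y hy)) (hvol y hy))

variable [I.Boundaryless] [IsManifold I ∞ N]

variable (I b) in
/-- The coordinate frame, as a basis of the tangent space. -/
def coordBasis {c : N} {y : E} (hy : y ∈ (extChartAt I c).target) :
    Basis ι ℝ (TangentSpace I ((extChartAt I c).symm y)) :=
  b.map (LinearEquiv.ofBijective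
    (show E →ₗ[ℝ] TangentSpace I ((extChartAt I c).symm y) from
      (mfderiv 𝓘(ℝ, E) I (extChartAt I c).symm y).toLinearMap) (by
    have h := (isInvertible_mfderivWithin_extChartAt_symm (I := I) hy).bijective
    rw [ModelWithCorners.Boundaryless.range_eq_univ, mfderivWithin_univ] at h
    exact h))

theorem AlternatingMap.apply_basis_ne_zero {V F : Type*} [AddCommGroup V] [Module ℝ V]
    [AddCommGroup F] [Module ℝ F]
    {f : V [⋀^ι]→ₗ[ℝ] F} (hf : f ≠ 0) (e : Basis ι ℝ V) : f e ≠ 0 := by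
  classical
  intro h
  refine hf (AlternatingMap.ext fun v => ?_)
  rw [AlternatingMap.eq_det_smul_basis e, h, smul_zero]
  rfl

theorem apply_coordFrame_ne_zero (hvol : ∀ p, vol p ≠ 0) {c : N} {y : E}
    (hy : y ∈ (extChartAt I c).target) : vol _ (coordFrame I b c y) ≠ 0 :=
  AlternatingMap.apply_basis_ne_zero (hvol _) (coordBasis I b hy)

theorem AlgebroidData.UnimodularFrame.continuousOn_pairing {A : AlgebroidData I N} {k : ℕ}
    {W : ∀ p : N, TangentSpace I p [⋀^ι]→ₗ[ℝ] ⋀[ℝ]^(k + 1) (A.Fiber p)} {c : N} {U : Set E}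
    (F : A.UnimodularFrame b W c U) (hU : U ⊆ (extChartAt I c).target) {γ : A.Form ℂ (k + 1)}
    (hγ : IsSmoothForm γ) :
    ContinuousOn (fun y => pairing (γ _) (W _) (coordFrame I b c y)) U := by
  have h1 : ContinuousOn (fun y => F.coeff y • γ ((extChartAt I c).symm y)
      (fun j => F.frame j ((extChartAt I c).symm y))) U := by
    refine F.contDiffOn_coeff.continuousOn.smul fun y hy => ?_
    obtain ⟨X, B, C, hX, -, hXE, -⟩ := F.exists_extension y hy
    exact (contDiffAt_form_apply (K := ℂ) hγ (hU hy) ⟨X, hX, hXE⟩).continuousAt.continuousWithinAt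
  exact h1.congr fun y hy => F.pairing_apply (K := ℂ) γ hy

variable [MeasurableSpace E] [BorelSpace E]

/-- Each `formIntegral` may choose its own charts, so additivity is not formal. Computed with one
common partition, it is additivity of the integrals over the regions. -/
theorem ChartPartition.formIntegral_sub (P : ChartPartition I N) {Z : Set N} (hZ : IsCompact Z)
    (hη : ∀ l, ContinuousOn (chartDensity I b vol η (P.center l)) (P.region l))
    (h0 : ∀ l, ∀ y ∈ P.region l, (extChartAt I (P.center l)).symm y ∉ Z →
      chartDensity I b vol η (P.center l) y = 0)
    (hη' : ∀ l, ContinuousOn (chartDensity I b vol η' (P.center l)) (P.region l))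
    (h0' : ∀ l, ∀ y ∈ P.region l, (extChartAt I (P.center l)).symm y ∉ Z →
      chartDensity I b vol η' (P.center l) y = 0) :
    formIntegral I b vol (fun p => η p - η' p) = formIntegral I b vol η - formIntegral I b vol η' := by
  have hsub : ∀ l y, chartDensity I b vol (fun p => η p - η' p) (P.center l) y =
      chartDensity I b vol η (P.center l) y - chartDensity I b vol η' (P.center l) y :=
    fun l y => mul_sub _ _ _
  obtain ⟨i1, e1⟩ := P.formIntegral_eq hZ hη h0
  obtain ⟨i2, e2⟩ := P.formIntegral_eq hZ hη' h0'
  obtain ⟨i3, e3⟩ := P.formIntegral_eq (η := fun p => η p - η' p) (vol := vol) (b := b) hZ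
    (fun l => ((hη l).sub (hη' l)).congr fun y _ => hsub l y)
    (fun l y hy hyZ => by rw [hsub, h0 l y hy hyZ, h0' l y hy hyZ, sub_zero])
  rw [e1, e2, e3, ← Finset.sum_sub_distrib]
  refine Finset.sum_congr rfl fun l _ => ?_
  rw [← MeasureTheory.integral_sub (i1 l) (i2 l)]
  simp only [hsub, mul_sub]

/-- A smooth partition of unity of a compact manifold subordinate to parts of charts. -/
theorem exists_chartPartition [CompactSpace N] [T2Space N] {s : N → Set N}
    (hs : ∀ c, IsOpen (s c)) (hmem : ∀ c, c ∈ s c) (hsub : ∀ c, s c ⊆ (extChartAt I c).source) :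
    ∃ P : ChartPartition I N, ∀ l, P.dom l = s (P.center l) := by
  obtain ⟨t, ht⟩ := isCompact_univ.elim_finite_subcover s hs fun p _ => mem_iUnion.2 ⟨p, hmem p⟩
  obtain ⟨f, hf⟩ := SmoothPartitionOfUnity.exists_isSubordinate (M := N) I isClosed_univ
    (fun l : Fin t.card => s (t.equivFin.symm l)) (fun l => hs _) (fun p hp => by
      obtain ⟨c, hc, hpc⟩ := mem_iUnion₂.1 (ht hp)
      exact mem_iUnion.2 ⟨t.equivFin ⟨c, hc⟩, by simpa using hpc⟩)
  exact ⟨{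
    size := t.card
    center := fun l => t.equivFin.symm l
    weight := fun l => f l
    contMDiff_weight := fun l => (f l).contMDiff
    sum_weight := fun p => by
      rw [← f.sum_eq_one (mem_univ p), finsum_eq_sum_of_fintype]
    dom := fun l => s (t.equivFin.symm l)
    isOpen_dom := fun l => hs _
    dom_subset := fun l => hsub _
    tsupport_weight := hf }, fun l => rfl⟩

end Density

/-! ### The integral over the base depends only on the cohomology class -/

namespace LieGroupoid

section Base

variable {n r k : ℕ} {M G : Type*}
    [TopologicalSpace M] [ChartedSpace (EuSp n) M] [IsManifold (𝓡 n) ∞ M]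
    [TopologicalSpace G]

theorem continuousOn_orientation [T2Space M] {vol : (tangentAlgebroid (𝓡 n) M).Form ℝ n}
    (hvol : IsOrientationForm vol) (c : M) :
    ContinuousOn (fun y => vol ((extChartAt (𝓡 n) c).symm y) (coordFrame (𝓡 n) (euBasis n) c y))
      (extChartAt (𝓡 n) c).target :=
  fun _ hy => (contDiffAt_form_coordFrame hvol.smooth hy (exists_contMDiff_tsupport_subset
    ((isOpen_extChartAt_source (I := 𝓡 n) c).mem_nhds ((extChartAt (𝓡 n) c).map_target hy)))
      (euBasis n)).continuousAt.continuousWithinAt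

/-- The unimodular frames of `𝔤` given by the local trivialisations. -/
theorem nonempty_unimodularFrame [T2Space M] [ChartedSpace (EuSp (n + (k + 1))) G]
    [IsManifold (𝓡 (n + (k + 1))) ∞ G] {Γ : LieGroupoid n (k + 1) M G} {Ω : Γ.Density}
    (hΩ : Γ.IsInvariantVolume Ω) (c : M) :
    Nonempty (Γ.algebroid.UnimodularFrame (euBasis n) Ω c (Γ.baseRegion c)) :=
  ⟨{
    frame := fun j p => Γ.locInv c p (euBasis (k + 1) j)
    coeff := baseCoeff Ω c
    vec := Γ.baseVec c
    contDiffOn_coeff := contDiffOn_baseCoeff hΩ c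
    contDiffOn_vec := contDiffOn_baseVec c
    apply_coordFrame := fun y hy => apply_coordFrame_eq_baseCoeff Ω hy.2.2
    anchor_frame := fun y hy j => mfderiv_baseVec hy.1 j
    exists_extension := fun y hy => by
      obtain ⟨X, hX, hXe⟩ := exists_extension_locInv (Γ := Γ) hy.2.2
      obtain ⟨C, hC, hB, hdiv⟩ := exists_extension_bracket hΩ hy
      choose B hB' using fun i j : Fin (k + 1) =>
        exists_isBracket (hX (euBasis (k + 1) i)) (hX (euBasis (k + 1) j))
      refine ⟨fun j => X (euBasis (k + 1) j), B, C, fun j => hX _, fun i j _ => hB' i j, ?_, hC,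
        fun i j _ => hB i j _ _ _ (hX _) (hX _) (hB' i j) ?_ ?_, hdiv⟩
      · filter_upwards [hXe] with p hp j
        exact hp _
      · filter_upwards [hXe] with p hp
        exact hp _
      · filter_upwards [hXe] with p hp
        exact hp _ }⟩

variable [ChartedSpace (EuSp (n + r)) G] [IsManifold (𝓡 (n + r)) ∞ G]
  {Γ : LieGroupoid n r M G} [CompactSpace M] [T2Space M]

variable (Γ) in
theorem exists_basePartition : ∃ P : ChartPartition (𝓡 n) M, ∀ l,
    P.dom l = (extChartAt (𝓡 n) (P.center l)).source ∩ Γ.base (P.center l) :=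
  exists_chartPartition
    (fun c => (isOpen_extChartAt_source c).inter (Γ.isOpen_base c))
    (fun c => ⟨mem_extChartAt_source c, Γ.mem_base c⟩) (fun _ => inter_subset_left)

/-- The pairing of a form with a density, in coordinates. -/
theorem pairing_density_coordFrame (Ω : Γ.Density) (α : Γ.algebroid.Form ℂ r) {c : M} {y : EuSp n}
    (hy : (extChartAt (𝓡 n) c).symm y ∈ Γ.base c) :
    pairing (α _) (Ω _) (coordFrame (𝓡 n) (euBasis n) c y) = baseCoeff Ω c y •
      α ((extChartAt (𝓡 n) c).symm y)
        (fun i => Γ.locInv c ((extChartAt (𝓡 n) c).symm y) (euBasis r i)) := by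
  refine (congrArg (exteriorPower.alternatingMapLinearEquiv (α _))
    (apply_coordFrame_eq_baseCoeff Ω hy)).trans ?_
  refine (map_smul (exteriorPower.alternatingMapLinearEquiv (α _)) _ _).trans ?_
  refine congrArg (baseCoeff Ω c y • ·) ?_
  exact exteriorPower.alternatingMapLinearEquiv_apply_ιMulti _ _

theorem contDiffAt_form_locInv {α : Γ.algebroid.Form ℂ r} (hα : AlgebroidData.IsSmoothForm α)
    {c : M} {y : EuSp n} (hy : y ∈ Γ.baseRegion c) :
    ContDiffAt ℝ ∞ (fun y => α ((extChartAt (𝓡 n) c).symm y)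
        (fun i => Γ.locInv c ((extChartAt (𝓡 n) c).symm y) (euBasis r i))) y := by
  obtain ⟨X, hX, hXe⟩ := exists_extension_locInv (Γ := Γ) hy.2.2
  refine contDiffAt_form_apply hα hy.1 (v := fun i p => Γ.locInv c p (euBasis r i))
    ⟨fun i => X (euBasis r i), fun i => hX _, ?_⟩
  filter_upwards [hXe] with p hp i
  exact hp _

theorem continuousOn_baseDensity {vol : (tangentAlgebroid (𝓡 n) M).Form ℝ n}
    (hvol : IsOrientationForm vol) {Ω : Γ.Density} (hΩ : Γ.IsInvariantVolume Ω)
    {α : Γ.algebroid.Form ℂ r} (hα : AlgebroidData.IsSmoothForm α) (c : M) :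
    ContinuousOn (chartDensity (𝓡 n) (euBasis n) vol (fun x => pairing (α x) (Ω x)) c)
      (Γ.baseRegion c) := by
  refine continuousOn_chartDensity ((continuousOn_orientation hvol c).mono inter_subset_left)
    (fun y hy => apply_coordFrame_ne_zero hvol.ne_zero hy.1) ?_
  refine ContinuousOn.congr (f := fun y => baseCoeff Ω c y • α ((extChartAt (𝓡 n) c).symm y)
        (fun i => Γ.locInv c ((extChartAt (𝓡 n) c).symm y) (euBasis r i)))
    ((contDiffOn_baseCoeff hΩ c).continuousOn.smul fun y hy =>
      (contDiffAt_form_locInv hα hy).continuousAt.continuousWithinAt)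
    fun y hy => pairing_density_coordFrame Ω α hy.2.2

theorem region_eq_baseRegion {P : ChartPartition (𝓡 n) M} (hP : ∀ l,
    P.dom l = (extChartAt (𝓡 n) (P.center l)).source ∩ Γ.base (P.center l)) (l) :
    P.region l = Γ.baseRegion (P.center l) := by
  rw [ChartPartition.region, hP]
  rfl

/-- The integral `∫_M ⟨α, Ω⟩` depends only on the class of `α`. -/
theorem baseIntegral_eq_of_isExact {volM : (tangentAlgebroid (𝓡 n) M).Form ℝ n}
    (hvolM : IsOrientationForm volM) {Ω : Γ.Density} (hΩ : Γ.IsInvariantVolume Ω)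
    {α α' : Γ.algebroid.Form ℂ r} (hα : AlgebroidData.IsSmoothForm α)
    (hα' : AlgebroidData.IsSmoothForm α') (h : AlgebroidData.IsExact (α' - α)) :
    Γ.baseIntegral volM α' Ω = Γ.baseIntegral volM α Ω := by
  let _ : MeasurableSpace (EuSp n) := borel (EuSp n)
  have : BorelSpace (EuSp n) := ⟨rfl⟩
  obtain ⟨P, hP⟩ := Γ.exists_basePartition
  cases r with
  | zero =>
    -- There are no forms of degree `-1`: in degree zero exactness means vanishing.
    have h0 : α' - α = 0 := h
    rw [sub_eq_zero.1 h0]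
  | succ k =>
    obtain ⟨β, hβ, hβα⟩ : ∃ β, AlgebroidData.IsSmoothForm β ∧
      AlgebroidData.IsDifferential β (α' - α) := h
    have F : ∀ l, Γ.algebroid.UnimodularFrame (euBasis n) Ω (P.center l) (P.region l) := fun l => by
      rw [region_eq_baseRegion hP]
      exact (nonempty_unimodularFrame hΩ _).some
    have h1 := formIntegral_pairing_differential_eq_zero (vol := volM) P
      (fun l => (continuousOn_orientation hvolM _).mono inter_subset_left)
      (fun l y hy => apply_coordFrame_ne_zero hvolM.ne_zero hy.1) F hβ
      -- On the compact manifold `M` every primitive has compact support.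
      isClosed_closure.isCompact hβα
    have h2 := P.formIntegral_sub (b := euBasis n) (vol := volM)
      (η := fun x => pairing (α' x) (Ω x)) (η' := fun x => pairing (α x) (Ω x)) isCompact_univ
      (fun l => by
        rw [region_eq_baseRegion hP]
        exact continuousOn_baseDensity hvolM hΩ hα' _) (fun _ _ _ h => absurd (mem_univ _) h)
      (fun l => by
        rw [region_eq_baseRegion hP]
        exact continuousOn_baseDensity hvolM hΩ hα _) (fun _ _ _ h => absurd (mem_univ _) h)
    have h3 : (fun x => pairing ((α' - α) x) (Ω x)) =
        fun x => pairing (α' x) (Ω x) - pairing (α x) (Ω x) := by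
      funext x
      refine AlternatingMap.ext fun v => ?_
      change exteriorPower.alternatingMapLinearEquiv (α' x - α x) (Ω x v) = _
      rw [map_sub]
      rfl
    rw [h3, h2] at h1
    exact sub_eq_zero.1 h1

end Base

end LieGroupoid

/-! ### Charts of the dual bundle -/

namespace LieGroupoid

variable {n r : ℕ} {M G : Type*}
    [TopologicalSpace M] [ChartedSpace (EuSp n) M] [IsManifold (𝓡 n) ∞ M]
    [TopologicalSpace G] [ChartedSpace (EuSp (n + r)) G] [IsManifold (𝓡 (n + r)) ∞ G]
    (Γ : LieGroupoid n r M G)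

/-- The local trivialisation of `𝔤*` around `c`. -/
abbrev dualTriv (c : M) := trivializationAt (EuSp r →L[ℝ] ℝ)
  (fun x : M => Γ.Alg x →L[ℝ] Bundle.Trivial M ℝ x) c

theorem dualTriv_baseSet (c : M) : (Γ.dualTriv c).baseSet = Γ.base c := by
  have h : (Γ.dualTriv c).baseSet = (trivializationAt (EuSp r) Γ.Alg c).baseSet ∩
    (trivializationAt ℝ (Bundle.Trivial M ℝ) c).baseSet := hom_trivializationAt_baseSet ..
  rw [h]
  exact inter_univ _

theorem symmL_eq_locInv {c x : M} (hx : x ∈ Γ.base c) (w : EuSp r) :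
    (trivializationAt (EuSp r) Γ.Alg c).symmL ℝ x w = Γ.locInv c x w := by
  refine Γ.locTriv_injective c x hx ?_
  rw [Γ.locTriv_locInv c x hx]
  have h := (trivializationAt (EuSp r) Γ.Alg c).continuousLinearMapAt_symmL (R := ℝ) hx w
  rwa [Trivialization.continuousLinearMapAt_apply_of_mem ℝ _ hx] at h

/-- The trivialisation of a bundle of homomorphisms composes with the inverse trivialisation of `𝔤`;
the components of a covector are its values on the local frame. -/
theorem dualTriv_apply {c : M} {p : Γ.DualTotal} (hp : p.1 ∈ Γ.base c) (w : EuSp r) :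
    (Γ.dualTriv c p).2 w = p.2 (Γ.locInv c p.1 w) := by
  rw [← Γ.symmL_eq_locInv hp]
  refine (congrArg (fun q : M × (EuSp r →L[ℝ] ℝ) => q.2 w) (hom_trivializationAt_apply ..)).trans ?_
  simp [ContinuousLinearMap.inCoordinates]

/-- The chart of `𝔤*` over the chart of `M` around `c`. -/
abbrev dualChart (c : M) := extChartAt (dualModel n r) (⟨c, 0⟩ : Γ.DualTotal)

theorem mem_dualChart_source {c : M} {p : Γ.DualTotal} : p ∈ (Γ.dualChart c).source ↔
    p.1 ∈ Γ.base c ∧ p.1 ∈ (extChartAt (𝓡 n) c).source := by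
  rw [dualChart, FiberBundle.extChartAt, PartialEquiv.trans_source]
  simp only [PartialEquiv.prod_source, PartialEquiv.refl_source, mem_inter_iff, mem_preimage,
    mem_prod, mem_univ, and_true]
  change p ∈ (Γ.dualTriv c).source ∧ (Γ.dualTriv c p).1 ∈ _ ↔ _
  rw [Trivialization.mem_source, Γ.dualTriv_baseSet]
  refine and_congr_right fun h => ?_
  rw [Trivialization.coe_fst' _ (by rwa [Γ.dualTriv_baseSet])]

theorem dualChart_apply {c : M} {p : Γ.DualTotal} (hp : p.1 ∈ Γ.base c) :
    Γ.dualChart c p = (extChartAt (𝓡 n) c p.1, (Γ.dualTriv c p).2) := by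
  rw [dualChart, FiberBundle.extChartAt]
  change (extChartAt (𝓡 n) c (Γ.dualTriv c p).1, _) = _
  rw [Trivialization.coe_fst' _ (by rwa [Γ.dualTriv_baseSet])]
  rfl

theorem dualChart_fst {c : M} {p : Γ.DualTotal} (hp : p.1 ∈ Γ.base c) :
    (Γ.dualChart c p).1 = extChartAt (𝓡 n) c p.1 := congrArg Prod.fst (Γ.dualChart_apply hp)

theorem dualChart_snd {c : M} {p : Γ.DualTotal} (hp : p.1 ∈ Γ.base c) (w : EuSp r) :
    (Γ.dualChart c p).2 w = p.2 (Γ.locInv c p.1 w) := by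
  rw [Γ.dualChart_apply hp]
  exact Γ.dualTriv_apply hp w

/-- The point of `𝔤*` with given coordinates. -/
def dualPoint (c : M) (z : EuSp n × (EuSp r →L[ℝ] ℝ)) : Γ.DualTotal :=
  ⟨(extChartAt (𝓡 n) c).symm z.1,
    (z.2.comp (Γ.locTriv c ((extChartAt (𝓡 n) c).symm z.1)) : Γ.Alg _ →L[ℝ] ℝ)⟩

theorem dualPoint_mem_source {c : M} {z : EuSp n × (EuSp r →L[ℝ] ℝ)} (hz : z.1 ∈ Γ.baseRegion c) :
    Γ.dualPoint c z ∈ (Γ.dualChart c).source := Γ.mem_dualChart_source.2 ⟨hz.2.2, hz.2.1⟩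

theorem dualChart_dualPoint {c : M} {z : EuSp n × (EuSp r →L[ℝ] ℝ)} (hz : z.1 ∈ Γ.baseRegion c) :
    Γ.dualChart c (Γ.dualPoint c z) = z := by
  refine Prod.ext ?_ (ContinuousLinearMap.ext fun w => ?_)
  · rw [Γ.dualChart_fst (p := Γ.dualPoint c z) hz.2.2]
    exact (extChartAt (𝓡 n) c).right_inv hz.1
  · rw [Γ.dualChart_snd (p := Γ.dualPoint c z) hz.2.2]
    exact congrArg z.2 (Γ.locTriv_locInv c _ hz.2.2 w)

theorem fst_dualChart_mem {c : M} {p : Γ.DualTotal} (hp : p ∈ (Γ.dualChart c).source) :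
    (Γ.dualChart c p).1 ∈ Γ.baseRegion c := by
  obtain ⟨h1, h2⟩ := Γ.mem_dualChart_source.1 hp
  rw [Γ.dualChart_fst h1]
  refine ⟨(extChartAt (𝓡 n) c).map_source h2, ?_⟩
  rw [mem_preimage, (extChartAt (𝓡 n) c).left_inv h2]
  exact ⟨h2, h1⟩

theorem mem_dualChart_target {c : M} {z : EuSp n × (EuSp r →L[ℝ] ℝ)} :
    z ∈ (Γ.dualChart c).target ↔ z.1 ∈ Γ.baseRegion c := by
  constructor
  · intro hz
    have h := Γ.fst_dualChart_mem ((Γ.dualChart c).map_target hz)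
    rwa [(Γ.dualChart c).right_inv hz] at h
  · intro hz
    have h := (Γ.dualChart c).map_source (Γ.dualPoint_mem_source hz)
    rwa [Γ.dualChart_dualPoint hz] at h

theorem dualChart_symm {c : M} {z : EuSp n × (EuSp r →L[ℝ] ℝ)} (hz : z.1 ∈ Γ.baseRegion c) :
    (Γ.dualChart c).symm z = Γ.dualPoint c z := by
  have h := (Γ.dualChart c).left_inv (Γ.dualPoint_mem_source hz)
  rwa [Γ.dualChart_dualPoint hz] at h

theorem contMDiff_proj : ContMDiff (dualModel n r) (𝓡 n) ∞ Γ.proj :=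
  Bundle.contMDiff_proj _

/-- The differential of the projection in coordinates. -/
theorem mfderiv_extChartAt_dproj {c : M} {p : Γ.DualTotal} (hp : p ∈ (Γ.dualChart c).source)
    (ξ : TangentSpace (dualModel n r) p) :
    (mfderiv (𝓡 n) 𝓘(ℝ, EuSp n) (extChartAt (𝓡 n) c) p.1 (Γ.dproj p ξ) : EuSp n) =
      (show EuSp n × (EuSp r →L[ℝ] ℝ) from mfderiv (dualModel n r)
        𝓘(ℝ, EuSp n × (EuSp r →L[ℝ] ℝ)) (Γ.dualChart c) p ξ).1 := by
  have h1 : HasMFDerivAt (dualModel n r) 𝓘(ℝ, EuSp n) (fun q => (Γ.dualChart c q).1) p _ :=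
    HasMFDerivAt.comp (f := Γ.dualChart c) (g := Prod.fst)
      (I' := 𝓘(ℝ, EuSp n × (EuSp r →L[ℝ] ℝ))) p
      (ContinuousLinearMap.fst ℝ (EuSp n) (EuSp r →L[ℝ] ℝ)).hasMFDerivAt
      ((contMDiffAt_extChartAt_of_mem_source hp).mdifferentiableAt (by simp)).hasMFDerivAt
  have h2 : HasMFDerivAt (dualModel n r) 𝓘(ℝ, EuSp n)
      (fun q => extChartAt (𝓡 n) c (Γ.proj q)) p _ :=
    HasMFDerivAt.comp (f := Γ.proj) (g := extChartAt (𝓡 n) c) p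
      ((contMDiffAt_extChartAt_of_mem_source (I := 𝓡 n)
        (Γ.mem_dualChart_source.1 hp).2).mdifferentiableAt (by simp)).hasMFDerivAt
      ((Γ.contMDiff_proj p).mdifferentiableAt (by simp)).hasMFDerivAt
  have h3 : (fun q => (Γ.dualChart c q).1) =ᶠ[𝓝 p] fun q => extChartAt (𝓡 n) c (Γ.proj q) := by
    filter_upwards [(isOpen_extChartAt_source (I := dualModel n r) _).mem_nhds hp] with q hq
    exact Γ.dualChart_fst (Γ.mem_dualChart_source.1 hq).1
  have h4 := (h2.congr_of_eventuallyEq h3).mfderiv.symm.trans h1.mfderiv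
  exact congrArg (fun L : EuSp n × (EuSp r →L[ℝ] ℝ) →L[ℝ] EuSp n => L ξ) h4

/-- The curve defining the vertical lift, in coordinates. -/
theorem dualChart_curve {c : M} {p : Γ.DualTotal} (hp : p.1 ∈ Γ.base c) (w : Γ.Dual p.1)
    (ℓ : EuSp r →L[ℝ] ℝ) (hℓ : ∀ v, ℓ v = w (Γ.locInv c p.1 v)) (s : ℝ) :
    Γ.dualChart c (⟨p.1, p.2 + s • w⟩ : Γ.DualTotal) = Γ.dualChart c p + s • ((0 : EuSp n), ℓ) := by
  refine Prod.ext ?_ (ContinuousLinearMap.ext fun v => ?_)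
  · rw [Γ.dualChart_fst (p := (⟨p.1, p.2 + s • w⟩ : Γ.DualTotal)) hp, Prod.fst_add,
      Γ.dualChart_fst hp]
    simp
  · rw [Γ.dualChart_snd (p := (⟨p.1, p.2 + s • w⟩ : Γ.DualTotal)) hp]
    change p.2 (Γ.locInv c p.1 v) + s • w (Γ.locInv c p.1 v) =
      (Γ.dualChart c p).2 v + s • ℓ v
    rw [Γ.dualChart_snd hp, hℓ]

/-- In the chart the curve defining the lift is an affine line in the fibre direction, and `ℓ` is
its velocity. -/
theorem mfderiv_dualChart_vertLift {c : M} {p : Γ.DualTotal} (hp : p ∈ (Γ.dualChart c).source)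
    (w : Γ.Dual p.1) (ℓ : EuSp r →L[ℝ] ℝ) (hℓ : ∀ v, ℓ v = w (Γ.locInv c p.1 v)) :
    (mfderiv (dualModel n r) 𝓘(ℝ, EuSp n × (EuSp r →L[ℝ] ℝ)) (Γ.dualChart c) p
      (Γ.vertLift p w) : EuSp n × (EuSp r →L[ℝ] ℝ)) = (0, ℓ) := by
  have hb := (Γ.mem_dualChart_source.1 hp).1
  let γ : ℝ → Γ.DualTotal := fun s => ⟨p.1, p.2 + s • w⟩
  have hγ0 : γ 0 = p := by simp [γ]
  have hsrc : ∀ s, γ s ∈ (Γ.dualChart c).source := fun s =>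
    Γ.mem_dualChart_source.2 (Γ.mem_dualChart_source.1 hp)
  have hz := (Γ.dualChart c).map_source hp
  have hline : HasFDerivAt (fun s : ℝ => Γ.dualChart c p + s • ((0 : EuSp n), ℓ))
      ((ContinuousLinearMap.id ℝ ℝ).smulRight ((0 : EuSp n), ℓ)) 0 :=
    ((ContinuousLinearMap.id ℝ ℝ).smulRight ((0 : EuSp n), ℓ)).hasFDerivAt.const_add _
  have hγ : γ = fun s => (Γ.dualChart c).symm (Γ.dualChart c p + s • ((0 : EuSp n), ℓ)) := by
    funext s
    rw [← Γ.dualChart_curve hb w ℓ hℓ s]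
    exact ((Γ.dualChart c).left_inv (hsrc s)).symm
  have hγd : MDifferentiableAt 𝓘(ℝ, ℝ) (dualModel n r) γ 0 := by
    rw [hγ]
    refine MDifferentiableAt.comp (g := (Γ.dualChart c).symm)
      (I' := 𝓘(ℝ, EuSp n × (EuSp r →L[ℝ] ℝ))) (0 : ℝ) ?_ hline.differentiableAt.mdifferentiableAt
    refine mdifferentiableAt_extChartAt_symm ?_
    simpa using hz
  have h1 : HasMFDerivAt 𝓘(ℝ, ℝ) 𝓘(ℝ, EuSp n × (EuSp r →L[ℝ] ℝ))
      (fun s => Γ.dualChart c (γ s)) 0 _ :=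
    HasMFDerivAt.comp (f := γ) (g := Γ.dualChart c) (0 : ℝ)
      ((contMDiffAt_extChartAt_of_mem_source (hsrc 0)).mdifferentiableAt (by simp)).hasMFDerivAt
      hγd.hasMFDerivAt
  have h2 : (fun s => Γ.dualChart c (γ s)) = fun s => Γ.dualChart c p + s • ((0 : EuSp n), ℓ) :=
    funext (Γ.dualChart_curve hb w ℓ hℓ)
  rw [h2] at h1
  have h3 := h1.mfderiv
  rw [mfderiv_eq_fderiv, hline.fderiv] at h3
  have h4 := congrArg (fun L : ℝ →L[ℝ] EuSp n × (EuSp r →L[ℝ] ℝ) => L 1) h3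
  have h5 : ∀ q (hq : q = p) (ξ : TangentSpace (dualModel n r) q),
      (mfderiv (dualModel n r) 𝓘(ℝ, EuSp n × (EuSp r →L[ℝ] ℝ)) (Γ.dualChart c) p
        (castTangent (dualModel n r) hq ξ) : EuSp n × (EuSp r →L[ℝ] ℝ)) =
      mfderiv (dualModel n r) 𝓘(ℝ, EuSp n × (EuSp r →L[ℝ] ℝ)) (Γ.dualChart c) q ξ := by
    rintro _ rfl ξ
    rfl
  refine (h5 _ hγ0 _).trans (h4.symm.trans ?_)
  simp

theorem symmL_dualTriv {x : M} {ℓ : EuSp r →L[ℝ] ℝ} {w : Γ.Dual x}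
    (h : ∀ v, ℓ v = w (Γ.locInv x x v)) : (Γ.dualTriv x).symmL ℝ x ℓ = w := by
  have hx : x ∈ (Γ.dualTriv x).baseSet := by
    rw [Γ.dualTriv_baseSet]
    exact Γ.mem_base x
  have h1 := (Γ.dualTriv x).continuousLinearMapAt_symmL (R := ℝ) hx ℓ
  rw [Trivialization.continuousLinearMapAt_apply_of_mem ℝ _ hx] at h1
  refine ContinuousLinearMap.ext fun X => ?_
  have h2 := Γ.dualTriv_apply (c := x) (p := ⟨x, (Γ.dualTriv x).symmL ℝ x ℓ⟩) (Γ.mem_base x)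
    (Γ.locTriv x x X)
  rw [h1, h, Γ.locInv_locTriv x x (Γ.mem_base x)] at h2
  exact h2.symm

/-- The vertical part is taken in the trivialisation centred at the base point of `p`, and the chart
centred there has the same fibre component. -/
theorem vertPart_vertLift (p : Γ.DualTotal) (w : Γ.Dual p.1) :
    Γ.vertPart p (Γ.vertLift p w) = w := by
  have hp : p ∈ (Γ.dualChart p.1).source :=
    Γ.mem_dualChart_source.2 ⟨Γ.mem_base _, mem_extChartAt_source _⟩
  let ℓ : EuSp r →L[ℝ] ℝ := LinearMap.toContinuousLinearMap
    (w.toLinearMap ∘ₗ (Γ.frameEquiv (Γ.mem_base p.1)).symm.toLinearMap)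
  have hℓ : ∀ v, ℓ v = w (Γ.locInv p.1 p.1 v) := fun v => rfl
  have h1 : HasMFDerivAt (dualModel n r) 𝓘(ℝ, EuSp r →L[ℝ] ℝ)
      (fun q => (Γ.dualChart p.1 q).2) p _ :=
    HasMFDerivAt.comp (f := Γ.dualChart p.1) (g := Prod.snd)
      (I' := 𝓘(ℝ, EuSp n × (EuSp r →L[ℝ] ℝ))) p
      (ContinuousLinearMap.snd ℝ (EuSp n) (EuSp r →L[ℝ] ℝ)).hasMFDerivAt
      ((contMDiffAt_extChartAt_of_mem_source hp).mdifferentiableAt (by simp)).hasMFDerivAt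
  have h3 : (fun q => (Γ.dualTriv p.1 q).2) =ᶠ[𝓝 p] fun q => (Γ.dualChart p.1 q).2 := by
    filter_upwards [(isOpen_extChartAt_source (I := dualModel n r) _).mem_nhds hp] with q hq
    rw [Γ.dualChart_apply (Γ.mem_dualChart_source.1 hq).1]
  have h4 := (h1.congr_of_eventuallyEq h3).mfderiv
  have h5 := congrArg (fun L : EuSp n × (EuSp r →L[ℝ] ℝ) →L[ℝ] (EuSp r →L[ℝ] ℝ) =>
    L (Γ.vertLift p w)) h4
  have h6 := h5.trans (congrArg Prod.snd (Γ.mfderiv_dualChart_vertLift hp w ℓ hℓ))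
  refine Eq.trans (congrArg ((Γ.dualTriv p.1).symmL ℝ p.1) h6) ?_
  exact Γ.symmL_dualTriv hℓ

theorem dproj_vertLift (p : Γ.DualTotal) (w : Γ.Dual p.1) : Γ.dproj p (Γ.vertLift p w) = 0 := by
  have hp : p ∈ (Γ.dualChart p.1).source :=
    Γ.mem_dualChart_source.2 ⟨Γ.mem_base _, mem_extChartAt_source _⟩
  let ℓ : EuSp r →L[ℝ] ℝ := LinearMap.toContinuousLinearMap
    (w.toLinearMap ∘ₗ (Γ.frameEquiv (Γ.mem_base p.1)).symm.toLinearMap)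
  refine (isInvertible_mfderiv_extChartAt (I := 𝓡 n) (mem_extChartAt_source p.1)).injective ?_
  rw [map_zero]
  exact (Γ.mfderiv_extChartAt_dproj hp _).trans
    (congrArg Prod.fst (Γ.mfderiv_dualChart_vertLift hp w ℓ fun v => rfl))

end LieGroupoid

/-! ### A local frame of the pull-back algebroid -/

/-- The dual of the standard basis. -/
abbrev euDualBasis (r : ℕ) : Basis (Fin r) ℝ (EuSp r →L[ℝ] ℝ) :=
  (euBasis r).dualBasis.map LinearMap.toContinuousLinearMap

theorem euDualBasis_apply {r : ℕ} (i j : Fin r) :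
    euDualBasis r j (euBasis r i) = if i = j then 1 else 0 :=
  (euBasis r).dualBasis_apply_self j i

/-- The two blocks of indices of a frame of even rank. -/
def splitIndex (r : ℕ) : Fin (2 * r) ≃ Fin r ⊕ Fin r :=
  (finCongr (two_mul r)).trans finSumFinEquiv.symm

theorem append_comp_cast {r : ℕ} {V : Type*} (v w : Fin r → V) :
    Fin.append v w ∘ Fin.cast (two_mul r) = Sum.elim v w ∘ splitIndex r := by
  funext a
  obtain ⟨a, rfl⟩ := (finCongr (two_mul r)).symm.surjective a
  obtain ⟨a, rfl⟩ := finSumFinEquiv.surjective a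
  rcases a with i | j
  · simp [splitIndex]
  · change Fin.append v w (Fin.natAdd r j) =
      Sum.elim v w (finSumFinEquiv.symm (Fin.natAdd r j))
    rw [Fin.append_right, finSumFinEquiv_symm_apply_natAdd]
    rfl

/-- The standard basis of `ℝ^r × (ℝ^r)*`. -/
abbrev euPairBasis (r : ℕ) : Basis (Fin (2 * r)) ℝ (EuSp r × (EuSp r →L[ℝ] ℝ)) :=
  ((euBasis r).prod (euDualBasis r)).reindex (splitIndex r).symm

theorem euPairBasis_eq (r : ℕ) : ⇑(euPairBasis r) = Sum.elim (fun i => (euBasis r i, 0))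
    (fun j => (0, euDualBasis r j)) ∘ splitIndex r := by
  funext a
  rw [euPairBasis, Basis.reindex_apply, Equiv.symm_symm, Function.comp_apply]
  rcases splitIndex r a with i | j <;> simp

namespace LieGroupoid

open VectorField

variable {n r : ℕ} {M G : Type*}
    [TopologicalSpace M] [ChartedSpace (EuSp n) M] [IsManifold (𝓡 n) ∞ M]
    [TopologicalSpace G] [ChartedSpace (EuSp (n + r)) G] [IsManifold (𝓡 (n + r)) ∞ G]
    {Γ : LieGroupoid n r M G}

/-- The differential of the chart of `𝔤*`. -/
def dDualChart (Γ : LieGroupoid n r M G) (c : M) (p : Γ.DualTotal) :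
    TangentSpace (dualModel n r) p →L[ℝ] EuSp n × (EuSp r →L[ℝ] ℝ) :=
  mfderiv (dualModel n r) 𝓘(ℝ, EuSp n × (EuSp r →L[ℝ] ℝ)) (Γ.dualChart c) p

theorem dDualChart_injective {c : M} {p : Γ.DualTotal} (hp : p ∈ (Γ.dualChart c).source) :
    Function.Injective (Γ.dDualChart c p) :=
  (isInvertible_mfderiv_extChartAt (I := dualModel n r) hp).injective

theorem mem_pullbackFiber_iff {c : M} {p : Γ.DualTotal} (hp : p ∈ (Γ.dualChart c).source)
    {X : Γ.Alg p.1} {ξ : TangentSpace (dualModel n r) p} :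
    (X, ξ) ∈ Γ.pullbackFiber (dualModel n r) Γ.proj p ↔
      (mfderiv (𝓡 n) 𝓘(ℝ, EuSp n) (extChartAt (𝓡 n) c) p.1 (Γ.anchor p.1 X) : EuSp n) =
        (Γ.dDualChart c p ξ).1 := by
  have h1 : (X, ξ) ∈ Γ.pullbackFiber (dualModel n r) Γ.proj p ↔
      Γ.anchor p.1 X = Γ.dproj p ξ := Iff.rfl
  rw [h1]
  have h2 := Γ.mfderiv_extChartAt_dproj hp ξ
  refine ⟨fun h => ?_, fun h => ?_⟩
  · rw [h]
    exact h2
  · exact (isInvertible_mfderiv_extChartAt (I := 𝓡 n)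
      (Γ.mem_dualChart_source.1 hp).2).injective (h.trans h2.symm)

/-- The coordinates of a fibre of `π^!𝔤`. -/
def fiberCoord (Γ : LieGroupoid n r M G) (c : M) (p : Γ.DualTotal) :
    Γ.piAlgebroid.Fiber p →ₗ[ℝ] EuSp r × (EuSp r →L[ℝ] ℝ) :=
  LinearMap.prod ((Γ.locTriv c p.1).toLinearMap ∘ₗ LinearMap.fst ℝ _ _ ∘ₗ
      (Γ.pullbackFiber (dualModel n r) Γ.proj p).subtype)
    (LinearMap.snd ℝ _ _ ∘ₗ (Γ.dDualChart c p).toLinearMap ∘ₗ LinearMap.snd ℝ _ _ ∘ₗ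
      (Γ.pullbackFiber (dualModel n r) Γ.proj p).subtype)

/-- The components of the anchor of a local section. -/
def anchorCoord (Γ : LieGroupoid n r M G) (c : M) (w : EuSp r) (x : M) : EuSp n :=
  mfderiv (𝓡 n) 𝓘(ℝ, EuSp n) (extChartAt (𝓡 n) c) x (Γ.anchor x (Γ.locInv c x w))

/-- The vector field on `𝔤*` which is constant along the fibres in the coordinates around `c`
and projects to an anchor. -/
def liftField (Γ : LieGroupoid n r M G) (c : M) (w : EuSp r) (ℓ : EuSp r →L[ℝ] ℝ)
    (p : Γ.DualTotal) : TangentSpace (dualModel n r) p :=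
  coordField (dualModel n r) (⟨c, 0⟩ : Γ.DualTotal) (fun q => (Γ.anchorCoord c w q.1, ℓ)) p

theorem dDualChart_liftField {c : M} {p : Γ.DualTotal} (hp : p ∈ (Γ.dualChart c).source)
    (w : EuSp r) (ℓ : EuSp r →L[ℝ] ℝ) :
    Γ.dDualChart c p (Γ.liftField c w ℓ p) = (Γ.anchorCoord c w p.1, ℓ) :=
  mfderiv_extChartAt_coordField hp _

theorem dproj_liftField {c : M} {p : Γ.DualTotal} (hp : p ∈ (Γ.dualChart c).source)
    (w : EuSp r) (ℓ : EuSp r →L[ℝ] ℝ) :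
    Γ.dproj p (Γ.liftField c w ℓ p) = Γ.anchor p.1 (Γ.locInv c p.1 w) :=
  ((mem_pullbackFiber_iff hp).2 (by rw [dDualChart_liftField hp]; rfl) :
    (Γ.locInv c p.1 w, Γ.liftField c w ℓ p) ∈ Γ.pullbackFiber (dualModel n r) Γ.proj p).symm

/-- In a pair `(X, ξ)` the horizontal component of `ξ` is forced by the anchor of `X`, so the
components of `X` and the vertical component of `ξ` are free coordinates. -/
theorem fiberCoord_bijective {c : M} {p : Γ.DualTotal} (hp : p ∈ (Γ.dualChart c).source) :
    Function.Bijective (Γ.fiberCoord c p) := by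
  have hb := (Γ.mem_dualChart_source.1 hp).1
  constructor
  · rw [injective_iff_map_eq_zero]
    rintro ⟨⟨X, ξ⟩, hv⟩ h
    replace h : ((Γ.locTriv c p.1 X, (Γ.dDualChart c p ξ).2) : EuSp r × (EuSp r →L[ℝ] ℝ)) = 0 := h
    have hX : X = 0 := Γ.locTriv_injective c p.1 hb
      ((congrArg Prod.fst h).trans (map_zero _).symm)
    have h1 := (mem_pullbackFiber_iff hp).1 hv
    have hξ : ξ = 0 := by
      refine dDualChart_injective hp (Eq.trans ?_ (Γ.dDualChart c p).map_zero.symm)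
      have h2 := congrArg (fun q : EuSp r × (EuSp r →L[ℝ] ℝ) => q.2) h
      refine Prod.ext (h1.symm.trans ?_) h2
      refine Eq.trans (congrArg _ (?_ : Γ.anchor p.1 X = 0)) (ContinuousLinearMap.map_zero _)
      exact (congrArg (Γ.anchor p.1) hX).trans (LinearMap.map_zero _)
    subst hX
    subst hξ
    rfl
  · rintro ⟨w, ℓ⟩
    refine ⟨⟨(Γ.locInv c p.1 w, Γ.liftField c w ℓ p), (dproj_liftField hp w ℓ).symm⟩, ?_⟩
    refine Prod.ext (Γ.locTriv_locInv c p.1 hb w) ?_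
    exact congrArg (fun q : EuSp n × (EuSp r →L[ℝ] ℝ) => q.2) (dDualChart_liftField hp w ℓ)

/-- The local trivialisation of `π^!𝔤`. -/
def fiberEquiv {c : M} {p : Γ.DualTotal} (hp : p ∈ (Γ.dualChart c).source) :
    Γ.piAlgebroid.Fiber p ≃ₗ[ℝ] EuSp r × (EuSp r →L[ℝ] ℝ) :=
  LinearEquiv.ofBijective (Γ.fiberCoord c p) (fiberCoord_bijective hp)

theorem fiberEquiv_apply {c : M} {p : Γ.DualTotal} (hp : p ∈ (Γ.dualChart c).source)
    (v : Γ.piAlgebroid.Fiber p) : fiberEquiv hp v = Γ.fiberCoord c p v := rfl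

open scoped Classical in
/-- The local frame of `π^!𝔤`. -/
def piFrame (Γ : LieGroupoid n r M G) (c : M) (a : Fin (2 * r)) (p : Γ.DualTotal) :
    Γ.piAlgebroid.Fiber p :=
  if hp : p ∈ (Γ.dualChart c).source then (fiberEquiv hp).symm (euPairBasis r a) else 0

theorem piFrame_eq {c : M} {p : Γ.DualTotal} (hp : p ∈ (Γ.dualChart c).source)
    (a : Fin (2 * r)) : Γ.piFrame c a p = (fiberEquiv hp).symm (euPairBasis r a) := dif_pos hp

theorem fiberCoord_piFrame {c : M} {p : Γ.DualTotal} (hp : p ∈ (Γ.dualChart c).source)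
    (a : Fin (2 * r)) : Γ.fiberCoord c p (Γ.piFrame c a p) = euPairBasis r a := by
  rw [piFrame_eq hp, ← fiberEquiv_apply hp, LinearEquiv.apply_symm_apply]

/-- The local frame of `π^!𝔤`, as a basis. -/
def piBasis {c : M} {p : Γ.DualTotal} (hp : p ∈ (Γ.dualChart c).source) :
    Basis (Fin (2 * r)) ℝ (Γ.piAlgebroid.Fiber p) := (euPairBasis r).map (fiberEquiv hp).symm

theorem piBasis_eq {c : M} {p : Γ.DualTotal} (hp : p ∈ (Γ.dualChart c).source) :
    ⇑(piBasis hp) = fun a => Γ.piFrame c a p := funext fun a => (piFrame_eq hp a).symm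

/-- The frame is defined through the inverse of a bijection; this makes its two components explicit.
-/
theorem eq_piFrame_iff {c : M} {p : Γ.DualTotal} (hp : p ∈ (Γ.dualChart c).source)
    {v : Γ.piAlgebroid.Fiber p} {a : Fin (2 * r)} : v = Γ.piFrame c a p ↔
      v.1.1 = Γ.locInv c p.1 (euPairBasis r a).1 ∧
        v.1.2 = Γ.liftField c (euPairBasis r a).1 (euPairBasis r a).2 p := by
  have hmem : (Γ.locInv c p.1 (euPairBasis r a).1,
      Γ.liftField c (euPairBasis r a).1 (euPairBasis r a).2 p) ∈
      Γ.pullbackFiber (dualModel n r) Γ.proj p := (dproj_liftField hp _ _).symm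
  have h1 : Γ.piFrame c a p = (⟨_, hmem⟩ : Γ.pullbackFiber (dualModel n r) Γ.proj p) := by
    refine (fiberCoord_bijective hp).1 ((fiberCoord_piFrame hp a).trans ?_)
    exact Prod.ext (Γ.locTriv_locInv c p.1 (Γ.mem_dualChart_source.1 hp).1 _).symm
      (congrArg (fun q : EuSp n × (EuSp r →L[ℝ] ℝ) => q.2) (dDualChart_liftField hp _ _)).symm
  rw [h1]
  refine ⟨fun h => ?_, fun h => Subtype.ext (Prod.ext h.1 h.2)⟩
  rw [h]
  exact ⟨rfl, rfl⟩

/-! ### Projectable sections -/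

/-- Sections of `π^!𝔤` given by a section of `𝔤` and a vector field over its anchor. -/
def projSection (X : ∀ x, Γ.Alg x) (V : ∀ p : Γ.DualTotal, TangentSpace (dualModel n r) p)
    (h : ∀ p, Γ.dproj p (V p) = Γ.anchor p.1 (X p.1)) (p : Γ.DualTotal) :
    Γ.piAlgebroid.Fiber p := ⟨(X p.1, V p), (h p).symm⟩

theorem isSmooth_projSection {X : ∀ x, Γ.Alg x}
    {V : ∀ p : Γ.DualTotal, TangentSpace (dualModel n r) p}
    (h : ∀ p, Γ.dproj p (V p) = Γ.anchor p.1 (X p.1)) (hX : Γ.algebroid.IsSmooth X)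
    (hV : ContMDiff (dualModel n r) (dualModel n r).tangent ∞
      (fun p => (⟨p, V p⟩ : TangentBundle (dualModel n r) Γ.DualTotal))) :
    Γ.piAlgebroid.IsSmooth (projSection X V h) :=
  ⟨ContMDiff.comp (g := fun x => (⟨x, X x⟩ : TotalSpace (EuSp r) Γ.Alg)) hX Γ.contMDiff_proj, hV⟩

/-- A projectable section is a single term with coefficient function one, so the derivative terms in
the bracket drop out and the bracket is taken componentwise. The pair obtained lies in the fibre
product because `V` and `W` are `π`-related to the anchors. -/
theorem exists_projSection_bracket {X Y : ∀ x, Γ.Alg x}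
    {V W : ∀ p : Γ.DualTotal, TangentSpace (dualModel n r) p}
    (hXV : ∀ p, Γ.dproj p (V p) = Γ.anchor p.1 (X p.1))
    (hYW : ∀ p, Γ.dproj p (W p) = Γ.anchor p.1 (Y p.1))
    (hX : Γ.algebroid.IsSmooth X) (hY : Γ.algebroid.IsSmooth Y)
    (hV : ContMDiff (dualModel n r) (dualModel n r).tangent ∞
      (fun p => (⟨p, V p⟩ : TangentBundle (dualModel n r) Γ.DualTotal)))
    (hW : ContMDiff (dualModel n r) (dualModel n r).tangent ∞
      (fun p => (⟨p, W p⟩ : TangentBundle (dualModel n r) Γ.DualTotal))) :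
    ∃ (Z : ∀ x, Γ.Alg x) (B : ∀ p, Γ.piAlgebroid.Fiber p), Γ.algebroid.IsBracket X Y Z ∧
      Γ.piAlgebroid.IsBracket (projSection X V hXV) (projSection Y W hYW) B ∧
      ∀ p, (B p).1.1 = Z p.1 ∧ (B p).1.2 = mlieBracket (dualModel n r) V W p := by
  obtain ⟨Z, hZ⟩ := exists_isBracket hX hY
  have hmem : ∀ p, Γ.dproj p (mlieBracket (dualModel n r) V W p) = Γ.anchor p.1 (Z p.1) := by
    intro p
    rw [anchor_bracket hX hY hZ]
    exact mfderiv_mlieBracket_of_related (I := dualModel n r) (I' := 𝓡 n) (Γ.contMDiff_proj p)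
      ((hV p).of_le (by simp)) ((hW p).of_le (by simp))
      ((contMDiff_anchor hX _).of_le (by simp)) ((contMDiff_anchor hY _).of_le (by simp))
      (Filter.Eventually.of_forall hXV) (Filter.Eventually.of_forall hYW)
  have hd : ∀ (p : Γ.DualTotal) (v : TangentSpace (dualModel n r) p),
      dirDeriv (dualModel n r) (fun _ : Γ.DualTotal => (1 : ℝ)) p v = 0 := by
    intro p v
    rw [dirDeriv, mfderiv_const]
    rfl
  refine ⟨Z, projSection Z _ hmem, hZ, ⟨1, 1, fun _ _ => 1, fun _ _ => 1, fun _ => X, fun _ => Y,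
    fun _ _ => Z, fun _ => contMDiff_const, fun _ => contMDiff_const, fun _ => hX, fun _ => hY,
    fun _ _ => hZ, fun p => ?_, fun p => ?_, fun p => ?_, fun p => rfl⟩, fun p => ⟨rfl, rfl⟩⟩
  · simp only [Finset.univ_unique, Finset.sum_singleton, one_smul]
    rfl
  · simp only [Finset.univ_unique, Finset.sum_singleton, one_smul]
    rfl
  · simp only [hd, Finset.univ_unique, Finset.sum_singleton, zero_smul, add_zero,
      sub_zero, one_mul]
    exact (one_smul ℝ _).symm

/-! ### Extensions of the local frame -/

theorem locInv_zero (c x : M) : Γ.locInv c x 0 = 0 := by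
  by_cases hx : x ∈ Γ.base c
  · exact map_zero (Γ.frameEquiv hx).symm
  · rw [locInv, dif_neg hx]

variable [T2Space M]

theorem contMDiffAt_anchorCoord {c x : M} (hx : x ∈ Γ.base c)
    (hc : x ∈ (extChartAt (𝓡 n) c).source) (w : EuSp r) :
    ContMDiffAt (𝓡 n) 𝓘(ℝ, EuSp n) ∞ (Γ.anchorCoord c w) x :=
  (contMDiffAt_tangentSection_iff (m := ⊤) hc).1 (contMDiffAt_anchor_locInv hx w)

end LieGroupoid

/-- The field does not depend on the second variable, so the second block of its derivative has no
diagonal entries. -/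
theorem divergence_prod {E F : Type} {ι κ : Type*} [NormedAddCommGroup E] [NormedSpace ℝ E]
    [NormedAddCommGroup F] [NormedSpace ℝ F] [Fintype ι] [Fintype κ] (b : Basis ι ℝ E)
    (b' : Basis κ ℝ F) {f : E → E} {g : E → F} {z : E × F} (hf : DifferentiableAt ℝ f z.1)
    (hg : DifferentiableAt ℝ g z.1) :
    divergence (b.prod b') (fun z => (f z.1, g z.1)) z = divergence b f z.1 := by
  have h : HasFDerivAt (fun z : E × F => (f z.1, g z.1))
      (((fderiv ℝ f z.1).comp (ContinuousLinearMap.fst ℝ E F)).prod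
        ((fderiv ℝ g z.1).comp (ContinuousLinearMap.fst ℝ E F))) z :=
    HasFDerivAt.prodMk (HasFDerivAt.comp (g := f) (f := Prod.fst) z hf.hasFDerivAt hasFDerivAt_fst)
      (HasFDerivAt.comp (g := g) (f := Prod.fst) z hg.hasFDerivAt hasFDerivAt_fst)
  rw [divergence, divergence, h.fderiv, Fintype.sum_sum_type]
  simp

section VectorSpace

variable {F : Type} [NormedAddCommGroup F] [NormedSpace ℝ F]

theorem contMDiffAt_const_vectorField (v x : F) : ContMDiffAt 𝓘(ℝ, F) 𝓘(ℝ, F).tangent 1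
    (fun x => (⟨x, v⟩ : TangentBundle 𝓘(ℝ, F) F)) x :=
  (contMDiffAt_vectorSpace_iff_contDiffAt (V := fun _ : F => v)).2 contDiffAt_const

theorem mlieBracket_const_vectorField (v w x : F) :
    VectorField.mlieBracket 𝓘(ℝ, F) (fun _ : F => (v : F)) (fun _ : F => (w : F)) x = (0 : F) := by
  refine (mlieBracket_vectorSpace (E := F) (fun _ => v) (fun _ => w) x).trans ?_
  simp only [VectorField.lieBracket, fderiv_fun_const, Pi.zero_apply,
    zero_apply, sub_zero]
  rfl

end VectorSpace

/-! ### Brackets and unimodularity of the frame of the pull-back algebroid -/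

namespace LieGroupoid

open VectorField

variable {n r : ℕ} {M G : Type*}
    [TopologicalSpace M] [ChartedSpace (EuSp n) M] [IsManifold (𝓡 n) ∞ M]
    [TopologicalSpace G] [ChartedSpace (EuSp (n + r)) G] [IsManifold (𝓡 (n + r)) ∞ G]
    {Γ : LieGroupoid n r M G}

theorem leftTranslate_zero (g : G) : Γ.leftTranslate g 0 = 0 := by
  have h : Γ.tangentMul g (Γ.u (Γ.s g)) 0 (Γ.incl (Γ.s g) 0) = 0 := by
    rw [tangentMul]
    refine Eq.trans (congrArg _ ?_) (ContinuousLinearMap.map_zero _)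
    exact Prod.ext rfl (ContinuousLinearMap.map_zero (Γ.incl (Γ.s g)))
  rw [leftTranslate, h]
  exact LinearMap.map_zero _

/-- Vertical frame vectors have the zero section as their component in `𝔤`; this disposes of that
component of their brackets. -/
theorem bracket_eq_zero_left {X Y Z : ∀ x, Γ.Alg x} (hX : ∀ x, X x = 0)
    (h : Γ.algebroid.IsBracket X Y Z) (x : M) : Z x = 0 := by
  refine Γ.incl_injective x ((h x).trans ?_)
  have h0 : (fun g => Γ.leftTranslate g (X (Γ.s g))) = 0 := by
    funext g
    rw [hX, leftTranslate_zero]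
    rfl
  rw [h0, mlieBracket_zero_left, map_zero]
  rfl

theorem bracket_eq_zero_right {X Y Z : ∀ x, Γ.Alg x} (hY : ∀ x, Y x = 0)
    (h : Γ.algebroid.IsBracket X Y Z) (x : M) : Z x = 0 := by
  refine Γ.incl_injective x ((h x).trans ?_)
  have h0 : (fun g => Γ.leftTranslate g (Y (Γ.s g))) = 0 := by
    funext g
    rw [hY, leftTranslate_zero]
    rfl
  rw [h0, mlieBracket_zero_right, map_zero]
  rfl

theorem contMDiffAt_dualChart {c : M} {p : Γ.DualTotal} (hp : p ∈ (Γ.dualChart c).source) :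
    ContMDiffAt (dualModel n r) 𝓘(ℝ, EuSp n × (EuSp r →L[ℝ] ℝ)) ∞ (Γ.dualChart c) p :=
  contMDiffAt_extChartAt_of_mem_source hp

theorem contMDiffAt_dualChart_snd {c : M} {p : Γ.DualTotal} (hp : p ∈ (Γ.dualChart c).source) :
    ContMDiffAt (dualModel n r) 𝓘(ℝ, EuSp r →L[ℝ] ℝ) ∞ (fun q => (Γ.dualChart c q).2) p :=
  ContMDiffAt.comp (g := fun z : EuSp n × (EuSp r →L[ℝ] ℝ) => z.2) (f := Γ.dualChart c)
    (I' := 𝓘(ℝ, EuSp n × (EuSp r →L[ℝ] ℝ))) p contDiff_snd.contMDiff.contMDiffAt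
    (contMDiffAt_dualChart hp)

theorem mfderiv_dualChart_snd {c : M} {p : Γ.DualTotal} (hp : p ∈ (Γ.dualChart c).source)
    (ξ : TangentSpace (dualModel n r) p) :
    (mfderiv (dualModel n r) 𝓘(ℝ, EuSp r →L[ℝ] ℝ) (fun q => (Γ.dualChart c q).2) p ξ :
      EuSp r →L[ℝ] ℝ) = (Γ.dDualChart c p ξ).2 := by
  have h1 := ((contMDiffAt_dualChart hp).mdifferentiableAt (by simp)).hasMFDerivAt
  have h2 := HasMFDerivAt.comp (g := fun z : EuSp n × (EuSp r →L[ℝ] ℝ) => z.2)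
    (f := Γ.dualChart c) (I' := 𝓘(ℝ, EuSp n × (EuSp r →L[ℝ] ℝ))) p
    (ContinuousLinearMap.snd ℝ (EuSp n) (EuSp r →L[ℝ] ℝ)).hasMFDerivAt h1
  exact congrArg (fun L => L ξ) h2.mfderiv

/-- The vertical components of brackets of the fields `liftField` vanish. -/
theorem dDualChart_mlieBracket_snd {c : M} {p : Γ.DualTotal} (hp : p ∈ (Γ.dualChart c).source)
    {V W : ∀ q : Γ.DualTotal, TangentSpace (dualModel n r) q}
    (hV : ContMDiff (dualModel n r) (dualModel n r).tangent ∞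
      (fun p => (⟨p, V p⟩ : TangentBundle (dualModel n r) Γ.DualTotal)))
    (hW : ContMDiff (dualModel n r) (dualModel n r).tangent ∞
      (fun p => (⟨p, W p⟩ : TangentBundle (dualModel n r) Γ.DualTotal)))
    {v w : EuSp r} {ℓ m : EuSp r →L[ℝ] ℝ}
    (hVe : ∀ᶠ q in 𝓝 p, V q = Γ.liftField c v ℓ q)
    (hWe : ∀ᶠ q in 𝓝 p, W q = Γ.liftField c w m q) :
    (Γ.dDualChart c p (mlieBracket (dualModel n r) V W p)).2 = 0 := by
  have hs := (isOpen_extChartAt_source (I := dualModel n r) (⟨c, 0⟩ : Γ.DualTotal)).mem_nhds hp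
  -- The fibre coordinates relate each lifted field to a constant field on the model fibre, and
  -- constant fields commute.
  have hrel : ∀ (V : ∀ q : Γ.DualTotal, TangentSpace (dualModel n r) q) (v : EuSp r)
      (ℓ : EuSp r →L[ℝ] ℝ), (∀ᶠ q in 𝓝 p, V q = Γ.liftField c v ℓ q) →
      ∀ᶠ q in 𝓝 p, mfderiv (dualModel n r) 𝓘(ℝ, EuSp r →L[ℝ] ℝ)
        (fun q => (Γ.dualChart c q).2) q (V q) = ℓ := by
    intro V v ℓ h
    filter_upwards [h, hs] with q hq hqs
    rw [hq]
    refine (mfderiv_dualChart_snd hqs _).trans ?_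
    exact congrArg (fun q : EuSp n × (EuSp r →L[ℝ] ℝ) => q.2) (dDualChart_liftField hqs v ℓ)
  have hconst : ∀ (ℓ : EuSp r →L[ℝ] ℝ) (x : EuSp r →L[ℝ] ℝ),
      ContMDiffAt 𝓘(ℝ, EuSp r →L[ℝ] ℝ) 𝓘(ℝ, EuSp r →L[ℝ] ℝ).tangent 1
        (fun x => (⟨x, ℓ⟩ : TangentBundle 𝓘(ℝ, EuSp r →L[ℝ] ℝ) (EuSp r →L[ℝ] ℝ))) x := by
    intro ℓ x
    exact contMDiffAt_const_vectorField ℓ x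
  have h := mfderiv_mlieBracket_of_related (I := dualModel n r) (I' := 𝓘(ℝ, EuSp r →L[ℝ] ℝ))
    (V' := fun _ => ℓ) (W' := fun _ => m) (contMDiffAt_dualChart_snd hp)
    ((hV p).of_le (by simp)) ((hW p).of_le (by simp)) (hconst ℓ _) (hconst m _)
    (hrel V v ℓ hVe) (hrel W w m hWe)
  refine ((mfderiv_dualChart_snd hp _).symm.trans h).trans ?_
  exact mlieBracket_const_vectorField ℓ m _

/-- The coefficients of the brackets of a local frame of `π^!𝔤`. -/
def blockCoeff (C : Fin r → Fin r → Fin r → ℝ) (a b m : Fin (2 * r)) : ℝ :=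
  Sum.elim (fun i => Sum.elim (fun j => Sum.elim (C i j) 0) 0 (splitIndex r b)) 0
    (splitIndex r a) (splitIndex r m)


theorem sum_blockCoeff (C : Fin r → Fin r → Fin r → ℝ) (a b : Fin (2 * r)) :
    ∑ m, blockCoeff C a b m • euPairBasis r m =
      (∑ m, Sum.elim (fun i => Sum.elim (fun j => C i j) 0 (splitIndex r b)) 0
        (splitIndex r a) m • euBasis r m, 0) := by
  have h := Equiv.sum_comp (splitIndex r) (fun m : Fin r ⊕ Fin r =>
    Sum.elim (fun i => Sum.elim (fun j => Sum.elim (C i j) 0) 0 (splitIndex r b)) 0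
      (splitIndex r a) m • (Sum.elim (fun i => (euBasis r i, 0)) (fun j => (0, euDualBasis r j)) m :
        EuSp r × (EuSp r →L[ℝ] ℝ)))
  rw [euPairBasis_eq]
  refine h.trans ?_
  rw [Fintype.sum_sum_type]
  rcases splitIndex r a with i | i <;> rcases splitIndex r b with j | j <;>
    simp [Prod.ext_iff, Prod.fst_sum, Prod.snd_sum]

section Hausdorff

variable [T2Space M]

/-- One cutoff function from `M` multiplies the section of `𝔤` and its lift, so the extension stays
over the anchor everywhere. That `X 0` vanishes identically, not just near the point, is what the
bracket with a vertical field requires. -/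
theorem exists_extension_liftField {c : M} {p₀ : Γ.DualTotal}
    (hp : p₀ ∈ (Γ.dualChart c).source) :
    ∃ (X : EuSp r → ∀ x, Γ.Alg x)
      (V : EuSp r → (EuSp r →L[ℝ] ℝ) → ∀ p : Γ.DualTotal, TangentSpace (dualModel n r) p),
      (∀ w ℓ p, Γ.dproj p (V w ℓ p) = Γ.anchor p.1 (X w p.1)) ∧
      (∀ w, Γ.algebroid.IsSmooth (X w)) ∧
      (∀ w ℓ, ContMDiff (dualModel n r) (dualModel n r).tangent ∞
        (fun p => (⟨p, V w ℓ p⟩ : TangentBundle (dualModel n r) Γ.DualTotal))) ∧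
      (∀ᶠ x in 𝓝 p₀.1, ∀ w, X w x = Γ.locInv c x w) ∧
      (∀ᶠ p in 𝓝 p₀, ∀ w ℓ, V w ℓ p = Γ.liftField c w ℓ p) ∧ ∀ x, X 0 x = 0 := by
  obtain ⟨hb, hc⟩ := Γ.mem_dualChart_source.1 hp
  have hopen := (Γ.isOpen_base c).inter (isOpen_extChartAt_source (I := 𝓡 n) c)
  obtain ⟨χ, hχ, hs, h1⟩ := exists_contMDiff_tsupport_subset (I := 𝓡 n)
    (hopen.mem_nhds ⟨hb, hc⟩)
  have hcont := Γ.contMDiff_proj.continuous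
  have hsupp : tsupport (fun p : Γ.DualTotal => χ p.1) ⊆ (Γ.dualChart c).source := fun p h =>
    Γ.mem_dualChart_source.2 (hs (tsupport_comp_subset_preimage χ hcont h))
  refine ⟨fun w x => χ x • Γ.locInv c x w, fun w ℓ p => χ p.1 • Γ.liftField c w ℓ p, ?_,
    fun w => isSmooth_smul_locInv hχ (hs.trans inter_subset_left) w, fun w ℓ => ?_, ?_, ?_, ?_⟩
  · intro w ℓ p
    by_cases h : p ∈ (Γ.dualChart c).source
    · refine (LinearMap.map_smul _ _ _).trans ?_
      refine Eq.trans ?_ (LinearMap.map_smul _ _ _).symm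
      exact congrArg (χ p.1 • ·) (dproj_liftField h w ℓ)
    · have h0 : χ p.1 = 0 := by
        by_contra h0
        exact h (hsupp (subset_tsupport (fun p : Γ.DualTotal => χ p.1) h0))
      refine (LinearMap.map_smul _ _ _).trans ?_
      refine Eq.trans ?_ (LinearMap.map_smul _ _ _).symm
      rw [h0, zero_smul, zero_smul]
  · refine contMDiff_smul_coordField (I := dualModel n r) (hχ.comp Γ.contMDiff_proj)
      (isOpen_extChartAt_source (I := dualModel n r) (⟨c, 0⟩ : Γ.DualTotal)) hsupp subset_rfl ?_
    intro p h
    obtain ⟨h2, h3⟩ := Γ.mem_dualChart_source.1 h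
    have h4 : ContMDiffAt (dualModel n r) 𝓘(ℝ, EuSp n) ∞ (fun q => Γ.anchorCoord c w q.1) p :=
      ContMDiffAt.comp (g := Γ.anchorCoord c w) (f := Γ.proj) p (contMDiffAt_anchorCoord h2 h3 w)
        (Γ.contMDiff_proj p)
    have h5 := h4.prodMk_space (contMDiffAt_const (c := ℓ))
    exact h5.contMDiffWithinAt
  · filter_upwards [h1] with x hx w
    rw [hx, one_smul]
  · filter_upwards [hcont.continuousAt.eventually h1] with p hp w ℓ
    exact (congrArg (· • Γ.liftField c w ℓ p) hp).trans (one_smul ℝ _)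
  · intro x
    beta_reduce
    rw [locInv_zero, smul_zero]

/-- Brackets within the first half of the frame reproduce the structure functions of `𝔤`, with no
vertical component, and all others vanish. The coefficient of the density is that of `Ω`, constant
along the fibres, so the divergence identity reduces to the one on `M`. -/
theorem exists_extension_piFrame {Ω : Γ.Density} (hΩ : Γ.IsInvariantVolume Ω) {c : M}
    {z : EuSp n × (EuSp r →L[ℝ] ℝ)} (hz : z.1 ∈ Γ.baseRegion c) :
    ∃ (S : Fin (2 * r) → ∀ p, Γ.piAlgebroid.Fiber p)
      (B : Fin (2 * r) → Fin (2 * r) → ∀ p, Γ.piAlgebroid.Fiber p)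
      (C : Fin (2 * r) → Fin (2 * r) → Fin (2 * r) → ℝ),
      (∀ a, Γ.piAlgebroid.IsSmooth (S a)) ∧
      (∀ a b, Γ.piAlgebroid.IsBracket (S a) (S b) (B a b)) ∧
      (∀ᶠ q in 𝓝 ((Γ.dualChart c).symm z), ∀ a, S a q = Γ.piFrame c a q) ∧
      (∀ a b m, C a b m = - C b a m) ∧
      (∀ a b, B a b ((Γ.dualChart c).symm z) =
        ∑ m, C a b m • Γ.piFrame c m ((Γ.dualChart c).symm z)) ∧
      (∀ a b m, (splitIndex r b).isRight → C a b m = 0) ∧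
      (∀ a, divergence ((euBasis n).prod (euDualBasis r))
        (fun x => baseCoeff Ω c x.1 • Sum.elim (fun i => (Γ.baseVec c i x.1, 0))
          (fun j => (0, euDualBasis r j)) (splitIndex r a)) z =
        baseCoeff Ω c z.1 * ∑ b, C b a b) := by
  obtain ⟨q, hq⟩ : ∃ q, q = (Γ.dualChart c).symm z := ⟨_, rfl⟩
  rw [← hq]
  have hqs : q ∈ (Γ.dualChart c).source :=
    hq ▸ (Γ.dualChart c).map_target (Γ.mem_dualChart_target.2 hz)
  have hq1 : q.1 = (extChartAt (𝓡 n) c).symm z.1 := by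
    rw [hq, Γ.dualChart_symm hz]
    rfl
  have hqb := (Γ.mem_dualChart_source.1 hqs).1
  obtain ⟨X, V, hXV, hX, hV, hXe, hVe, hX0⟩ := exists_extension_liftField hqs
  obtain ⟨C, hC, hCB, hdiv⟩ := exists_extension_bracket hΩ hz
  let e := euPairBasis r
  choose Z B hZ hB hBe using fun a b : Fin (2 * r) => exists_projSection_bracket
    (hXV (e a).1 (e a).2) (hXV (e b).1 (e b).2) (hX _) (hX _) (hV _ _) (hV _ _)
  refine ⟨fun a => projSection (X (e a).1) (V (e a).1 (e a).2) (hXV _ _), B, blockCoeff C,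
    fun a => isSmooth_projSection _ (hX _) (hV _ _), hB, ?_, ?_, ?_, ?_, ?_⟩
  · filter_upwards [hVe, Γ.contMDiff_proj.continuous.continuousAt.eventually hXe,
      (isOpen_extChartAt_source (I := dualModel n r) (⟨c, 0⟩ : Γ.DualTotal)).mem_nhds hqs]
      with p h1 h2 h3 a
    exact (eq_piFrame_iff h3).2 ⟨h2 _, h1 _ _⟩
  · intro a b m
    simp only [blockCoeff]
    rcases splitIndex r a with i | i <;> rcases splitIndex r b with j | j <;>
      rcases splitIndex r m with k | k <;> first | exact hC i j k | simp
  · intro a b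
    refine (fiberCoord_bijective hqs).1 ?_
    have h1 : Γ.fiberCoord c q (∑ m, blockCoeff C a b m • Γ.piFrame c m q) =
        ∑ m, blockCoeff C a b m • euPairBasis r m := by
      refine (map_sum (Γ.fiberCoord c q) _ _).trans (Finset.sum_congr rfl fun m _ => ?_)
      exact (LinearMap.map_smul _ _ _).trans (congrArg _ (fiberCoord_piFrame hqs m))
    refine Eq.trans ?_ (h1.trans (sum_blockCoeff C a b)).symm
    refine Prod.ext ?_ ?_
    · have h2 : Z a b q.1 = ∑ m, Sum.elim (fun i => Sum.elim (fun j => C i j) 0 (splitIndex r b)) 0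
          (splitIndex r a) m • Γ.locInv c q.1 (euBasis r m) := by
        have ha : (e a).1 = Sum.elim (euBasis r) 0 (splitIndex r a) := by
          change (euPairBasis r a).1 = _
          rw [euPairBasis_eq, Function.comp_apply]
          rcases splitIndex r a with i | i <;> rfl
        have hb : (e b).1 = Sum.elim (euBasis r) 0 (splitIndex r b) := by
          change (euPairBasis r b).1 = _
          rw [euPairBasis_eq, Function.comp_apply]
          rcases splitIndex r b with i | i <;> rfl
        have h3 := hZ a b
        rw [ha, hb] at h3
        generalize splitIndex r a = a' at h3 ⊢
        generalize splitIndex r b = b' at h3 ⊢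
        rcases a' with i | i
        · rcases b' with j | j
          · rw [hq1] at hXe ⊢
            exact hCB i j _ _ _ (hX _) (hX _) h3 (hXe.mono fun _ h => h _)
              (hXe.mono fun _ h => h _)
          · refine (bracket_eq_zero_right hX0 h3 _).trans ?_
            simp
        · refine (bracket_eq_zero_left hX0 h3 _).trans ?_
          simp
      change Γ.locTriv c q.1 (B a b q).1.1 = _
      rw [(hBe a b q).1, h2, map_sum]
      refine Finset.sum_congr rfl fun m _ => ?_
      rw [map_smul, Γ.locTriv_locInv c q.1 hqb]
    · change (Γ.dDualChart c q (B a b q).1.2).2 = 0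
      rw [(hBe a b q).2]
      exact dDualChart_mlieBracket_snd hqs (hV _ _) (hV _ _) (hVe.mono fun _ h => h _ _)
        (hVe.mono fun _ h => h _ _)
  · intro a b m hb
    simp only [blockCoeff]
    generalize splitIndex r b = b' at hb ⊢
    rcases b' with j | j
    · exact absurd hb (by simp)
    · rcases splitIndex r a with i | i <;> simp
  -- For a lifted frame vector the trace reduces to its first block, which is the identity on the
  -- base. For a vertical one the structure functions vanish, and so does the divergence, because
  -- the field is constant along the fibres and has no base component.
  · intro a
    have h0 := (((contDiffOn_baseCoeff hΩ c).contDiffAt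
      ((Γ.isOpen_baseRegion c).mem_nhds hz)).differentiableAt (by simp))
    have hsum := Equiv.sum_comp (splitIndex r) (fun m : Fin r ⊕ Fin r =>
      Sum.elim (fun i => Sum.elim (fun j => Sum.elim (C i j) 0) 0 (splitIndex r a)) 0 m m)
    refine Eq.trans ?_ (congrArg (baseCoeff Ω c z.1 * ·) hsum.symm)
    rw [Fintype.sum_sum_type]
    rcases splitIndex r a with j | j
    · have h1 := (((contDiffOn_baseVec (Γ := Γ) c j).contDiffAt
        ((Γ.isOpen_baseRegion c).mem_nhds hz)).differentiableAt (by simp))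
      have h2 := divergence_prod (euBasis n) (euDualBasis r) (z := z)
        (f := fun x => baseCoeff Ω c x • Γ.baseVec c j x)
        (g := fun x => baseCoeff Ω c x • (0 : EuSp r →L[ℝ] ℝ)) (h0.smul h1)
        (h0.smul (differentiableAt_const _))
      refine h2.trans ((hdiv j).trans ?_)
      simp
    · have h2 := divergence_prod (euBasis n) (euDualBasis r) (z := z)
        (f := fun x => baseCoeff Ω c x • (0 : EuSp n))
        (g := fun x => baseCoeff Ω c x • euDualBasis r j) (h0.smul (differentiableAt_const _))
        (h0.smul (differentiableAt_const _))
      refine h2.trans ?_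
      simp [divergence]

end Hausdorff

end LieGroupoid

/-! ### The canonical symplectic form and its Liouville volume -/

theorem exteriorPower.epsilon_eq_ιMulti {V : Type*} [AddCommGroup V] [Module ℝ V] {k : ℕ}
    (e : Basis (Fin k) ℝ V) (L : ⋀[ℝ]^k V →ₗ[ℝ] ℝ) (h : L (exteriorPower.ιMulti ℝ k e) = 1) :
    (Classical.epsilon fun ν => L ν = 1) = exteriorPower.ιMulti ℝ k e := by
  -- The top exterior power is a line, so an element on which `L` takes the value one is unique and
  -- the choice is harmless.
  have h2 := Classical.epsilon_spec (p := fun ν => L ν = 1) ⟨_, h⟩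
  have h3 := exteriorPower.eq_smul_ιMulti_basis e (Classical.epsilon fun ν => L ν = 1)
  generalize (Classical.epsilon fun ν => L ν = 1) = ν at h2 h3
  replace h2 : L ν = 1 := h2
  rw [h3, map_smul, h, smul_eq_mul, mul_one] at h2
  rw [h3, h2, one_smul]

namespace LieGroupoid

variable {n r : ℕ} {M G : Type*}
    [TopologicalSpace M] [ChartedSpace (EuSp n) M] [IsManifold (𝓡 n) ∞ M]
    [TopologicalSpace G] [ChartedSpace (EuSp (n + r)) G] [IsManifold (𝓡 (n + r)) ∞ G]
    {Γ : LieGroupoid n r M G}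

/-- The Koszul formula for the canonical symplectic form. -/
theorem differential_tautological {Θ : Γ.piAlgebroid.Form ℝ 2}
    (hΘ : AlgebroidData.IsDifferential Γ.tautological Θ) {S T B : ∀ p, Γ.piAlgebroid.Fiber p}
    (hS : Γ.piAlgebroid.IsSmooth S) (hT : Γ.piAlgebroid.IsSmooth T)
    (hB : Γ.piAlgebroid.IsBracket S T B) (p : Γ.DualTotal) :
    Θ p ![S p, T p] =
      dirDeriv (dualModel n r) (fun q : Γ.DualTotal => (q.2 (T q).1.1 : ℝ)) p (S p).1.2 -
      dirDeriv (dualModel n r) (fun q : Γ.DualTotal => (q.2 (S q).1.1 : ℝ)) p (T p).1.2 -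
      p.2 (B p).1.1 := by
  have h := hΘ ![S, T] (fun _ _ => B) (by simp [Fin.forall_fin_two, hS, hT])
    (by simp [Fin.forall_fin_two, hB]) p
  have h1 : (fun i => ![S, T] i p) = ![S p, T p] := by
    funext i
    fin_cases i <;> rfl
  rw [h1] at h
  refine h.trans ?_
  have h2 : (Finset.Iio (0 : Fin 2)) = ∅ := rfl
  have h3 : (Finset.Iio (1 : Fin 2)) = {0} := rfl
  rw [Fin.sum_univ_two, Fin.sum_univ_two, h2, h3, Finset.sum_empty, Finset.sum_singleton]
  simp only [Fin.val_zero, Fin.val_one, pow_zero, pow_one, one_mul, neg_one_mul, zero_add]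
  rw [← sub_eq_add_neg, ← sub_eq_add_neg]
  rfl

section Hausdorff

variable [T2Space M]

/-- In the Koszul formula the second argument is vertical: `λ` vanishes on it near `p`, and its
brackets with the frame vanish at `p`. What remains is minus the derivative of the fibre-linear
function `q ↦ ⟨q, e⟩` in a coordinate direction of the fibre. -/
theorem symplectic_piFrame {Θ : Γ.piAlgebroid.Form ℝ 2}
    (hΘ : AlgebroidData.IsDifferential Γ.tautological Θ) {Ω : Γ.Density}
    (hΩ : Γ.IsInvariantVolume Ω) {c : M} {p : Γ.DualTotal} (hp : p ∈ (Γ.dualChart c).source)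
    (a : Fin (2 * r)) (j : Fin r) :
    Θ p ![Γ.piFrame c a p, Γ.piFrame c ((splitIndex r).symm (Sum.inr j)) p] =
      - euDualBasis r j (euPairBasis r a).1 := by
  obtain ⟨S, B, C, hS, hB, hSe, -, hBC, hC, -⟩ :=
    exists_extension_piFrame hΩ (Γ.fst_dualChart_mem hp)
  rw [(Γ.dualChart c).left_inv hp] at hSe hBC
  set b := (splitIndex r).symm (Sum.inr j) with hb
  have heb : euPairBasis r b = (0, euDualBasis r j) := by
    rw [euPairBasis_eq, hb, Function.comp_apply, Equiv.apply_symm_apply]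
    rfl
  have hs := (isOpen_extChartAt_source (I := dualModel n r) (⟨c, 0⟩ : Γ.DualTotal)).mem_nhds hp
  have h0 := hSe.self_of_nhds
  rw [← h0 a, ← h0 b, differential_tautological hΘ (hS a) (hS b) (hB a b)]
  have hfst : ∀ a, ∀ᶠ q in 𝓝 p, (q.2 (S a q).1.1 : ℝ) =
      (Γ.dualChart c q).2 (euPairBasis r a).1 := by
    intro a
    filter_upwards [hSe, hs] with q h1 h2
    rw [Γ.dualChart_snd (Γ.mem_dualChart_source.1 h2).1, ((eq_piFrame_iff h2).1 (h1 a)).1]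
  have h1 : dirDeriv (dualModel n r) (fun q : Γ.DualTotal => (q.2 (S b q).1.1 : ℝ)) p
      (S a p).1.2 = 0 := by
    have h2 : (fun q : Γ.DualTotal => (q.2 (S b q).1.1 : ℝ)) =ᶠ[𝓝 p] fun _ => 0 := by
      filter_upwards [hfst b] with q hq
      rw [hq, heb]
      exact ContinuousLinearMap.map_zero _
    rw [dirDeriv, h2.mfderiv_eq, mfderiv_const]
    rfl
  have h2 : dirDeriv (dualModel n r) (fun q : Γ.DualTotal => (q.2 (S a q).1.1 : ℝ)) p
      (S b p).1.2 = euDualBasis r j (euPairBasis r a).1 := by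
    have h4 : (fun q : Γ.DualTotal => (q.2 (S a q).1.1 : ℝ)) =ᶠ[𝓝 p]
      fun q => (Γ.dualChart c q).2 (euPairBasis r a).1 := hfst a
    rw [dirDeriv, h4.mfderiv_eq]
    have h3 := HasMFDerivAt.comp (g := fun ℓ : EuSp r →L[ℝ] ℝ => ℓ (euPairBasis r a).1)
      (f := fun q => (Γ.dualChart c q).2) (I' := 𝓘(ℝ, EuSp r →L[ℝ] ℝ)) p
      (ContinuousLinearMap.apply ℝ ℝ (euPairBasis r a).1).hasMFDerivAt
      ((contMDiffAt_dualChart_snd hp).mdifferentiableAt (by simp)).hasMFDerivAt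
    refine (congrArg (fun L => L (S b p).1.2) h3.mfderiv).trans ?_
    refine (congrArg (fun L : EuSp r →L[ℝ] ℝ => L (euPairBasis r a).1)
      (mfderiv_dualChart_snd hp (S b p).1.2)).trans ?_
    rw [((eq_piFrame_iff hp).1 (h0 b)).2]
    refine (congrArg (fun L : EuSp n × (EuSp r →L[ℝ] ℝ) => L.2 (euPairBasis r a).1)
      (dDualChart_liftField hp _ _)).trans ?_
    rw [heb]
  have h3 : B a b p = 0 := by
    rw [hBC]
    refine Finset.sum_eq_zero fun m _ => ?_
    rw [hC a b m (by simp [hb])]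
    exact zero_smul ℝ _
  rw [h1, h2, h3, zero_sub]
  refine (congrArg (fun t : ℝ => - euDualBasis r j (euPairBasis r a).1 - t) ?_).trans (sub_zero _)
  exact ContinuousLinearMap.map_zero _

theorem wedgePow_piFrame {Θ : Γ.piAlgebroid.Form ℝ 2}
    (hΘ : AlgebroidData.IsDifferential Γ.tautological Θ) {Ω : Γ.Density}
    (hΩ : Γ.IsInvariantVolume Ω) {c : M} {p : Γ.DualTotal} (hp : p ∈ (Γ.dualChart c).source) :
    wedgePow (Θ p) r (fun a => Γ.piFrame c a p) =
      (-1) ^ (r * (r + 1) / 2) * (r.factorial : ℝ) := by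
  have h := wedgePow_append (Θ p) r (fun i => Γ.piFrame c ((splitIndex r).symm (Sum.inl i)) p)
    (fun i => Γ.piFrame c ((splitIndex r).symm (Sum.inr i)) p) (fun i j => by
      rw [symplectic_piFrame hΘ hΩ hp, euPairBasis_eq, Function.comp_apply, Equiv.apply_symm_apply]
      refine (congrArg Neg.neg (euDualBasis_apply i j)).trans ?_
      split_ifs <;> simp) (fun i j => by
      rw [symplectic_piFrame hΘ hΩ hp, euPairBasis_eq, Function.comp_apply, Equiv.apply_symm_apply]
      exact (congrArg Neg.neg (ContinuousLinearMap.map_zero _)).trans neg_zero)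
  rw [append_comp_cast] at h
  refine Eq.trans (congrArg _ ?_) h
  funext a
  obtain ⟨a, rfl⟩ := (splitIndex r).symm.surjective a
  rw [Function.comp_apply, Equiv.apply_symm_apply]
  rcases a with i | i <;> rfl

/-- The sign and the factorial of the normalisation are those of `wedgePow_piFrame`, so the
Liouville volume of the frame is exactly one. -/
theorem liouvilleDual_eq {Θ : Γ.piAlgebroid.Form ℝ 2}
    (hΘ : AlgebroidData.IsDifferential Γ.tautological Θ) {Ω : Γ.Density}
    (hΩ : Γ.IsInvariantVolume Ω) {c : M} {p : Γ.DualTotal} (hp : p ∈ (Γ.dualChart c).source) :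
    Γ.liouvilleDual Θ p = exteriorPower.ιMulti ℝ (2 * r) (fun a => Γ.piFrame c a p) := by
  have h1 : exteriorPower.alternatingMapLinearEquiv
      (((-1 : ℝ) ^ (r * (r + 1) / 2) / (r.factorial : ℝ)) • wedgePow (Θ p) r)
      (exteriorPower.ιMulti ℝ (2 * r) (piBasis hp)) = 1 := by
    rw [exteriorPower.alternatingMapLinearEquiv_apply_ιMulti, AlternatingMap.smul_apply, piBasis_eq,
      wedgePow_piFrame hΘ hΩ hp, smul_eq_mul]
    have h2 : (r.factorial : ℝ) ≠ 0 := Nat.cast_ne_zero.2 r.factorial_ne_zero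
    have h3 : ((-1 : ℝ) ^ (r * (r + 1) / 2)) * (-1) ^ (r * (r + 1) / 2) = 1 := by
      rw [← mul_pow]
      simp
    rw [div_mul_eq_mul_div, ← _root_.mul_assoc, h3, one_mul, div_self h2]
  exact (exteriorPower.epsilon_eq_ιMulti _ _ h1).trans
    (congrArg (exteriorPower.ιMulti ℝ (2 * r)) (piBasis_eq hp))

end Hausdorff


/-! ### Coordinate frames of `𝔤*` -/

theorem apply_eq_baseCoeff (Ω : Γ.Density) {c x : M} (hb : x ∈ Γ.base c)
    (hc : x ∈ (extChartAt (𝓡 n) c).source) {Y : Fin n → TangentSpace (𝓡 n) x}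
    (hY : ∀ i, (mfderiv (𝓡 n) 𝓘(ℝ, EuSp n) (extChartAt (𝓡 n) c) x (Y i) : EuSp n) =
      euBasis n i) : Ω x Y = baseCoeff Ω c (extChartAt (𝓡 n) c x) •
        exteriorPower.ιMulti ℝ r (fun i => Γ.locInv c x (euBasis r i)) := by
  obtain ⟨y, hy⟩ : ∃ y, y = extChartAt (𝓡 n) c x := ⟨_, rfl⟩
  have hx : x = (extChartAt (𝓡 n) c).symm y := by rw [hy, (extChartAt (𝓡 n) c).left_inv hc]
  have hyt : y ∈ (extChartAt (𝓡 n) c).target := hy ▸ (extChartAt (𝓡 n) c).map_source hc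
  rw [← hy]
  clear hy
  subst hx
  have h : Y = coordFrame (𝓡 n) (euBasis n) c y := funext fun i =>
    (isInvertible_mfderiv_extChartAt hc).injective
      ((hY i).trans (mfderiv_extChartAt_mfderiv_symm hyt _).symm)
  rw [h, apply_coordFrame_eq_baseCoeff Ω hb]

/-- The coordinates of the fibres, as elements of the dual fibres. -/
def dualFrame (Γ : LieGroupoid n r M G) (c x : M) (j : Fin r) : Γ.Dual x :=
  ((euDualBasis r j).comp (Γ.locTriv c x) : Γ.Alg x →L[ℝ] ℝ)

theorem dualFrame_locInv {c x : M} (hx : x ∈ Γ.base c) (j : Fin r) (w : EuSp r) :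
    (Γ.dualFrame c x j (Γ.locInv c x w) : ℝ) = euDualBasis r j w :=
  congrArg (euDualBasis r j) (Γ.locTriv_locInv c x hx w)

/-- `X` consists of the coordinate vectors at `p` in the chart of `𝔤*`. -/
def IsCoordFrame (Γ : LieGroupoid n r M G) (c : M) (p : Γ.DualTotal)
    (X : Fin n ⊕ Fin r → TangentSpace (dualModel n r) p) : Prop :=
  ∀ a, Γ.dDualChart c p (X a) = (euBasis n).prod (euDualBasis r) a

theorem isCoordFrame_coordFrame {c : M} {z : EuSp n × (EuSp r →L[ℝ] ℝ)}
    (hz : z.1 ∈ Γ.baseRegion c) : Γ.IsCoordFrame c ((Γ.dualChart c).symm z)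
      (coordFrame (dualModel n r) ((euBasis n).prod (euDualBasis r)) (⟨c, 0⟩ : Γ.DualTotal) z) :=
  fun _ => mfderiv_extChartAt_mfderiv_symm (I := dualModel n r) (Γ.mem_dualChart_target.2 hz) _

namespace IsCoordFrame

variable {c : M} {p : Γ.DualTotal} {X : Fin n ⊕ Fin r → TangentSpace (dualModel n r) p}

/-- The second block consists of vertical vectors, which `dproj` kills. Hence only the identity
shuffle contributes to products of base forms with fibre forms. -/
theorem eq_sumElim (hX : Γ.IsCoordFrame c p X) (hp : p ∈ (Γ.dualChart c).source) :
    X = Sum.elim (fun i => X (Sum.inl i)) (fun j => Γ.vertLift p (Γ.dualFrame c p.1 j)) := by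
  funext a
  rcases a with i | j
  · rfl
  · refine dDualChart_injective hp ((hX _).trans ?_)
    refine Eq.trans ?_ (Γ.mfderiv_dualChart_vertLift hp (Γ.dualFrame c p.1 j) (euDualBasis r j)
      fun v => (dualFrame_locInv (Γ.mem_dualChart_source.1 hp).1 j v).symm).symm
    simp

theorem mfderiv_dproj (hX : Γ.IsCoordFrame c p X) (hp : p ∈ (Γ.dualChart c).source) (i : Fin n) :
    (mfderiv (𝓡 n) 𝓘(ℝ, EuSp n) (extChartAt (𝓡 n) c) p.1 (Γ.dproj p (X (Sum.inl i))) : EuSp n) =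
      euBasis n i := by
  refine (Γ.mfderiv_extChartAt_dproj hp _).trans ?_
  refine (congrArg (fun q : EuSp n × (EuSp r →L[ℝ] ℝ) => q.1) (hX (Sum.inl i))).trans ?_
  simp

theorem density_dproj (hX : Γ.IsCoordFrame c p X) (hp : p ∈ (Γ.dualChart c).source)
    (Ω : Γ.Density) : Ω p.1 (fun i => Γ.dproj p (X (Sum.inl i))) =
      baseCoeff Ω c (Γ.dualChart c p).1 •
        exteriorPower.ιMulti ℝ r (fun i => Γ.locInv c p.1 (euBasis r i)) := by
  obtain ⟨hb, hc⟩ := Γ.mem_dualChart_source.1 hp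
  rw [Γ.dualChart_fst hb]
  exact apply_eq_baseCoeff Ω hb hc fun i => hX.mfderiv_dproj hp i

/-- Forms of type (base, fibre) on coordinate frames. -/
theorem domCoprod_apply {N₁ N₂ : Type*} [AddCommGroup N₁] [Module ℝ N₁] [AddCommGroup N₂]
    [Module ℝ N₂] (hX : Γ.IsCoordFrame c p X) (hp : p ∈ (Γ.dualChart c).source)
    (a : TangentSpace (𝓡 n) p.1 [⋀^Fin n]→ₗ[ℝ] N₁) (b : Γ.Dual p.1 [⋀^Fin r]→ₗ[ℝ] N₂) :
    (a.compLinearMap (Γ.dproj p)).domCoprod (b.compLinearMap (Γ.vertPart p)) X =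
      a (fun i => Γ.dproj p (X (Sum.inl i))) ⊗ₜ b (Γ.dualFrame c p.1) := by
  refine (congrArg _ (hX.eq_sumElim hp)).trans ?_
  refine (AlternatingMap.domCoprod_sumElim _ _ _ _ fun x i j h => ?_).trans ?_
  · refine a.map_coord_zero i ?_
    rw [h, Γ.dproj_vertLift]
  · congr 1
    refine congrArg b (funext fun j => ?_)
    exact Γ.vertPart_vertLift p _

/-- The base factor gives the coefficient times the wedge of the frame; contracting that with the
dual frame gives the determinant of the identity matrix. -/
theorem densityForm_apply (hX : Γ.IsCoordFrame c p X) (hp : p ∈ (Γ.dualChart c).source)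
    (Ω : Γ.Density) : Γ.densityForm Ω p X = baseCoeff Ω c (Γ.dualChart c p).1 := by
  refine (congrArg (contractRight ℝ (⋀[ℝ]^r (Γ.Alg p.1))) (hX.domCoprod_apply hp (Ω p.1)
    ((exteriorPower.alternatingMapToDual ℝ (Γ.Alg p.1) r).compLinearMap
      (ContinuousLinearMap.coeLM ℝ)))).trans ?_
  rw [contractRight_apply, hX.density_dproj hp Ω, map_smul, smul_eq_mul]
  refine (congrArg (baseCoeff Ω c (Γ.dualChart c p).1 * ·) ?_).trans (mul_one _)
  refine (exteriorPower.alternatingMapToDual_apply_ιMulti _ _).trans ?_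
  rw [← Matrix.det_one (n := Fin r)]
  congr 1
  ext i j
  refine (dualFrame_locInv (Γ.mem_dualChart_source.1 hp).1 _ _).trans ?_
  refine (euDualBasis_apply _ _).trans ?_
  rw [Matrix.one_apply]

theorem totalOrientation_apply (hX : Γ.IsCoordFrame c p X) (hp : p ∈ (Γ.dualChart c).source)
    (volM : (tangentAlgebroid (𝓡 n) M).Form ℝ n) (volE : ∀ x : M, Γ.Dual x [⋀^Fin r]→ₗ[ℝ] ℝ) :
    Γ.totalOrientation volM volE p X =
      volM p.1 (fun i => Γ.dproj p (X (Sum.inl i))) * volE p.1 (Γ.dualFrame c p.1) :=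
  congrArg (LinearMap.mul' ℝ ℝ) (hX.domCoprod_apply hp (volM p.1) (volE p.1))

end IsCoordFrame

end LieGroupoid

/-! ### The symplectic volume as an invariant density -/

namespace LieGroupoid

section Frame

variable {n r : ℕ} {M G : Type*}
    [TopologicalSpace M] [ChartedSpace (EuSp n) M] [IsManifold (𝓡 n) ∞ M]
    [TopologicalSpace G] [ChartedSpace (EuSp (n + r)) G] [IsManifold (𝓡 (n + r)) ∞ G]
    {Γ : LieGroupoid n r M G}

theorem eq_coordFrame {c x : M} (hc : x ∈ (extChartAt (𝓡 n) c).source)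
    {Y : Fin n → TangentSpace (𝓡 n) x}
    (hY : ∀ i, (mfderiv (𝓡 n) 𝓘(ℝ, EuSp n) (extChartAt (𝓡 n) c) x (Y i) : EuSp n) =
      euBasis n i) {y : EuSp n} (hy : y ∈ (extChartAt (𝓡 n) c).target)
    (hx : x = (extChartAt (𝓡 n) c).symm y) {N₁ : Type*} [AddCommGroup N₁] [Module ℝ N₁]
    (η : ∀ x : M, TangentSpace (𝓡 n) x [⋀^Fin n]→ₗ[ℝ] N₁) :
    η x Y = η _ (coordFrame (𝓡 n) (euBasis n) c y) := by
  subst hx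
  have h : Y = coordFrame (𝓡 n) (euBasis n) c y := funext fun i =>
    (isInvertible_mfderiv_extChartAt hc).injective
      ((hY i).trans (mfderiv_extChartAt_mfderiv_symm hy _).symm)
  rw [h]

theorem fst_dualChart_symm {c : M} {z : EuSp n × (EuSp r →L[ℝ] ℝ)} (hz : z.1 ∈ Γ.baseRegion c) :
    ((Γ.dualChart c).symm z).1 = (extChartAt (𝓡 n) c).symm z.1 := by
  rw [Γ.dualChart_symm hz]
  rfl

theorem dualChart_symm_mem {c : M} {z : EuSp n × (EuSp r →L[ℝ] ℝ)} (hz : z.1 ∈ Γ.baseRegion c) :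
    (Γ.dualChart c).symm z ∈ (Γ.dualChart c).source :=
  (Γ.dualChart c).map_target (Γ.mem_dualChart_target.2 hz)

theorem anchorCoord_zero (c x : M) : Γ.anchorCoord c 0 x = 0 := by
  have h : Γ.anchor x (Γ.locInv c x 0) = 0 := by rw [locInv_zero, map_zero]
  exact (congrArg (mfderiv (𝓡 n) 𝓘(ℝ, EuSp n) (extChartAt (𝓡 n) c) x) h).trans
    (ContinuousLinearMap.map_zero _)

/-- The anchors of the frame of `π^!𝔤` in coordinates. -/
def piVec (Γ : LieGroupoid n r M G) (c : M) (a : Fin (2 * r)) (z : EuSp n × (EuSp r →L[ℝ] ℝ)) :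
    EuSp n × (EuSp r →L[ℝ] ℝ) :=
  Sum.elim (fun i => (Γ.baseVec c i z.1, 0)) (fun j => (0, euDualBasis r j)) (splitIndex r a)

theorem piVec_eq (c : M) (a : Fin (2 * r)) (z : EuSp n × (EuSp r →L[ℝ] ℝ)) :
    Γ.piVec c a z = (Γ.anchorCoord c (euPairBasis r a).1 ((extChartAt (𝓡 n) c).symm z.1),
      (euPairBasis r a).2) := by
  rw [piVec, euPairBasis_eq, Function.comp_apply]
  rcases splitIndex r a with i | j
  · rfl
  · exact Prod.ext (anchorCoord_zero _ _).symm rfl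

theorem anchor_piFrame {c : M} {z : EuSp n × (EuSp r →L[ℝ] ℝ)} (hz : z.1 ∈ Γ.baseRegion c)
    (a : Fin (2 * r)) :
    Γ.piAlgebroid.anchor _ (Γ.piFrame c a ((Γ.dualChart c).symm z)) =
      mfderiv 𝓘(ℝ, EuSp n × (EuSp r →L[ℝ] ℝ)) (dualModel n r) (Γ.dualChart c).symm z
        (Γ.piVec c a z) := by
  have hs := dualChart_symm_mem hz
  have h1 : Γ.piAlgebroid.anchor _ (Γ.piFrame c a ((Γ.dualChart c).symm z)) =
      Γ.liftField c (euPairBasis r a).1 (euPairBasis r a).2 ((Γ.dualChart c).symm z) :=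
    ((eq_piFrame_iff hs).1 rfl).2
  refine h1.trans (dDualChart_injective hs ?_)
  refine (dDualChart_liftField hs _ _).trans ?_
  refine Eq.trans ?_ (mfderiv_extChartAt_mfderiv_symm (I := dualModel n r)
    (Γ.mem_dualChart_target.2 hz) _).symm
  rw [piVec_eq, fst_dualChart_symm hz]

theorem contDiffOn_piVec [T2Space M] (c : M) (a : Fin (2 * r)) :
    ContDiffOn ℝ ∞ (Γ.piVec c a) (Γ.dualChart c).target := by
  have h : Γ.piVec c a = fun z => Sum.elim (fun i => (Γ.baseVec c i z.1, (0 : EuSp r →L[ℝ] ℝ)))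
    (fun j => ((0 : EuSp n), euDualBasis r j)) (splitIndex r a) := rfl
  rw [h]
  rcases splitIndex r a with i | j
  · exact ((contDiffOn_baseVec c i).comp contDiff_fst.contDiffOn
      (fun z hz => Γ.mem_dualChart_target.1 hz)).prodMk contDiffOn_const
  · exact contDiffOn_const

theorem symplecticVolume_coordFrame [T2Space M] {Θ : Γ.piAlgebroid.Form ℝ 2}
    (hΘ : AlgebroidData.IsDifferential Γ.tautological Θ) {Ω : Γ.Density}
    (hΩ : Γ.IsInvariantVolume Ω) {c : M} {z : EuSp n × (EuSp r →L[ℝ] ℝ)}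
    (hz : z.1 ∈ Γ.baseRegion c) :
    Γ.symplecticVolume Θ Ω _ (coordFrame (dualModel n r) ((euBasis n).prod (euDualBasis r))
      (⟨c, 0⟩ : Γ.DualTotal) z) = baseCoeff Ω c z.1 •
        exteriorPower.ιMulti ℝ (2 * r) (fun a => Γ.piFrame c a ((Γ.dualChart c).symm z)) := by
  have hs := dualChart_symm_mem hz
  have h1 := (isCoordFrame_coordFrame hz).densityForm_apply hs Ω
  rw [(Γ.dualChart c).right_inv (Γ.mem_dualChart_target.2 hz)] at h1
  have h2 := liouvilleDual_eq hΘ hΩ hs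
  change Γ.densityForm Ω _ _ • Γ.liouvilleDual Θ _ = _
  exact congrArg₂ (· • ·) h1 h2

end Frame

/-- Stokes' theorem needs a rank of the form successor; for rank `2 * (k + 1)` the form to be
differentiated has degree `2 * k + 1`. The frame covers the whole chart of `𝔤*`, with the
coefficient of `Ω` pulled back. -/
theorem nonempty_unimodularFrame_pullback {n k : ℕ} {M G : Type*}
    [TopologicalSpace M] [ChartedSpace (EuSp n) M] [IsManifold (𝓡 n) ∞ M] [T2Space M]
    [TopologicalSpace G] [ChartedSpace (EuSp (n + (k + 1))) G]
    [IsManifold (𝓡 (n + (k + 1))) ∞ G] {Γ : LieGroupoid n (k + 1) M G}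
    {Θ : Γ.piAlgebroid.Form ℝ 2} (hΘ : AlgebroidData.IsDifferential Γ.tautological Θ)
    {Ω : Γ.Density} (hΩ : Γ.IsInvariantVolume Ω) (c : M) :
    Nonempty (AlgebroidData.UnimodularFrame (k := 2 * k + 1) Γ.piAlgebroid
      ((euBasis n).prod (euDualBasis (k + 1))) (Γ.symplecticVolume Θ Ω) (⟨c, 0⟩ : Γ.DualTotal)
      (Γ.dualChart c).target) :=
  ⟨{
    frame := fun a => Γ.piFrame c a
    coeff := fun z => baseCoeff Ω c z.1
    vec := Γ.piVec c
    contDiffOn_coeff := (contDiffOn_baseCoeff hΩ c).comp contDiff_fst.contDiffOn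
      (fun z hz => Γ.mem_dualChart_target.1 hz)
    contDiffOn_vec := fun a => contDiffOn_piVec (r := k + 1) (Γ := Γ) c a
    apply_coordFrame := fun z hz =>
      symplecticVolume_coordFrame hΘ hΩ (Γ.mem_dualChart_target.1 hz)
    anchor_frame := fun z hz a => anchor_piFrame (Γ.mem_dualChart_target.1 hz) a
    exists_extension := fun z hz => by
      obtain ⟨S, B, C, hS, hB, hSe, hC, hBC, -, hdiv⟩ :=
        exists_extension_piFrame hΩ (Γ.mem_dualChart_target.1 hz)
      exact ⟨S, B, C, hS, fun a b _ => hB a b, hSe, hC, fun a b _ => hBC a b, hdiv⟩ }⟩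

end LieGroupoid

/-- The Haar measure of a basis is the image of Lebesgue measure under its linear coordinates. This
connects chart integrals with the normalisation of a Thom form, which is stated over `Fin r → ℝ`. -/
theorem integral_basis_addHaar {F K : Type*} [NormedAddCommGroup F] [NormedSpace ℝ F]
    [FiniteDimensional ℝ F] [MeasurableSpace F] [BorelSpace F] [NormedAddCommGroup K]
    [NormedSpace ℝ K] {r : ℕ} (b : Basis (Fin r) ℝ F) (f : F → K) :
    ∫ x, f x ∂b.addHaar = ∫ c : Fin r → ℝ, f (∑ i, c i • b i) := by
  have h1 : b = (Pi.basisFun ℝ (Fin r)).map (b.equivFunL.symm : (Fin r → ℝ) ≃L[ℝ] F).toLinearEquiv := by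
    ext i
    simp [Basis.equivFunL]
  have h2 : (Pi.basisFun ℝ (Fin r)).addHaar = MeasureTheory.volume := by
    rw [Basis.addHaar_def, Basis.parallelepiped_basisFun,
      MeasureTheory.addHaarMeasure_eq_volume_pi]
  have h3 := Basis.map_addHaar (Pi.basisFun ℝ (Fin r)) b.equivFunL.symm
  rw [h2] at h3
  have h4 : b.addHaar = MeasureTheory.Measure.map b.equivFunL.symm MeasureTheory.volume :=
    (congrArg Basis.addHaar h1).trans h3.symm
  rw [h4]
  refine ((b.equivFunL.symm.toHomeomorph.measurableEmbedding).integral_map f).trans ?_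
  refine MeasureTheory.integral_congr_ae (Filter.Eventually.of_forall fun c => ?_)
  exact congrArg f (b.equivFun_symm_apply c)

/-! ### Orientation and partition of unity on the total space -/

namespace LieGroupoid

open MeasureTheory

variable {n r : ℕ} {M G : Type*}
    [TopologicalSpace M] [ChartedSpace (EuSp n) M] [IsManifold (𝓡 n) ∞ M]
    [TopologicalSpace G] [ChartedSpace (EuSp (n + r)) G] [IsManifold (𝓡 (n + r)) ∞ G]
    {Γ : LieGroupoid n r M G}

/-- The local trivialisation of the dual bundle. -/
def dualEquiv {c x : M} (hx : x ∈ Γ.base c) : (EuSp r →L[ℝ] ℝ) ≃ₗ[ℝ] Γ.Dual x where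
  toFun := fun ℓ => (ℓ.comp (Γ.locTriv c x) : Γ.Alg x →L[ℝ] ℝ)
  map_add' := fun _ _ => rfl
  map_smul' := fun _ _ => rfl
  invFun := fun w => LinearMap.toContinuousLinearMap
    ((w : Γ.Alg x →L[ℝ] ℝ).toLinearMap ∘ₗ (Γ.frameEquiv hx).symm.toLinearMap)
  left_inv := fun ℓ => ContinuousLinearMap.ext fun v => congrArg ℓ (Γ.locTriv_locInv c x hx v)
  right_inv := fun w => ContinuousLinearMap.ext fun X => congrArg w (Γ.locInv_locTriv c x hx X)

/-- The local frame of the dual bundle, as a basis. -/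
def dualBasis {c x : M} (hx : x ∈ Γ.base c) : Basis (Fin r) ℝ (Γ.Dual x) :=
  (euDualBasis r).map (dualEquiv hx)

theorem dualBasis_eq {c x : M} (hx : x ∈ Γ.base c) : ⇑(dualBasis hx) = Γ.dualFrame c x := by
  funext j
  rw [dualBasis, Basis.map_apply]
  rfl

theorem dualFrame_eq_dualPoint {c x : M} (hc : x ∈ (extChartAt (𝓡 n) c).source) (j : Fin r) :
    (⟨x, Γ.dualFrame c x j⟩ : Γ.DualTotal) =
      Γ.dualPoint c (extChartAt (𝓡 n) c x, euDualBasis r j) := by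
  have h : x = (extChartAt (𝓡 n) c).symm (extChartAt (𝓡 n) c x) :=
    ((extChartAt (𝓡 n) c).left_inv hc).symm
  have h2 : ∀ y, y = x → (⟨x, Γ.dualFrame c x j⟩ : Γ.DualTotal) = ⟨y, Γ.dualFrame c y j⟩ := by
    rintro _ rfl
    rfl
  exact h2 _ h.symm

theorem mem_baseRegion {c x : M} (hb : x ∈ Γ.base c) (hc : x ∈ (extChartAt (𝓡 n) c).source) :
    extChartAt (𝓡 n) c x ∈ Γ.baseRegion c :=
  ⟨(extChartAt (𝓡 n) c).map_source hc, by
    rw [mem_preimage, (extChartAt (𝓡 n) c).left_inv hc]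
    exact ⟨hc, hb⟩⟩

theorem contMDiffAt_dualFrame {c x : M} (hb : x ∈ Γ.base c)
    (hc : x ∈ (extChartAt (𝓡 n) c).source) (j : Fin r) :
    ContMDiffAt (𝓡 n) (dualModel n r) ∞ (fun x => (⟨x, Γ.dualFrame c x j⟩ : Γ.DualTotal)) x := by
  have hopen := (Γ.isOpen_base c).inter (isOpen_extChartAt_source (I := 𝓡 n) c)
  have h1 : (fun x => (⟨x, Γ.dualFrame c x j⟩ : Γ.DualTotal)) =ᶠ[𝓝 x]
      fun x => (Γ.dualChart c).symm (extChartAt (𝓡 n) c x, euDualBasis r j) := by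
    filter_upwards [hopen.mem_nhds ⟨hb, hc⟩] with y hy
    rw [dualFrame_eq_dualPoint hy.2, Γ.dualChart_symm (z := (extChartAt (𝓡 n) c y,
      euDualBasis r j)) (mem_baseRegion hy.1 hy.2)]
  refine ContMDiffAt.congr_of_eventuallyEq ?_ h1
  have h2 : ContMDiffAt 𝓘(ℝ, EuSp n × (EuSp r →L[ℝ] ℝ)) (dualModel n r) ∞ (Γ.dualChart c).symm
      (extChartAt (𝓡 n) c x, euDualBasis r j) :=
    contMDiffAt_extChartAt_symm_of_mem_target (I := dualModel n r)
      (Γ.mem_dualChart_target.2 (mem_baseRegion hb hc))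
  exact ContMDiffAt.comp (g := (Γ.dualChart c).symm)
    (f := fun x => (extChartAt (𝓡 n) c x, euDualBasis r j)) x h2
    ((contMDiffAt_extChartAt_of_mem_source hc).prodMk_space contMDiffAt_const)

theorem fiberOrientation_ne_zero {volE : ∀ x : M, Γ.Dual x [⋀^Fin r]→ₗ[ℝ] ℝ}
    (hvolE : Γ.IsFiberOrientationForm volE) {c x : M} (hb : x ∈ Γ.base c) :
    volE x (Γ.dualFrame c x) ≠ 0 := by
  rw [← dualBasis_eq hb]
  exact AlternatingMap.apply_basis_ne_zero (hvolE.ne_zero x) (dualBasis hb)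

/-- Smoothness of the fibre orientation is tested on global sections, so the dual frame is cut off
by a function equal to one near the point. -/
theorem continuousAt_fiberOrientation [T2Space M] {volE : ∀ x : M, Γ.Dual x [⋀^Fin r]→ₗ[ℝ] ℝ}
    (hvolE : Γ.IsFiberOrientationForm volE) {c x : M} (hb : x ∈ Γ.base c)
    (hc : x ∈ (extChartAt (𝓡 n) c).source) :
    ContinuousAt (fun x => volE x (Γ.dualFrame c x)) x := by
  have hopen := (Γ.isOpen_base c).inter (isOpen_extChartAt_source (I := 𝓡 n) c)
  obtain ⟨χ, hχ, hs, h1⟩ := exists_contMDiff_tsupport_subset (I := 𝓡 n)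
    (hopen.mem_nhds ⟨hb, hc⟩)
  have h2 := hvolE.smooth (fun j x => χ x • Γ.dualFrame c x j) fun j => by
    have h := ContMDiffOn.smul_section_of_tsupport (V := fun x : M => Γ.Dual x)
      (F := EuSp r →L[ℝ] ℝ) (I := 𝓡 n)
      (s := fun p => Γ.dualFrame c p j) hχ.contMDiffOn hopen hs (n := ∞) (fun p hp =>
        (contMDiffAt_dualFrame hp.1 hp.2 j).contMDiffWithinAt)
    exact h
  refine h2.continuous.continuousAt.congr ?_
  filter_upwards [h1] with y hy
  congr 1
  funext j
  rw [hy, one_smul]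

/-- The orientation of `𝔤*` in coordinates. -/
theorem totalOrientation_coordFrame (volM : (tangentAlgebroid (𝓡 n) M).Form ℝ n)
    (volE : ∀ x : M, Γ.Dual x [⋀^Fin r]→ₗ[ℝ] ℝ) {c : M} {z : EuSp n × (EuSp r →L[ℝ] ℝ)}
    (hz : z.1 ∈ Γ.baseRegion c) :
    Γ.totalOrientation volM volE _ (coordFrame (dualModel n r) ((euBasis n).prod (euDualBasis r))
      (⟨c, 0⟩ : Γ.DualTotal) z) =
      volM ((extChartAt (𝓡 n) c).symm z.1) (coordFrame (𝓡 n) (euBasis n) c z.1) *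
        volE _ (Γ.dualFrame c ((extChartAt (𝓡 n) c).symm z.1)) := by
  have hs := dualChart_symm_mem hz
  have hX := isCoordFrame_coordFrame hz
  refine (hX.totalOrientation_apply hs volM volE).trans ?_
  have h1 := eq_coordFrame (Γ.mem_dualChart_source.1 hs).2 (fun i => hX.mfderiv_dproj hs i) hz.1
    (fst_dualChart_symm hz) volM
  refine congrArg₂ (· * ·) h1 ?_
  exact congrArg (fun x => volE x (Γ.dualFrame c x)) (fst_dualChart_symm hz)

theorem continuousOn_totalOrientation [T2Space M] {volM : (tangentAlgebroid (𝓡 n) M).Form ℝ n}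
    (hvolM : IsOrientationForm volM) {volE : ∀ x : M, Γ.Dual x [⋀^Fin r]→ₗ[ℝ] ℝ}
    (hvolE : Γ.IsFiberOrientationForm volE) (c : M) :
    ContinuousOn (fun z => Γ.totalOrientation volM volE _ (coordFrame (dualModel n r)
      ((euBasis n).prod (euDualBasis r)) (⟨c, 0⟩ : Γ.DualTotal) z)) (Γ.dualChart c).target := by
  have h1 : ContinuousOn (fun z : EuSp n × (EuSp r →L[ℝ] ℝ) =>
      volM ((extChartAt (𝓡 n) c).symm z.1) (coordFrame (𝓡 n) (euBasis n) c z.1) *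
        volE _ (Γ.dualFrame c ((extChartAt (𝓡 n) c).symm z.1))) (Γ.dualChart c).target := by
    refine ContinuousOn.mul ?_ ?_
    · exact (continuousOn_orientation hvolM c).comp continuousOn_fst
        fun z hz => (Γ.mem_dualChart_target.1 hz).1
    · intro z hz
      obtain ⟨h1, h2, h3⟩ := Γ.mem_dualChart_target.1 hz
      have h4 : ContinuousAt (fun z : EuSp n × (EuSp r →L[ℝ] ℝ) =>
          (extChartAt (𝓡 n) c).symm z.1) z :=
        ContinuousAt.comp (g := (extChartAt (𝓡 n) c).symm) (f := Prod.fst)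
          (contMDiffAt_extChartAt_symm_of_mem_target (I := 𝓡 n) h1).continuousAt continuousAt_fst
      exact (ContinuousAt.comp (g := fun x => volE x (Γ.dualFrame c x))
        (f := fun z : EuSp n × (EuSp r →L[ℝ] ℝ) => (extChartAt (𝓡 n) c).symm z.1)
        (continuousAt_fiberOrientation hvolE h3 h2) h4).continuousWithinAt
  exact h1.congr fun z hz => totalOrientation_coordFrame volM volE (Γ.mem_dualChart_target.1 hz)

theorem totalOrientation_ne_zero {volM : (tangentAlgebroid (𝓡 n) M).Form ℝ n}
    (hvolM : IsOrientationForm volM) {volE : ∀ x : M, Γ.Dual x [⋀^Fin r]→ₗ[ℝ] ℝ}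
    (hvolE : Γ.IsFiberOrientationForm volE) {c : M} {z : EuSp n × (EuSp r →L[ℝ] ℝ)}
    (hz : z.1 ∈ Γ.baseRegion c) :
    Γ.totalOrientation volM volE _ (coordFrame (dualModel n r) ((euBasis n).prod (euDualBasis r))
      (⟨c, 0⟩ : Γ.DualTotal) z) ≠ 0 := by
  rw [totalOrientation_coordFrame volM volE hz]
  exact mul_ne_zero (apply_coordFrame_ne_zero hvolM.ne_zero hz.1)
    (fiberOrientation_ne_zero hvolE hz.2.2)

/-- The partition of unity of `𝔤*` pulled back from the base. -/
def pullbackPartition {P : ChartPartition (𝓡 n) M} (hP : ∀ l,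
    P.dom l = (extChartAt (𝓡 n) (P.center l)).source ∩ Γ.base (P.center l)) :
    ChartPartition (dualModel n r) Γ.DualTotal where
  size := P.size
  center := fun l => ⟨P.center l, 0⟩
  weight := fun l p => P.weight l p.1
  contMDiff_weight := fun l => (P.contMDiff_weight l).comp Γ.contMDiff_proj
  sum_weight := fun p => P.sum_weight p.1
  dom := fun l => (Γ.dualChart (P.center l)).source
  isOpen_dom := fun l => isOpen_extChartAt_source (I := dualModel n r) _
  dom_subset := fun _ => subset_rfl
  tsupport_weight := fun l p hp => by
    have h := P.tsupport_weight l
      (tsupport_comp_subset_preimage (P.weight l) Γ.contMDiff_proj.continuous hp)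
    rw [hP] at h
    exact Γ.mem_dualChart_source.2 ⟨h.2, h.1⟩

theorem region_pullbackPartition {P : ChartPartition (𝓡 n) M} (hP : ∀ l,
    P.dom l = (extChartAt (𝓡 n) (P.center l)).source ∩ Γ.base (P.center l)) (l : Fin (pullbackPartition hP).size) :
    (pullbackPartition hP).region l = (Γ.dualChart (P.center l)).target :=
  inter_eq_left.2 fun _ hz => (Γ.dualChart (P.center l)).map_target hz

end LieGroupoid

theorem pairing_zero {V W K : Type*} [AddCommGroup V] [Module ℝ V] [AddCommGroup W] [Module ℝ W]
    [NormedField K] [NormedAlgebra ℝ K] {k : ℕ} {ι : Type*} (Ω : W [⋀^ι]→ₗ[ℝ] ⋀[ℝ]^k V) :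
    pairing (0 : V [⋀^Fin k]→ₗ[ℝ] K) Ω = 0 := by
  refine AlternatingMap.ext fun v => ?_
  simp [pairing]

/-! ### Integration along the fibres -/

namespace LieGroupoid

open MeasureTheory

variable {n r : ℕ} {M G : Type*}
    [TopologicalSpace M] [ChartedSpace (EuSp n) M] [IsManifold (𝓡 n) ∞ M]
    [TopologicalSpace G] [ChartedSpace (EuSp (n + r)) G] [IsManifold (𝓡 (n + r)) ∞ G]
    {Γ : LieGroupoid n r M G}

/-- The value of a form on `𝔤*` on the vertical coordinate vectors. -/
def vertValue (Γ : LieGroupoid n r M G) (c : M)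
    (τ : (tangentAlgebroid (dualModel n r) Γ.DualTotal).Form ℂ r) (p : Γ.DualTotal) : ℂ :=
  τ p (fun j => Γ.vertLift p (Γ.dualFrame c p.1 j))

theorem liftField_eq_vertLift {c : M} {p : Γ.DualTotal} (hp : p ∈ (Γ.dualChart c).source)
    (j : Fin r) : Γ.liftField c 0 (euDualBasis r j) p = Γ.vertLift p (Γ.dualFrame c p.1 j) := by
  refine dDualChart_injective hp ((dDualChart_liftField hp _ _).trans ?_)
  rw [anchorCoord_zero]
  exact (Γ.mfderiv_dualChart_vertLift hp (Γ.dualFrame c p.1 j) (euDualBasis r j)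
    fun v => (dualFrame_locInv (Γ.mem_dualChart_source.1 hp).1 j v).symm).symm

/-- The form `π^*α` kills the vertical half of the frame, so the identity shuffle alone contributes.
The anchors of that half are the vertical lifts of the dual frame. -/
theorem thomProduct_piFrame (α : Γ.algebroid.Form ℂ r)
    (τ : (tangentAlgebroid (dualModel n r) Γ.DualTotal).Form ℂ r) {c : M} {p : Γ.DualTotal}
    (hp : p ∈ (Γ.dualChart c).source) :
    Γ.thomProduct α τ p (fun a => Γ.piFrame c a p) =
      α p.1 (fun i => Γ.locInv c p.1 (euBasis r i)) * Γ.vertValue c τ p := by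
  have hinl : ∀ i, (euPairBasis r ((splitIndex r).symm (Sum.inl i))) = (euBasis r i, 0) := by
    intro i
    rw [euPairBasis_eq, Function.comp_apply, Equiv.apply_symm_apply]
    rfl
  have hinr : ∀ j, (euPairBasis r ((splitIndex r).symm (Sum.inr j))) = (0, euDualBasis r j) := by
    intro i
    rw [euPairBasis_eq, Function.comp_apply, Equiv.apply_symm_apply]
    rfl
  let v : Fin r → Γ.piAlgebroid.Fiber p := fun i => Γ.piFrame c ((splitIndex r).symm (Sum.inl i)) p
  let w : Fin r → Γ.piAlgebroid.Fiber p := fun j => Γ.piFrame c ((splitIndex r).symm (Sum.inr j)) p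
  have hsplit : (fun a => Γ.piFrame c a p) ∘ (splitIndex r).symm = Sum.elim v w := by
    funext a
    rcases a with i | j <;> rfl
  have hv : ∀ i, (v i).1.1 = Γ.locInv c p.1 (euBasis r i) := fun i => by
    rw [((eq_piFrame_iff hp).1 rfl).1, hinl]
  have hw : ∀ j, (w j).1.1 = 0 := fun j => by
    rw [((eq_piFrame_iff hp).1 rfl).1, hinr, locInv_zero]
    rfl
  have hw' : ∀ j, (w j).1.2 = Γ.vertLift p (Γ.dualFrame c p.1 j) := fun j => by
    rw [((eq_piFrame_iff hp).1 rfl).2, hinr]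
    exact liftField_eq_vertLift hp j
  have h1 : Γ.thomProduct α τ p (fun a => Γ.piFrame c a p) = LinearMap.mul' ℝ ℂ
      ((Γ.pullbackForm (dualModel n r) Γ.proj α p).domCoprod
        (Γ.anchorPullback (dualModel n r) Γ.proj τ p)
          ((fun a => Γ.piFrame c a p) ∘ (splitIndex r).symm)) := rfl
  rw [h1, hsplit, AlternatingMap.domCoprod_sumElim _ _ _ _ fun x i j h => ?_,
    LinearMap.mul'_apply]
  · refine congrArg₂ (· * ·) ?_ ?_
    · exact congrArg (α p.1) (funext hv)
    · exact congrArg (τ p) (funext hw')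
  · refine AlternatingMap.map_coord_zero (α p.1) i ?_
    change (x i).1.1 = 0
    rw [h, hw]

theorem vertValue_coordFrame (τ : (tangentAlgebroid (dualModel n r) Γ.DualTotal).Form ℂ r) {c : M}
    {z : EuSp n × (EuSp r →L[ℝ] ℝ)} (hz : z.1 ∈ Γ.baseRegion c) :
    Γ.vertValue c τ ((Γ.dualChart c).symm z) = τ ((Γ.dualChart c).symm z) (fun j =>
      mfderiv 𝓘(ℝ, EuSp n × (EuSp r →L[ℝ] ℝ)) (dualModel n r) (Γ.dualChart c).symm z
        (0, euDualBasis r j)) := by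
  refine congrArg (τ ((Γ.dualChart c).symm z)) (funext fun j => ?_)
  refine (congrFun ((isCoordFrame_coordFrame hz).eq_sumElim (dualChart_symm_mem hz))
    (Sum.inr j)).symm.trans ?_
  rw [coordFrame]
  exact congrArg (mfderiv 𝓘(ℝ, EuSp n × (EuSp r →L[ℝ] ℝ)) (dualModel n r) (Γ.dualChart c).symm z)
    (by simp; rfl)

/-- The pairing of `π^*α ∧ ρ^*τ` with the symplectic volume, in coordinates. -/
theorem pairing_thomProduct [CompactSpace M] [T2Space M] {Θ : Γ.piAlgebroid.Form ℝ 2}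
    (hΘ : AlgebroidData.IsDifferential Γ.tautological Θ) {Ω : Γ.Density}
    (hΩ : Γ.IsInvariantVolume Ω) (α : Γ.algebroid.Form ℂ r)
    (τ : (tangentAlgebroid (dualModel n r) Γ.DualTotal).Form ℂ r) {c : M}
    {z : EuSp n × (EuSp r →L[ℝ] ℝ)} (hz : z.1 ∈ Γ.baseRegion c) :
    pairing (Γ.thomProduct α τ ((Γ.dualChart c).symm z))
      (Γ.symplecticVolume Θ Ω ((Γ.dualChart c).symm z))
      (coordFrame (dualModel n r) ((euBasis n).prod (euDualBasis r)) (⟨c, 0⟩ : Γ.DualTotal) z) =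
    pairing (α ((extChartAt (𝓡 n) c).symm z.1)) (Ω ((extChartAt (𝓡 n) c).symm z.1))
      (coordFrame (𝓡 n) (euBasis n) c z.1) * Γ.vertValue c τ ((Γ.dualChart c).symm z) := by
  have hs := dualChart_symm_mem hz
  rw [pairing_density_coordFrame Ω α hz.2.2]
  refine (congrArg (exteriorPower.alternatingMapLinearEquiv (Γ.thomProduct α τ _))
    (symplecticVolume_coordFrame hΘ hΩ hz)).trans ?_
  refine (map_smul (exteriorPower.alternatingMapLinearEquiv (Γ.thomProduct α τ _)) _ _).trans ?_
  refine Eq.trans ?_ (smul_mul_assoc _ _ _).symm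
  refine congrArg (baseCoeff Ω c z.1 • ·) ?_
  refine (exteriorPower.alternatingMapLinearEquiv_apply_ιMulti _ _).trans ?_
  refine (thomProduct_piFrame α τ hs).trans ?_
  refine congrArg (· * Γ.vertValue c τ ((Γ.dualChart c).symm z)) ?_
  exact congrArg (fun x => α x (fun i => Γ.locInv c x (euBasis r i))) (fst_dualChart_symm hz)

/-- The density of `π^*α ∧ ρ^*τ` in coordinates. -/
theorem chartDensity_thomProduct [CompactSpace M] [T2Space M] {Θ : Γ.piAlgebroid.Form ℝ 2}
    (hΘ : AlgebroidData.IsDifferential Γ.tautological Θ) {Ω : Γ.Density}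
    (hΩ : Γ.IsInvariantVolume Ω) (volM : (tangentAlgebroid (𝓡 n) M).Form ℝ n)
    (volE : ∀ x : M, Γ.Dual x [⋀^Fin r]→ₗ[ℝ] ℝ) (α : Γ.algebroid.Form ℂ r)
    (τ : (tangentAlgebroid (dualModel n r) Γ.DualTotal).Form ℂ r) {c : M}
    {z : EuSp n × (EuSp r →L[ℝ] ℝ)} (hz : z.1 ∈ Γ.baseRegion c) :
    chartDensity (dualModel n r) ((euBasis n).prod (euDualBasis r))
      (Γ.totalOrientation volM volE)
      (fun p => pairing (Γ.thomProduct α τ p) (Γ.symplecticVolume Θ Ω p)) ⟨c, 0⟩ z =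
    chartDensity (𝓡 n) (euBasis n) volM (fun x => pairing (α x) (Ω x)) c z.1 *
      ((Real.sign (volE ((extChartAt (𝓡 n) c).symm z.1)
        (Γ.dualFrame c ((extChartAt (𝓡 n) c).symm z.1))) : ℂ) *
          Γ.vertValue c τ ((Γ.dualChart c).symm z)) := by
  have h1 := totalOrientation_coordFrame volM volE hz
  have h2 := pairing_thomProduct hΘ hΩ α τ hz
  refine (congrArg₂ (fun (a : ℝ) (b : ℂ) => (Real.sign a : ℂ) * b) h1 h2).trans ?_
  beta_reduce
  -- With "base first, then fibre" the orientation sign splits into the sign on the base and the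
  -- sign of the fibre orientation, one for each factor of the integrand.
  rw [real_sign_mul, Complex.ofReal_mul]
  exact mul_mul_mul_comm _ _ _ _

theorem continuousOn_thomProduct [CompactSpace M] [T2Space M] {Θ : Γ.piAlgebroid.Form ℝ 2}
    (hΘ : AlgebroidData.IsDifferential Γ.tautological Θ) {Ω : Γ.Density}
    (hΩ : Γ.IsInvariantVolume Ω) {α : Γ.algebroid.Form ℂ r} (hα : AlgebroidData.IsSmoothForm α)
    {τ : (tangentAlgebroid (dualModel n r) Γ.DualTotal).Form ℂ r}
    (hτ : AlgebroidData.IsSmoothForm τ) (c : M) :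
    ContinuousOn (fun z => pairing (Γ.thomProduct α τ ((Γ.dualChart c).symm z))
      (Γ.symplecticVolume Θ Ω ((Γ.dualChart c).symm z))
      (coordFrame (dualModel n r) ((euBasis n).prod (euDualBasis r)) (⟨c, 0⟩ : Γ.DualTotal) z))
      (Γ.dualChart c).target := by
  have h1 : ContinuousOn (fun y => pairing (α ((extChartAt (𝓡 n) c).symm y))
      (Ω ((extChartAt (𝓡 n) c).symm y)) (coordFrame (𝓡 n) (euBasis n) c y)) (Γ.baseRegion c) :=
    ContinuousOn.congr (f := fun y => baseCoeff Ω c y • α ((extChartAt (𝓡 n) c).symm y)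
        (fun i => Γ.locInv c ((extChartAt (𝓡 n) c).symm y) (euBasis r i)))
      ((contDiffOn_baseCoeff hΩ c).continuousOn.smul fun y hy =>
        (contDiffAt_form_locInv hα hy).continuousAt.continuousWithinAt)
      fun y hy => pairing_density_coordFrame Ω α hy.2.2
  have h2 : ContinuousOn (fun z => Γ.vertValue c τ ((Γ.dualChart c).symm z))
      (Γ.dualChart c).target := by
    refine ContinuousOn.congr (f := fun z => τ ((Γ.dualChart c).symm z) (fun j =>
      mfderiv 𝓘(ℝ, EuSp n × (EuSp r →L[ℝ] ℝ)) (dualModel n r) (Γ.dualChart c).symm z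
        (0, euDualBasis r j))) ?_ fun z hz =>
      vertValue_coordFrame τ (Γ.mem_dualChart_target.1 hz)
    intro z hz
    have hz' := Γ.mem_dualChart_target.1 hz
    have hopen := (Γ.isOpen_base c).inter (isOpen_extChartAt_source (I := 𝓡 n) c)
    -- The cutoff function is taken on `M` and pulled back: the chart of `𝔤*` is the full preimage
    -- of an open subset of `M`.
    obtain ⟨χ, hχ, hs, h1⟩ := exists_contMDiff_tsupport_subset (I := 𝓡 n)
      (hopen.mem_nhds ⟨hz'.2.2, hz'.2.1⟩)
    have hcont := Γ.contMDiff_proj.continuous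
    refine (contDiffAt_form_coordFrame (I := dualModel n r) hτ hz
      ⟨fun p => χ p.1, hχ.comp Γ.contMDiff_proj, fun p h =>
        Γ.mem_dualChart_source.2 (hs (tsupport_comp_subset_preimage χ hcont h)), ?_⟩
      (fun j => (0, euDualBasis r j))).continuousAt.continuousWithinAt
    refine hcont.continuousAt.eventually (p := fun x => χ x = 1) ?_
    have h3 : Γ.proj ((Γ.dualChart c).symm z) = (extChartAt (𝓡 n) c).symm z.1 :=
      fst_dualChart_symm hz'
    exact h3 ▸ h1
  refine ContinuousOn.congr (ContinuousOn.mul (h1.comp continuousOn_fst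
    fun z hz => Γ.mem_dualChart_target.1 hz) h2) fun z hz => ?_
  exact pairing_thomProduct hΘ hΩ α τ (Γ.mem_dualChart_target.1 hz)

/-- The integrals of a Thom form over the fibres in coordinates. -/
theorem IsThomForm.integral_vertValue {volE : ∀ x : M, Γ.Dual x [⋀^Fin r]→ₗ[ℝ] ℝ}
    {τ : (tangentAlgebroid (dualModel n r) Γ.DualTotal).Form ℂ r} (hτ : Γ.IsThomForm volE τ)
    {c : M} {y : EuSp n} (hy : y ∈ Γ.baseRegion c) :
    (Real.sign (volE ((extChartAt (𝓡 n) c).symm y)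
        (Γ.dualFrame c ((extChartAt (𝓡 n) c).symm y))) : ℂ) *
      ∫ ℓ, Γ.vertValue c τ ((Γ.dualChart c).symm (y, ℓ)) ∂(euDualBasis r).addHaar = 1 := by
  -- Of all bases allowed in the definition of a Thom form, the dual local frame is the one whose
  -- linear coordinates are the fibre coordinates of the chart.
  have h := hτ.integral_eq_one _ (dualBasis hy.2.2)
  rw [dualBasis_eq hy.2.2] at h
  rw [integral_basis_addHaar]
  refine Eq.trans (congrArg _ (integral_congr_ae (Filter.Eventually.of_forall fun a => ?_))) h
  beta_reduce
  rw [Γ.dualChart_symm (z := (y, ∑ i, a i • euDualBasis r i)) hy]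
  refine congrArg (Γ.vertValue c τ) (?_ : _ = (⟨_, ∑ i, a i • Γ.dualFrame c _ i⟩ : Γ.DualTotal))
  refine congrArg (TotalSpace.mk _) ((map_sum (dualEquiv hy.2.2) _ _).trans ?_)
  exact Finset.sum_congr rfl fun i _ => map_smul (dualEquiv hy.2.2) _ _


section Compact

variable [CompactSpace M] [T2Space M] {Θ : Γ.piAlgebroid.Form ℝ 2}
  {Ω : Γ.Density} {volM : (tangentAlgebroid (𝓡 n) M).Form ℝ n}
  {volE : ∀ x : M, Γ.Dual x [⋀^Fin r]→ₗ[ℝ] ℝ} {α : Γ.algebroid.Form ℂ r}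
  {τ : (tangentAlgebroid (dualModel n r) Γ.DualTotal).Form ℂ r}

theorem continuousOn_thomDensity (hΘ : AlgebroidData.IsDifferential Γ.tautological Θ)
    (hΩ : Γ.IsInvariantVolume Ω) (hvolM : IsOrientationForm volM)
    (hvolE : Γ.IsFiberOrientationForm volE) (hα : AlgebroidData.IsSmoothForm α)
    (hτ : AlgebroidData.IsSmoothForm τ) (c : M) :
    ContinuousOn (chartDensity (dualModel n r) ((euBasis n).prod (euDualBasis r))
      (Γ.totalOrientation volM volE)
      (fun p => pairing (Γ.thomProduct α τ p) (Γ.symplecticVolume Θ Ω p)) ⟨c, 0⟩)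
      (Γ.dualChart c).target :=
  continuousOn_chartDensity (continuousOn_totalOrientation hvolM hvolE c)
    (fun _ hz => totalOrientation_ne_zero hvolM hvolE (Γ.mem_dualChart_target.1 hz))
    (continuousOn_thomProduct hΘ hΩ hα hτ c)

theorem thomDensity_eq_zero (hΘ : AlgebroidData.IsDifferential Γ.tautological Θ)
    (hΩ : Γ.IsInvariantVolume Ω) {c : M} {z : EuSp n × (EuSp r →L[ℝ] ℝ)}
    (hz : z ∈ (Γ.dualChart c).target)
    (h : (Γ.dualChart c).symm z ∉ closure {p | τ p ≠ 0}) :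
    chartDensity (dualModel n r) ((euBasis n).prod (euDualBasis r))
      (Γ.totalOrientation volM volE)
      (fun p => pairing (Γ.thomProduct α τ p) (Γ.symplecticVolume Θ Ω p)) ⟨c, 0⟩ z = 0 := by
  have h0 : τ ((Γ.dualChart c).symm z) = 0 := by
    by_contra h0
    exact h (subset_closure h0)
  rw [chartDensity_thomProduct hΘ hΩ volM volE α τ (Γ.mem_dualChart_target.1 hz), vertValue, h0]
  refine (congrArg _ ((congrArg _ ?_).trans (mul_zero _))).trans (mul_zero _)
  rfl

/-- Integration of `π^*α ∧ ρ^*τ` over the fibres. -/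
theorem totalIntegral_thomProduct (hΘ : AlgebroidData.IsDifferential Γ.tautological Θ)
    (hΩ : Γ.IsInvariantVolume Ω) (hvolM : IsOrientationForm volM)
    (hvolE : Γ.IsFiberOrientationForm volE) (hα : AlgebroidData.IsSmoothForm α)
    (hτ : Γ.IsThomForm volE τ) :
    Γ.totalIntegral (Γ.totalOrientation volM volE) (Γ.thomProduct α τ) (Γ.symplecticVolume Θ Ω) =
      Γ.baseIntegral volM α Ω := by
  obtain ⟨P, hP⟩ := Γ.exists_basePartition
  obtain ⟨-, e1⟩ := P.formIntegral_eq (b := euBasis n) (vol := volM)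
    (η := fun x => pairing (α x) (Ω x)) isCompact_univ (fun l => by
        rw [region_eq_baseRegion hP]
        exact continuousOn_baseDensity hvolM hΩ hα _) (fun _ _ _ h => absurd (mem_univ _) h)
  obtain ⟨i2, e2⟩ := (pullbackPartition hP).formIntegral_eq
    (b := (euBasis n).prod (euDualBasis r)) (vol := Γ.totalOrientation volM volE)
    (η := fun p => pairing (Γ.thomProduct α τ p) (Γ.symplecticVolume Θ Ω p)) hτ.compact
    (fun l => by
      rw [region_pullbackPartition hP]
      exact continuousOn_thomDensity hΘ hΩ hvolM hvolE hα hτ.cocycle.1 (P.center l))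
    (fun l z hz h => by
      rw [region_pullbackPartition hP] at hz
      exact thomDensity_eq_zero hΘ hΩ hz h)
  refine e2.trans (Eq.trans (Finset.sum_congr rfl fun l _ => ?_) e1.symm)
  have i3 := i2 l
  -- Both the region and the Haar measure of the product basis are products, so Fubini's theorem
  -- applies.
  have hreg : (pullbackPartition hP).region l = Γ.baseRegion (P.center l) ×ˢ univ := by
    rw [region_pullbackPartition hP]
    ext z
    rw [Γ.mem_dualChart_target]
    simp
  rw [hreg, Basis.prod_addHaar] at i3 ⊢
  rw [setIntegral_prod _ i3]
  refine Eq.trans ?_ (congrArg (fun s => ∫ y in s,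
    (P.weight l ((extChartAt (𝓡 n) (P.center l)).symm y) : ℂ) *
      chartDensity (𝓡 n) (euBasis n) volM (fun x => pairing (α x) (Ω x)) (P.center l) y
        ∂(euBasis n).addHaar) (region_eq_baseRegion hP l).symm)
  refine setIntegral_congr_fun (Γ.isOpen_baseRegion _).measurableSet fun y hy => ?_
  -- The weight and the base density do not depend on the fibre variable and leave the inner
  -- integral; what remains inside is the vertical part of `τ`, and its signed integral is one.
  have h1 : ∀ ℓ : EuSp r →L[ℝ] ℝ,
      ((pullbackPartition hP).weight l ((Γ.dualChart (P.center l)).symm (y, ℓ)) : ℂ) *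
        chartDensity (dualModel n r) ((euBasis n).prod (euDualBasis r))
          (Γ.totalOrientation volM volE)
          (fun p => pairing (Γ.thomProduct α τ p) (Γ.symplecticVolume Θ Ω p))
          ⟨P.center l, 0⟩ (y, ℓ) =
      ((P.weight l ((extChartAt (𝓡 n) (P.center l)).symm y) : ℂ) *
        chartDensity (𝓡 n) (euBasis n) volM (fun x => pairing (α x) (Ω x)) (P.center l) y *
        (Real.sign (volE ((extChartAt (𝓡 n) (P.center l)).symm y)
          (Γ.dualFrame (P.center l) ((extChartAt (𝓡 n) (P.center l)).symm y))) : ℂ)) *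
        Γ.vertValue (P.center l) τ ((Γ.dualChart (P.center l)).symm (y, ℓ)) := by
    intro ℓ
    have h2 : (pullbackPartition hP).weight l ((Γ.dualChart (P.center l)).symm (y, ℓ)) =
        P.weight l ((extChartAt (𝓡 n) (P.center l)).symm y) :=
      congrArg (P.weight l) (fst_dualChart_symm (z := (y, ℓ)) hy)
    rw [h2, chartDensity_thomProduct hΘ hΩ volM volE α τ (z := (y, ℓ)) hy]
    ring
  refine Eq.trans (setIntegral_congr_fun MeasurableSet.univ fun ℓ _ => h1 ℓ) ?_
  rw [setIntegral_univ, integral_const_mul, _root_.mul_assoc, hτ.integral_vertValue hy, mul_one]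

theorem sub_pairing_symplecticVolume (Θ : Γ.piAlgebroid.Form ℝ 2) (Ω : Γ.Density)
    (c c' : Γ.piAlgebroid.Form ℂ (2 * r)) :
    (fun p => pairing ((c - c') p) (Γ.symplecticVolume Θ Ω p)) =
      fun p => pairing (c p) (Γ.symplecticVolume Θ Ω p) -
        pairing (c' p) (Γ.symplecticVolume Θ Ω p) := by
  funext p
  refine AlternatingMap.ext fun v => ?_
  change exteriorPower.alternatingMapLinearEquiv (c p - c' p) _ = _
  rw [map_sub]
  rfl

end Compact

/-- The integral over `𝔤*` depends only on the compactly supported class. -/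
theorem totalIntegral_eq_of_isExactCompact {n k : ℕ} {M G : Type*}
    [TopologicalSpace M] [ChartedSpace (EuSp n) M] [IsManifold (𝓡 n) ∞ M] [CompactSpace M]
    [T2Space M] [TopologicalSpace G] [ChartedSpace (EuSp (n + (k + 1))) G]
    [IsManifold (𝓡 (n + (k + 1))) ∞ G] {Γ : LieGroupoid n (k + 1) M G}
    {Θ : Γ.piAlgebroid.Form ℝ 2} (hΘ : AlgebroidData.IsDifferential Γ.tautological Θ)
    {Ω : Γ.Density} (hΩ : Γ.IsInvariantVolume Ω)
    {volM : (tangentAlgebroid (𝓡 n) M).Form ℝ n} (hvolM : IsOrientationForm volM)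
    {volE : ∀ x : M, Γ.Dual x [⋀^Fin (k + 1)]→ₗ[ℝ] ℝ} (hvolE : Γ.IsFiberOrientationForm volE)
    {α : Γ.algebroid.Form ℂ (k + 1)} (hα : AlgebroidData.IsSmoothForm α)
    {τ : (tangentAlgebroid (dualModel n (k + 1)) Γ.DualTotal).Form ℂ (k + 1)}
    (hτ : Γ.IsThomForm volE τ) {c : Γ.piAlgebroid.Form ℂ (2 * (k + 1))}
    (hc : AlgebroidData.IsSmoothForm c) (hc_supp : AlgebroidData.IsCompactlySupported c)
    {β : Γ.piAlgebroid.Form ℂ (2 * k + 1)} (hβ : AlgebroidData.IsSmoothForm β)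
    (hβc : AlgebroidData.IsCompactlySupported β)
    (h : AlgebroidData.IsDifferential (k := 2 * k + 1) β (c - Γ.thomProduct α τ)) :
    Γ.totalIntegral (Γ.totalOrientation volM volE) c (Γ.symplecticVolume Θ Ω) =
      Γ.totalIntegral (Γ.totalOrientation volM volE) (Γ.thomProduct α τ)
        (Γ.symplecticVolume Θ Ω) := by
  obtain ⟨P, hP⟩ := Γ.exists_basePartition
  have hvol : ∀ l, ContinuousOn (fun z => Γ.totalOrientation volM volE _
      (coordFrame (dualModel n (k + 1)) ((euBasis n).prod (euDualBasis (k + 1)))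
        ((pullbackPartition hP).center l) z)) ((pullbackPartition hP).region l) := fun l => by
    rw [region_pullbackPartition hP]
    exact continuousOn_totalOrientation hvolM hvolE (P.center l)
  have hvol0 : ∀ l, ∀ z ∈ (pullbackPartition hP).region l, Γ.totalOrientation volM volE _
      (coordFrame (dualModel n (k + 1)) ((euBasis n).prod (euDualBasis (k + 1)))
        ((pullbackPartition hP).center l) z) ≠ 0 := fun l z hz => by
    rw [region_pullbackPartition hP] at hz
    exact totalOrientation_ne_zero hvolM hvolE (Γ.mem_dualChart_target.1 hz)
  have F : ∀ l, AlgebroidData.UnimodularFrame (k := 2 * k + 1) Γ.piAlgebroid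
      ((euBasis n).prod (euDualBasis (k + 1))) (Γ.symplecticVolume Θ Ω)
      ((pullbackPartition hP).center l) ((pullbackPartition hP).region l) := fun l => by
    rw [region_pullbackPartition hP]
    exact (nonempty_unimodularFrame_pullback hΘ hΩ (P.center l)).some
  -- Here the primitive must have compact support, since the fibres of `𝔤*` are not compact.
  have h1 := formIntegral_pairing_differential_eq_zero (vol := Γ.totalOrientation volM volE)
    (pullbackPartition hP) hvol hvol0 F hβ hβc h
  have h2 := (pullbackPartition hP).formIntegral_sub
    (b := (euBasis n).prod (euDualBasis (k + 1))) (vol := Γ.totalOrientation volM volE)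
    (η := fun p => pairing (c p) (Γ.symplecticVolume Θ Ω p))
    (η' := fun p => pairing (Γ.thomProduct α τ p) (Γ.symplecticVolume Θ Ω p))
    -- One compact set serves both forms: the product with `ρ^*τ` pairs to zero outside the support
    -- of `τ`.
    (hc_supp.union hτ.compact)
    (fun l => continuousOn_chartDensity (hvol l) (hvol0 l)
      ((F l).continuousOn_pairing inter_subset_left hc))
    (fun l z hz hZ => by
      have h0 : c ((extChartAt (dualModel n (k + 1)) ((pullbackPartition hP).center l)).symm z) =
          0 := by
        by_contra h0
        exact hZ (Or.inl (subset_closure h0))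
      refine chartDensity_eq_zero _ _ _ ?_
      beta_reduce
      rw [h0]
      exact pairing_zero _)
    (fun l => by
      rw [region_pullbackPartition hP]
      exact continuousOn_thomDensity hΘ hΩ hvolM hvolE hα hτ.cocycle.1 (P.center l))
    (fun l z hz hZ => by
      rw [region_pullbackPartition hP] at hz
      exact thomDensity_eq_zero hΘ hΩ hz fun h => hZ (Or.inr h))
  have h3 := (congrArg (formIntegral (dualModel n (k + 1))
    ((euBasis n).prod (euDualBasis (k + 1))) (Γ.totalOrientation volM volE))
    (sub_pairing_symplecticVolume Θ Ω c (Γ.thomProduct α τ))).symm.trans h1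
  exact sub_eq_zero.1 (h2.symm.trans h3)

end LieGroupoid

end

theorem mainTheorem2 {n r : ℕ} {M G : Type*}
    [TopologicalSpace M] [ChartedSpace (EuSp n) M] [IsManifold (𝓡 n) ∞ M]
    [CompactSpace M] [T2Space M]
    [TopologicalSpace G] [ChartedSpace (EuSp (n + r)) G] [IsManifold (𝓡 (n + r)) ∞ G]
    (Γ : LieGroupoid n r M G)
    -- the invariant transversal density
    (Ω : Γ.Density) (hΩ : Γ.IsInvariantVolume Ω)
    -- the orientations of `M` and of the vector bundle `𝔤*`
    (volM : (tangentAlgebroid (𝓡 n) M).Form ℝ n) (hvolM : LieGroupoid.IsOrientationForm volM)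
    (volE : ∀ x : M, Γ.Dual x [⋀^Fin r]→ₗ[ℝ] ℝ) (hvolE : Γ.IsFiberOrientationForm volE)
    -- the canonical symplectic form on `π^!𝔤`
    (Θ : Γ.piAlgebroid.Form ℝ 2) (hΘ : AlgebroidData.IsDifferential Γ.tautological Θ)
    -- a representative of the Thom class of `𝔤*`
    (τ : (tangentAlgebroid (dualModel n r) Γ.DualTotal).Form ℂ r) (hτ : Γ.IsThomForm volE τ)
    -- two representatives of a class in `H^r(𝔤)`
    (α α' : Γ.algebroid.Form ℂ r) (hα : AlgebroidData.IsCocycle α)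
    (hα' : AlgebroidData.IsCocycle α') (hαα' : AlgebroidData.IsExact (α' - α))
    -- a representative of the class `π^*α ∧ Th^𝔤(𝔤*)` in `H^{2r}_c(π^!𝔤)`
    (c : Γ.piAlgebroid.Form ℂ (2 * r)) (hc : AlgebroidData.IsCocycle c)
    (hc_supp : AlgebroidData.IsCompactlySupported c)
    (hc_class : AlgebroidData.IsExactCompact (c - Γ.thomProduct α τ)) :
    Γ.baseIntegral volM α' Ω =
      Γ.totalIntegral (Γ.totalOrientation volM volE) c (Γ.symplecticVolume Θ Ω) := by
  have h1 := LieGroupoid.baseIntegral_eq_of_isExact hvolM hΩ hα.1 hα'.1 hαα'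
  have h2 := LieGroupoid.totalIntegral_thomProduct hΘ hΩ hvolM hvolE hα.1 hτ
  rw [h1, ← h2]
  cases r with
  | zero =>
    -- For rank zero there are no primitives, and the two representatives coincide.
    have h0 : c - Γ.thomProduct α τ = 0 := hc_class
    rw [sub_eq_zero.1 h0]
  | succ k =>
    obtain ⟨β, hβ, hβc, h⟩ : ∃ β : Γ.piAlgebroid.Form ℂ (2 * k + 1),
      AlgebroidData.IsSmoothForm β ∧ AlgebroidData.IsCompactlySupported β ∧
        AlgebroidData.IsDifferential (k := 2 * k + 1) β (c - Γ.thomProduct α τ) := hc_class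
    exact (LieGroupoid.totalIntegral_eq_of_isExactCompact hΘ hΩ hvolM hvolE hα.1 hτ hc.1 hc_supp
      hβ hβc h).symm
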